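/- **Setting.** Let $K\ge 2$ and $m_0\ge 0$ be integers and let $\rho\ge 0$ be a bounded probability density on $\mathbb R$ with compact support. Let $\mathcal B$ be the infinite rooted tree with root $0$ in which every vertex has $K+1$ neighbours; write $y\prec x$ if $\mathrm{dist}(0,x)=\mathrm{dist}(0,y)+\mathrm{dist}(y,x)$. Let $J$ be the set of vertices whose distance to $0$ is a multiple of $m_0+1$, let $\{\omega_y\}_{y\in J}$ be i.i.d. real random variables with distribution $\rho(x)\,dx$, let $P_y$ be the projection onto $\ell^2(\{x:\ y\prec x,\ \mathrm{dist}(y,x)\le m_0\})$, and put $M_0=\frac{K^{m_0+1}-1}{K-1}$. Let $\Delta$ be the adjacency operator, $H^\omega_\lambda=\Delta+\lambda\sum_{y\in J}\omega_yP_y$, and let $H^\omega_{\lambda,L}=\chi_{\Lambda_L}H^\omega_\lambda\chi_{\Lambda_L}$ be its cut-off on $\ell^2(\Lambda_L)$, where $\Lambda_L=\{x:\mathrm{dist}(0,x)\le L\}$. For $E_0\in\mathbb R$ let $\mu^{\omega,\lambda}_{E_0,L}$ be the point measure on $\mathbb{R}$ given by $\mu^{\omega,\lambda}_{E_0,L}(f)=\mathrm{tr}\,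 f\big(|\Lambda_L|(H^\omega_{\lambda,L}-E_0)\big)$, so that $\mu^{\omega,\lambda}_{E_0,L}(I)$ is the number of eigenvalues, with multiplicity, of $|\Lambda_L|(H^\omega_{\lambda,L}-E_0)$ in $I$. Let $\mathcal C$ be the canopy tree: its vertices form countably infinite layers $\mathcal C_0=\partial\mathcal C,\mathcal C_1,\dots$; each layer $\mathcal C_n$ is partitioned into sets of $K$ vertices, each of which is joined to one vertex of $\mathcal C_{n+1}$, different sets being joined to different vertices and every vertex of $\mathcal C_{n+1}$ being reached, and the graph so obtained is connected. On $\ell^2(\mathcal C)$ let $H^\omega_{\mathcal C,\lambda}=\Delta_{\mathcal C}+\lambda\sum_{y\in J_{\mathcal C}}\omega_yP_y$, where $J_{\mathcal C}$ consists of the vertices of the layers $m_0+(m_0+1)k$, $k\ge0$, the $\omega_y$ are i.i.d. with distribution $\rho(x)\,dx$, and $P_y$ is the projection onto $\ell^2$ of the set of vertices $x$ with $\mathrm{dist}(y,x)\le m_0$ and $\mathrm{dist}(\partial\mathcal C,y)=\mathrm{dist}(\partial\mathcal C,x)+\mathrm{dist}(x,y)$. Its density of states measure is $$n_{\mathcal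 C,\lambda}(B)=\frac{K-1}{K}\sum_{n=0}^\infty K^{-n}\,\mathbb E\big[\langle\delta_{x_n},E_{H^\omega_{\mathcal C,\lambda}}(B)\delta_{x_n}\rangle\big],\qquad x_n\in\mathcal C_n .$$ For $E\in\mathbb{R}$ put $$n_{\mathcal C,\lambda}(E)=\sup_{a<b}\ \limsup_{\varepsilon\downarrow0}\frac{n_{\mathcal C,\lambda}([E+\varepsilon a,E+\varepsilon b])}{\varepsilon(b-a)}.$$ **Theorem.** There is $\lambda_0>0$, depending only on $K,m_0,\rho$, such that the following holds for every $\lambda>\lambda_0$. The function $E\mapsto n_{\mathcal C,\lambda}(E)$ is finite everywhere and is a density of the measure $n_{\mathcal C,\lambda}$ with respect to Lebesgue measure. For every $E_0\in\mathbb R$ and every bounded interval $I\subset\mathbb R$ there is a strictly increasing sequence $(L_n)$ of natural numbers such that the random variables $\mu^{\omega,\lambda}_{E_0,L_n}(I)$ converge in distribution to a compound Poisson random variable $\mathcal P_I$ (the case $\mathcal P_I=0$ being allowed), and there are numbers $p_k(I)$, $1\le k\le M_0$, with $$\mathbb E\big[e^{it\mathcal P_I}\big]=\exp\Big(\sum_{k=1}^{M_0}(e^{itk}-1)\,p_k(I)\Big)\quad\text{for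 all } t\in\mathbb R,\qquad 0\le p_k(I)\le\frac{K\,n_{\mathcal C,\lambda}(E_0)}{k}\,|I|\quad\text{for }1\le k\le M_0 .$$ -/

import Mathlib

open MeasureTheory ProbabilityTheory Filter Topology
open scoped ENNReal

noncomputable section

namespace BetheCanopy

/-! ### The Bethe lattice -/

/-- Number of vertices at distance `r` from the root of the rooted tree in which every vertex has
`K + 1` neighbours. -/
def sphereCard (K : ℕ) : ℕ → ℕ
  | 0 => 1
  | r + 1 => (K + 1) * K ^ r

/-- Vertices of the rooted `(K + 1)`-regular tree: a vertex is a generation `r` together with its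
position among the `sphereCard K r` vertices of this generation. -/
def BetheVertex (K : ℕ) : Type := Σ r : ℕ, Fin (sphereCard K r)

/-- The root. -/
def betheRoot (K : ℕ) : BetheVertex K := ⟨0, ⟨0, Nat.one_pos⟩⟩

/-- `y` is the parent of `x`: the root is the parent of all `K + 1` vertices of generation `1`;
in the later generations the children of the vertex number `i` are the vertices
number `K * i, …, K * i + (K - 1)` of the next generation. -/
def BetheIsParent {K : ℕ} (y x : BetheVertex K) : Prop :=
  x.1 = y.1 + 1 ∧ (y.1 = 0 ∨ (x.2 : ℕ) / K = (y.2 : ℕ))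

/-- The Bethe lattice: the infinite rooted tree in which every vertex has `K + 1` neighbours. -/
def betheGraph (K : ℕ) : SimpleGraph (BetheVertex K) where
  Adj x y := BetheIsParent x y ∨ BetheIsParent y x
  symm := ⟨fun _ _ h => h.symm⟩
  loopless := ⟨fun x h => by
    rcases h with h | h <;> exact absurd h.1 (by omega)⟩

/-- `y ≺ x`: the vertex `y` lies between the root and `x` (`x` is forward to `y`). -/
def betheForward {K : ℕ} (y x : BetheVertex K) : Prop :=
  (betheGraph K).dist (betheRoot K) x
    = (betheGraph K).dist (betheRoot K) y + (betheGraph K).dist y x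

/-- The ball `Λ_L` of radius `L` around the root. -/
def betheBall (K L : ℕ) : Set (BetheVertex K) :=
  {x | (betheGraph K).dist (betheRoot K) x ≤ L}

lemma betheGraph_reachable_root {K : ℕ} :
    ∀ (r : ℕ) (i : Fin (sphereCard K r)),
      (betheGraph K).Reachable (betheRoot K) (⟨r, i⟩ : BetheVertex K)
  | 0, i => by
      have hi : i = ⟨0, Nat.one_pos⟩ := Fin.ext (Nat.lt_one_iff.mp i.isLt)
      rw [hi]
      exact SimpleGraph.Reachable.refl _
  | 1, i => by
      refine SimpleGraph.Adj.reachable ?_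
      exact Or.inl ⟨rfl, Or.inl rfl⟩
  | r + 2, i => by
      have hlt : (i : ℕ) / K < sphereCard K (r + 1) := by
        have h : (i : ℕ) < (K + 1) * K ^ (r + 1) := i.isLt
        have h2 : (i : ℕ) < K * ((K + 1) * K ^ r) := by
          calc (i : ℕ) < (K + 1) * K ^ (r + 1) := h
            _ = K * ((K + 1) * K ^ r) := by ring
        exact Nat.div_lt_of_lt_mul h2
      refine (betheGraph_reachable_root (r + 1) ⟨(i : ℕ) / K, hlt⟩).trans
        (SimpleGraph.Adj.reachable ?_)
      exact Or.inl ⟨rfl, Or.inr rfl⟩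

lemma generation_le_length {K : ℕ} {x y : BetheVertex K} (w : (betheGraph K).Walk x y) :
    y.1 ≤ x.1 + w.length := by
  induction w with
  | nil => simp
  | cons h p ih =>
      rw [SimpleGraph.Walk.length_cons]
      rcases h with h | h <;> have := h.1 <;> omega

lemma betheBall_finite (K L : ℕ) : (betheBall K L).Finite := by
  have hfin : (Set.range (fun p : (Σ r : Fin (L + 1), Fin (sphereCard K r)) =>
      (⟨(p.1 : ℕ), p.2⟩ : BetheVertex K))).Finite := Set.finite_range _
  refine hfin.subset ?_
  rintro ⟨r, i⟩ hx
  obtain ⟨w, hw⟩ := (betheGraph_reachable_root r i).exists_walk_length_eq_dist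
  have h1 := generation_le_length w
  have h2 : (betheGraph K).dist (betheRoot K) (⟨r, i⟩ : BetheVertex K) ≤ L := hx
  have h3 : r ≤ L := by
    have h4 : (betheRoot K).1 = 0 := rfl
    rw [h4] at h1
    have h5 : r ≤ 0 + w.length := h1
    omega
  exact ⟨⟨⟨r, Nat.lt_succ_of_le h3⟩, i⟩, rfl⟩

instance (K L : ℕ) : Fintype (betheBall K L) := (betheBall_finite K L).fintype

/-! ### The Anderson operator on the Bethe lattice and its cut-off -/

/-- The set `J` of the sites that carry a random variable: the vertices whose distance to the root
is a multiple of `m₀ + 1`. -/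
def betheSites (K m₀ : ℕ) : Set (BetheVertex K) :=
  {y | (m₀ + 1) ∣ (betheGraph K).dist (betheRoot K) y}

open Classical in
/-- The potential `∑_{y ∈ J} ω_y P_y` at the vertex `x`, where `P_y` is the projection onto the
functions supported on `{x | dist y x ≤ m₀ and y ≺ x}`. (At each `x` only finitely many
terms are not zero.) -/
def bethePotential (K m₀ : ℕ) (w : betheSites K m₀ → ℝ) (x : BetheVertex K) : ℝ :=
  ∑ᶠ y : betheSites K m₀,
    if (betheGraph K).dist y.1 x ≤ m₀ ∧ betheForward y.1 x then w y else 0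

open Classical in
/-- The matrix elements `⟨δ_x, (A + lam V) δ_y⟩`, where `A` is the adjacency operator of the
graph `G` and `V` is a potential. -/
def schrodingerKernel {V : Type*} (G : SimpleGraph V) (lam : ℝ) (v : V → ℝ) (x y : V) : ℂ :=
  (if G.Adj x y then 1 else 0) + (if x = y then ((lam * v x : ℝ) : ℂ) else 0)

lemma schrodingerKernel_conj {V : Type*} (G : SimpleGraph V) (lam : ℝ) (v : V → ℝ) (x y : V) :
    star (schrodingerKernel G lam v y x) = schrodingerKernel G lam v x y := by
  classical
  unfold schrodingerKernel
  by_cases h : x = y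
  · subst h; simp
  · have h' : ¬ y = x := fun e => h e.symm
    by_cases ha : G.Adj x y
    · simp [h, h', ha, ha.symm]
    · have ha' : ¬ G.Adj y x := fun e => ha e.symm
      simp [h, h', ha, ha']

/-- The cut-off operator `χ_{Λ_L} H χ_{Λ_L}` on `ℓ²(Λ_L)`, as a matrix. -/
def cutoffOperator (K m₀ : ℕ) (lam : ℝ) (w : betheSites K m₀ → ℝ) (L : ℕ) :
    Matrix (betheBall K L) (betheBall K L) ℂ :=
  Matrix.of fun x y => schrodingerKernel (betheGraph K) lam (bethePotential K m₀ w) x.1 y.1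

lemma cutoffOperator_isHermitian (K m₀ : ℕ) (lam : ℝ) (w : betheSites K m₀ → ℝ) (L : ℕ) :
    (cutoffOperator K m₀ lam w L).IsHermitian := by
  ext x y
  exact schrodingerKernel_conj _ _ _ _ _

open Classical in
/-- The point process `f ↦ tr f(|Λ_L| (H_L - E₀))`: the sum of the unit point masses at the
points `|Λ_L| (e - E₀)`, where `e` runs through the eigenvalues of the cut-off operator `H_L`,
counted with multiplicity. -/
def eigenvalueProcess (K m₀ : ℕ) (lam : ℝ) (w : betheSites K m₀ → ℝ) (E₀ : ℝ) (L : ℕ) :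
    Measure ℝ :=
  ∑ i : betheBall K L, Measure.dirac
    ((Fintype.card (betheBall K L) : ℝ)
      * ((cutoffOperator_isHermitian K m₀ lam w L).eigenvalues i - E₀))

/-! ### The canopy tree and its Anderson operator -/

/-- Vertices of the canopy tree: the pair `(n, j)` is the vertex number `j` of the layer
`𝒞_n`; it has distance `n` to the boundary `𝒞_0`. -/
abbrev CanopyVertex : Type := ℕ × ℕ

/-- The canopy tree: the layer `𝒞_n` is partitioned into the sets of `K` vertices
`(n, K * i), …, (n, K * i + (K - 1))`, which are joined to the vertex `(n + 1, i)`. -/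
def canopyGraph (K : ℕ) : SimpleGraph CanopyVertex where
  Adj x y := (y.1 = x.1 + 1 ∧ y.2 = x.2 / K) ∨ (x.1 = y.1 + 1 ∧ x.2 = y.2 / K)
  symm := ⟨fun _ _ h => h.symm⟩
  loopless := ⟨fun x h => by
    rcases h with h | h <;> exact absurd h.1 (by omega)⟩

/-- The set `J_𝒞` of the sites that carry a random variable. -/
def canopySites (m₀ : ℕ) : Set CanopyVertex :=
  {y | ∃ k : ℕ, y.1 = m₀ + (m₀ + 1) * k}

open Classical in
/-- The potential `∑_{y ∈ J_𝒞} ω_y P_y` at the vertex `x`, where `P_y` is the projection onto the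
functions supported on the vertices `x` with `dist y x ≤ m₀` and
`dist(∂𝒞, y) = dist(∂𝒞, x) + dist(x, y)`. -/
def canopyPotential (K m₀ : ℕ) (w : canopySites m₀ → ℝ) (x : CanopyVertex) : ℝ :=
  ∑ᶠ y : canopySites m₀,
    if (canopyGraph K).dist y.1 x ≤ m₀ ∧ y.1.1 = x.1 + (canopyGraph K).dist x y.1
      then w y else 0

/-- The Hilbert space `ℓ²(𝒞)`. -/
abbrev CanopySpace : Type := lp (fun _ : CanopyVertex => ℂ) 2

/-- The unit vector `δ_x`. -/
def canopyDelta (x : CanopyVertex) : CanopySpace := lp.single 2 x (1 : ℂ)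

open Classical in
/-- The Anderson operator `Δ_𝒞 + lam ∑_{y ∈ J_𝒞} ω_y P_y` on `ℓ²(𝒞)`: the (unique) bounded
operator that acts by the kernel `schrodingerKernel`. It exists as soon as `ω` is bounded, hence
almost surely if the `ω_y` have a distribution with compact support. (For other `ω` the value
is `0`.) -/
def canopyOperator (K m₀ : ℕ) (lam : ℝ) (w : canopySites m₀ → ℝ) :
    CanopySpace →L[ℂ] CanopySpace :=
  if h : ∃ A : CanopySpace →L[ℂ] CanopySpace, ∀ (ψ : CanopySpace) (x : CanopyVertex),
      A ψ x = ∑' y, schrodingerKernel (canopyGraph K) lam (canopyPotential K m₀ w) x y * ψ y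
  then h.choose else 0

/-! ### Spectral measures and the density of states -/

/-- The positive functional `f ↦ ⟨ψ, f(A) ψ⟩` on `C_c(ℝ)`, for a bounded operator `A` on
a Hilbert space (the continuous functional calculus; meaningful if `A` is self-adjoint). -/
def spectralFunctional {H : Type*} [NormedAddCommGroup H] [InnerProductSpace ℂ H]
    [CompleteSpace H] (A : H →L[ℂ] H) (ψ : H) :
    CompactlySupportedContinuousMap ℝ ℝ →ₚ[ℝ] ℝ :=
  PositiveLinearMap.mk₀
    { toFun := fun f => (inner ℂ ψ (cfc (fun x : ℝ => f x) A ψ)).re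
      map_add' := fun f g => by
        have h : cfc (fun x : ℝ => (f + g) x) A
            = cfc (fun x : ℝ => f x) A + cfc (fun x : ℝ => g x) A :=
          cfc_add A (fun x : ℝ => f x) (fun x : ℝ => g x)
            f.continuous.continuousOn g.continuous.continuousOn
        rw [h, add_apply, inner_add_right, Complex.add_re]
      map_smul' := fun c f => by
        have h : cfc (fun x : ℝ => (c • f) x) A = c • cfc (fun x : ℝ => f x) A :=
          cfc_smul c (fun x : ℝ => f x) A f.continuous.continuousOn
        rw [h, smul_apply, inner_smul_right_eq_smul, Complex.smul_re]
        rfl }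
    (fun f hf => by
      have h : 0 ≤ cfc (fun x : ℝ => f x) A := cfc_nonneg (fun x _ => hf x)
      exact ((ContinuousLinearMap.nonneg_iff_isPositive _).mp h).re_inner_nonneg_right ψ)

/-- The spectral measure `B ↦ ⟨ψ, E_A(B) ψ⟩` of a bounded self-adjoint operator `A`: the
measure that represents the functional `f ↦ ⟨ψ, f(A) ψ⟩`. -/
def spectralMeasureAt {H : Type*} [NormedAddCommGroup H] [InnerProductSpace ℂ H]
    [CompleteSpace H] (A : H →L[ℂ] H) (ψ : H) : Measure ℝ :=
  RealRMK.rieszMeasure (spectralFunctional A ψ)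

/-- The probability measure `ρ(x) dx`. -/
def singleSiteLaw (ρ : ℝ → ℝ) : Measure ℝ :=
  volume.withDensity fun x => ENNReal.ofReal (ρ x)

/-- The density of states measure
`n(B) = (K - 1)/K ∑_n K^{-n} 𝔼 ⟨δ_{x_n}, E_H(B) δ_{x_n}⟩` of the Anderson operator `H` on the
canopy tree, where `x_n` is a vertex of the layer `n`. The expectation is with respect to the
independent random variables `ω_y`, `y ∈ J_𝒞`, with distribution `ρ(x) dx`. -/
def densityOfStates (K m₀ : ℕ) (ρ : ℝ → ℝ) (lam : ℝ) (xs : ℕ → CanopyVertex) (B : Set ℝ) :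
    ℝ≥0∞ :=
  (((K : ℝ≥0∞) - 1) / K) * ∑' n : ℕ, ((K : ℝ≥0∞) ^ n)⁻¹ *
    ∫⁻ w, spectralMeasureAt (canopyOperator K m₀ lam w) (canopyDelta (xs n)) B
      ∂(Measure.infinitePi fun _ : canopySites m₀ => singleSiteLaw ρ)

/-- The density at the point `E` of a set function `n` on `ℝ`, normalized so that it is defined
at every point: the supremum over all `a < b` of
`limsup_{ε ↓ 0} n([E + ε a, E + ε b]) / (ε (b - a))`.
If `n` is a finite measure without atoms, this is the derivative of its distribution function
wherever that derivative exists; if `n` is absolutely continuous it is a version of its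
Lebesgue density. -/
def densityAt (n : Set ℝ → ℝ≥0∞) (E : ℝ) : ℝ≥0∞ :=
  ⨆ (a : ℝ) (b : ℝ) (_ : a < b),
    limsup (fun ε : ℝ => n (Set.Icc (E + ε * a) (E + ε * b)) / ENNReal.ofReal (ε * (b - a)))
      (𝓝[>] (0 : ℝ))

/-! ### Compound Poisson distributions -/

/-- Convolution powers of a measure on `ℝ`. -/
def convPower (ν : Measure ℝ) : ℕ → Measure ℝ
  | 0 => Measure.dirac 0
  | n + 1 => (convPower ν n).conv ν

/-- `Q` is a compound Poisson distribution: the distribution of `Y_1 + ⋯ + Y_N`, where `N` is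
Poisson distributed with some parameter `r ≥ 0` and `Y_1, Y_2, …` are independent, independent
of `N`, with a common distribution `ν`. -/
def IsCompoundPoisson (Q : Measure ℝ) : Prop :=
  ∃ (r : NNReal) (ν : Measure ℝ), IsProbabilityMeasure ν ∧
    Q = Measure.sum fun n : ℕ => poissonMeasure r {n} • convPower ν n

end BetheCanopy

end

/-! The ball is cut into independent pieces, so that the number of its eigenvalues in a window of
width of order `1/|Λ_L|` around `E₀` becomes, outside a rare event, a sum of many i.i.d. integer
variables each of which is rarely nonzero. Take a ball with `8r` generations, `r` a positive
multiple of `m₀ + 1`, and delete the edges between the generations `r - 1` and `r`. There remain a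
top tree with `r` generations and `m = (K + 1) K^(r - 1)` rooted trees with `7r` generations. No
block of the potential crosses the cut, hence the lower trees carry i.i.d. potentials. With `x =
K^r`, `m` is of order `x` and the ball has of order `x^8` vertices.

Eigenvalue counts are controlled by two estimates for random block potentials. Wegner: the expected
number of eigenvalues in an interval is at most a constant times volume times length
(`lintegral_eigCount_Ioc_mul_le`, by lowering the random variables one block at a time). Minami:
since one block variable is a perturbation of rank at most `M`, the product of the count and of its
excess over `M` has expectation bounded by a squared Wegner bound
(`lintegral_eigCount_Ioc_mul_sub_le`). For the lower trees `M = M₀`, and this is why only jumps `k ≤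
M₀` survive.

The cut is harmless because of localization. For large disorder the moments of order `1/2` of the
Green function decay exponentially (`lintegral_sum_esqrt_green_le`, induction over the graph by a
Schur complement). So with high probability the Green function at `E₀` of the first `2r` generations
decays, and every eigenvector with energy in the window is tiny near the cut
(`norm_eigenvector_le`). Trial spaces of such eigenvectors compare the spectra before and after the
cut in both directions (`eigCount_le_sum_partBlock`, `sum_partBlock_le_eigCount`), up to a shift
much smaller than `1/|Λ_L|`. By Wegner, with high probability no eigenvalue lies that close to an
end of the window, and the top tree has none in the window. Then the count of the ball equals the
sum of the counts of the lower trees (`StrongDisorder.exists_measure_le`).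

By Wegner, `m` times the probability of exactly `k` eigenvalues in a lower tree stays bounded; along
a subsequence these numbers converge to `p k`. By Minami, `m` times the probability of more than
`M₀` eigenvalues tends to `0`. The characteristic function of the sum is a power `(1 + g)^m` with `m
g` convergent, which gives the compound Poisson limit (`tendsto_integral_exp_pow`,
`StrongDisorder.exists_tendsto`).

The bound for `p k` uses the canopy tree. Its density of states is the limit of the expected counts
of huge trees per leaf: this holds for moments, hence for polynomials, and continuous functions
sandwich intervals (`tendsto_trace_pow`, `eventually_lintegral_eigCount_le`). A huge tree contains
many copies of the lower tree at its bottom, and by localization the eigenvalues of the good copies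
are almost eigenvalues of the huge tree; so the expected count of a good lower tree is at most the
number of its leaves times the unnormalized density of states of a slightly larger window
(`StrongDisorder.lintegral_good_le`). As `m` times this number of leaves is at most `(K - 1) |Λ_L|`,
and the normalization of the density of states is `(K - 1) / K`, the factor `K` of the theorem
appears. Finally, Wegner's estimate survives the limit and makes the density of states Lipschitz
(`layerSum_Icc_le_length`), so that its pointwise density is finite and represents it. -/

noncomputable section

namespace BetheCanopy

/-! ### Counting eigenvalues of Hermitian matrices -/

section EigenvalueCounting

variable {V : Type*} [Fintype V]

/-- The squared Euclidean norm. -/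
def sqNorm (v : V → ℂ) : ℝ := ∑ x, ‖v x‖ ^ 2

lemma sqNorm_nonneg (v : V → ℂ) : 0 ≤ sqNorm v := Finset.sum_nonneg fun _ _ => by positivity

lemma sqNorm_pos {v : V → ℂ} (hv : v ≠ 0) : 0 < sqNorm v := by
  obtain ⟨x, hx⟩ := Function.ne_iff.mp hv
  exact Finset.sum_pos' (fun _ _ => by positivity)
    ⟨x, Finset.mem_univ _, by have : 0 < ‖v x‖ := norm_pos_iff.mpr hx
                              positivity⟩

lemma sqNorm_eq_zero {v : V → ℂ} : sqNorm v = 0 ↔ v = 0 := by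
  refine ⟨fun h => ?_, fun h => by simp [h, sqNorm]⟩
  by_contra hv
  exact (sqNorm_pos hv).ne' h

lemma coe_sqNorm (v : V → ℂ) : ((sqNorm v : ℝ) : ℂ) = star v ⬝ᵥ v := by
  simp [sqNorm, dotProduct, ← Complex.conj_mul']

/-- The real part of the quadratic form of a matrix. -/
def quadForm (A : Matrix V V ℂ) (v : V → ℂ) : ℝ := (star v ⬝ᵥ A.mulVec v).re

variable [DecidableEq V]

open Classical in
/-- The number of eigenvalues in `B`, counted with multiplicity, of a Hermitian matrix. -/
def eigCount (A : Matrix V V ℂ) (B : Set ℝ) : ℕ := A.charpoly.roots.countP fun z => z.re ∈ B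

-- Counting roots of the characteristic polynomial makes `eigCount` independent of a proof of
-- hermiticity and invariant under relabelling; here it is tied to the eigenvalues of the spectral
-- theorem.
open Classical in
lemma eigCount_eq_card {A : Matrix V V ℂ} (hA : A.IsHermitian) (B : Set ℝ) :
    eigCount A B = (Finset.univ.filter fun i => hA.eigenvalues i ∈ B).card := by
  rw [eigCount, hA.roots_charpoly_eq_eigenvalues, Multiset.countP_map]
  simp [Finset.card, Finset.filter]

open Classical in
lemma eigCount_eq_sum {A : Matrix V V ℂ} (hA : A.IsHermitian) (B : Set ℝ) :
    eigCount A B = ∑ i, if hA.eigenvalues i ∈ B then 1 else 0 := by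
  rw [eigCount_eq_card hA, Finset.card_filter]

lemma eigCount_submatrix {W : Type*} [Fintype W] [DecidableEq W] (A : Matrix V V ℂ) (e : W ≃ V)
    (B : Set ℝ) : eigCount (A.submatrix e e) B = eigCount A B := by
  have : A.submatrix e e = Matrix.reindex e.symm e.symm A := by simp [Matrix.reindex_apply]
  rw [eigCount, eigCount, this, Matrix.charpoly_reindex]

lemma eigCount_mono (A : Matrix V V ℂ) {B B' : Set ℝ} (h : B ⊆ B') :
    eigCount A B ≤ eigCount A B' := by
  classical
  unfold eigCount
  rw [Multiset.countP_eq_card_filter, Multiset.countP_eq_card_filter]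
  exact Multiset.card_le_card (Multiset.monotone_filter_right _ fun z hz => h hz)

lemma eigCount_le_card {A : Matrix V V ℂ} (hA : A.IsHermitian) (B : Set ℝ) :
    eigCount A B ≤ Fintype.card V := by
  classical
  rw [eigCount_eq_card hA]
  exact Finset.card_le_univ _

lemma eigCount_univ {A : Matrix V V ℂ} (hA : A.IsHermitian) :
    eigCount A Set.univ = Fintype.card V := by
  classical
  rw [eigCount_eq_card hA]
  simp

lemma eigCount_union {A : Matrix V V ℂ} (hA : A.IsHermitian) {B B' : Set ℝ} (h : Disjoint B B') :
    eigCount A (B ∪ B') = eigCount A B + eigCount A B' := by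
  classical
  rw [eigCount_eq_card hA, eigCount_eq_card hA, eigCount_eq_card hA, ← Finset.card_union_of_disjoint]
  · congr 1; ext i; simp
  · rw [Finset.disjoint_filter]
    exact fun i _ hi hi' => Set.disjoint_left.mp h hi hi'

/-- The coordinates of a vector with respect to the eigenvector basis. -/
def spectralCoord {A : Matrix V V ℂ} (hA : A.IsHermitian) : (V → ℂ) →ₗ[ℂ] (V → ℂ) :=
  Matrix.mulVecLin (star (hA.eigenvectorUnitary : Matrix V V ℂ))

/-- The vector with given coordinates with respect to the eigenvector basis. -/
def spectralSynth {A : Matrix V V ℂ} (hA : A.IsHermitian) : (V → ℂ) →ₗ[ℂ] (V → ℂ) :=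
  Matrix.mulVecLin (hA.eigenvectorUnitary : Matrix V V ℂ)

lemma spectralCoord_synth {A : Matrix V V ℂ} (hA : A.IsHermitian) (v : V → ℂ) :
    spectralCoord hA (spectralSynth hA v) = v := by
  simp [spectralCoord, spectralSynth, Matrix.mulVec_mulVec]

lemma spectralSynth_coord {A : Matrix V V ℂ} (hA : A.IsHermitian) (v : V → ℂ) :
    spectralSynth hA (spectralCoord hA v) = v := by
  simp [spectralCoord, spectralSynth, Matrix.mulVec_mulVec]

lemma sqNorm_spectralSynth {A : Matrix V V ℂ} (hA : A.IsHermitian) (v : V → ℂ) :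
    sqNorm (spectralSynth hA v) = sqNorm v := by
  have : ((sqNorm (spectralSynth hA v) : ℝ) : ℂ) = sqNorm v := by
    rw [coe_sqNorm, coe_sqNorm]
    simp only [spectralSynth, Matrix.mulVecLin_apply]
    rw [Matrix.star_mulVec, Matrix.dotProduct_mulVec, Matrix.vecMul_vecMul,
      ← Matrix.star_eq_conjTranspose, Unitary.coe_star_mul_self, Matrix.vecMul_one]
  exact_mod_cast this

lemma sqNorm_spectralCoord {A : Matrix V V ℂ} (hA : A.IsHermitian) (v : V → ℂ) :
    sqNorm (spectralCoord hA v) = sqNorm v := by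
  rw [← sqNorm_spectralSynth hA, spectralSynth_coord]

lemma mulVec_spectralSynth {A : Matrix V V ℂ} (hA : A.IsHermitian) (v : V → ℂ) :
    A.mulVec (spectralSynth hA v) = spectralSynth hA (fun i => hA.eigenvalues i * v i) := by
  refine (congrArg (fun M => M.mulVec (spectralSynth hA v)) hA.spectral_theorem).trans ?_
  simp only [Unitary.conjStarAlgAut_apply, spectralSynth, Matrix.mulVecLin_apply,
    Matrix.mulVec_mulVec]
  rw [Matrix.mul_assoc, Matrix.mul_assoc, ← Matrix.mulVec_mulVec]
  congr 1
  rw [Unitary.coe_star_mul_self, Matrix.mul_one]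
  ext i
  simp [Matrix.mulVec_diagonal]

lemma spectralCoord_mulVec {A : Matrix V V ℂ} (hA : A.IsHermitian) (v : V → ℂ) (i : V) :
    spectralCoord hA (A.mulVec v) i = hA.eigenvalues i * spectralCoord hA v i := by
  conv_lhs => rw [← spectralSynth_coord hA v, mulVec_spectralSynth, spectralCoord_synth]

lemma quadForm_eq_sum {A : Matrix V V ℂ} (hA : A.IsHermitian) (v : V → ℂ) :
    quadForm A v = ∑ i, hA.eigenvalues i * ‖spectralCoord hA v i‖ ^ 2 := by
  have h : star v ⬝ᵥ A.mulVec v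
      = star (spectralCoord hA v) ⬝ᵥ spectralCoord hA (A.mulVec v) := by
    simp only [spectralCoord, Matrix.mulVecLin_apply]
    rw [Matrix.star_mulVec, Matrix.dotProduct_mulVec _ (star _), Matrix.vecMul_vecMul,
      ← Matrix.star_eq_conjTranspose, star_star, Unitary.mul_star_self_of_mem hA.eigenvectorUnitary.2, Matrix.vecMul_one]
  rw [quadForm, h, dotProduct, Complex.re_sum]
  refine Finset.sum_congr rfl fun i _ => ?_
  rw [spectralCoord_mulVec, Pi.star_apply, mul_left_comm, Complex.star_def, Complex.conj_mul',
    ← Complex.ofReal_pow, ← Complex.ofReal_mul, Complex.ofReal_re]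

/-- A dimension count: the conditions in the hypothesis are `eigCount A B + b.card` linear
functionals, and they separate the points of a space of dimension `card ι`. Together with the same
argument for several operators at once, this is the source of the comparisons of spectra below. -/
lemma card_le_eigCount_add {ι : Type*} [Fintype ι] {A : Matrix V V ℂ} (hA : A.IsHermitian)
    (B : Set ℝ) (b : Finset V) (f : (ι → ℂ) →ₗ[ℂ] (V → ℂ))
    (h : ∀ a, (∀ x ∈ b, f a x = 0) → (∀ i, hA.eigenvalues i ∈ B → spectralCoord hA (f a) i = 0) →
      a = 0) : Fintype.card ι ≤ eigCount A B + b.card := by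
  classical
  let g : (ι → ℂ) →ₗ[ℂ] (((Finset.univ.filter fun i => hA.eigenvalues i ∈ B) ⊕ b) → ℂ) :=
    LinearMap.pi (Sum.elim (fun i => LinearMap.proj i.1 ∘ₗ spectralCoord hA ∘ₗ f)
      (fun x => LinearMap.proj x.1 ∘ₗ f))
  have hg : Function.Injective g := by
    rw [← LinearMap.ker_eq_bot, LinearMap.ker_eq_bot']
    intro a ha
    refine h a (fun x hx => ?_) fun i hi => ?_
    · simpa [g] using congrFun ha (Sum.inr ⟨x, hx⟩)
    · simpa [g] using congrFun ha (Sum.inl ⟨i, by simpa using hi⟩)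
  have := LinearMap.finrank_le_finrank_of_injective hg
  rw [Module.finrank_fintype_fun_eq_card, Module.finrank_fintype_fun_eq_card] at this
  rw [eigCount_eq_card hA]
  simpa [Fintype.card_subtype] using this

open Classical in
/-- The linear combinations of the eigenvectors with eigenvalues in `B`. -/
def eigSynth {A : Matrix V V ℂ} (hA : A.IsHermitian) (B : Set ℝ) :
    ({i // hA.eigenvalues i ∈ B} → ℂ) →ₗ[ℂ] (V → ℂ) :=
  spectralSynth hA ∘ₗ LinearMap.pi fun i =>
    if h : hA.eigenvalues i ∈ B then LinearMap.proj ⟨i, h⟩ else 0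

lemma spectralCoord_eigSynth {A : Matrix V V ℂ} (hA : A.IsHermitian) (B : Set ℝ)
    (a : {i // hA.eigenvalues i ∈ B} → ℂ) {i : V} (h : hA.eigenvalues i ∈ B) :
    spectralCoord hA (eigSynth hA B a) i = a ⟨i, h⟩ := by
  simp [eigSynth, spectralCoord_synth, h]

lemma spectralCoord_eigSynth_of_notMem {A : Matrix V V ℂ} (hA : A.IsHermitian) (B : Set ℝ)
    (a : {i // hA.eigenvalues i ∈ B} → ℂ) {i : V} (h : hA.eigenvalues i ∉ B) :
    spectralCoord hA (eigSynth hA B a) i = 0 := by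
  simp [eigSynth, spectralCoord_synth, h]

open Classical in
lemma sqNorm_eigSynth {A : Matrix V V ℂ} (hA : A.IsHermitian) (B : Set ℝ)
    (a : {i // hA.eigenvalues i ∈ B} → ℂ) : sqNorm (eigSynth hA B a) = sqNorm a := by
  rw [← sqNorm_spectralCoord hA, sqNorm, sqNorm]
  rw [← Finset.sum_filter_of_ne (p := fun i => hA.eigenvalues i ∈ B) fun i _ hi => by
    by_contra h
    exact hi (by rw [spectralCoord_eigSynth_of_notMem hA B a h]; simp)]
  rw [Finset.sum_subtype _ (p := fun i => hA.eigenvalues i ∈ B) (by simp)]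
  refine Finset.sum_congr rfl fun i _ => ?_
  rw [spectralCoord_eigSynth hA B a i.2]

lemma card_eigSynth_domain {A : Matrix V V ℂ} (hA : A.IsHermitian) (B : Set ℝ)
    [Fintype {i // hA.eigenvalues i ∈ B}] :
    Fintype.card {i // hA.eigenvalues i ∈ B} = eigCount A B := by
  classical
  rw [eigCount_eq_card hA, Fintype.card_subtype]

/-- A comparison of quadratic forms on the vectors that vanish on `b` implies a comparison of the
eigenvalue counting functions, up to the size of `b`. -/
lemma eigCount_Iic_le_of_quadForm_le {A A' : Matrix V V ℂ} (hA : A.IsHermitian)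
    (hA' : A'.IsHermitian) (b : Finset V) {δ : ℝ}
    (h : ∀ v : V → ℂ, (∀ x ∈ b, v x = 0) → quadForm A v ≤ quadForm A' v + δ * sqNorm v) (E : ℝ) :
    eigCount A' (Set.Iic E) ≤ eigCount A (Set.Iic (E + δ)) + b.card := by
  classical
  rw [← card_eigSynth_domain hA' (Set.Iic E)]
  refine card_le_eigCount_add hA _ b (eigSynth hA' (Set.Iic E)) fun a ha h2 => ?_
  -- The min-max argument: a nonzero combination of eigenvectors of `A'` below `E` that vanishes on
  -- `b` and is orthogonal to the eigenvectors of `A` below `E + δ` would violate the comparison of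
  -- the forms.
  by_contra hne
  set v := eigSynth hA' (Set.Iic E) a with hv
  have hpos : 0 < sqNorm v := by rw [hv, sqNorm_eigSynth]; exact sqNorm_pos hne
  have h1 : quadForm A' v ≤ E * sqNorm v := by
    rw [quadForm_eq_sum hA', ← sqNorm_spectralCoord hA' v, sqNorm, Finset.mul_sum]
    refine Finset.sum_le_sum fun i _ => ?_
    by_cases hi : hA'.eigenvalues i ∈ Set.Iic E
    · exact mul_le_mul_of_nonneg_right hi (by positivity)
    · rw [hv, spectralCoord_eigSynth_of_notMem _ _ _ hi]; simp
  have h3 : (E + δ) * sqNorm v < quadForm A v := by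
    rw [quadForm_eq_sum hA, ← sqNorm_spectralCoord hA v, sqNorm, Finset.mul_sum]
    rw [← sqNorm_spectralCoord hA v] at hpos
    obtain ⟨i, -, hi⟩ := Finset.exists_ne_zero_of_sum_ne_zero hpos.ne'
    have hge : ∀ j, (E + δ) * ‖spectralCoord hA v j‖ ^ 2
        ≤ hA.eigenvalues j * ‖spectralCoord hA v j‖ ^ 2 := by
      intro j
      by_cases hj : hA.eigenvalues j ∈ Set.Iic (E + δ)
      · rw [h2 j hj]; simp
      · exact mul_le_mul_of_nonneg_right (not_le.mp hj).le (by positivity)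
    refine Finset.sum_lt_sum (fun j _ => hge j) ⟨i, Finset.mem_univ _, ?_⟩
    have hi' : hA.eigenvalues i ∉ Set.Iic (E + δ) := fun hj => hi (by rw [h2 i hj]; simp)
    exact mul_lt_mul_of_pos_right (not_le.mp hi') (lt_of_le_of_ne (by positivity) hi.symm)
  have := h v ha
  nlinarith

lemma sqNorm_mulVec_sub {A : Matrix V V ℂ} (hA : A.IsHermitian) (c : ℝ) (v : V → ℂ) :
    sqNorm (A.mulVec v - (c : ℂ) • v)
      = ∑ i, (hA.eigenvalues i - c) ^ 2 * ‖spectralCoord hA v i‖ ^ 2 := by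
  rw [← sqNorm_spectralCoord hA, sqNorm]
  refine Finset.sum_congr rfl fun i _ => ?_
  rw [map_sub, map_smul, Pi.sub_apply, spectralCoord_mulVec, Pi.smul_apply, smul_eq_mul,
    ← sub_mul, norm_mul, mul_pow, ← Complex.ofReal_sub, Complex.norm_real, Real.norm_eq_abs,
    sq_abs]

/-- If the coordinates of `v ≠ 0` for the eigenvalues in `[c - r, c + r]` vanish, then
`r ‖v‖ < ‖(A - c) v‖`. -/
lemma lt_sqNorm_mulVec_sub {A : Matrix V V ℂ} (hA : A.IsHermitian) {c r : ℝ} (hr : 0 ≤ r)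
    {v : V → ℂ} (hv : v ≠ 0)
    (h : ∀ i, hA.eigenvalues i ∈ Set.Icc (c - r) (c + r) → spectralCoord hA v i = 0) :
    r ^ 2 * sqNorm v < sqNorm (A.mulVec v - (c : ℂ) • v) := by
  rw [sqNorm_mulVec_sub hA]
  have hpos := sqNorm_pos hv
  rw [← sqNorm_spectralCoord hA v] at hpos ⊢
  rw [sqNorm, Finset.mul_sum]
  have hlt : ∀ j, hA.eigenvalues j ∉ Set.Icc (c - r) (c + r) →
      r ^ 2 < (hA.eigenvalues j - c) ^ 2 := by
    intro j hj
    rw [sq_lt_sq, abs_of_nonneg hr, lt_abs]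
    by_contra hcon
    push Not at hcon
    exact hj ⟨by linarith [hcon.2], by linarith [hcon.1]⟩
  obtain ⟨i, -, hi⟩ := Finset.exists_ne_zero_of_sum_ne_zero hpos.ne'
  refine Finset.sum_lt_sum (fun j _ => ?_) ⟨i, Finset.mem_univ _, ?_⟩
  · by_cases hj : hA.eigenvalues j ∈ Set.Icc (c - r) (c + r)
    · rw [h j hj]; simp
    · exact mul_le_mul_of_nonneg_right (hlt j hj).le (by positivity)
  · have hi' : hA.eigenvalues i ∉ Set.Icc (c - r) (c + r) := fun hj => hi (by rw [h i hj]; simp)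
    exact mul_lt_mul_of_pos_right (hlt i hi') (lt_of_le_of_ne (by positivity) hi.symm)

/-- A space of approximate eigenvectors forces eigenvalues. -/
lemma card_le_eigCount_Icc {ι : Type*} [Fintype ι] {A : Matrix V V ℂ} (hA : A.IsHermitian)
    {c r : ℝ} (hr : 0 ≤ r) (f : (ι → ℂ) →ₗ[ℂ] (V → ℂ)) (hf : Function.Injective f)
    (h : ∀ a, sqNorm (A.mulVec (f a) - (c : ℂ) • f a) ≤ r ^ 2 * sqNorm (f a)) :
    Fintype.card ι ≤ eigCount A (Set.Icc (c - r) (c + r)) := by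
  have := card_le_eigCount_add hA (Set.Icc (c - r) (c + r)) ∅ f fun a _ h2 => by
    by_contra hne
    have h0 : f a ≠ 0 := fun h0 => hne (hf (by rw [h0, map_zero]))
    exact (lt_sqNorm_mulVec_sub hA hr h0 h2).not_ge (h a)
  simpa using this

lemma sqNorm_mulVec_eigSynth_sub_le {A : Matrix V V ℂ} (hA : A.IsHermitian) {c r : ℝ} {B : Set ℝ}
    (hB : B ⊆ Set.Icc (c - r) (c + r)) (a : {i // hA.eigenvalues i ∈ B} → ℂ) :
    sqNorm (A.mulVec (eigSynth hA B a) - (c : ℂ) • eigSynth hA B a)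
      ≤ r ^ 2 * sqNorm (eigSynth hA B a) := by
  rw [sqNorm_mulVec_sub hA, ← sqNorm_spectralCoord hA (eigSynth hA B a), sqNorm, Finset.mul_sum]
  refine Finset.sum_le_sum fun i _ => ?_
  by_cases hi : hA.eigenvalues i ∈ B
  · refine mul_le_mul_of_nonneg_right ?_ (by positivity)
    have := hB hi
    exact sq_le_sq' (by linarith [this.1]) (by linarith [this.2])
  · rw [spectralCoord_eigSynth_of_notMem _ _ _ hi]; simp

end EigenvalueCounting


/-! ### Hermitian matrices with a random block potential -/

section BlockPotential

set_option linter.unusedSectionVars false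

variable {V : Type*} [Fintype V] [DecidableEq V]

/-- The operator `A + lam v` with a real potential `v`. -/
def ham (A : Matrix V V ℂ) (lam : ℝ) (v : V → ℝ) : Matrix V V ℂ :=
  A + Matrix.diagonal fun x => ((lam * v x : ℝ) : ℂ)

lemma ham_isHermitian {A : Matrix V V ℂ} (hA : A.IsHermitian) (lam : ℝ) (v : V → ℝ) :
    (ham A lam v).IsHermitian :=
  hA.add (Matrix.isHermitian_diagonal_iff.mpr fun _ => Complex.conj_ofReal _)

lemma quadForm_ham (A : Matrix V V ℂ) (lam : ℝ) (v : V → ℝ) (u : V → ℂ) :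
    quadForm (ham A lam v) u = quadForm A u + ∑ x, lam * v x * ‖u x‖ ^ 2 := by
  rw [quadForm, ham, Matrix.add_mulVec, dotProduct_add, Complex.add_re, quadForm]
  congr 1
  rw [dotProduct, Complex.re_sum]
  refine Finset.sum_congr rfl fun x _ => ?_
  rw [Matrix.mulVec_diagonal, Pi.star_apply, mul_left_comm, Complex.star_def, Complex.conj_mul',
    ← Complex.ofReal_pow, ← Complex.ofReal_mul, Complex.ofReal_re]

lemma eigCount_ham_le_of_le {A : Matrix V V ℂ} (hA : A.IsHermitian) (lam : ℝ) {v v' : V → ℝ}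
    {δ : ℝ} (h : ∀ x, lam * v x ≤ lam * v' x + δ) (E : ℝ) :
    eigCount (ham A lam v') (Set.Iic E) ≤ eigCount (ham A lam v) (Set.Iic (E + δ)) := by
  have := eigCount_Iic_le_of_quadForm_le (ham_isHermitian hA lam v) (ham_isHermitian hA lam v') ∅
    (δ := δ) (fun u _ => by
      rw [quadForm_ham, quadForm_ham, sqNorm, Finset.mul_sum, add_assoc, ← Finset.sum_add_distrib]
      gcongr with x
      rw [← add_mul]
      exact mul_le_mul_of_nonneg_right (h x) (by positivity)) E
  simpa using this

lemma eigCount_ham_antitone {A : Matrix V V ℂ} (hA : A.IsHermitian) {lam : ℝ} (hlam : 0 ≤ lam)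
    {v v' : V → ℝ} (h : v ≤ v') (E : ℝ) :
    eigCount (ham A lam v') (Set.Iic E) ≤ eigCount (ham A lam v) (Set.Iic E) := by
  have := eigCount_ham_le_of_le hA lam (v := v) (v' := v') (δ := 0)
    (fun x => by rw [add_zero]; exact mul_le_mul_of_nonneg_left (h x) hlam) E
  simpa using this

/-- Vectors that vanish on `b` do not see the change of the potential, so only the codimension
`b.card` is lost. This is the finite rank bound for the variation of one block variable, of whatever
size. -/
lemma eigCount_ham_le_add_card {A : Matrix V V ℂ} (hA : A.IsHermitian) (lam : ℝ) {v v' : V → ℝ}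
    {b : Finset V} (h : ∀ x ∉ b, v x = v' x) (E : ℝ) :
    eigCount (ham A lam v') (Set.Iic E) ≤ eigCount (ham A lam v) (Set.Iic E) + b.card := by
  have := eigCount_Iic_le_of_quadForm_le (ham_isHermitian hA lam v) (ham_isHermitian hA lam v') b
    (δ := 0) (fun u hu => by
      rw [quadForm_ham, quadForm_ham, zero_mul, add_zero]
      refine le_of_eq (congrArg _ (Finset.sum_congr rfl fun x _ => ?_))
      by_cases hx : x ∈ b
      · simp [hu x hx]
      · rw [h x hx]) E
  simpa using this

/-- A shift of the whole potential is a shift of the energy; Wegner's estimate uses it to turn the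
length of an interval into a displacement of the random variables. -/
lemma eigCount_ham_sub {A : Matrix V V ℂ} (hA : A.IsHermitian) (lam : ℝ) (v : V → ℝ) (δ E : ℝ) :
    eigCount (ham A lam fun x => v x - δ) (Set.Iic E)
      = eigCount (ham A lam v) (Set.Iic (E + lam * δ)) := by
  apply le_antisymm
  · exact eigCount_ham_le_of_le hA lam (fun x => by linarith) E
  · have := eigCount_ham_le_of_le hA lam (v' := v) (v := fun x => v x - δ) (δ := -(lam * δ))
      (fun x => by linarith) (E + lam * δ)
    simpa using this

lemma eigCount_Ioc {A : Matrix V V ℂ} (hA : A.IsHermitian) {a b : ℝ} (hab : a ≤ b) :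
    eigCount A (Set.Iic b) = eigCount A (Set.Iic a) + eigCount A (Set.Ioc a b) := by
  rw [← eigCount_union hA, Set.Iic_union_Ioc_eq_Iic hab]
  exact Set.disjoint_left.mpr fun x hx hx' => not_lt.mpr hx hx'.1

lemma exists_eigCount_Iio_eq {A : Matrix V V ℂ} (hA : A.IsHermitian) (E : ℝ) :
    ∃ δ > 0, eigCount A (Set.Iio E) ≤ eigCount A (Set.Iic (E - δ)) := by
  classical
  obtain ⟨δ, hδ, h⟩ : ∃ δ > 0, ∀ i, hA.eigenvalues i < E → hA.eigenvalues i ≤ E - δ := by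
    by_cases hne : (Finset.univ.filter fun i => hA.eigenvalues i < E).Nonempty
    · obtain ⟨i, hi, hmax⟩ := Finset.exists_max_image _ hA.eigenvalues hne
      rw [Finset.mem_filter] at hi
      exact ⟨E - hA.eigenvalues i, sub_pos.mpr hi.2, fun j hj => by
        have := hmax j (by simpa using hj); linarith⟩
    · exact ⟨1, one_pos, fun j hj => absurd ⟨j, by simpa using hj⟩ hne⟩
  refine ⟨δ, hδ, ?_⟩
  rw [eigCount_eq_card hA, eigCount_eq_card hA]
  exact Finset.card_le_card fun i hi => by simpa using h i (by simpa using hi)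

/-- Eigenvalues strictly below `E` stay below `E` under small perturbations, since there are
finitely many of them. The count on `Iio` is thus lower semicontinuous, which starts the proof of
measurability. -/
lemma isOpen_le_eigCount_ham {A : Matrix V V ℂ} (hA : A.IsHermitian) (lam E : ℝ) (k : ℕ) :
    IsOpen {v : V → ℝ | k ≤ eigCount (ham A lam v) (Set.Iio E)} := by
  rw [isOpen_iff_mem_nhds]
  intro v hv
  obtain ⟨δ, hδ, h⟩ := exists_eigCount_Iio_eq (ham_isHermitian hA lam v) E
  have hc : ∀ᶠ v' in 𝓝 v, ∀ x, lam * v' x < lam * v x + δ / 2 := by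
    rw [eventually_all]
    intro x
    have : ContinuousAt (fun v' : V → ℝ => lam * v' x) v :=
      (continuous_const.mul (continuous_apply x)).continuousAt
    exact this.eventually_lt_const (by linarith)
  filter_upwards [hc] with v' hv'
  calc k ≤ eigCount (ham A lam v) (Set.Iic (E - δ)) := le_trans hv h
    _ ≤ eigCount (ham A lam v') (Set.Iic (E - δ + δ / 2)) :=
        eigCount_ham_le_of_le hA lam (fun x => (hv' x).le) _
    _ ≤ _ := eigCount_mono _ fun y (hy : y ≤ _) => by
        show y < E
        linarith

/-- The half-lines `Iio E` are a generating π-system, and in the set variable `eigCount` is a finite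
measure, so the induction over measurable sets applies. -/
lemma measurable_eigCount_ham {A : Matrix V V ℂ} (hA : A.IsHermitian) (lam : ℝ) {B : Set ℝ}
    (hB : MeasurableSet B) : Measurable fun v : V → ℝ => eigCount (ham A lam v) B := by
  induction B, hB using MeasurableSpace.induction_on_inter
    (borel_eq_generateFrom_Iio ℝ ▸ BorelSpace.measurable_eq) isPiSystem_Iio with
  | empty => simp [eigCount]
  | basic t ht =>
    obtain ⟨E, rfl⟩ := ht
    exact measurable_of_Ici fun k => (isOpen_le_eigCount_ham hA lam E k).measurableSet
  | compl t ht ih =>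
    have : (fun v : V → ℝ => eigCount (ham A lam v) tᶜ)
        = fun v => Fintype.card V - eigCount (ham A lam v) t := by
      funext v
      rw [← eigCount_univ (ham_isHermitian hA lam v), ← Set.union_compl_self t,
        eigCount_union (ham_isHermitian hA lam v) disjoint_compl_right]
      simp
    rw [this]
    exact (measurable_from_top (f := fun n => Fintype.card V - n)).comp ih
  | iUnion t hd ht ih =>
    classical
    have h : ∀ v : V → ℝ, (eigCount (ham A lam v) (⋃ i, t i) : ℝ≥0∞)
        = ∑' i, (eigCount (ham A lam v) (t i) : ℝ≥0∞) := by
      intro v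
      have hsum : ∀ B : Set ℝ, (eigCount (ham A lam v) B : ℝ≥0∞)
          = ∑ j, B.indicator (fun _ => (1 : ℝ≥0∞)) ((ham_isHermitian hA lam v).eigenvalues j) := by
        intro B
        rw [eigCount_eq_sum (ham_isHermitian hA lam v)]
        push_cast
        rfl
      simp_rw [hsum]
      rw [Summable.tsum_finsetSum fun _ _ => ENNReal.summable]
      refine Finset.sum_congr rfl fun j _ => ?_
      by_cases hj : ∃ i, (ham_isHermitian hA lam v).eigenvalues j ∈ t i
      · obtain ⟨i, hi⟩ := hj
        rw [tsum_eq_single i fun i' hi' => Set.indicator_of_notMem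
          (fun hmem => Set.disjoint_left.mp (hd hi') hmem hi) _, Set.indicator_of_mem hi,
          Set.indicator_of_mem (Set.mem_iUnion.mpr ⟨i, hi⟩)]
      · push Not at hj
        rw [Set.indicator_of_notMem (by simpa using hj)]
        exact (ENNReal.tsum_eq_zero.mpr fun i => Set.indicator_of_notMem (hj i) _).symm
    have hm : Measurable fun v : V → ℝ => (eigCount (ham A lam v) (⋃ i, t i) : ℝ≥0∞) := by
      simp_rw [h]
      exact Measurable.tsum fun i => (measurable_from_top (f := Nat.cast)).comp (ih i)
    refine measurable_of_Ici fun k => ?_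
    have : (fun v : V → ℝ => eigCount (ham A lam v) (⋃ i, t i)) ⁻¹' Set.Ici k
        = (fun v : V → ℝ => (eigCount (ham A lam v) (⋃ i, t i) : ℝ≥0∞)) ⁻¹' Set.Ici (k : ℝ≥0∞) := by
      ext v; simp
    rw [this]
    exact hm measurableSet_Ici

end BlockPotential

/-! ### Resampling one random variable, and the one-variable shift estimate -/

section Resampling

set_option linter.unusedSectionVars false

variable {β : Type*} (ν : Measure ℝ) [IsProbabilityMeasure ν]

open Classical in
/-- Resampling one coordinate does not change the law of a family of independent random
variables. -/
lemma lintegral_infinitePi_update (b : β) {f : (β → ℝ) → ℝ≥0∞} (hf : Measurable f) :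
    ∫⁻ w, f w ∂(Measure.infinitePi fun _ : β => ν)
      = ∫⁻ w, ∫⁻ t, f (Function.update w b t) ∂ν ∂(Measure.infinitePi fun _ : β => ν) := by
  have hu : Measurable fun q : (β → ℝ) × ℝ => Function.update q.1 b q.2 := measurable_update'
  -- Both laws agree on boxes; in a box the coordinate `b` is supplied by the fresh variable and the
  -- others by the old family.
  have hmap : ((Measure.infinitePi fun _ : β => ν).prod ν).map
      (fun q : (β → ℝ) × ℝ => Function.update q.1 b q.2) = Measure.infinitePi fun _ : β => ν := by
    apply Measure.eq_infinitePi
    intro s t ht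
    rw [Measure.map_apply hu (.pi s.countable_toSet fun i _ => ht i)]
    by_cases hb : b ∈ s
    · have : (fun q : (β → ℝ) × ℝ => Function.update q.1 b q.2) ⁻¹' (Set.pi s t)
          = (Set.pi (s.erase b) t) ×ˢ t b := by
        ext q
        simp only [Set.mem_preimage, Set.mem_pi, Finset.mem_coe, Set.mem_prod, Finset.mem_erase]
        constructor
        · intro h
          refine ⟨fun i hi => ?_, ?_⟩
          · have := h i hi.2
            rwa [Function.update_of_ne hi.1] at this
          · simpa using h b hb
        · rintro ⟨h, h'⟩ i hi
          by_cases hib : i = b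
          · subst hib; simpa using h'
          · rw [Function.update_of_ne hib]
            exact h i ⟨hib, hi⟩
      rw [this, Measure.prod_prod, Measure.infinitePi_pi _ fun i _ => ht i, mul_comm,
        Finset.mul_prod_erase s (fun i => ν (t i)) hb]
    · have : (fun q : (β → ℝ) × ℝ => Function.update q.1 b q.2) ⁻¹' (Set.pi s t)
          = (Set.pi s t) ×ˢ Set.univ := by
        ext q
        simp only [Set.mem_preimage, Set.mem_pi, Finset.mem_coe, Set.mem_prod, Set.mem_univ,
          and_true]
        refine forall₂_congr fun i hi => ?_
        rw [Function.update_of_ne fun h : i = b => hb (h ▸ hi)]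
      rw [this, Measure.prod_prod, Measure.infinitePi_pi _ fun i _ => ht i, measure_univ, mul_one]
  conv_lhs => rw [← hmap]
  rw [lintegral_map hf hu]
  exact lintegral_prod _ (hf.comp hu).aemeasurable

/-- The shift estimate for a bounded antitone function. -/
lemma lintegral_shift_sub_le {C : NNReal} (hν : ν ≤ C • volume) {g : ℝ → ℕ} (hg : Antitone g)
    {M : ℕ} (hM : ∀ t t', g t ≤ g t' + M) {δ : ℝ} (hδ : 0 ≤ δ) :
    ∫⁻ t, ((g (t - δ) - g t : ℕ) : ℝ≥0∞) ∂ν ≤ C * (M * ENNReal.ofReal δ) := by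
  have hanti : Antitone fun t => (g t : ℝ) := fun a b hab =>
    Nat.cast_le.mpr (hg hab)
  have hanti' : Antitone fun t => (g (t - δ) : ℝ) := fun a b hab =>
    Nat.cast_le.mpr (hg (by linarith))
  have hnn : ∀ t, 0 ≤ (g (t - δ) : ℝ) - g t := fun t => by
    have := hg (show t - δ ≤ t by linarith)
    rw [sub_nonneg]; exact_mod_cast this
  have hcast : ∀ t, ((g (t - δ) - g t : ℕ) : ℝ≥0∞) = ENNReal.ofReal ((g (t - δ) : ℝ) - g t) := by
    intro t
    rw [← Nat.cast_sub (hg (by linarith)), ENNReal.ofReal_natCast]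
  have hmeas : Measurable fun t => ENNReal.ofReal ((g (t - δ) : ℝ) - g t) :=
    (hanti'.measurable.sub hanti.measurable).ennreal_ofReal
  -- Over `[-n, n]` the integral of `g (t - δ) - g t` telescopes to integrals over two intervals of
  -- length `δ` at the ends, and `g` varies by at most `M`. The bound is independent of `n`.
  have hT : ∀ n : ℕ, ∫⁻ t in Set.Icc (-(n : ℝ)) n, ENNReal.ofReal ((g (t - δ) : ℝ) - g t)
      ≤ M * ENNReal.ofReal δ := by
    intro n
    have hn : -(n : ℝ) ≤ n := by have : (0 : ℝ) ≤ n := n.cast_nonneg; linarith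
    have hi1 : ∀ a b, IntervalIntegrable (fun t => (g t : ℝ)) volume a b :=
      fun a b => hanti.intervalIntegrable
    have hi2 : ∀ a b, IntervalIntegrable (fun t => (g (t - δ) : ℝ)) volume a b :=
      fun a b => hanti'.intervalIntegrable
    have hint := (hi2 (-n) n).sub (hi1 (-n) n)
    rw [← ofReal_integral_eq_lintegral_ofReal, integral_Icc_eq_integral_Ioc,
      ← intervalIntegral.integral_of_le hn, intervalIntegral.integral_sub (hi2 _ _) (hi1 _ _),
      intervalIntegral.integral_comp_sub_right (fun t => (g t : ℝ)) δ,
      intervalIntegral.integral_interval_sub_interval_comm (hi1 _ _) (hi1 _ _) (hi1 _ _)]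
    · have e1 : ∫ t in (-(n : ℝ) - δ)..(-n), (g t : ℝ) ≤ δ * g (-n - δ) := by
        have := intervalIntegral.integral_mono_on (f := fun t => (g t : ℝ))
          (g := fun _ => (g (-n - δ) : ℝ)) (by linarith) (hi1 (-(n : ℝ) - δ) (-n)) (by simp)
          (fun x hx => hanti hx.1)
        rw [intervalIntegral.integral_const, smul_eq_mul] at this
        convert this using 2; ring
      have e2 : δ * g n ≤ ∫ t in ((n : ℝ) - δ)..n, (g t : ℝ) := by
        have := intervalIntegral.integral_mono_on (g := fun t => (g t : ℝ))
          (f := fun _ => (g n : ℝ)) (by linarith) (by simp) (hi1 ((n : ℝ) - δ) n)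
          (fun x hx => hanti hx.2)
        rw [intervalIntegral.integral_const, smul_eq_mul] at this
        convert this using 2; ring
      have e3 : (g (-n - δ) : ℝ) ≤ g n + M := by exact_mod_cast hM _ _
      rw [← ENNReal.ofReal_natCast, ← ENNReal.ofReal_mul (by positivity)]
      apply ENNReal.ofReal_le_ofReal
      nlinarith
    · exact (intervalIntegrable_iff_integrableOn_Icc_of_le hn).mp hint
    · exact ae_of_all _ hnn
  calc ∫⁻ t, ((g (t - δ) - g t : ℕ) : ℝ≥0∞) ∂ν
      ≤ ∫⁻ t, ENNReal.ofReal ((g (t - δ) : ℝ) - g t) ∂(C • volume) := by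
        simp_rw [hcast]
        exact lintegral_mono' hν le_rfl
    _ = C * ∫⁻ t, ENNReal.ofReal ((g (t - δ) : ℝ) - g t) := by
        rw [lintegral_smul_measure]; rfl
    _ ≤ _ := by
        gcongr
        have hcov : AECover volume atTop fun n : ℕ => Set.Icc (-(n : ℝ)) n :=
          aecover_Icc (tendsto_neg_atTop_atBot.comp tendsto_natCast_atTop_atTop)
            tendsto_natCast_atTop_atTop
        exact le_of_tendsto' (hcov.lintegral_tendsto_of_countably_generated hmeas.aemeasurable) hT

end Resampling

/-! ### Wegner and Minami estimates -/

section Wegner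

set_option linter.unusedSectionVars false

variable {V β : Type*} [Fintype V] [DecidableEq V]

open Classical in
/-- All blocks of the block map `s` have at most `M` elements. -/
def BlockCardLE (s : V → β) (M : ℕ) : Prop := ∀ b, (Finset.univ.filter fun x => s x = b).card ≤ M

open Classical in
/-- Lower by `δ` the variables with index in `S`. -/
def lowerOn (S : Finset β) (δ : ℝ) (w : β → ℝ) : β → ℝ := fun i => if i ∈ S then w i - δ else w i

lemma lowerOn_le (S : Finset β) {δ : ℝ} (hδ : 0 ≤ δ) (w : β → ℝ) : lowerOn S δ w ≤ w := by
  intro i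
  unfold lowerOn
  split_ifs <;> linarith

open Classical in
lemma lowerOn_insert_le (S : Finset β) (b : β) {δ : ℝ} (hδ : 0 ≤ δ) (w : β → ℝ) :
    lowerOn (insert b S) δ w ≤ lowerOn S δ w := by
  intro i
  unfold lowerOn
  split_ifs with h1 h2 <;> first | linarith | skip
  exact absurd (Finset.mem_insert_of_mem ‹_›) h1

lemma measurable_lowerOn (S : Finset β) (δ : ℝ) : Measurable (lowerOn S δ) := by
  classical
  refine measurable_pi_lambda _ fun i => ?_
  unfold lowerOn
  split_ifs <;> fun_prop

open Classical in
lemma lowerOn_insert_update {S : Finset β} {b : β} (hb : b ∉ S) (δ : ℝ) (w : β → ℝ) (t : ℝ) :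
    lowerOn (insert b S) δ (Function.update w b t)
      = Function.update (lowerOn S δ w) b (t - δ) := by
  funext i
  by_cases hi : i = b
  · subst hi; simp [lowerOn]
  · simp [lowerOn, hi]

open Classical in
lemma lowerOn_update {S : Finset β} {b : β} (hb : b ∉ S) (δ : ℝ) (w : β → ℝ) (t : ℝ) :
    lowerOn S δ (Function.update w b t) = Function.update (lowerOn S δ w) b t := by
  funext i
  by_cases hi : i = b
  · subst hi; simp [lowerOn, hb]
  · simp [lowerOn, hi]

lemma measurable_comp_blockMap (s : V → β) : Measurable fun w : β → ℝ => fun x => w (s x) := by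
  fun_prop

lemma measurable_eigCount_comp {A : Matrix V V ℂ} (hA : A.IsHermitian) (lam : ℝ) (s : V → β)
    {B : Set ℝ} (hB : MeasurableSet B) :
    Measurable fun w : β → ℝ => eigCount (ham A lam fun x => w (s x)) B :=
  (measurable_eigCount_ham hA lam hB).comp (measurable_comp_blockMap s)

lemma measurable_natCast_ennreal {α : Type*} [MeasurableSpace α] {f : α → ℕ} (hf : Measurable f) :
    Measurable fun x => (f x : ℝ≥0∞) :=
  (measurable_from_top (f := Nat.cast)).comp hf

variable (ν : Measure ℝ) [IsProbabilityMeasure ν]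

open Classical in
/-- Wegner's estimate, with a weight `f` that is dominated, after resampling any coordinate,
by a function `F`. -/
lemma lintegral_eigCount_Ioc_mul_le {A : Matrix V V ℂ} (hA : A.IsHermitian) {lam : ℝ}
    (hlam : 0 < lam) {s : V → β} {M : ℕ} (hM : BlockCardLE s M) {C : NNReal}
    (hν : ν ≤ C • volume) (E : ℝ) {h : ℝ} (hh : 0 ≤ h) {f F : (β → ℝ) → ℝ≥0∞}
    (hf : Measurable f) (hF : Measurable F)
    (hfF : ∀ w b t, f (Function.update w b t) ≤ F w) :
    ∫⁻ w, (eigCount (ham A lam fun x => w (s x)) (Set.Ioc E (E + h)) : ℝ≥0∞) * f w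
        ∂(Measure.infinitePi fun _ : β => ν)
      ≤ Fintype.card V * (C * (M * ENNReal.ofReal (h / lam)))
        * ∫⁻ w, F w ∂(Measure.infinitePi fun _ : β => ν) := by
  -- Lowering every variable by `h / lam` moves the spectrum down by exactly `h`.
  set δ := h / lam with hδ
  have hδ0 : 0 ≤ δ := by positivity
  set N : Finset β → (β → ℝ) → ℕ :=
    fun S w => eigCount (ham A lam fun x => lowerOn S δ w (s x)) (Set.Iic E) with hN
  have hNmeas : ∀ S, Measurable (N S) := fun S =>
    (measurable_eigCount_comp hA lam s measurableSet_Iic).comp (measurable_lowerOn S δ)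
  have hNmono : ∀ S b w, N S w ≤ N (insert b S) w := fun S b w =>
    eigCount_ham_antitone hA hlam.le (fun x => lowerOn_insert_le S b hδ0 w (s x)) E
  have hN0 : ∀ S w, N ∅ w ≤ N S w := fun S w =>
    eigCount_ham_antitone hA hlam.le (fun x => by
      have := lowerOn_le S hδ0 w (s x)
      simpa [lowerOn] using this) E
  have hmeas : ∀ S S', Measurable fun w => ((N S w - N S' w : ℕ) : ℝ≥0∞) * f w := fun S S' =>
    (measurable_natCast_ennreal ((hNmeas S).sub (hNmeas S'))).mul hf
  -- Lower one further block and resample its variable: as a function of this variable alone the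
  -- count is antitone and, the block having at most `M` sites, of oscillation at most `M`, so the
  -- shift estimate applies. The weight is replaced by `F`, which does not see the resampled
  -- variable.
  have hstep : ∀ S b, b ∉ S →
      ∫⁻ w, ((N (insert b S) w - N S w : ℕ) : ℝ≥0∞) * f w ∂(Measure.infinitePi fun _ : β => ν)
        ≤ (C * (M * ENNReal.ofReal δ)) * ∫⁻ w, F w ∂(Measure.infinitePi fun _ : β => ν) := by
    intro S b hb
    rw [lintegral_infinitePi_update ν b (hmeas _ _), ← lintegral_const_mul _ hF]
    refine lintegral_mono fun w => ?_
    set g : ℝ → ℕ := fun t =>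
      eigCount (ham A lam fun x => Function.update (lowerOn S δ w) b t (s x)) (Set.Iic E) with hg
    have hgeq : ∀ t, N (insert b S) (Function.update w b t) - N S (Function.update w b t)
        = g (t - δ) - g t := by
      intro t
      simp only [hN, hg, lowerOn_insert_update hb, lowerOn_update hb]
    have hganti : Antitone g := fun t t' htt => eigCount_ham_antitone hA hlam.le (fun x => by
      by_cases hx : s x = b
      · simpa [hx] using htt
      · simp [hx]) E
    have hgM : ∀ t t', g t ≤ g t' + M := fun t t' =>
      (eigCount_ham_le_add_card hA lam (b := Finset.univ.filter fun x => s x = b) (fun x hx => by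
        have hx' : s x ≠ b := by simpa using hx
        simp [hx']) E).trans (Nat.add_le_add_left (hM b) _)
    calc ∫⁻ t, ((N (insert b S) (Function.update w b t) - N S (Function.update w b t) : ℕ) : ℝ≥0∞)
            * f (Function.update w b t) ∂ν
        ≤ ∫⁻ t, ((g (t - δ) - g t : ℕ) : ℝ≥0∞) * F w ∂ν := by
          refine lintegral_mono fun t => ?_
          rw [hgeq t]
          exact mul_le_mul_right (hfF w b t) _
      _ = (∫⁻ t, ((g (t - δ) - g t : ℕ) : ℝ≥0∞) ∂ν) * F w := by
          refine lintegral_mul_const _ (measurable_natCast_ennreal (Measurable.sub ?_ ?_))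
          · exact hganti.measurable.comp (measurable_id.sub_const δ)
          · exact hganti.measurable
      _ ≤ _ := by
          gcongr
          exact lintegral_shift_sub_le ν hν hganti hgM hδ0
  have hind : ∀ S : Finset β,
      ∫⁻ w, ((N S w - N ∅ w : ℕ) : ℝ≥0∞) * f w ∂(Measure.infinitePi fun _ : β => ν)
        ≤ S.card * ((C * (M * ENNReal.ofReal δ))
          * ∫⁻ w, F w ∂(Measure.infinitePi fun _ : β => ν)) := by
    intro S
    induction S using Finset.induction_on with
    | empty => simp
    | insert b S hb ih =>
      have hsplit : ∀ w, ((N (insert b S) w - N ∅ w : ℕ) : ℝ≥0∞) * f w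
          = ((N (insert b S) w - N S w : ℕ) : ℝ≥0∞) * f w + ((N S w - N ∅ w : ℕ) : ℝ≥0∞) * f w := by
        intro w
        rw [← add_mul, ← Nat.cast_add]
        congr 3
        have := hNmono S b w
        have := hN0 S w
        omega
      simp_rw [hsplit]
      rw [lintegral_add_left (hmeas _ _),
        Finset.card_insert_of_notMem hb, Nat.cast_add, Nat.cast_one, add_mul, one_mul, add_comm]
      exact add_le_add ih (hstep S b hb)
  -- Once the variables of all blocks that occur are lowered, the difference of the counts is the
  -- count in `(E, E + h]`; the number of steps is at most the number of vertices.
  have hfin : ∀ w, eigCount (ham A lam fun x => w (s x)) (Set.Ioc E (E + h))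
      = N (Finset.univ.image s) w - N ∅ w := by
    intro w
    have h1 : N (Finset.univ.image s) w
        = eigCount (ham A lam fun x => w (s x)) (Set.Iic (E + h)) := by
      have : E + h = E + lam * δ := by rw [hδ]; field_simp
      rw [this, ← eigCount_ham_sub hA]
      simp [hN, lowerOn]
    have h2 : N ∅ w = eigCount (ham A lam fun x => w (s x)) (Set.Iic E) := by
      simp [hN, lowerOn]
    rw [h1, h2, eigCount_Ioc (ham_isHermitian hA _ _) (show E ≤ E + h by linarith)]
    omega
  simp_rw [hfin]
  refine (hind _).trans ?_
  rw [← mul_assoc]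
  gcongr
  exact Finset.card_image_le

lemma lintegral_eigCount_Ioc_le {A : Matrix V V ℂ} (hA : A.IsHermitian) {lam : ℝ}
    (hlam : 0 < lam) {s : V → β} {M : ℕ} (hM : BlockCardLE s M) {C : NNReal}
    (hν : ν ≤ C • volume) (E : ℝ) {h : ℝ} (hh : 0 ≤ h) :
    ∫⁻ w, (eigCount (ham A lam fun x => w (s x)) (Set.Ioc E (E + h)) : ℝ≥0∞)
        ∂(Measure.infinitePi fun _ : β => ν)
      ≤ Fintype.card V * (C * (M * ENNReal.ofReal (h / lam))) := by
  have := lintegral_eigCount_Ioc_mul_le ν hA hlam hM hν E hh (f := fun _ => 1) (F := fun _ => 1)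
    measurable_const measurable_const (fun _ _ _ => le_rfl)
  simpa using this

/-- Wegner's estimate. -/
lemma lintegral_eigCount_Icc_le {A : Matrix V V ℂ} (hA : A.IsHermitian) {lam : ℝ}
    (hlam : 0 < lam) {s : V → β} {M : ℕ} (hM : BlockCardLE s M) {C : NNReal}
    (hν : ν ≤ C • volume) {a b : ℝ} (hab : a ≤ b) :
    ∫⁻ w, (eigCount (ham A lam fun x => w (s x)) (Set.Icc a b) : ℝ≥0∞)
        ∂(Measure.infinitePi fun _ : β => ν)
      ≤ Fintype.card V * (C * (M * ENNReal.ofReal ((b - a) / lam))) := by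
  have hlim : Tendsto (fun η : ℝ => (Fintype.card V : ℝ≥0∞)
      * (C * (M * ENNReal.ofReal ((b - a + η) / lam)))) (𝓝[>] 0)
      (𝓝 (Fintype.card V * (C * (M * ENNReal.ofReal ((b - a) / lam))))) := by
    have h1 : Tendsto (fun η : ℝ => ENNReal.ofReal ((b - a + η) / lam)) (𝓝[>] 0)
        (𝓝 (ENNReal.ofReal ((b - a) / lam))) := by
      refine ENNReal.tendsto_ofReal (tendsto_nhdsWithin_of_tendsto_nhds ?_)
      have : Continuous fun η : ℝ => (b - a + η) / lam := by fun_prop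
      simpa using this.tendsto 0
    exact ENNReal.Tendsto.const_mul (ENNReal.Tendsto.const_mul (ENNReal.Tendsto.const_mul h1
      (Or.inr (by simp))) (Or.inr (by simp))) (Or.inr (by simp))
  refine ge_of_tendsto hlim ?_
  -- The left end point is gained by starting the half-open interval at `a - η` and letting `η` tend
  -- to `0`.
  filter_upwards [self_mem_nhdsWithin] with η (hη : 0 < η)
  have := lintegral_eigCount_Ioc_le ν hA hlam hM hν (a - η) (h := b - a + η) (by linarith)
  refine le_trans (lintegral_mono fun w => ?_) this
  refine Nat.cast_le.mpr (eigCount_mono _ fun x hx => ⟨by linarith [hx.1], by linarith [hx.2]⟩)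

/-- Minami's estimate for perturbations of rank at most `M`. -/
lemma lintegral_eigCount_Ioc_mul_sub_le {A : Matrix V V ℂ} (hA : A.IsHermitian) {lam : ℝ}
    (hlam : 0 < lam) {s : V → β} {M : ℕ} (hM : BlockCardLE s M) {C : NNReal}
    (hν : ν ≤ C • volume) (E : ℝ) {h : ℝ} (hh : 0 ≤ h) :
    ∫⁻ w, (eigCount (ham A lam fun x => w (s x)) (Set.Ioc E (E + h)) : ℝ≥0∞)
        * ((eigCount (ham A lam fun x => w (s x)) (Set.Ioc E (E + h)) - M : ℕ) : ℝ≥0∞)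
        ∂(Measure.infinitePi fun _ : β => ν)
      ≤ (Fintype.card V * (C * (M * ENNReal.ofReal (h / lam)))) ^ 2 := by
  classical
  have hmeas := measurable_eigCount_comp hA lam s (measurableSet_Ioc (a := E) (b := E + h))
  -- The weighted estimate, with the excess of the count over `M` as weight: resampling one block
  -- changes the count by at most `M`, so the weight is dominated by the unmodified count, to which
  -- Wegner's estimate applies once more.
  refine (lintegral_eigCount_Ioc_mul_le ν hA hlam hM hν E hh
    (f := fun w => ((eigCount (ham A lam fun x => w (s x)) (Set.Ioc E (E + h)) - M : ℕ) : ℝ≥0∞))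
    (F := fun w => (eigCount (ham A lam fun x => w (s x)) (Set.Ioc E (E + h)) : ℝ≥0∞))
    (measurable_natCast_ennreal (hmeas.sub_const M)) (measurable_natCast_ennreal hmeas)
    fun w b t => ?_).trans ?_
  · refine Nat.cast_le.mpr (Nat.sub_le_iff_le_add.mpr ?_)
    have hrank : ∀ (w w' : β → ℝ) (E' : ℝ), (∀ i ≠ b, w i = w' i) →
        eigCount (ham A lam fun x => w (s x)) (Set.Iic E')
          ≤ eigCount (ham A lam fun x => w' (s x)) (Set.Iic E') + M := fun w w' E' hw =>
      (eigCount_ham_le_add_card hA lam (b := Finset.univ.filter fun x => s x = b) (fun x hx => by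
        have hx' : s x ≠ b := by simpa using hx
        exact (hw _ hx').symm) E').trans (Nat.add_le_add_left (hM b) _)
    have hw : ∀ i ≠ b, Function.update w b t i = w i := fun i hi => Function.update_of_ne hi _ _
    have hE : E ≤ E + h := by linarith
    have e1 := eigCount_Ioc (ham_isHermitian hA lam fun x => w (s x)) hE
    have e2 := eigCount_Ioc (ham_isHermitian hA lam fun x => Function.update w b t (s x)) hE
    -- According to the direction of the change, one end of the interval is treated by monotonicity
    -- and only the other one by the rank. This loses `M` and not `2 * M`, which is decisive for the
    -- number of admissible jumps.
    rcases le_total t (w b) with htb | htb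
    · have hle : Function.update w b t ≤ w := by
        intro i
        by_cases hi : i = b
        · subst hi; simpa using htb
        · rw [hw i hi]
      have m1 := eigCount_ham_antitone hA hlam.le (fun x => hle (s x)) E
      have m2 := hrank (Function.update w b t) w (E + h) hw
      omega
    · have hle : w ≤ Function.update w b t := by
        intro i
        by_cases hi : i = b
        · subst hi; simpa using htb
        · rw [hw i hi]
      have m1 := eigCount_ham_antitone hA hlam.le (fun x => hle (s x)) (E + h)
      have m2 := hrank w (Function.update w b t) E fun i hi => (hw i hi).symm
      omega
  · rw [sq]
    exact mul_le_mul_right (lintegral_eigCount_Ioc_le ν hA hlam hM hν E hh) _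

end Wegner

/-! ### Fractional moments of the Green function -/

section FractionalMoments

/-- The square root of an extended nonnegative number. -/
def esqrt (x : ℝ≥0∞) : ℝ≥0∞ := x ^ (1 / 2 : ℝ)

lemma esqrt_mul (x y : ℝ≥0∞) : esqrt (x * y) = esqrt x * esqrt y :=
  ENNReal.mul_rpow_of_nonneg _ _ (by norm_num)

lemma esqrt_mono {x y : ℝ≥0∞} (h : x ≤ y) : esqrt x ≤ esqrt y :=
  ENNReal.rpow_le_rpow h (by norm_num)

lemma esqrt_sq (x : ℝ≥0∞) : esqrt x ^ 2 = x := by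
  rw [esqrt, ← ENNReal.rpow_natCast, ← ENNReal.rpow_mul]; norm_num

lemma esqrt_zero : esqrt 0 = 0 := ENNReal.zero_rpow_of_pos (by norm_num)

/-- The exponent `1 / 2` has two virtues: it is subadditive, so that matrix products can be
estimated term by term, and `|x|^(-1/2)` is locally integrable, so that resolvents have finite
moments of this order. -/
lemma esqrt_sum_le {ι : Type*} (S : Finset ι) (f : ι → ℝ≥0∞) :
    esqrt (∑ i ∈ S, f i) ≤ ∑ i ∈ S, esqrt (f i) := by
  classical
  induction S using Finset.induction_on with
  | empty => simp [esqrt_zero]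
  | insert i S hi ih =>
    rw [Finset.sum_insert hi, Finset.sum_insert hi]
    exact (ENNReal.rpow_add_le_add_rpow _ _ (by norm_num) (by norm_num)).trans (add_le_add le_rfl ih)

lemma measurable_esqrt : Measurable esqrt := by unfold esqrt; fun_prop

/-- Where `|lam * t + q| ≥ h` the integrand is at most `θ / 2` by the choice of `h`; the rest is the
integral of a locally integrable singularity, which scaling by `lam` makes of order `1 / lam`.
Translation invariance of Lebesgue measure makes this uniform in `q`. -/
lemma exists_lintegral_esqrt_inv_le (ν : Measure ℝ) [IsProbabilityMeasure ν] {C : NNReal}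
    (hν : ν ≤ C • volume) {θ : ℝ≥0∞} (hθ : 0 < θ) :
    ∃ lam₀ : ℝ, 0 < lam₀ ∧ ∀ lam, lam₀ < lam → ∀ q : ℝ,
      ∫⁻ t, esqrt (‖lam * t + q‖ₑ⁻¹) ∂ν ≤ θ := by
  obtain ⟨h, hh, hhθ⟩ : ∃ h : ℝ, 0 < h ∧ esqrt ((ENNReal.ofReal h)⁻¹) ≤ θ / 2 := by
    have h1 : Tendsto (fun h : ℝ => esqrt ((ENNReal.ofReal h)⁻¹)) atTop (𝓝 0) := by
      have h2 : Tendsto (fun h : ℝ => (ENNReal.ofReal h)⁻¹) atTop (𝓝 0) := by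
        have := ENNReal.tendsto_ofReal_atTop.inv
        simpa using this
      have := (ENNReal.continuous_rpow_const (y := (1 / 2 : ℝ))).tendsto (0 : ℝ≥0∞)
      rw [ENNReal.zero_rpow_of_pos (by norm_num)] at this
      exact this.comp h2
    obtain ⟨h, h2, h3⟩ := ((h1.eventually_le_const (ENNReal.half_pos hθ.ne')).and
      (eventually_gt_atTop 0)).exists
    exact ⟨h, h3, h2⟩
  set c := ∫⁻ x in Set.Ioo (-h) h, esqrt (‖x‖ₑ⁻¹) with hc
  have hcfin : c < ∞ := by
    have hpos : ∫⁻ x in Set.Ioc 0 h, esqrt (‖x‖ₑ⁻¹) < ∞ := by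
      have hint := (intervalIntegral.intervalIntegrable_rpow' (a := 0) (b := h)
        (r := -(1 / 2)) (by norm_num))
      rw [intervalIntegrable_iff_integrableOn_Ioc_of_le hh.le] at hint
      refine lt_of_le_of_lt (le_of_eq ?_) hint.2
      refine setLIntegral_congr_fun measurableSet_Ioc fun x hx => ?_
      have hx0 : 0 < x := hx.1
      rw [Real.enorm_of_nonneg hx0.le, Real.enorm_of_nonneg (by positivity), esqrt,
        ENNReal.inv_rpow, ← ENNReal.rpow_neg, ENNReal.ofReal_rpow_of_pos hx0]
    have hneg : ∫⁻ x in Set.Ico (-h) 0, esqrt (‖x‖ₑ⁻¹) < ∞ := by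
      have : ∫⁻ x in Set.Ico (-h) 0, esqrt (‖x‖ₑ⁻¹) = ∫⁻ x in Set.Ioc 0 h, esqrt (‖x‖ₑ⁻¹) := by
        rw [← lintegral_indicator measurableSet_Ico, ← lintegral_indicator measurableSet_Ioc,
          ← lintegral_neg_eq_self]
        congr 1; funext x
        by_cases hx : x ∈ Set.Ioc 0 h
        · rw [Set.indicator_of_mem hx, Set.indicator_of_mem
            (show -x ∈ Set.Ico (-h) 0 from ⟨by linarith [hx.2], by linarith [hx.1]⟩),
            enorm_neg]
        · rw [Set.indicator_of_notMem hx, Set.indicator_of_notMem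
            fun hx' : -x ∈ Set.Ico (-h) 0 => hx ⟨by linarith [hx'.2], by linarith [hx'.1]⟩]
      rw [this]; exact hpos
    calc c ≤ ∫⁻ x in Set.Ico (-h) 0 ∪ ({0} ∪ Set.Ioc 0 h), esqrt (‖x‖ₑ⁻¹) := by
          refine lintegral_mono_set fun x hx => ?_
          rcases lt_trichotomy x 0 with h0 | h0 | h0
          · exact Or.inl ⟨hx.1.le, h0⟩
          · exact Or.inr (Or.inl h0)
          · exact Or.inr (Or.inr ⟨h0, hx.2.le⟩)
      _ ≤ (∫⁻ x in Set.Ico (-h) 0, esqrt (‖x‖ₑ⁻¹))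
          + ((∫⁻ x in {(0 : ℝ)}, esqrt (‖x‖ₑ⁻¹)) + ∫⁻ x in Set.Ioc 0 h, esqrt (‖x‖ₑ⁻¹)) :=
          (lintegral_union_le _ _ _).trans (add_le_add le_rfl (lintegral_union_le _ _ _))
      _ < ∞ := by simpa using ENNReal.add_lt_top.mpr ⟨hneg, hpos⟩
  obtain ⟨lam₀, hlam₀, hle⟩ : ∃ lam₀ : ℝ, 0 < lam₀ ∧
      ∀ lam, lam₀ < lam → C * (ENNReal.ofReal |lam⁻¹| * c) ≤ θ / 2 := by
    have h1 : Tendsto (fun lam : ℝ => C * (ENNReal.ofReal |lam⁻¹| * c)) atTop (𝓝 0) := by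
      have h2 : Tendsto (fun lam : ℝ => ENNReal.ofReal |lam⁻¹|) atTop (𝓝 0) := by
        have := ENNReal.tendsto_ofReal (tendsto_inv_atTop_zero (𝕜 := ℝ)).abs
        simpa using this
      have h3 := ENNReal.Tendsto.const_mul (a := (C : ℝ≥0∞))
        (ENNReal.Tendsto.mul_const (b := c) h2 (Or.inr hcfin.ne)) (Or.inr (by simp))
      simpa using h3
    obtain ⟨a, ha⟩ := (eventually_atTop.mp (h1.eventually_le_const (ENNReal.half_pos hθ.ne')))
    exact ⟨max a 1, by positivity, fun lam hlam => ha lam ((le_max_left _ _).trans hlam.le)⟩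
  refine ⟨lam₀, hlam₀, fun lam hlam q => ?_⟩
  have hlam0 : lam ≠ 0 := (hlam₀.trans hlam).ne'
  set φ : ℝ → ℝ≥0∞ := (Set.Ioo (-h) h).indicator fun x => esqrt (‖x‖ₑ⁻¹) with hφ
  have hφm : Measurable φ :=
    (measurable_esqrt.comp (measurable_enorm.inv)).indicator measurableSet_Ioo
  have hpt : ∀ x : ℝ, esqrt (‖x‖ₑ⁻¹) ≤ θ / 2 + φ x := by
    intro x
    by_cases hx : x ∈ Set.Ioo (-h) h
    · rw [hφ, Set.indicator_of_mem hx]; exact le_add_self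
    · refine le_add_right ((esqrt_mono ?_).trans hhθ)
      rw [ENNReal.inv_le_inv, Real.enorm_eq_ofReal_abs]
      refine ENNReal.ofReal_le_ofReal ?_
      by_contra hcon
      exact hx (abs_lt.mp (not_le.mp hcon))
  calc ∫⁻ t, esqrt (‖lam * t + q‖ₑ⁻¹) ∂ν ≤ ∫⁻ t, (θ / 2 + φ (lam * t + q)) ∂ν :=
        lintegral_mono fun t => hpt _
    _ = θ / 2 + ∫⁻ t, φ (lam * t + q) ∂ν := by
        rw [lintegral_add_left measurable_const]; simp
    _ ≤ θ / 2 + ∫⁻ t, φ (lam * t + q) ∂(C • volume) := by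
        gcongr
    _ = θ / 2 + C * (ENNReal.ofReal |lam⁻¹| * c) := by
        rw [lintegral_smul_measure]
        have h1 : ∫⁻ t, φ (lam * t + q) = ∫⁻ t, φ (t + q) ∂(volume.map (lam * ·)) := by
          rw [lintegral_map (by fun_prop) (by fun_prop)]
        rw [h1, Real.map_volume_mul_left hlam0, lintegral_smul_measure,
          lintegral_add_right_eq_self φ q, hφ, lintegral_indicator measurableSet_Ioo]
        rfl
    _ ≤ θ / 2 + θ / 2 := by gcongr; exact hle lam hlam
    _ = θ := ENNReal.add_halves θ

end FractionalMoments

/-! ### The Green function of a finite operator -/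

section Green

variable {V : Type*} [Fintype V] [DecidableEq V]

/-- The Green function, the matrix of the resolvent (`0` if `E` is an eigenvalue). -/
def green (A : Matrix V V ℂ) (lam : ℝ) (v : V → ℝ) (E : ℝ) : Matrix V V ℂ :=
  (ham A lam v - (E : ℂ) • (1 : Matrix V V ℂ))⁻¹

lemma measurable_green (A : Matrix V V ℂ) (lam E : ℝ) (x y : V) :
    Measurable fun v : V → ℝ => green A lam v E x y := by
  have hc : Continuous fun v : V → ℝ => ham A lam v - (E : ℂ) • (1 : Matrix V V ℂ) := by
    unfold ham
    refine (continuous_const.add (Continuous.matrix_diagonal ?_)).sub continuous_const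
    fun_prop
  simp only [green, Matrix.inv_def, Ring.inverse_eq_inv', Matrix.smul_apply, smul_eq_mul]
  exact (hc.matrix_det.measurable.inv).mul
    ((continuous_apply_apply x y).comp hc.matrix_adjugate).measurable

lemma eigCount_eq_zero {A : Matrix V V ℂ} {B : Set ℝ} :
    eigCount A B = 0 ↔ ∀ z ∈ A.charpoly.roots, z.re ∉ B := by
  classical
  rw [eigCount, Multiset.countP_eq_zero]

lemma isUnit_det_of_eigCount_eq_zero (H : Matrix V V ℂ) (E : ℝ)
    (h : eigCount H (Set.Icc E E) = 0) : IsUnit (H - (E : ℂ) • (1 : Matrix V V ℂ)).det := by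
  rw [isUnit_iff_ne_zero]
  intro h0
  have hroot : (E : ℂ) ∈ H.charpoly.roots := by
    rw [Polynomial.mem_roots H.charpoly_monic.ne_zero, Polynomial.IsRoot, Matrix.eval_charpoly,
      ← neg_sub, Matrix.det_neg, Matrix.scalar_apply, ← Matrix.smul_one_eq_diagonal, h0, mul_zero]
  exact eigCount_eq_zero.mp h _ hroot (by simp)

/-- Wegner's estimate for the degenerate interval `[E, E]`: the expected number of eigenvalues equal
to `E` is zero. The length being zero, the trivial bound for the size of the blocks is enough. -/
lemma ae_isUnit_det {β : Type*} (ν : Measure ℝ) [IsProbabilityMeasure ν] {A : Matrix V V ℂ}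
    (hA : A.IsHermitian) {lam : ℝ} (hlam : 0 < lam) (s : V → β) {C : NNReal}
    (hν : ν ≤ C • volume) (E : ℝ) :
    ∀ᵐ w ∂(Measure.infinitePi fun _ : β => ν),
      IsUnit (ham A lam (fun x => w (s x)) - (E : ℂ) • (1 : Matrix V V ℂ)).det := by
  have h := lintegral_eigCount_Icc_le ν hA hlam (s := s) (M := Fintype.card V)
    (fun b => Finset.card_le_univ _) hν (le_refl E)
  rw [sub_self, zero_div, ENNReal.ofReal_zero, mul_zero, mul_zero, mul_zero, nonpos_iff_eq_zero,
    lintegral_eq_zero_iff (measurable_natCast_ennreal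
      (measurable_eigCount_comp hA lam s measurableSet_Icc))] at h
  filter_upwards [h] with w hw
  exact isUnit_det_of_eigCount_eq_zero _ E (by simpa using hw)

/-- The solution of `(t + Q) u = g` for a Hermitian matrix `Q`. -/
lemma esqrt_enorm_le_of_add_mulVec_eq {Q : Matrix V V ℂ} (hQ : Q.IsHermitian) {t : ℝ}
    (ht : ∀ i, t + hQ.eigenvalues i ≠ 0) {u g : V → ℂ} (h : (t : ℂ) • u + Q.mulVec u = g) (x : V) :
    esqrt ‖u x‖ₑ ≤ (∑ i, esqrt (‖t + hQ.eigenvalues i‖ₑ⁻¹)) * ∑ a, esqrt ‖g a‖ₑ := by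
  -- In the eigenbasis of `Q` the equation is diagonal; the entries of the unitary are bounded by
  -- one, which costs only sums over the block.
  have hU : ∀ i j, ‖(hQ.eigenvectorUnitary : Matrix V V ℂ) i j‖ₑ ≤ 1 := by
    intro i j
    rw [← ofReal_norm, ENNReal.ofReal_le_one]
    exact entry_norm_bound_of_unitary hQ.eigenvectorUnitary.2 i j
  have hU' : ∀ i j, ‖(star (hQ.eigenvectorUnitary : Matrix V V ℂ)) i j‖ₑ ≤ 1 := by
    intro i j
    rw [Matrix.star_apply, RCLike.star_def, RCLike.enorm_conj]
    exact hU j i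
  have hg : ∀ i, ‖spectralCoord hQ g i‖ₑ ≤ ∑ a, ‖g a‖ₑ := by
    intro i
    simp only [spectralCoord, Matrix.mulVecLin_apply, Matrix.mulVec, dotProduct]
    refine (enorm_sum_le _ _).trans (Finset.sum_le_sum fun a _ => ?_)
    rw [enorm_mul]
    exact mul_le_of_le_one_left' (hU' i a)
  have hu : ∀ i, ‖spectralCoord hQ u i‖ₑ ≤ ‖t + hQ.eigenvalues i‖ₑ⁻¹ * ∑ a, ‖g a‖ₑ := by
    intro i
    have h1 : ((t + hQ.eigenvalues i : ℝ) : ℂ) * spectralCoord hQ u i = spectralCoord hQ g i := by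
      rw [← h, map_add, map_smul, Pi.add_apply, Pi.smul_apply, spectralCoord_mulVec, smul_eq_mul,
        ← add_mul, Complex.ofReal_add]
    have h2 : ‖t + hQ.eigenvalues i‖ₑ * ‖spectralCoord hQ u i‖ₑ = ‖spectralCoord hQ g i‖ₑ := by
      rw [← h1, enorm_mul, ← ofReal_norm, ← ofReal_norm ((_ : ℝ) : ℂ), Complex.norm_real]
    rw [mul_comm, ← div_eq_mul_inv, ENNReal.le_div_iff_mul_le (Or.inl (by simpa using ht i))
      (Or.inl (by simp)), mul_comm, h2]
    exact hg i
  have hx : ‖u x‖ₑ ≤ ∑ i, ‖t + hQ.eigenvalues i‖ₑ⁻¹ * ∑ a, ‖g a‖ₑ := by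
    conv_lhs => rw [← spectralSynth_coord hQ u]
    simp only [spectralSynth, Matrix.mulVecLin_apply, Matrix.mulVec, dotProduct]
    refine (enorm_sum_le _ _).trans (Finset.sum_le_sum fun i _ => ?_)
    rw [enorm_mul]
    exact (mul_le_of_le_one_left' (hU x i)).trans (hu i)
  calc esqrt ‖u x‖ₑ ≤ esqrt ((∑ i, ‖t + hQ.eigenvalues i‖ₑ⁻¹) * ∑ a, ‖g a‖ₑ) := by
        rw [Finset.sum_mul]; exact esqrt_mono hx
    _ ≤ _ := by
        rw [esqrt_mul]
        exact mul_le_mul' (esqrt_sum_le _ _) (esqrt_sum_le _ _)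

end Green

/-! ### Removing one block: the Schur complement -/

section Depletion

set_option linter.unusedSectionVars false

variable {V β : Type*} [Fintype V] [DecidableEq V]

lemma mulVec_subtype_split (p : V → Prop) [DecidablePred p] (H : Matrix V V ℂ) (u : V → ℂ) (x : V) :
    H.mulVec u x = ∑ a : {a // p a}, H x a * u a + ∑ c : {c // ¬ p c}, H x c * u c := by
  rw [Matrix.mulVec, dotProduct]
  exact (Fintype.sum_subtype_add_sum_subtype p fun z => H x z * u z).symm

open Classical in
/-- The Schur complement of the block `b`, without the random variable of this block. -/
def schurCompl (A : Matrix V V ℂ) (lam : ℝ) (s : V → β) (w : β → ℝ) (E : ℝ) (b : β) :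
    Matrix {x // s x = b} {x // s x = b} ℂ :=
  A.submatrix Subtype.val Subtype.val - (E : ℂ) • 1
    - A.submatrix Subtype.val (Subtype.val : {x // ¬ s x = b} → V)
      * green (A.submatrix Subtype.val Subtype.val) lam (fun y : {x // ¬ s x = b} => w (s y)) E
      * (A.submatrix Subtype.val (Subtype.val : {x // ¬ s x = b} → V)).conjTranspose

lemma green_isHermitian {A : Matrix V V ℂ} (hA : A.IsHermitian) (lam : ℝ) (v : V → ℝ) (E : ℝ) :
    (green A lam v E).IsHermitian := by
  refine Matrix.IsHermitian.inv ((ham_isHermitian hA lam v).sub ?_)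
  rw [Matrix.IsHermitian, Matrix.conjTranspose_smul, Matrix.conjTranspose_one]
  simp

open Classical in
lemma schurCompl_isHermitian {A : Matrix V V ℂ} (hA : A.IsHermitian) (lam : ℝ) (s : V → β)
    (w : β → ℝ) (E : ℝ) (b : β) : (schurCompl A lam s w E b).IsHermitian := by
  refine ((hA.submatrix _).sub ?_).sub ?_
  · rw [Matrix.IsHermitian, Matrix.conjTranspose_smul, Matrix.conjTranspose_one]
    simp
  · exact Matrix.isHermitian_mul_mul_conjTranspose _ (green_isHermitian (hA.submatrix _) _ _ _)

open Classical in
/-- The equation for a column of the Green function inside the block `b`. -/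
lemma schurCompl_equation {A : Matrix V V ℂ} (hA : A.IsHermitian) (lam : ℝ) (s : V → β)
    (w : β → ℝ) (E t : ℝ) (b : β)
    (hc : IsUnit (ham (A.submatrix Subtype.val Subtype.val) lam
      (fun y : {x // ¬ s x = b} => w (s y)) - (E : ℂ) • 1).det)
    (hH : IsUnit (ham A lam (fun x => Function.update w b t (s x)) - (E : ℂ) • 1).det) (y : V) :
    ((lam * t : ℝ) : ℂ) • (fun a : {x // s x = b} =>
        green A lam (fun x => Function.update w b t (s x)) E a y)
      + (schurCompl A lam s w E b).mulVec (fun a : {x // s x = b} =>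
        green A lam (fun x => Function.update w b t (s x)) E a y)
    = fun a : {x // s x = b} => (1 : Matrix V V ℂ) a y - ∑ c : {x // ¬ s x = b}, A a c *
        ∑ z : {x // ¬ s x = b}, green (A.submatrix Subtype.val Subtype.val) lam
          (fun y : {x // ¬ s x = b} => w (s y)) E c z * (1 : Matrix V V ℂ) z y := by
  set G := green A lam (fun x => Function.update w b t (s x)) E with hG
  set Gc := green (A.submatrix Subtype.val Subtype.val) lam
    (fun y : {x // ¬ s x = b} => w (s y)) E with hGc
  set uS : {x // s x = b} → ℂ := fun a => G a y with huS
  set uT : {x // ¬ s x = b} → ℂ := fun a => G a y with huT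
  set B : Matrix {x // s x = b} {x // ¬ s x = b} ℂ := A.submatrix Subtype.val Subtype.val with hB
  set eT : {x // ¬ s x = b} → ℂ := fun z => (1 : Matrix V V ℂ) z y with heT
  set eS : {x // s x = b} → ℂ := fun z => (1 : Matrix V V ℂ) z y with heS
  have hmul : (ham A lam (fun x => Function.update w b t (s x)) - (E : ℂ) • 1) * G = 1 :=
    Matrix.mul_nonsing_inv _ hH
  have hmulc : Gc * (ham (A.submatrix Subtype.val Subtype.val) lam
      (fun y : {x // ¬ s x = b} => w (s y)) - (E : ℂ) • 1) = 1 :=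
    Matrix.nonsing_inv_mul _ hc
  have hrow : ∀ x, (∑ a : {x // s x = b}, A x a * uS a) + (∑ c : {x // ¬ s x = b}, A x c * uT c)
      + ((lam * Function.update w b t (s x) : ℝ) : ℂ) * G x y - E * G x y
      = (1 : Matrix V V ℂ) x y := by
    intro x
    have h1 := congrFun (congrFun hmul x) y
    rw [Matrix.sub_mul, ham, Matrix.add_mul] at h1
    simp only [Matrix.sub_apply, Matrix.add_apply, Matrix.diagonal_mul, Matrix.smul_mul,
      Matrix.one_mul, Matrix.smul_apply, smul_eq_mul] at h1
    rw [← h1, Matrix.mul_apply', ← Matrix.mulVec, mulVec_subtype_split (fun x => s x = b)]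
  -- The equation outside the block. Solving it with the depleted Green function `Gc` and inserting
  -- the result into the equation inside the block leaves the Schur complement, which does not
  -- involve the variable `t` of the block.
  have hT : (ham (A.submatrix Subtype.val Subtype.val) lam
      (fun y : {x // ¬ s x = b} => w (s y)) - (E : ℂ) • 1).mulVec uT
      = eT - B.conjTranspose.mulVec uS := by
    funext c
    have h1 := hrow c
    rw [Function.update_of_ne c.2] at h1
    have h2 : B.conjTranspose.mulVec uS c = ∑ a : {x // s x = b}, A c a * uS a := by
      rw [Matrix.mulVec, dotProduct]
      refine Finset.sum_congr rfl fun a _ => ?_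
      rw [Matrix.conjTranspose_apply, hB, Matrix.submatrix_apply, ← hA.apply c.1 a.1]
    rw [Pi.sub_apply, h2, Matrix.sub_mulVec, ham, Matrix.add_mulVec, Matrix.smul_mulVec,
      Matrix.one_mulVec]
    simp only [Pi.sub_apply, Pi.add_apply, Matrix.mulVec_diagonal, Pi.smul_apply, smul_eq_mul,
      heT]
    rw [← h1, Matrix.mulVec, dotProduct]
    simp only [Matrix.submatrix_apply, huT]
    ring
  have huT' : uT = Gc.mulVec eT - Gc.mulVec (B.conjTranspose.mulVec uS) := by
    rw [← Matrix.mulVec_sub, ← hT, Matrix.mulVec_mulVec, hmulc, Matrix.one_mulVec]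
  have hS : ((lam * t : ℝ) : ℂ) • uS + (A.submatrix Subtype.val Subtype.val :
      Matrix {x // s x = b} {x // s x = b} ℂ).mulVec uS - (E : ℂ) • uS + B.mulVec uT = eS := by
    funext a
    have h1 := hrow a
    rw [a.2, Function.update_self] at h1
    simp only [Pi.add_apply, Pi.sub_apply, Pi.smul_apply, smul_eq_mul, heS]
    rw [← h1, Matrix.mulVec, dotProduct, Matrix.mulVec, dotProduct]
    simp only [Matrix.submatrix_apply, hB, huS]
    ring
  have hfin : ((lam * t : ℝ) : ℂ) • uS + (schurCompl A lam s w E b).mulVec uS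
      = eS - B.mulVec (Gc.mulVec eT) := by
    rw [← hS, huT', schurCompl, Matrix.sub_mulVec, Matrix.sub_mulVec, Matrix.smul_mulVec,
      Matrix.one_mulVec, ← Matrix.mulVec_mulVec, ← Matrix.mulVec_mulVec, Matrix.mulVec_sub]
    abel
  rw [hfin]
  rfl

end Depletion

/-! ### Exponential decay of fractional moments at large disorder -/

section FractionalMomentBound

variable (ν : Measure ℝ) [IsProbabilityMeasure ν]

open Classical in
/-- The fractional moments of the Green function decay at large disorder: the estimate for
general weights. -/
theorem lintegral_sum_esqrt_green_le {β : Type*} {lam : ℝ} (hlam : 0 < lam) {C : NNReal}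
    (hν : ν ≤ C • volume) {θ κ D : ℝ≥0∞} {M : ℕ}
    (hθ : ∀ q : ℝ, ∫⁻ t, esqrt (‖lam * t + q‖ₑ⁻¹) ∂ν ≤ θ)
    (hsmall : M * θ * (M * κ + M * (D * κ ^ 2)) ≤ 1) (E : ℝ) (n : ℕ) :
    ∀ (V : Type*) [Fintype V] [DecidableEq V], Fintype.card V ≤ n →
    ∀ {A : Matrix V V ℂ}, A.IsHermitian → ∀ {s : V → β}, BlockCardLE s M →
    ∀ U : V → ℝ≥0∞, (∀ x y, s x = s y → U y ≤ κ * U x) → (∀ x y, A x y ≠ 0 → U y ≤ κ * U x) →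
    (∀ x, ∑ y, esqrt ‖A x y‖ₑ ≤ D) → ∀ x,
    ∫⁻ w, ∑ y, esqrt ‖green A lam (fun x => w (s x)) E x y‖ₑ * U y
      ∂(Measure.infinitePi fun _ : β => ν) ≤ U x := by
  -- The induction is on the number of vertices: removing the block of `x` leaves a smaller graph
  -- with the same structural bounds.
  induction n with
  | zero =>
    intro V _ _ hcard A hA s hM U hU1 hU2 hD x
    exact absurd hcard (by have := Fintype.card_pos_iff.mpr ⟨x⟩; omega)
  | succ n ih =>
    intro V _ _ hcard A hA s hM U hU1 hU2 hD x
    set b := s x with hb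
    set Ac : Matrix {x // ¬ s x = b} {x // ¬ s x = b} ℂ :=
      A.submatrix Subtype.val Subtype.val with hAc
    have hAcH : Ac.IsHermitian := hA.submatrix _
    set Gc : (β → ℝ) → Matrix {x // ¬ s x = b} {x // ¬ s x = b} ℂ := fun w =>
      green Ac lam (fun y => w (s y)) E with hGc
    set Fc : {x // ¬ s x = b} → (β → ℝ) → ℝ≥0∞ := fun c w =>
      ∑ y, esqrt ‖Gc w c y‖ₑ * U y with hFc
    have hih : ∀ c, ∫⁻ w, Fc c w ∂(Measure.infinitePi fun _ : β => ν) ≤ U c := by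
      refine ih {x // ¬ s x = b} ?_ hAcH (s := fun y => s y) ?_ (fun y => U y)
        (fun y z h => hU1 _ _ h) (fun y z h => hU2 _ _ h) ?_
      · have := Fintype.card_subtype_lt (p := fun z => ¬ s z = b) (x := x) (by simp [hb])
        omega
      · intro b'
        refine le_trans ?_ (hM b')
        refine Finset.card_le_card_of_injOn Subtype.val (fun y hy => ?_) Subtype.val_injective.injOn
        simpa using hy
      · intro y
        refine le_trans ?_ (hD y)
        rw [← Fintype.sum_subtype_add_sum_subtype (fun z => ¬ s z = b)
          fun z => esqrt ‖A y z‖ₑ]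
        exact le_self_add
    have hgm : ∀ y z, Measurable fun w : β → ℝ => green A lam (fun x => w (s x)) E y z :=
      fun y z => (measurable_green A lam E y z).comp (measurable_comp_blockMap s)
    have hgcm : ∀ y z, Measurable fun w : β → ℝ => Gc w y z :=
      fun y z => (measurable_green Ac lam E y z).comp (measurable_comp_blockMap fun y : {x // ¬ s x = b} => s y)
    have hFcm : ∀ c, Measurable (Fc c) := fun c =>
      Finset.measurable_sum _ fun y _ =>
        (measurable_esqrt.comp (hgcm c y).enorm).mul_const _
    have hfm : Measurable fun w : β → ℝ =>
        ∑ y, esqrt ‖green A lam (fun x => w (s x)) E x y‖ₑ * U y :=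
      Finset.measurable_sum _ fun y _ => (measurable_esqrt.comp (hgm x y).enorm).mul_const _
    -- The variable of the block of `x` is integrated first, since neither the Schur complement nor
    -- the depleted Green function depends on it.
    rw [lintegral_infinitePi_update ν b hfm]
    set K : (β → ℝ) → ℝ≥0∞ := fun w => M * (κ * U x)
      + ∑ a : {x // s x = b}, ∑ c : {x // ¬ s x = b}, esqrt ‖A a c‖ₑ * Fc c w with hK
    have hcardS : (Fintype.card {x // s x = b} : ℝ≥0∞) ≤ M := by
      rw [Fintype.card_subtype]; exact_mod_cast hM b
    have hinner : ∀ᵐ w ∂(Measure.infinitePi fun _ : β => ν),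
        ∫⁻ t, ∑ y, esqrt ‖green A lam (fun x => Function.update w b t (s x)) E x y‖ₑ * U y ∂ν
          ≤ M * θ * K w := by
      filter_upwards [ae_isUnit_det ν hAcH hlam (fun y => s y) hν E] with w hw
      set Q := schurCompl A lam s w E b with hQdef
      have hQ : Q.IsHermitian := schurCompl_isHermitian hA lam s w E b
      set T : ℝ → ℝ≥0∞ := fun t => ∑ i, esqrt (‖lam * t + hQ.eigenvalues i‖ₑ⁻¹) with hT
      have hTm1 : ∀ i, Measurable fun t : ℝ => esqrt (‖lam * t + hQ.eigenvalues i‖ₑ⁻¹) :=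
        fun i => measurable_esqrt.comp (by fun_prop)
      have hTm : Measurable T := Finset.measurable_sum _ fun i _ => hTm1 i
      have hTint : ∫⁻ t, T t ∂ν ≤ M * θ := by
        rw [hT, lintegral_finsetSum _ fun i _ => hTm1 i]
        calc ∑ i, ∫⁻ t, esqrt (‖lam * t + hQ.eigenvalues i‖ₑ⁻¹) ∂ν
            ≤ ∑ i : {x // s x = b}, θ := Finset.sum_le_sum fun i _ => hθ _
          _ = Fintype.card {x // s x = b} * θ := by simp
          _ ≤ M * θ := by gcongr
      have hae : ∀ᵐ t ∂ν, ∀ i, lam * t + hQ.eigenvalues i ≠ 0 := by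
        have hac : ν ≪ volume :=
          (Measure.absolutelyContinuous_of_le hν).trans Measure.smul_absolutelyContinuous
        refine hac.ae_le (ae_all_iff.mpr fun i => ?_)
        refine Set.Countable.ae_notMem (Set.countable_singleton (-hQ.eigenvalues i / lam))
          volume |>.mono fun t ht h0 => ht ?_
        rw [Set.mem_singleton_iff, eq_div_iff hlam.ne']
        linarith
      refine (lintegral_mono_ae (hae.mono fun t ht => ?_)).trans
        ((lintegral_mul_const (K w) hTm).le.trans (by gcongr))
      -- If `E` happens to be an eigenvalue after resampling, the Green function is zero by
      -- convention and nothing is to be shown.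
      by_cases hH : IsUnit (ham A lam (fun x => Function.update w b t (s x)) - (E : ℂ) • 1).det
      swap
      · have : green A lam (fun x => Function.update w b t (s x)) E = 0 :=
          Matrix.nonsing_inv_apply_not_isUnit _ hH
        simp [this, esqrt_zero]
      have hbound : ∀ y, esqrt ‖green A lam (fun x => Function.update w b t (s x)) E x y‖ₑ
          ≤ T t * ∑ a : {x // s x = b}, esqrt ‖(1 : Matrix V V ℂ) a y
            - ∑ c : {x // ¬ s x = b}, A a c * ∑ z, Gc w c z * (1 : Matrix V V ℂ) z y‖ₑ :=
        fun y => esqrt_enorm_le_of_add_mulVec_eq hQ ht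
          (schurCompl_equation hA lam s w E t b hw hH y) ⟨x, hb.symm⟩
      -- For columns inside the block the right-hand side of the Schur equation is a unit vector.
      have hS : ∀ y : {x // s x = b},
          ∑ a : {x // s x = b}, esqrt ‖(1 : Matrix V V ℂ) a y
            - ∑ c : {x // ¬ s x = b}, A a c * ∑ z, Gc w c z * (1 : Matrix V V ℂ) z y‖ₑ = 1 := by
        intro y
        have h0 : ∀ z : {x // ¬ s x = b}, (1 : Matrix V V ℂ) z y = 0 := fun z =>
          Matrix.one_apply_ne fun h => z.2 (h ▸ y.2)
        simp only [h0, mul_zero, Finset.sum_const_zero, sub_zero]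
        rw [Finset.sum_eq_single y]
        · simp [esqrt]
        · intro a _ ha
          rw [Matrix.one_apply_ne fun h => ha (Subtype.ext h)]
          simp [esqrt_zero]
        · simp
      -- Columns outside the block are reached by one hop out of the block, followed by the depleted
      -- Green function.
      have hTc : ∀ y : {x // ¬ s x = b},
          ∑ a : {x // s x = b}, esqrt ‖(1 : Matrix V V ℂ) a y
            - ∑ c : {x // ¬ s x = b}, A a c * ∑ z, Gc w c z * (1 : Matrix V V ℂ) z y‖ₑ
          ≤ ∑ a : {x // s x = b}, ∑ c : {x // ¬ s x = b}, esqrt ‖A a c‖ₑ * esqrt ‖Gc w c y‖ₑ := by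
        intro y
        refine Finset.sum_le_sum fun a _ => ?_
        have h0 : (1 : Matrix V V ℂ) a y = 0 := Matrix.one_apply_ne fun h => y.2 (h ▸ a.2)
        have h1 : ∀ c, ∑ z, Gc w c z * (1 : Matrix V V ℂ) z y = Gc w c y := by
          intro c
          rw [Finset.sum_eq_single y]
          · simp
          · intro z _ hz
            rw [Matrix.one_apply_ne fun h => hz (Subtype.ext h), mul_zero]
          · simp
        simp only [h0, h1, zero_sub, enorm_neg]
        refine (esqrt_mono (enorm_sum_le _ _)).trans ((esqrt_sum_le _ _).trans (le_of_eq ?_))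
        refine Finset.sum_congr rfl fun c _ => ?_
        rw [enorm_mul, esqrt_mul]
      rw [← Fintype.sum_subtype_add_sum_subtype (fun z => s z = b)
        fun y => esqrt ‖green A lam (fun x => Function.update w b t (s x)) E x y‖ₑ * U y, hK,
        mul_add]
      refine add_le_add ?_ ?_
      · calc ∑ y : {x // s x = b},
              esqrt ‖green A lam (fun x => Function.update w b t (s x)) E x y‖ₑ * U y
            ≤ ∑ y : {x // s x = b}, T t * (κ * U x) := by
              refine Finset.sum_le_sum fun y _ => mul_le_mul' ?_ (hU1 _ _ (hb.symm.trans y.2.symm))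
              have := hbound y
              rwa [hS y, mul_one] at this
          _ = Fintype.card {x // s x = b} * (T t * (κ * U x)) := by simp
          _ ≤ M * (T t * (κ * U x)) := by gcongr
          _ = _ := by ring
      · calc ∑ y : {x // ¬ s x = b},
              esqrt ‖green A lam (fun x => Function.update w b t (s x)) E x y‖ₑ * U y
            ≤ ∑ y : {x // ¬ s x = b}, (T t * ∑ a : {x // s x = b}, ∑ c : {x // ¬ s x = b},
                esqrt ‖A a c‖ₑ * esqrt ‖Gc w c y‖ₑ) * U y := by
              refine Finset.sum_le_sum fun y _ => mul_le_mul' ?_ le_rfl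
              exact (hbound y).trans (mul_le_mul' le_rfl (hTc y))
          _ = T t * ∑ a : {x // s x = b}, ∑ c : {x // ¬ s x = b}, esqrt ‖A a c‖ₑ * Fc c w := by
              simp only [mul_assoc]
              rw [← Finset.mul_sum]
              simp only [Finset.sum_mul]
              rw [Finset.sum_comm]
              congr 1
              refine Finset.sum_congr rfl fun a _ => ?_
              rw [Finset.sum_comm]
              refine Finset.sum_congr rfl fun c _ => ?_
              rw [hFc, Finset.mul_sum]
              refine Finset.sum_congr rfl fun y _ => ?_
              ring
          _ ≤ _ := le_rfl
    -- The induction hypothesis bounds the depleted sums from `c` by `U c`, and `U c ≤ κ ^ 2 * U x`: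
    -- one factor for a move inside the block, one for the hop. Multiplied by `M * θ`, the total is
    -- at most `U x` by `hsmall`.
    have hKint : ∫⁻ w, K w ∂(Measure.infinitePi fun _ : β => ν)
        ≤ (M * κ + M * (D * κ ^ 2)) * U x := by
      have hm1 : ∀ a : {x // s x = b}, ∀ c : {x // ¬ s x = b}, Measurable fun w => esqrt ‖A a c‖ₑ * Fc c w :=
        fun a c => (hFcm c).const_mul _
      rw [lintegral_add_left measurable_const, lintegral_const, measure_univ, mul_one, add_mul,
        lintegral_finsetSum _ fun a _ => Finset.measurable_sum _ fun c _ => hm1 a c]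
      refine add_le_add (by rw [mul_assoc]) ?_
      calc ∑ a : {x // s x = b}, ∫⁻ w, ∑ c : {x // ¬ s x = b}, esqrt ‖A a c‖ₑ * Fc c w
              ∂(Measure.infinitePi fun _ : β => ν)
          ≤ ∑ a : {x // s x = b}, D * (κ ^ 2 * U x) := by
            refine Finset.sum_le_sum fun a _ => ?_
            rw [lintegral_finsetSum _ fun c _ => hm1 a c]
            calc ∑ c : {x // ¬ s x = b}, ∫⁻ w, esqrt ‖A a c‖ₑ * Fc c w
                    ∂(Measure.infinitePi fun _ : β => ν)
                ≤ ∑ c : {x // ¬ s x = b}, esqrt ‖A a c‖ₑ * (κ ^ 2 * U x) := by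
                  refine Finset.sum_le_sum fun c _ => ?_
                  rw [lintegral_const_mul _ (hFcm c)]
                  by_cases h0 : A a c = 0
                  · simp [h0, esqrt_zero]
                  · refine mul_le_mul' le_rfl ((hih c).trans ((hU2 _ _ h0).trans ?_))
                    rw [sq, mul_assoc]
                    exact mul_le_mul' le_rfl (hU1 _ _ (hb.symm.trans a.2.symm))
              _ = (∑ c : {x // ¬ s x = b}, esqrt ‖A a c‖ₑ) * (κ ^ 2 * U x) := by
                  rw [Finset.sum_mul]
              _ ≤ D * (κ ^ 2 * U x) := by
                  refine mul_le_mul' (le_trans ?_ (hD a)) le_rfl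
                  rw [← Fintype.sum_subtype_add_sum_subtype (fun z => s z = b)
                    fun z => esqrt ‖A a z‖ₑ]
                  exact le_add_self
        _ = Fintype.card {x // s x = b} * (D * (κ ^ 2 * U x)) := by simp
        _ ≤ M * (D * (κ ^ 2 * U x)) := by gcongr
        _ = _ := by ring
    have hKm : Measurable K := measurable_const.add
      (Finset.measurable_sum _ fun a _ => Finset.measurable_sum _ fun c _ => (hFcm c).const_mul _)
    calc _ ≤ ∫⁻ w, M * θ * K w ∂(Measure.infinitePi fun _ : β => ν) := lintegral_mono_ae hinner
      _ = M * θ * ∫⁻ w, K w ∂(Measure.infinitePi fun _ : β => ν) := lintegral_const_mul _ hKm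
      _ ≤ M * θ * ((M * κ + M * (D * κ ^ 2)) * U x) := by gcongr
      _ ≤ 1 * U x := by rw [← mul_assoc]; gcongr
      _ = U x := one_mul _

end FractionalMomentBound

/-! ### Comparison of a matrix with its block-diagonal part -/

section Comparison

set_option linter.unusedSectionVars false

variable {V : Type*} [Fintype V]

lemma sqNorm_eq_norm_sq (v : V → ℂ) : sqNorm v = ‖WithLp.toLp 2 v‖ ^ 2 := by
  rw [EuclideanSpace.norm_sq_eq]; rfl

lemma sqNorm_sub_le {u w : V → ℂ} {a b N : ℝ} (ha : 0 ≤ a) (hb : 0 ≤ b)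
    (hN : 0 ≤ N) (hu : sqNorm u ≤ a ^ 2 * N) (hw : sqNorm w ≤ b ^ 2 * N) :
    sqNorm (u - w) ≤ (a + b) ^ 2 * N := by
  have hu' : ‖WithLp.toLp 2 u‖ ≤ a * √N := by
    rw [sqNorm_eq_norm_sq] at hu
    refine abs_le_of_sq_le_sq' (by rw [mul_pow, Real.sq_sqrt hN]; exact hu) (by positivity) |>.2
  have hw' : ‖WithLp.toLp 2 w‖ ≤ b * √N := by
    rw [sqNorm_eq_norm_sq] at hw
    refine abs_le_of_sq_le_sq' (by rw [mul_pow, Real.sq_sqrt hN]; exact hw) (by positivity) |>.2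
  have h : ‖WithLp.toLp 2 (u - w)‖ ≤ (a + b) * √N := by
    rw [WithLp.toLp_sub]
    exact (norm_sub_le _ _).trans (by linarith)
  rw [sqNorm_eq_norm_sq, ← Real.sq_sqrt hN, ← mul_pow]
  exact pow_le_pow_left₀ (norm_nonneg _) h 2

/-- Schur's test. -/
lemma sqNorm_mulVec_le {A : Matrix V V ℂ} (hA : A.IsHermitian) {D : ℝ}
    (hD : ∀ x, ∑ y, ‖A x y‖ ≤ D) (u : V → ℂ) : sqNorm (A.mulVec u) ≤ D ^ 2 * sqNorm u := by
  have hrow : ∀ x, ‖A.mulVec u x‖ ^ 2 ≤ D * ∑ y, ‖A x y‖ * ‖u y‖ ^ 2 := by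
    intro x
    calc ‖A.mulVec u x‖ ^ 2 ≤ (∑ y, ‖A x y‖ * ‖u y‖) ^ 2 := by
          refine pow_le_pow_left₀ (norm_nonneg _) ?_ 2
          rw [Matrix.mulVec, dotProduct]
          refine (norm_sum_le _ _).trans (le_of_eq (Finset.sum_congr rfl fun y _ => norm_mul _ _))
      _ = (∑ y, √‖A x y‖ * (√‖A x y‖ * ‖u y‖)) ^ 2 := by
          congr 1
          refine Finset.sum_congr rfl fun y _ => ?_
          rw [← mul_assoc, Real.mul_self_sqrt (norm_nonneg _)]
      _ ≤ (∑ y, √‖A x y‖ ^ 2) * ∑ y, (√‖A x y‖ * ‖u y‖) ^ 2 :=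
          Finset.sum_mul_sq_le_sq_mul_sq _ _ _
      _ = (∑ y, ‖A x y‖) * ∑ y, ‖A x y‖ * ‖u y‖ ^ 2 := by
          simp only [mul_pow, Real.sq_sqrt (norm_nonneg _)]
      _ ≤ D * ∑ y, ‖A x y‖ * ‖u y‖ ^ 2 := by
          gcongr
          exact hD x
  calc sqNorm (A.mulVec u) ≤ ∑ x, D * ∑ y, ‖A x y‖ * ‖u y‖ ^ 2 :=
        Finset.sum_le_sum fun x _ => hrow x
    _ = D * ∑ y, (∑ x, ‖A y x‖) * ‖u y‖ ^ 2 := by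
        rw [← Finset.mul_sum, Finset.sum_comm]
        simp only [Finset.sum_mul]
        congr 1
        refine Finset.sum_congr rfl fun y _ => Finset.sum_congr rfl fun x _ => ?_
        rw [← hA.apply x y, norm_star]
    _ ≤ D * ∑ y, D * ‖u y‖ ^ 2 := by
        rcases isEmpty_or_nonempty V with hV | ⟨⟨x0⟩⟩
        · simp
        · have hD0 : 0 ≤ D := (Finset.sum_nonneg fun y _ => norm_nonneg _).trans (hD x0)
          gcongr with y
          exact hD y
    _ = D ^ 2 * sqNorm u := by rw [← Finset.mul_sum, sqNorm]; ring

variable [DecidableEq V]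

-- A combination of eigenvectors that are all at most `ε` on `Z` is small there by Cauchy–Schwarz.
-- One factor `m` stems from the number of eigenvectors and one from the number of sites.
open Classical in
lemma sqNorm_restrict_eigSynth_le {A : Matrix V V ℂ} (hA : A.IsHermitian) (B : Set ℝ) (Z : Set V)
    {ε : ℝ} (h : ∀ i, hA.eigenvalues i ∈ B → ∀ x ∈ Z,
      ‖(hA.eigenvectorUnitary : Matrix V V ℂ) x i‖ ≤ ε) {m : ℝ} (hm : Fintype.card V ≤ m)
    (a : {i // hA.eigenvalues i ∈ B} → ℂ) :
    sqNorm (fun x => if x ∈ Z then eigSynth hA B a x else 0)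
      ≤ (m * ε) ^ 2 * sqNorm (eigSynth hA B a) := by
  set v := eigSynth hA B a with hv
  have hpt : ∀ x, ‖if x ∈ Z then v x else 0‖ ^ 2 ≤ ε ^ 2 * (Fintype.card V * sqNorm v) := by
    intro x
    split_ifs with hx
    swap
    · rw [norm_zero, zero_pow two_ne_zero]
      exact mul_nonneg (sq_nonneg _) (mul_nonneg (Nat.cast_nonneg _) (sqNorm_nonneg _))
    · have h1 : v x = ∑ i, (hA.eigenvectorUnitary : Matrix V V ℂ) x i * spectralCoord hA v i := by
        conv_lhs => rw [← spectralSynth_coord hA v]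
        rfl
      have h2 : ‖v x‖ ≤ ∑ i, ε * ‖spectralCoord hA v i‖ := by
        rw [h1]
        refine (norm_sum_le _ _).trans (Finset.sum_le_sum fun i _ => ?_)
        rw [norm_mul]
        by_cases hi : hA.eigenvalues i ∈ B
        · exact mul_le_mul_of_nonneg_right (h i hi x hx) (norm_nonneg _)
        · rw [hv, spectralCoord_eigSynth_of_notMem hA B a hi]; simp
      calc ‖v x‖ ^ 2 ≤ (∑ i, ε * ‖spectralCoord hA v i‖) ^ 2 :=
            pow_le_pow_left₀ (norm_nonneg _) h2 2
        _ = ε ^ 2 * (∑ i, ‖spectralCoord hA v i‖) ^ 2 := by rw [← Finset.mul_sum, mul_pow]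
        _ ≤ ε ^ 2 * (Fintype.card V * ∑ i, ‖spectralCoord hA v i‖ ^ 2) := by
            gcongr
            exact sq_sum_le_card_mul_sum_sq
        _ = _ := by rw [← sqNorm_spectralCoord hA v]; rfl
  calc sqNorm (fun x => if x ∈ Z then v x else 0)
      ≤ ∑ _x : V, ε ^ 2 * (Fintype.card V * sqNorm v) := Finset.sum_le_sum fun x _ => hpt x
    _ = ((Fintype.card V : ℝ) * ε) ^ 2 * sqNorm v := by
        rw [Finset.sum_const, Finset.card_univ, nsmul_eq_mul]; ring
    _ ≤ (m * ε) ^ 2 * sqNorm v := by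
        refine mul_le_mul_of_nonneg_right ?_ (sqNorm_nonneg v)
        rw [mul_pow, mul_pow]
        gcongr

variable {J : Type*}

open Classical in
/-- The part of `H` that connects different parts of the partition `τ`. -/
def offBlock (H : Matrix V V ℂ) (τ : V → J) : Matrix V V ℂ :=
  Matrix.of fun x y => if τ x = τ y then 0 else H x y

/-- The restriction of `H` to the part number `j`. -/
def partBlock (H : Matrix V V ℂ) (τ : V → J) (j : J) : Matrix {x // τ x = j} {x // τ x = j} ℂ :=
  H.submatrix Subtype.val Subtype.val

lemma offBlock_isHermitian {H : Matrix V V ℂ} (hH : H.IsHermitian) (τ : V → J) :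
    (offBlock H τ).IsHermitian := by
  ext x y
  rw [Matrix.conjTranspose_apply, offBlock, Matrix.of_apply, Matrix.of_apply]
  by_cases h : τ x = τ y
  · simp [h]
  · simp only [h, Ne.symm h, if_false]
    exact hH.apply x y

lemma partBlock_isHermitian {H : Matrix V V ℂ} (hH : H.IsHermitian) (τ : V → J) (j : J) :
    (partBlock H τ j).IsHermitian := hH.submatrix _

lemma partBlock_mulVec [DecidableEq J] (H : Matrix V V ℂ) (τ : V → J) (j : J) (v : V → ℂ) (x : {x // τ x = j}) :
    (partBlock H τ j).mulVec (fun y => v y) x = H.mulVec v x - (offBlock H τ).mulVec v x := by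
  rw [mulVec_subtype_split (fun y => τ y = j), mulVec_subtype_split (fun y => τ y = j)]
  have h1 : ∑ a : {y // τ y = j}, offBlock H τ x a * v a = 0 :=
    Finset.sum_eq_zero fun a _ => by simp [offBlock, x.2, a.2]
  have h2 : ∑ c : {y // ¬ τ y = j}, offBlock H τ x c * v c
      = ∑ c : {y // ¬ τ y = j}, H x c * v c :=
    Finset.sum_congr rfl fun c _ => by simp [offBlock, x.2, Ne.symm c.2]
  rw [h1, h2, zero_add, add_sub_cancel_right]
  rfl

variable [Fintype J] [DecidableEq J]

lemma sqNorm_eq_sum_parts (τ : V → J) (v : V → ℂ) :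
    sqNorm v = ∑ j, sqNorm (fun x : {x // τ x = j} => v x) :=
  (Fintype.sum_fiberwise τ fun x => ‖v x‖ ^ 2).symm

/-- The coupling between the parts only sees the values of a vector on `Z`, which is where
eigenvectors will be known to be small. -/
lemma offBlock_mulVec_restrict (H : Matrix V V ℂ) (τ : V → J) (Z : Set V) [DecidablePred (· ∈ Z)]
    (hZ : ∀ x y, offBlock H τ x y ≠ 0 → y ∈ Z) (v : V → ℂ) :
    (offBlock H τ).mulVec v = (offBlock H τ).mulVec (fun x => if x ∈ Z then v x else 0) := by
  funext x
  refine Finset.sum_congr rfl fun y _ => ?_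
  by_cases h : offBlock H τ x y = 0
  · simp [h]
  · simp [hZ x y h]

/-- If the eigenvectors of `H` for the eigenvalues in `B` are small where `H` connects different
parts, the eigenvalues of `H` in `B` are close to eigenvalues of the parts. -/
lemma eigCount_le_sum_partBlock {H : Matrix V V ℂ} (hH : H.IsHermitian) (τ : V → J) (Z : Set V)
    (hZ : ∀ x y, offBlock H τ x y ≠ 0 → y ∈ Z) {D : ℝ} (hD0 : 0 ≤ D)
    (hD : ∀ x, ∑ y, ‖offBlock H τ x y‖ ≤ D)
    {B : Set ℝ} {c r : ℝ} (hr : 0 ≤ r) (hB : B ⊆ Set.Icc (c - r) (c + r)) {ε : ℝ} (hε : 0 ≤ ε)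
    (h : ∀ i, hH.eigenvalues i ∈ B → ∀ x ∈ Z,
      ‖(hH.eigenvectorUnitary : Matrix V V ℂ) x i‖ ≤ ε) {m : ℝ} (hm : Fintype.card V ≤ m) :
    eigCount H B ≤ ∑ j, eigCount (partBlock H τ j)
      (Set.Icc (c - (r + D * (m * ε))) (c + (r + D * (m * ε)))) := by
  classical
  set r' := r + D * (m * ε) with hr'
  have hm0 : 0 ≤ m := le_trans (Nat.cast_nonneg _) hm
  have hr'0 : 0 ≤ r' := by positivity
  set Bp := Set.Icc (c - r') (c + r') with hBp
  have hP := partBlock_isHermitian hH τ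
  let f := eigSynth hH B
  -- The comparison is a dimension count: a combination of eigenvectors of `H` is sent to its
  -- coordinates along those eigenvectors of the parts whose eigenvalues lie in the enlarged
  -- interval.
  let g : ({i // hH.eigenvalues i ∈ B} → ℂ) →ₗ[ℂ]
      ((Σ j, {i // (hP j).eigenvalues i ∈ Bp}) → ℂ) :=
    LinearMap.pi fun q => LinearMap.proj q.2.1 ∘ₗ spectralCoord (hP q.1)
      ∘ₗ LinearMap.funLeft ℂ ℂ Subtype.val ∘ₗ f
  have hg : Function.Injective g := by
    rw [← LinearMap.ker_eq_bot, LinearMap.ker_eq_bot']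
    intro a ha
    by_contra hne
    set v := f a with hv
    have hvpos : 0 < sqNorm v := by rw [hv, sqNorm_eigSynth]; exact sqNorm_pos hne
    have h1 := sqNorm_mulVec_eigSynth_sub_le hH hB a
    have h2 : sqNorm ((offBlock H τ).mulVec v) ≤ (D * (m * ε)) ^ 2 * sqNorm v := by
      rw [offBlock_mulVec_restrict H τ Z hZ]
      refine (sqNorm_mulVec_le (offBlock_isHermitian hH τ) hD _).trans ?_
      rw [mul_pow, mul_assoc]
      gcongr
      exact sqNorm_restrict_eigSynth_le hH B Z h hm a
    have h3 := sqNorm_sub_le hr (by positivity) (sqNorm_nonneg _) h1 h2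
    rw [← hr', sqNorm_eq_sum_parts τ] at h3
    -- If these coordinates vanish, every nonzero piece of `v` is moved by the operator of its part
    -- by strictly more than `r'` times its norm. Since `v` is an approximate eigenvector of `H` up
    -- to `r` and the coupling adds at most `D * (m * ε)`, summation over the parts gives a
    -- contradiction.
    have h4 : ∀ j, (fun x : {x // τ x = j} => v x) ≠ 0 →
        r' ^ 2 * sqNorm (fun x : {x // τ x = j} => v x)
        < sqNorm (fun x : {x // τ x = j} =>
            (H.mulVec v - (c : ℂ) • v - (offBlock H τ).mulVec v) x) := by
      intro j hj
      have h5 := lt_sqNorm_mulVec_sub (hP j) hr'0 hj (c := c) fun i hi =>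
        congrFun ha ⟨j, i, hi⟩
      refine h5.trans_le (le_of_eq (congrArg sqNorm ?_))
      funext x
      rw [Pi.sub_apply, partBlock_mulVec]
      simp only [Pi.sub_apply, Pi.smul_apply, smul_eq_mul]
      ring
    have h6 : ∀ j, r' ^ 2 * sqNorm (fun x : {x // τ x = j} => v x)
        ≤ sqNorm (fun x : {x // τ x = j} =>
            (H.mulVec v - (c : ℂ) • v - (offBlock H τ).mulVec v) x) := by
      intro j
      by_cases hj : (fun x : {x // τ x = j} => v x) = 0
      · rw [hj]
        have : sqNorm (0 : {x // τ x = j} → ℂ) = 0 := sqNorm_eq_zero.mpr rfl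
        rw [this, mul_zero]
        exact sqNorm_nonneg _
      · exact (h4 j hj).le
    obtain ⟨x0, hx0⟩ : ∃ x, v x ≠ 0 := by
      by_contra hcon
      push Not at hcon
      exact hvpos.ne' (sqNorm_eq_zero.mpr (funext hcon))
    have h7 : r' ^ 2 * sqNorm v < ∑ j, sqNorm (fun x : {x // τ x = j} =>
        (H.mulVec v - (c : ℂ) • v - (offBlock H τ).mulVec v) x) := by
      rw [sqNorm_eq_sum_parts τ, Finset.mul_sum]
      refine Finset.sum_lt_sum (fun j _ => h6 j) ⟨τ x0, Finset.mem_univ _, h4 _ fun h0 => ?_⟩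
      exact hx0 (congrFun h0 ⟨x0, rfl⟩)
    exact absurd h3 (not_le.mpr h7)
  have := LinearMap.finrank_le_finrank_of_injective hg
  rw [Module.finrank_fintype_fun_eq_card, Module.finrank_fintype_fun_eq_card,
    card_eigSynth_domain, Fintype.card_sigma] at this
  refine this.trans (le_of_eq (Finset.sum_congr rfl fun j _ => ?_))
  exact card_eigSynth_domain (hP j) Bp

/-- If the eigenvectors of the parts of `H` for the eigenvalues in `B j` are small where `H`
connects different parts, these eigenvalues are close to eigenvalues of `H`. -/
lemma sum_partBlock_le_eigCount {H : Matrix V V ℂ} (hH : H.IsHermitian) (τ : V → J) (Z : Set V)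
    (hZ : ∀ x y, offBlock H τ x y ≠ 0 → y ∈ Z) {D : ℝ} (hD0 : 0 ≤ D)
    (hD : ∀ x, ∑ y, ‖offBlock H τ x y‖ ≤ D)
    {B : J → Set ℝ} {c r : ℝ} (hr : 0 ≤ r) (hB : ∀ j, B j ⊆ Set.Icc (c - r) (c + r))
    {ε : ℝ} (hε : 0 ≤ ε) {m : ℝ} (hm0 : 0 ≤ m)
    (h : ∀ j, ∀ i, (partBlock_isHermitian hH τ j).eigenvalues i ∈ B j →
      ∀ x : {x // τ x = j}, x.1 ∈ Z →
      ‖((partBlock_isHermitian hH τ j).eigenvectorUnitary : Matrix _ _ ℂ) x i‖ ≤ ε)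
    (hm : ∀ j, (B j).Nonempty → Fintype.card {x // τ x = j} ≤ m) :
    ∑ j, eigCount (partBlock H τ j) (B j)
      ≤ eigCount H (Set.Icc (c - (r + D * (m * ε))) (c + (r + D * (m * ε)))) := by
  classical
  have hP := partBlock_isHermitian hH τ
  -- In the converse direction, eigenvectors of the parts are glued together; the result is an
  -- isometry onto a space of approximate eigenvectors of `H`.
  let f : ((Σ j, {i // (hP j).eigenvalues i ∈ B j}) → ℂ) →ₗ[ℂ] (V → ℂ) :=
    LinearMap.pi fun x => LinearMap.proj ⟨x, rfl⟩ ∘ₗ eigSynth (hP (τ x)) (B (τ x))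
      ∘ₗ LinearMap.funLeft ℂ ℂ (fun i => ⟨τ x, i⟩)
  have hf : ∀ a j, (fun x : {x // τ x = j} => f a x)
      = eigSynth (hP j) (B j) (fun i => a ⟨j, i⟩) := by
    intro a j
    funext ⟨x, hx⟩
    subst hx
    rfl
  have hfnorm : ∀ a, sqNorm (f a) = sqNorm a := by
    intro a
    rw [sqNorm_eq_sum_parts τ, sqNorm, Fintype.sum_sigma]
    refine Finset.sum_congr rfl fun j _ => ?_
    rw [hf, sqNorm_eigSynth]
    rfl
  have hinj : Function.Injective f := by
    rw [← LinearMap.ker_eq_bot, LinearMap.ker_eq_bot']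
    intro a ha
    rw [← sqNorm_eq_zero, ← hfnorm, ha]
    exact sqNorm_eq_zero.mpr rfl
  have hmain := card_le_eigCount_Icc hH (c := c) (r := r + D * (m * ε)) (by positivity) f hinj
    fun a => by
      set v := f a with hv
      have hfv : ∀ j, (fun x : {x // τ x = j} => v x)
          = eigSynth (hP j) (B j) (fun i => a ⟨j, i⟩) := hf a
      have h1 : sqNorm (H.mulVec v - (offBlock H τ).mulVec v - (c : ℂ) • v)
          ≤ r ^ 2 * sqNorm v := by
        rw [sqNorm_eq_sum_parts τ, sqNorm_eq_sum_parts τ v, Finset.mul_sum]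
        refine Finset.sum_le_sum fun j _ => ?_
        have h2 := sqNorm_mulVec_eigSynth_sub_le (hP j) (hB j) (fun i => a ⟨j, i⟩)
        rw [← hfv j] at h2
        refine le_trans (le_of_eq (congrArg sqNorm ?_)) h2
        funext x
        have h5 := partBlock_mulVec H τ j v x
        simp only [Pi.sub_apply, Pi.smul_apply, smul_eq_mul]
        rw [h5]
      have h2 : sqNorm (-(offBlock H τ).mulVec v) ≤ (D * (m * ε)) ^ 2 * sqNorm v := by
        have hneg : sqNorm (-(offBlock H τ).mulVec v) = sqNorm ((offBlock H τ).mulVec v) := by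
          simp [sqNorm]
        rw [hneg, offBlock_mulVec_restrict H τ Z hZ]
        refine (sqNorm_mulVec_le (offBlock_isHermitian hH τ) hD _).trans ?_
        rw [mul_pow, mul_assoc]
        gcongr
        rw [sqNorm_eq_sum_parts τ, sqNorm_eq_sum_parts τ v, Finset.mul_sum]
        refine Finset.sum_le_sum fun j _ => ?_
        -- A part with empty window contributes no vectors, so its size need not be bounded by `m`;
        -- this is used for the top of a tree.
        by_cases hne : (B j).Nonempty
        · have h3 := sqNorm_restrict_eigSynth_le (hP j) (B j) {x | x.1 ∈ Z} (h j) (hm j hne)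
            (fun i => a ⟨j, i⟩)
          rw [← hfv j] at h3
          refine le_trans (le_of_eq (congrArg sqNorm (funext fun x => ?_))) h3
          by_cases hx : x.1 ∈ Z <;> simp [hx]
        · have h0 : (fun x : {x // τ x = j} => v x) = 0 := by
            rw [hfv j]
            have : IsEmpty {i // (hP j).eigenvalues i ∈ B j} :=
              ⟨fun i => hne ⟨_, i.2⟩⟩
            rw [Subsingleton.elim (fun i => a ⟨j, i⟩) 0, map_zero]
          have h0' : (fun x : {x // τ x = j} => if x.1 ∈ Z then v x else 0) = 0 := by
            funext x
            have := congrFun h0 x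
            simp only [Pi.zero_apply] at this ⊢
            rw [this, ite_self]
          have hz : sqNorm (0 : {x // τ x = j} → ℂ) = 0 := sqNorm_eq_zero.mpr rfl
          rw [h0, h0', hz, mul_zero]
      have h3 := sqNorm_sub_le hr (by positivity) (sqNorm_nonneg _) h1 h2
      refine le_trans (le_of_eq (congrArg sqNorm ?_)) h3
      abel
  rw [Fintype.card_sigma] at hmain
  refine le_trans (le_of_eq (Finset.sum_congr rfl fun j _ => ?_)) hmain
  exact (card_eigSynth_domain (hP j) (B j)).symm

end Comparison

/-! ### Decay of eigenvectors from decay of the Green function -/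

section EigenvectorDecay

/-- Eigenvectors are small where the Green function of a smaller region decays. -/
lemma norm_eigenvector_le {V D : Type*} [Fintype V] [Fintype D] [DecidableEq D]
    {H : Matrix V V ℂ} {ι : D → V} {G : Matrix D D ℂ} {E E₀ : ℝ}
    (hG : G * (H.submatrix ι ι - (E₀ : ℂ) • 1) = 1) {W : D → ℝ} (hW : ∀ x, 0 < W x) {b : ℝ}
    (hb : ∀ x, ∑ y, ‖G x y‖ * W y ≤ b * W x) {ψ : V → ℂ} (hψ : H.mulVec ψ = (E : ℂ) • ψ) {ζ : ℝ}
    (hζ : ∀ y, ‖∑ a, H (ι y) (ι a) * ψ (ι a) - H.mulVec ψ (ι y)‖ ≤ ζ * W y)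
    (hE : |E - E₀| * b ≤ 1 / 2) (x : D) : ‖ψ (ι x)‖ ≤ 2 * b * ζ * W x := by
  have hb0 : 0 ≤ b := by
    have h1 : 0 ≤ b * W x := (Finset.sum_nonneg fun y _ =>
      mul_nonneg (norm_nonneg _) (hW y).le).trans (hb x)
    exact nonneg_of_mul_nonneg_left h1 (hW x)
  -- The smallest `m` with `‖ψ‖ ≤ m W` on the region; it is to be bounded by `2 b ζ`.
  obtain ⟨x₁, -, hx₁⟩ := Finset.exists_max_image Finset.univ (fun x => ‖ψ (ι x)‖ / W x) ⟨x, by simp⟩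
  set m := ‖ψ (ι x₁)‖ / W x₁ with hm
  have hmle : ∀ y, ‖ψ (ι y)‖ ≤ m * W y := fun y =>
    (div_le_iff₀ (hW y)).mp (hx₁ y (Finset.mem_univ _))
  -- Resolvent identity: on the region, `(H - E₀) ψ` is `(E - E₀) ψ` plus the contribution of the
  -- edges that leave the region.
  have heq : ∀ z, ψ (ι z) = ∑ y, G z y * (((E - E₀ : ℝ) : ℂ) * ψ (ι y)
      + (∑ a, H (ι y) (ι a) * ψ (ι a) - H.mulVec ψ (ι y))) := by
    intro z
    have h1 : (fun y => ((E - E₀ : ℝ) : ℂ) * ψ (ι y)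
        + (∑ a, H (ι y) (ι a) * ψ (ι a) - H.mulVec ψ (ι y)))
        = (H.submatrix ι ι - (E₀ : ℂ) • 1).mulVec (fun y => ψ (ι y)) := by
      funext y
      have h0 : (H.submatrix ι ι).mulVec (fun y => ψ (ι y)) y
          = ∑ a, H (ι y) (ι a) * ψ (ι a) := rfl
      rw [hψ, Matrix.sub_mulVec, Matrix.smul_mulVec, Matrix.one_mulVec]
      simp only [Pi.sub_apply, Pi.smul_apply, smul_eq_mul, h0]
      push_cast
      ring
    have h2 := congrArg (fun F : D → ℂ => (G.mulVec F) z) h1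
    simp only [Matrix.mulVec_mulVec, hG, Matrix.one_mulVec] at h2
    exact h2.symm
  have hpt : ∀ z, ‖ψ (ι z)‖ ≤ (|E - E₀| * m + ζ) * (b * W z) := by
    intro z
    have hcoef : 0 ≤ |E - E₀| * m + ζ := by
      have hz := hζ z
      have : 0 ≤ ζ := nonneg_of_mul_nonneg_left ((norm_nonneg _).trans hz) (hW z)
      have hm0 : 0 ≤ m := div_nonneg (norm_nonneg _) (hW _).le
      positivity
    calc ‖ψ (ι z)‖ ≤ ∑ y, ‖G z y‖ * ((|E - E₀| * m + ζ) * W y) := by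
          rw [heq z]
          refine (norm_sum_le _ _).trans (Finset.sum_le_sum fun y _ => ?_)
          rw [norm_mul]
          refine mul_le_mul_of_nonneg_left ?_ (norm_nonneg _)
          refine (norm_add_le _ _).trans ?_
          rw [norm_mul, Complex.norm_real, Real.norm_eq_abs, add_mul, mul_assoc]
          exact add_le_add (mul_le_mul_of_nonneg_left (hmle y) (abs_nonneg _)) (hζ y)
      _ = (|E - E₀| * m + ζ) * ∑ y, ‖G z y‖ * W y := by
          rw [Finset.mul_sum]
          exact Finset.sum_congr rfl fun y _ => by ring
      _ ≤ _ := mul_le_mul_of_nonneg_left (hb z) hcoef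
  have hm0 : 0 ≤ m := div_nonneg (norm_nonneg _) (hW _).le
  have hfin : m ≤ 2 * b * ζ := by
    have h1 : m ≤ (|E - E₀| * m + ζ) * b := by
      rw [hm, div_le_iff₀ (hW x₁), ← hm, mul_assoc]
      exact hpt x₁
    -- From `m ≤ |E - E₀| b m + b ζ` and `|E - E₀| b ≤ 1/2`, the first term is absorbed on the left.
    nlinarith
  exact (hmle x).trans (mul_le_mul_of_nonneg_right hfin (hW x).le)

end EigenvectorDecay

/-! ### Finite rooted trees -/

section Trees

/-- Number of vertices at distance `r` from the root of a rooted tree in which the root has `κ`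
children and every other vertex has `K` children. -/
def genCard (κ K : ℕ) : ℕ → ℕ
  | 0 => 1
  | r + 1 => κ * K ^ r

lemma genCard_self (K r : ℕ) : genCard K K r = K ^ r := by
  cases r with
  | zero => rfl
  | succ r => rw [genCard, pow_succ, mul_comm]

lemma genCard_add {κ K r : ℕ} (hr : 1 ≤ r) (u : ℕ) :
    genCard κ K (r + u) = genCard κ K r * K ^ u := by
  obtain ⟨r, rfl⟩ := Nat.exists_eq_add_of_le' hr
  rw [show r + 1 + u = r + u + 1 by ring, genCard, genCard, pow_add, mul_assoc]

lemma pow_le_genCard {κ K : ℕ} (hκ : K ≤ κ) (r : ℕ) : K ^ r ≤ genCard κ K r := by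
  rw [← genCard_self]
  cases r with
  | zero => rfl
  | succ r => exact Nat.mul_le_mul_right _ hκ

/-- The first `R` generations of the rooted tree in which the root has `κ` children and every other
vertex has `K` children: a vertex is a pair of a generation and a number. -/
def treeFinset (κ K R : ℕ) : Finset (ℕ × ℕ) :=
  ((Finset.range R).sigma fun r => Finset.range (genCard κ K r)).map
    (Equiv.sigmaEquivProd ℕ ℕ).toEmbedding

lemma mem_treeFinset {κ K R : ℕ} {x : ℕ × ℕ} :
    x ∈ treeFinset κ K R ↔ x.1 < R ∧ x.2 < genCard κ K x.1 := by
  rw [treeFinset, Finset.mem_map]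
  constructor
  · rintro ⟨⟨r, i⟩, h, rfl⟩
    simpa using h
  · rintro ⟨h1, h2⟩
    exact ⟨⟨x.1, x.2⟩, by simpa using ⟨h1, h2⟩, rfl⟩

lemma card_treeFinset (κ K R : ℕ) :
    (treeFinset κ K R).card = ∑ r ∈ Finset.range R, genCard κ K r := by
  rw [treeFinset, Finset.card_map, Finset.card_sigma]
  simp

/-- `y` is the parent of `x`. -/
def TreeParent (K : ℕ) (y x : ℕ × ℕ) : Prop := x.1 = y.1 + 1 ∧ (y.1 = 0 ∨ x.2 / K = y.2)

/-- The first vertex of the block of `x`; the blocks are made of `p` consecutive generations. -/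
def treeSite (K p : ℕ) (x : ℕ × ℕ) : ℕ × ℕ :=
  (p * (x.1 / p), if x.1 < p then 0 else x.2 / K ^ (x.1 % p))

open Classical in
/-- The adjacency matrix of the tree. -/
def treeHop (κ K R : ℕ) : Matrix (treeFinset κ K R) (treeFinset κ K R) ℂ :=
  Matrix.of fun x y => if TreeParent K x y ∨ TreeParent K y x then 1 else 0

lemma treeHop_isHermitian (κ K R : ℕ) : (treeHop κ K R).IsHermitian := by
  ext x y
  have h : (TreeParent K y x ∨ TreeParent K x y) ↔ (TreeParent K x y ∨ TreeParent K y x) := or_comm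
  simp only [Matrix.conjTranspose_apply, treeHop, Matrix.of_apply]
  by_cases h' : TreeParent K x y ∨ TreeParent K y x
  · rw [if_pos h', if_pos (h.mpr h'), star_one]
  · rw [if_neg h', if_neg (mt h.mp h'), star_zero]

lemma treeHop_ne_zero {κ K R : ℕ} {x y : treeFinset κ K R} (h : treeHop κ K R x y ≠ 0) :
    TreeParent K x y ∨ TreeParent K y x := by
  by_contra hcon
  exact h (by simp [treeHop, hcon])

lemma norm_treeHop_le {κ K R : ℕ} (x y : treeFinset κ K R) : ‖treeHop κ K R x y‖ ≤ 1 := by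
  simp only [treeHop, Matrix.of_apply]
  split_ifs <;> simp

/-- The bound allows `K + 1` children and a parent at every vertex, although the root has no parent
and other vertices have `K` children. Children are distinguished by their remainder modulo `K`,
those of the root by their number. -/
lemma treeHop_degree_le {κ K R : ℕ} (hκ : κ ≤ K + 1) (hK : 0 < K) (x : treeFinset κ K R) :
    (Finset.univ.filter fun y => treeHop κ K R x y ≠ 0).card ≤ K + 2 := by
  classical
  have hsub : (Finset.univ.filter fun y => treeHop κ K R x y ≠ 0)
      ⊆ (Finset.univ.filter fun y : treeFinset κ K R => TreeParent K x y)
        ∪ (Finset.univ.filter fun y : treeFinset κ K R => TreeParent K y x) := by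
    intro y hy
    rw [Finset.mem_filter] at hy
    rcases treeHop_ne_zero hy.2 with h | h
    · exact Finset.mem_union_left _ (by simpa using h)
    · exact Finset.mem_union_right _ (by simpa using h)
  have h1 : (Finset.univ.filter fun y : treeFinset κ K R => TreeParent K x y).card ≤ K + 1 := by
    rw [← Finset.card_range (K + 1)]
    refine Finset.card_le_card_of_injOn (fun y => if x.1.1 = 0 then y.1.2 else y.1.2 % K) ?_ ?_
    · intro y hy
      have hy' : TreeParent K x y := by simpa using hy
      have hyV := (mem_treeFinset.mp y.2).2
      simp only [Finset.coe_range, Set.mem_Iio]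
      split_ifs with h0
      · rw [hy'.1, h0, zero_add, genCard, pow_zero, mul_one] at hyV
        omega
      · exact (Nat.mod_lt _ hK).trans (Nat.lt_succ_self K)
    · intro y hy z hz hyz
      have hy' : TreeParent K x y := by simpa using hy
      have hz' : TreeParent K x z := by simpa using hz
      refine Subtype.ext (Prod.ext (hy'.1.trans hz'.1.symm) ?_)
      by_cases h0 : x.1.1 = 0
      · simpa [h0] using hyz
      · simp only [h0, if_false] at hyz
        have e1 := hy'.2.resolve_left h0
        have e2 := hz'.2.resolve_left h0
        rw [← Nat.div_add_mod y.1.2 K, ← Nat.div_add_mod z.1.2 K, e1, e2, hyz]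
  have h2 : (Finset.univ.filter fun y : treeFinset κ K R => TreeParent K y x).card ≤ 1 := by
    rw [Finset.card_le_one]
    intro y hy z hz
    have hy' : TreeParent K y x := by simpa using hy
    have hz' : TreeParent K z x := by simpa using hz
    have h1 : y.1.1 = z.1.1 := by have := hy'.1; have := hz'.1; omega
    refine Subtype.ext (Prod.ext h1 ?_)
    by_cases h0 : y.1.1 = 0
    · have e1 := (mem_treeFinset.mp y.2).2
      have e2 := (mem_treeFinset.mp z.2).2
      rw [← h1, h0, genCard] at e2
      rw [h0, genCard] at e1
      omega
    · rw [← hy'.2.resolve_left h0, ← hz'.2.resolve_left (h1 ▸ h0)]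
  have := (Finset.card_le_card hsub).trans (Finset.card_union_le _ _)
  omega

lemma sum_norm_treeHop_le {κ K R : ℕ} (hκ : κ ≤ K + 1) (hK : 0 < K) (x : treeFinset κ K R) :
    ∑ y, ‖treeHop κ K R x y‖ ≤ K + 2 := by
  classical
  rw [← Finset.sum_filter_of_ne (p := fun y => treeHop κ K R x y ≠ 0)
    fun y _ h h0 => h (by rw [h0, norm_zero])]
  refine (Finset.sum_le_card_nsmul _ _ 1 fun y _ => norm_treeHop_le x y).trans ?_
  rw [nsmul_eq_mul, mul_one]
  exact_mod_cast treeHop_degree_le hκ hK x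

lemma sum_esqrt_treeHop_le {κ K R : ℕ} (hκ : κ ≤ K + 1) (hK : 0 < K) (x : treeFinset κ K R) :
    ∑ y, esqrt ‖treeHop κ K R x y‖ₑ ≤ (K + 2 : ℕ) := by
  classical
  rw [← Finset.sum_filter_of_ne (p := fun y => treeHop κ K R x y ≠ 0)
    fun y _ h h0 => h (by rw [h0, enorm_zero, esqrt_zero])]
  refine (Finset.sum_le_card_nsmul _ _ 1 fun y _ => ?_).trans ?_
  · have : esqrt 1 = 1 := by simp [esqrt]
    rw [← this]
    refine esqrt_mono ?_
    rw [← ofReal_norm, ENNReal.ofReal_le_one]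
    exact norm_treeHop_le x y
  · rw [nsmul_eq_mul, mul_one]
    exact_mod_cast treeHop_degree_le hκ hK x

lemma treeSite_eq_iff_level {K p : ℕ} (hp : 0 < p) {x y : ℕ × ℕ}
    (h : treeSite K p x = treeSite K p y) : x.1 / p = y.1 / p := by
  have := congrArg Prod.fst h
  exact Nat.eq_of_mul_eq_mul_left hp this

/-- Reducing the generation modulo `p` embeds every block into the first `p` generations. For `κ =
K` and `p = m₀ + 1` the bound is `M₀`; for `κ = K + 1` the block of the root is larger, but this
enters only constants. -/
lemma blockCardLE_treeSite {κ K p : ℕ} (hp : 0 < p) (hK : 0 < K) (hκ : K ≤ κ) (R : ℕ) :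
    BlockCardLE (fun x : treeFinset κ K R => treeSite K p x)
      (∑ v ∈ Finset.range p, genCard κ K v) := by
  classical
  intro b
  rw [← card_treeFinset]
  refine Finset.card_le_card_of_injOn (fun x : treeFinset κ K R =>
    (x.1.1 % p, if x.1.1 < p then x.1.2 else x.1.2 % K ^ (x.1.1 % p))) ?_ ?_
  · intro x _
    rw [Finset.mem_coe, mem_treeFinset]
    refine ⟨Nat.mod_lt _ hp, ?_⟩
    dsimp only
    split_ifs with h
    · rw [Nat.mod_eq_of_lt h]; exact (mem_treeFinset.mp x.2).2
    · exact (Nat.mod_lt _ (Nat.pow_pos hK)).trans_le (pow_le_genCard hκ _)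
  · intro x hx y hy hxy
    have hx' : treeSite K p x = b := by simpa using hx
    have hy' : treeSite K p y = b := by simpa using hy
    have hs := hx'.trans hy'.symm
    have hl := treeSite_eq_iff_level hp hs
    simp only [Prod.mk.injEq] at hxy
    have h1 : x.1.1 = y.1.1 := by
      rw [← Nat.div_add_mod x.1.1 p, ← Nat.div_add_mod y.1.1 p, hl, hxy.1]
    refine Subtype.ext (Prod.ext h1 ?_)
    have h2 := congrArg Prod.snd hs
    have h3 := hxy.2
    simp only [treeSite] at h2
    rw [← h1] at h2 h3
    by_cases hlt : x.1.1 < p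
    · simpa [hlt] using h3
    · simp only [hlt, if_false] at h2 h3
      rw [← Nat.div_add_mod x.1.2 (K ^ (x.1.1 % p)), ← Nat.div_add_mod y.1.2 (K ^ (x.1.1 % p)),
        h2, h3]

/-- The operator on the tree with a block potential. -/
def treeHam (κ K R : ℕ) (lam : ℝ) (v : treeFinset κ K R → ℝ) :
    Matrix (treeFinset κ K R) (treeFinset κ K R) ℂ := ham (treeHop κ K R) lam v

lemma treeHam_isHermitian (κ K R : ℕ) (lam : ℝ) (v : treeFinset κ K R → ℝ) :
    (treeHam κ K R lam v).IsHermitian := ham_isHermitian (treeHop_isHermitian κ K R) lam v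

lemma treeHam_apply_of_ne {κ K R : ℕ} {lam : ℝ} {v : treeFinset κ K R → ℝ}
    {x y : treeFinset κ K R} (h : x ≠ y) : treeHam κ K R lam v x y = treeHop κ K R x y := by
  simp [treeHam, ham, h]

/-- The inclusion of the first generations. -/
def treeIncl {κ K d R : ℕ} (h : d ≤ R) (x : treeFinset κ K d) : treeFinset κ K R :=
  ⟨x.1, mem_treeFinset.mpr ⟨(mem_treeFinset.mp x.2).1.trans_le h, (mem_treeFinset.mp x.2).2⟩⟩

lemma treeIncl_injective {κ K d R : ℕ} (h : d ≤ R) :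
    Function.Injective (treeIncl h : treeFinset κ K d → treeFinset κ K R) := by
  intro x y hxy
  exact Subtype.ext (congrArg (fun z : treeFinset κ K R => z.1) hxy)

lemma treeHam_submatrix_treeIncl {κ K d R : ℕ} (h : d ≤ R) (lam : ℝ)
    (v : treeFinset κ K R → ℝ) :
    (treeHam κ K R lam v).submatrix (treeIncl h) (treeIncl h)
      = treeHam κ K d lam (fun x => v (treeIncl h x)) := by
  ext x y
  by_cases hxy : x = y
  · subst hxy
    simp [treeHam, ham, treeHop, treeIncl]
  · rw [Matrix.submatrix_apply, treeHam_apply_of_ne hxy,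
      treeHam_apply_of_ne fun h' => hxy (treeIncl_injective h h')]
    rfl

/-! ### Decomposition of a tree into subtrees -/

/-- The index of the subtree with root in generation `r₀` that contains a vertex. -/
def treePart {κ K r₀ R : ℕ} (x : treeFinset κ K R) : Option (Fin (genCard κ K r₀)) :=
  if h : r₀ ≤ x.1.1 ∧ x.1.2 / K ^ (x.1.1 - r₀) < genCard κ K r₀ then
    some ⟨x.1.2 / K ^ (x.1.1 - r₀), h.2⟩ else none

lemma treePart_of_le {κ K r₀ R : ℕ} (hr₀ : 1 ≤ r₀) (x : treeFinset κ K R)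
    (h : r₀ ≤ x.1.1) : x.1.2 / K ^ (x.1.1 - r₀) < genCard κ K r₀ := by
  have hx := (mem_treeFinset.mp x.2).2
  rw [← Nat.add_sub_of_le h, genCard_add hr₀] at hx
  exact Nat.div_lt_of_lt_mul (by rwa [mul_comm])

lemma treePart_eq_none_iff {κ K r₀ R : ℕ} (hr₀ : 1 ≤ r₀) (x : treeFinset κ K R) :
    (treePart x : Option (Fin (genCard κ K r₀))) = none ↔ x.1.1 < r₀ := by
  by_cases h : r₀ ≤ x.1.1
  · rw [treePart, dif_pos ⟨h, treePart_of_le hr₀ x h⟩]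
    exact ⟨fun h' => (Option.some_ne_none _ h').elim, fun h' => absurd h (not_le.mpr h')⟩
  · rw [treePart, dif_neg fun h' => h h'.1]
    exact ⟨fun _ => not_le.mp h, fun _ => rfl⟩

lemma treePart_eq_some_iff {κ K r₀ R : ℕ} (x : treeFinset κ K R)
    (j : Fin (genCard κ K r₀)) :
    treePart x = some j ↔ r₀ ≤ x.1.1 ∧ x.1.2 / K ^ (x.1.1 - r₀) = j := by
  unfold treePart
  split_ifs with h
  · rw [Option.some_inj, Fin.ext_iff]
    exact ⟨fun h' => ⟨h.1, h'⟩, fun h' => h'.2⟩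
  · simp only [false_iff]
    rintro ⟨h1, h2⟩
    exact h ⟨h1, h2 ▸ j.2⟩

/-- The vertex of the subtree number `j` that corresponds to `x`. -/
def subtreeVertex (K r₀ j : ℕ) (x : ℕ × ℕ) : ℕ × ℕ := (r₀ + x.1, j * K ^ x.1 + x.2)

lemma subtreeVertex_mem {κ K r₀ R' : ℕ} (hr₀ : 1 ≤ r₀) (j : Fin (genCard κ K r₀))
    {x : ℕ × ℕ} (hx : x ∈ treeFinset K K R') :
    subtreeVertex K r₀ j x ∈ treeFinset κ K (r₀ + R') := by
  rw [mem_treeFinset] at hx ⊢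
  rw [genCard_self] at hx
  refine ⟨by simp only [subtreeVertex]; omega, ?_⟩
  simp only [subtreeVertex]
  rw [genCard_add hr₀]
  calc (j : ℕ) * K ^ x.1 + x.2 < j * K ^ x.1 + K ^ x.1 := by omega
    _ = (j + 1) * K ^ x.1 := by ring
    _ ≤ genCard κ K r₀ * K ^ x.1 := Nat.mul_le_mul_right _ j.2

/-- The subtree number `j` is a tree. -/
def subtreeEquiv {κ K r₀ R' : ℕ} (hr₀ : 1 ≤ r₀) (hK : 0 < K) (j : Fin (genCard κ K r₀)) :
    treeFinset K K R' ≃ {x : treeFinset κ K (r₀ + R') // treePart x = some j} where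
  toFun x := ⟨⟨subtreeVertex K r₀ j x, subtreeVertex_mem hr₀ j x.2⟩, by
    rw [treePart_eq_some_iff]
    have hx := (mem_treeFinset.mp x.2).2
    rw [genCard_self] at hx
    refine ⟨Nat.le_add_right _ _, ?_⟩
    simp only [subtreeVertex, Nat.add_sub_cancel_left]
    rw [mul_comm, Nat.mul_add_div (Nat.pow_pos hK), Nat.div_eq_of_lt hx, add_zero]⟩
  invFun x := ⟨(x.1.1.1 - r₀, x.1.1.2 % K ^ (x.1.1.1 - r₀)), by
    have hx := (mem_treeFinset.mp x.1.2).1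
    have h1 := ((treePart_eq_some_iff _ _).mp x.2).1
    rw [mem_treeFinset, genCard_self]
    exact ⟨by dsimp only; omega, Nat.mod_lt _ (Nat.pow_pos hK)⟩⟩
  left_inv x := by
    have hx := (mem_treeFinset.mp x.2).2
    rw [genCard_self] at hx
    refine Subtype.ext (Prod.ext ?_ ?_)
    · simp [subtreeVertex]
    · simp only [subtreeVertex, Nat.add_sub_cancel_left]
      rw [mul_comm, Nat.mul_add_mod, Nat.mod_eq_of_lt hx]
  right_inv x := by
    obtain ⟨h1, h2⟩ := (treePart_eq_some_iff _ _).mp x.2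
    refine Subtype.ext (Subtype.ext (Prod.ext ?_ ?_))
    · simp only [subtreeVertex]; omega
    · simp only [subtreeVertex]
      rw [← h2, mul_comm, Nat.div_add_mod]

lemma treeParent_subtreeVertex {K r₀ : ℕ} (hr₀ : 1 ≤ r₀) (hK : 0 < K) (j : ℕ) {x y : ℕ × ℕ}
    (hx : x.2 < K ^ x.1) (hy : y.2 < K ^ y.1) :
    TreeParent K (subtreeVertex K r₀ j x) (subtreeVertex K r₀ j y) ↔ TreeParent K x y := by
  unfold TreeParent subtreeVertex
  dsimp only
  have h0 : r₀ + x.1 ≠ 0 := by omega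
  constructor
  · rintro ⟨h1, h2⟩
    have h1' : y.1 = x.1 + 1 := by omega
    refine ⟨h1', Or.inr ?_⟩
    have h3 := h2.resolve_left h0
    rw [h1', pow_succ, ← mul_assoc, mul_comm _ K, Nat.mul_add_div hK] at h3
    omega
  · rintro ⟨h1, h2⟩
    refine ⟨by omega, Or.inr ?_⟩
    rw [h1, pow_succ, ← mul_assoc, mul_comm _ K, Nat.mul_add_div hK]
    rcases h2 with h2 | h2
    · rw [h1, h2, zero_add, pow_one] at hy
      rw [h2, pow_zero] at hx
      rw [Nat.div_eq_of_lt hy]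
      omega
    · omega

lemma partBlock_submatrix_subtreeEquiv {κ K r₀ R' : ℕ} (hr₀ : 1 ≤ r₀) (hK : 0 < K)
    (j : Fin (genCard κ K r₀)) (lam : ℝ) (v : treeFinset κ K (r₀ + R') → ℝ) :
    (partBlock (treeHam κ K (r₀ + R') lam v) treePart (some j)).submatrix
      (subtreeEquiv hr₀ hK j) (subtreeEquiv hr₀ hK j)
      = treeHam K K R' lam (fun x => v (subtreeEquiv hr₀ hK j x)) := by
  ext x y
  by_cases hxy : x = y
  · subst hxy
    simp [treeHam, ham, treeHop, partBlock, TreeParent]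
  · have hne : ((subtreeEquiv hr₀ hK j x).1 : treeFinset κ K (r₀ + R'))
        ≠ (subtreeEquiv hr₀ hK j y).1 := fun h =>
      hxy ((subtreeEquiv hr₀ hK j).injective (Subtype.ext h))
    rw [Matrix.submatrix_apply, partBlock, Matrix.submatrix_apply, treeHam_apply_of_ne hne,
      treeHam_apply_of_ne hxy]
    have hx := (mem_treeFinset.mp x.2).2
    have hy := (mem_treeFinset.mp y.2).2
    rw [genCard_self] at hx hy
    have h1 := treeParent_subtreeVertex hr₀ hK j hx hy
    have h2 := treeParent_subtreeVertex hr₀ hK j hy hx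
    classical
    change (if TreeParent K (subtreeVertex K r₀ j x) (subtreeVertex K r₀ j y) ∨
      TreeParent K (subtreeVertex K r₀ j y) (subtreeVertex K r₀ j x) then (1 : ℂ) else 0)
      = if TreeParent K x y ∨ TreeParent K y x then 1 else 0
    simp only [h1, h2]

/-- Edges between different parts of the decomposition join the generations `r₀ - 1` and `r₀`. -/
lemma level_of_offBlock_ne_zero {κ K r₀ R' : ℕ} (hr₀ : 1 ≤ r₀) (lam : ℝ)
    (v : treeFinset κ K (r₀ + R') → ℝ) {x y : treeFinset κ K (r₀ + R')}
    (h : offBlock (treeHam κ K (r₀ + R') lam v)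
      (treePart : _ → Option (Fin (genCard κ K r₀))) x y ≠ 0) : y.1.1 ≤ r₀ := by
  have hne : (treePart x : Option (Fin (genCard κ K r₀))) ≠ treePart y := by
    intro heq
    exact h (by simp [offBlock, heq])
  have hxy : x ≠ y := fun h' => hne (by rw [h'])
  have hhop : treeHop κ K (r₀ + R') x y ≠ 0 := by
    rw [offBlock, Matrix.of_apply, if_neg hne, treeHam_apply_of_ne hxy] at h
    exact h
  by_contra hcon
  push Not at hcon
  apply hne
  -- From generation `r₀` on, a child has the same ancestor in generation `r₀` as its parent. So an
  -- edge between different parts has its upper end in generation `r₀ - 1`.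
  have key : ∀ a b : treeFinset κ K (r₀ + R'), TreeParent K a b → r₀ ≤ a.1.1 →
      (treePart a : Option (Fin (genCard κ K r₀))) = treePart b := by
    intro a b hab ha
    have hb : r₀ ≤ b.1.1 := by have := hab.1; omega
    have h1 := treePart_of_le hr₀ a ha
    symm
    have : (treePart a : Option (Fin (genCard κ K r₀))) = some ⟨_, h1⟩ :=
      (treePart_eq_some_iff _ _).mpr ⟨ha, rfl⟩
    rw [this, treePart_eq_some_iff]
    refine ⟨hb, ?_⟩
    have h2 := hab.2.resolve_left (by omega)
    dsimp only
    rw [← h2, Nat.div_div_eq_div_mul, ← pow_succ', hab.1]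
    congr 2
    omega
  rcases treeHop_ne_zero hhop with h1 | h1
  · exact key x y h1 (by have := h1.1; omega)
  · exact (key y x h1 (by omega)).symm

/-- The first generations as a part of the decomposition. -/
def topEquiv {κ K r₀ R' : ℕ} (hr₀ : 1 ≤ r₀) :
    treeFinset κ K r₀ ≃ {x : treeFinset κ K (r₀ + R') //
      (treePart x : Option (Fin (genCard κ K r₀))) = none} where
  toFun x := ⟨treeIncl (Nat.le_add_right _ _) x,
    (treePart_eq_none_iff hr₀ _).mpr (mem_treeFinset.mp x.2).1⟩
  invFun x := ⟨x.1.1, mem_treeFinset.mpr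
    ⟨(treePart_eq_none_iff hr₀ x.1).mp x.2, (mem_treeFinset.mp x.1.2).2⟩⟩
  left_inv _ := rfl
  right_inv _ := rfl

lemma partBlock_submatrix_topEquiv {κ K r₀ R' : ℕ} (hr₀ : 1 ≤ r₀) (lam : ℝ)
    (v : treeFinset κ K (r₀ + R') → ℝ) :
    (partBlock (treeHam κ K (r₀ + R') lam v)
        (treePart : _ → Option (Fin (genCard κ K r₀))) none).submatrix
      (topEquiv hr₀) (topEquiv hr₀)
      = treeHam κ K r₀ lam (fun x => v (treeIncl (Nat.le_add_right _ _) x)) :=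
  treeHam_submatrix_treeIncl (Nat.le_add_right r₀ R') lam v

/-- Cutting at a depth `p * a` respects the blocks: those of a subtree, formed from its own root,
are blocks of the whole tree. The case `x.1 < p` needs care, because `treeSite` treats the block of
a root separately. -/
lemma treeSite_subtreeVertex {K p a : ℕ} (hp : 0 < p) (ha : 1 ≤ a) (hK : 0 < K) (j : ℕ)
    {x : ℕ × ℕ} (hx : x.2 < K ^ x.1) :
    treeSite K p (subtreeVertex K (p * a) j x)
      = subtreeVertex K (p * a) j (treeSite K p x) := by
  have hpa : p ≤ p * a := Nat.le_mul_of_pos_right p ha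
  have hnlt : ¬ p * a + x.1 < p := by omega
  have hdecomp : x.1 = p * (x.1 / p) + x.1 % p := (Nat.div_add_mod _ _).symm
  simp only [treeSite, subtreeVertex, hnlt, if_false, Nat.mul_add_mod, Nat.mul_add_div hp,
    Prod.mk.injEq]
  refine ⟨by ring, ?_⟩
  have h1 : j * K ^ x.1 = K ^ (x.1 % p) * (j * K ^ (p * (x.1 / p))) := by
    conv_lhs => rw [hdecomp, pow_add]
    ring
  rw [h1, Nat.mul_add_div (Nat.pow_pos hK)]
  congr 1
  split_ifs with h
  · rw [Nat.mod_eq_of_lt h, Nat.div_eq_of_lt hx]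
  · rfl

lemma treeSite_lt {K p : ℕ} {x : ℕ × ℕ} (hx : x.2 < K ^ x.1) (hK : 0 < K) :
    (treeSite K p x).2 < K ^ (treeSite K p x).1 := by
  simp only [treeSite]
  split_ifs with h
  · exact Nat.pow_pos hK
  · refine Nat.div_lt_of_lt_mul ?_
    rwa [← pow_add, Nat.mod_add_div]

lemma subtreeVertex_inj {K r₀ j j' : ℕ} {x y : ℕ × ℕ} (hx : x.2 < K ^ x.1) (hy : y.2 < K ^ y.1) :
    subtreeVertex K r₀ j x = subtreeVertex K r₀ j' y ↔ j = j' ∧ x = y := by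
  constructor
  · intro h
    simp only [subtreeVertex, Prod.mk.injEq] at h
    have h1 : x.1 = y.1 := by omega
    have hpos : 0 < K ^ x.1 := by omega
    rw [← h1] at hy h
    have e1 := congrArg (· / K ^ x.1) h.2
    have e2 := congrArg (· % K ^ x.1) h.2
    rw [mul_comm, Nat.mul_add_div hpos, Nat.div_eq_of_lt hx, mul_comm, Nat.mul_add_div hpos,
      Nat.div_eq_of_lt hy] at e1
    rw [mul_comm, Nat.mul_add_mod, Nat.mod_eq_of_lt hx, mul_comm, Nat.mul_add_mod,
      Nat.mod_eq_of_lt hy] at e2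
    exact ⟨by simpa using e1, Prod.ext h1 e2⟩
  · rintro ⟨rfl, rfl⟩; rfl

end Trees

/-! ### Laws of block potentials -/

section Laws

set_option linter.unusedSectionVars false

variable (ν : Measure ℝ) [IsProbabilityMeasure ν]

/-- The law of a block potential depends only on the partition into blocks. -/
lemma map_infinitePi_comp {V β β' : Type*} {s : V → β} {s' : V → β'}
    (h : ∀ x y, s x = s y ↔ s' x = s' y) :
    (Measure.infinitePi fun _ : β => ν).map (fun w x => w (s x))
      = (Measure.infinitePi fun _ : β' => ν).map (fun w x => w (s' x)) := by
  -- Both families factor through the quotient of `V` by the partition into blocks, which embeds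
  -- into either index set, and marginals of product measures along injections are product measures.
  let e : Quotient (Setoid.ker s) → β := Setoid.kerLift s
  have he : Function.Injective e := Setoid.kerLift_injective s
  let e' : Quotient (Setoid.ker s) → β' := Quotient.lift s' fun x y hxy => (h x y).mp hxy
  have he' : Function.Injective e' := by
    rintro ⟨x⟩ ⟨y⟩ hxy
    exact Quotient.sound ((h x y).mpr hxy)
  let q : V → Quotient (Setoid.ker s) := fun x => Quotient.mk _ x
  have m1 : Measurable fun (w : Quotient (Setoid.ker s) → ℝ) (x : V) => w (q x) := by fun_prop
  have h1 := congrArg (Measure.map fun w x => w (q x))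
    (Measure.map_infinitePi_infinitePi_of_inj (P := fun _ : β => ν) he)
  have h2 := congrArg (Measure.map fun w x => w (q x))
    (Measure.map_infinitePi_infinitePi_of_inj (P := fun _ : β' => ν) he')
  rw [Measure.map_map m1 (by fun_prop)] at h1 h2
  exact h1.trans h2.symm

lemma lintegral_infinitePi_comp {V β β' : Type*} {s : V → β} {s' : V → β'}
    (h : ∀ x y, s x = s y ↔ s' x = s' y) {F : (V → ℝ) → ℝ≥0∞} (hF : Measurable F) :
    ∫⁻ w, F (fun x => w (s x)) ∂(Measure.infinitePi fun _ : β => ν)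
      = ∫⁻ w, F (fun x => w (s' x)) ∂(Measure.infinitePi fun _ : β' => ν) := by
  have h1 := congrArg (fun m => ∫⁻ v, F v ∂m) (map_infinitePi_comp ν h)
  rwa [lintegral_map hF (by fun_prop), lintegral_map hF (by fun_prop)] at h1

lemma integral_infinitePi_comp {V β β' E : Type*} [NormedAddCommGroup E] [NormedSpace ℝ E]
    [MeasurableSpace E] [BorelSpace E] [SecondCountableTopology E] {s : V → β} {s' : V → β'}
    (h : ∀ x y, s x = s y ↔ s' x = s' y) {F : (V → ℝ) → E} (hF : Measurable F) :
    ∫ w, F (fun x => w (s x)) ∂(Measure.infinitePi fun _ : β => ν)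
      = ∫ w, F (fun x => w (s' x)) ∂(Measure.infinitePi fun _ : β' => ν) := by
  have h1 := congrArg (fun m => ∫ v, F v ∂m) (map_infinitePi_comp ν h)
  have m1 : Measurable fun (w : β → ℝ) (x : V) => w (s x) := by fun_prop
  have m2 : Measurable fun (w : β' → ℝ) (x : V) => w (s' x) := by fun_prop
  rwa [integral_map m1.aemeasurable hF.aestronglyMeasurable,
    integral_map m2.aemeasurable hF.aestronglyMeasurable] at h1

/-- Block potentials over disjoint sets of blocks of the same shape are independent and have the
same law. -/
lemma integral_prod_infinitePi_comp {V β β' J : Type*} [Fintype J] {s : J → V → β} {s' : V → β'}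
    (h : ∀ i j x y, s i x = s j y ↔ i = j ∧ s' x = s' y) {F : (V → ℝ) → ℂ} (hF : Measurable F) :
    ∫ w, ∏ j, F (fun x => w (s j x)) ∂(Measure.infinitePi fun _ : β => ν)
      = (∫ w, F (fun x => w (s' x)) ∂(Measure.infinitePi fun _ : β' => ν)) ^ Fintype.card J := by
  -- The blocks are relabelled by pairs of a part and a block of the model; a product measure over
  -- pairs is a product over the parts of product measures.
  have h1 := integral_infinitePi_comp ν (V := J × V) (s := fun z => s z.1 z.2)
    (s' := fun z => (z.1, s' z.2)) (fun z z' => by rw [h, Prod.mk.injEq])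
    (F := fun v => ∏ j, F fun x => v (j, x))
    (Finset.measurable_prod _ fun j _ => hF.comp (by fun_prop))
  rw [h1]
  have h2 := Measure.infinitePi_map_curry (ι := J) (κ := β') fun _ _ => ν
  have hF' : Measurable fun v : β' → ℝ => F fun x => v (s' x) := hF.comp (by fun_prop)
  have h3 := congrArg (fun m => ∫ v, ∏ j, F (fun x => v j (s' x)) ∂m) h2
  have hP : Measurable fun v : J → β' → ℝ => ∏ j, F fun x => v j (s' x) :=
    Finset.measurable_prod _ fun j _ => hF'.comp (measurable_pi_apply j)
  rw [integral_map (MeasurableEquiv.measurable _).aemeasurable hP.aestronglyMeasurable,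
    Measure.infinitePi_eq_pi (μ := fun _ : J => Measure.infinitePi fun _ : β' => ν)] at h3
  exact h3.trans (integral_fintype_prod_eq_pow fun v : β' → ℝ => F fun x => v (s' x))

end Laws

/-! ### Localization near the root of a tree -/

section TreeGreen

set_option linter.unusedSectionVars false

/-- The Green function of a tree decays away from the root, with the weights `q ^ (2 * r)` in the
generation `r` and the constant `b`. -/
def GreenDecay (κ K d : ℕ) (lam E : ℝ) (q : ℕ) (b : ℝ) (v : treeFinset κ K d → ℝ) : Prop :=
  IsUnit (ham (treeHop κ K d) lam v - (E : ℂ) • (1 : Matrix _ _ ℂ)).det ∧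
    ∀ x, ∑ y, ‖green (treeHop κ K d) lam v E x y‖ * (q : ℝ) ^ (2 * y.1.1)
      ≤ b * (q : ℝ) ^ (2 * x.1.1)

lemma measurableSet_greenDecay (κ K d : ℕ) (lam E : ℝ) (q : ℕ) (b : ℝ) :
    MeasurableSet {v | GreenDecay κ K d lam E q b v} := by
  have hc : Continuous fun v : treeFinset κ K d → ℝ =>
      ham (treeHop κ K d) lam v - (E : ℂ) • (1 : Matrix _ _ ℂ) := by
    unfold ham
    refine (continuous_const.add (Continuous.matrix_diagonal ?_)).sub continuous_const
    fun_prop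
  refine MeasurableSet.inter ?_ ?_
  · have e : {v : treeFinset κ K d → ℝ | IsUnit (ham (treeHop κ K d) lam v
        - (E : ℂ) • (1 : Matrix _ _ ℂ)).det} = (fun v => (ham (treeHop κ K d) lam v
        - (E : ℂ) • (1 : Matrix _ _ ℂ)).det) ⁻¹' {0}ᶜ := Set.ext fun v => isUnit_iff_ne_zero
    change MeasurableSet {v : treeFinset κ K d → ℝ | IsUnit _}
    rw [e]
    exact (measurableSet_singleton (0 : ℂ)).compl.preimage hc.matrix_det.measurable
  · have : {v : treeFinset κ K d → ℝ | ∀ x,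
        ∑ y, ‖green (treeHop κ K d) lam v E x y‖ * (q : ℝ) ^ (2 * y.1.1)
          ≤ b * (q : ℝ) ^ (2 * x.1.1)} = ⋂ x, {v : treeFinset κ K d → ℝ |
        ∑ y, ‖green (treeHop κ K d) lam v E x y‖ * (q : ℝ) ^ (2 * y.1.1)
          ≤ b * (q : ℝ) ^ (2 * x.1.1)} := by ext; simp
    change MeasurableSet {v : treeFinset κ K d → ℝ | ∀ x, _}
    rw [this]
    refine MeasurableSet.iInter fun x => measurableSet_le ?_ measurable_const
    exact Finset.measurable_sum _ fun y _ => ((measurable_green _ _ _ x y).norm.mul_const _)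

variable (ν : Measure ℝ) [IsProbabilityMeasure ν]

lemma BlockCardLE.mono {V β : Type*} [Fintype V] [DecidableEq β] {s : V → β} {M M' : ℕ}
    (h : BlockCardLE s M) (hM : M ≤ M') : BlockCardLE s M' := fun b => (h b).trans hM

/-- At large disorder, the Green function decays with high probability. -/
lemma measure_not_greenDecay_le {κ K d p q : ℕ} (hp : 0 < p) (hK : 0 < K) (hκ : K ≤ κ)
    (hκ' : κ ≤ K + 1) (hq : 0 < q) {lam : ℝ} (hlam : 0 < lam) {C : NNReal}
    (hν : ν ≤ C • volume) {θ : ℝ≥0∞} {M : ℕ} (hM : ∑ v ∈ Finset.range p, genCard κ K v ≤ M)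
    (hθ : ∀ t₀ : ℝ, ∫⁻ t, esqrt (‖lam * t + t₀‖ₑ⁻¹) ∂ν ≤ θ)
    (hsmall : M * θ * (M * (q : ℝ≥0∞) ^ p + M * ((K + 2 : ℕ) * ((q : ℝ≥0∞) ^ p) ^ 2)) ≤ 1)
    (E : ℝ) {b : ℝ} (hb : 0 < b) :
    (Measure.infinitePi fun _ : ℕ × ℕ => ν)
        {w | ¬ GreenDecay κ K d lam E q b fun x => w (treeSite K p x)}
      ≤ (treeFinset κ K d).card * (esqrt (ENNReal.ofReal b))⁻¹ := by
  classical
  set π := Measure.infinitePi fun _ : ℕ × ℕ => ν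
  let s : treeFinset κ K d → ℕ × ℕ := fun x => treeSite K p x
  let U : treeFinset κ K d → ℝ≥0∞ := fun x => (q : ℝ≥0∞) ^ x.1.1
  let Φ : (ℕ × ℕ → ℝ) → treeFinset κ K d → ℝ≥0∞ := fun w x =>
    ∑ y, esqrt ‖green (treeHop κ K d) lam (fun x => w (s x)) E x y‖ₑ * U y
  have hq1 : (1 : ℝ≥0∞) ≤ q := by exact_mod_cast hq
  have hqpos : (q : ℝ≥0∞) ≠ 0 := by positivity
  have hU0 : ∀ x, U x ≠ 0 := fun x => pow_ne_zero _ hqpos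
  have hUt : ∀ x, U x ≠ ∞ := fun x => ENNReal.pow_ne_top (ENNReal.natCast_ne_top q)
  -- Vertices of one block, and neighbours, are at most `p` generations apart, so `q ^ p` serves as
  -- the growth factor of the weights.
  have hlev : ∀ x y : treeFinset κ K d, y.1.1 ≤ p + x.1.1 → U y ≤ (q : ℝ≥0∞) ^ p * U x := by
    intro x y h
    rw [← pow_add]
    exact pow_le_pow_right₀ hq1 h
  have hint : ∀ x, ∫⁻ w, Φ w x ∂π ≤ U x := by
    refine lintegral_sum_esqrt_green_le ν hlam hν hθ hsmall E _ _ le_rfl (treeHop_isHermitian κ K d)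
      ((blockCardLE_treeSite hp hK hκ d).mono hM) U (fun x y h => hlev x y ?_)
      (fun x y h => hlev x y ?_) (sum_esqrt_treeHop_le hκ' hK)
    · have h1 := treeSite_eq_iff_level hp h
      have h2 := Nat.div_add_mod x.1.1 p
      have h3 := Nat.div_add_mod y.1.1 p
      have h4 := Nat.mod_lt y.1.1 hp
      rw [← h1] at h3
      omega
    · rcases treeHop_ne_zero h with h | h <;> have := h.1 <;> omega
  have hmeas : ∀ x, Measurable fun w => Φ w x := by
    intro x
    refine Finset.measurable_sum _ fun y _ => Measurable.mul_const ?_ _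
    exact measurable_esqrt.comp ((measurable_green _ _ _ x y).comp
      (measurable_comp_blockMap s)).enorm
  have hbpos : ENNReal.ofReal b ≠ 0 := by simpa using hb
  have hsb0 : esqrt (ENNReal.ofReal b) ≠ 0 := by
    intro h0
    rw [esqrt, ENNReal.rpow_eq_zero_iff] at h0
    rcases h0 with h0 | h0
    · exact hbpos h0.1
    · exact ENNReal.ofReal_ne_top h0.1
  have hsbt : esqrt (ENNReal.ofReal b) ≠ ∞ := by
    intro h0
    rw [esqrt, ENNReal.rpow_eq_top_iff] at h0
    rcases h0 with h0 | h0
    · exact hbpos h0.1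
    · exact ENNReal.ofReal_ne_top h0.1
  -- Markov's inequality for the weighted fractional moment at one vertex; the union bound over `x`
  -- gives the factor `card`.
  have hmarkov : ∀ x, π {w | esqrt (ENNReal.ofReal b) * U x ≤ Φ w x}
      ≤ (esqrt (ENNReal.ofReal b))⁻¹ := by
    intro x
    have h1 := (mul_meas_ge_le_lintegral (μ := π) (hmeas x)
      (esqrt (ENNReal.ofReal b) * U x)).trans (hint x)
    rw [mul_comm, ← mul_assoc] at h1
    have h2 : π {w | esqrt (ENNReal.ofReal b) * U x ≤ Φ w x} * esqrt (ENNReal.ofReal b) ≤ 1 := by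
      rw [← ENNReal.mul_le_mul_iff_left (hU0 x) (hUt x), one_mul]
      exact h1
    rwa [← ENNReal.le_div_iff_mul_le (Or.inl hsb0) (Or.inl hsbt), one_div] at h2
  have hsub : ∀ᵐ w ∂π, w ∈ {w | ¬ GreenDecay κ K d lam E q b fun x => w (treeSite K p x)} →
      w ∈ ⋃ x, {w | esqrt (ENNReal.ofReal b) * U x ≤ Φ w x} := by
    filter_upwards [ae_isUnit_det ν (treeHop_isHermitian κ K d) hlam s hν E] with w hw hbad
    by_contra hcon
    apply hbad
    refine ⟨hw, fun x => ?_⟩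
    have hx : Φ w x < esqrt (ENNReal.ofReal b) * U x := by
      by_contra h
      exact hcon (Set.mem_iUnion.mpr ⟨x, not_lt.mp h⟩)
    -- Passing from square roots back to the Green function squares the weights. This is why
    -- `GreenDecay` has the exponents `2 * r` while the fractional moments have `r`.
    have hsq : ∀ y : treeFinset κ K d, U y = esqrt (ENNReal.ofReal ((q : ℝ) ^ (2 * y.1.1))) := by
      intro y
      rw [ENNReal.ofReal_pow (by positivity), ENNReal.ofReal_natCast, mul_comm, pow_mul, pow_two, esqrt_mul,
        ← pow_two, esqrt_sq]
    have h1 : esqrt (ENNReal.ofReal (∑ y, ‖green (treeHop κ K d) lam (fun x => w (s x)) E x y‖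
        * (q : ℝ) ^ (2 * y.1.1))) ≤ Φ w x := by
      rw [ENNReal.ofReal_sum_of_nonneg fun y _ => by positivity]
      refine (esqrt_sum_le _ _).trans (Finset.sum_le_sum fun y _ => ?_)
      rw [ENNReal.ofReal_mul (norm_nonneg _), esqrt_mul, ofReal_norm, ← hsq]
    have h2 := h1.trans_lt hx
    rw [hsq x, ← esqrt_mul, ← ENNReal.ofReal_mul hb.le] at h2
    by_contra hcon'
    exact absurd h2 (not_lt.mpr (esqrt_mono (ENNReal.ofReal_le_ofReal (not_le.mp hcon').le)))
  calc π {w | ¬ GreenDecay κ K d lam E q b fun x => w (treeSite K p x)}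
      ≤ π (⋃ x, {w | esqrt (ENNReal.ofReal b) * U x ≤ Φ w x}) := measure_mono_ae hsub
    _ ≤ ∑ x, π {w | esqrt (ENNReal.ofReal b) * U x ≤ Φ w x} := measure_iUnion_fintype_le _ _
    _ ≤ ∑ _x : treeFinset κ K d, (esqrt (ENNReal.ofReal b))⁻¹ :=
        Finset.sum_le_sum fun x _ => hmarkov x
    _ = _ := by rw [Finset.sum_const, nsmul_eq_mul, Finset.card_univ, Fintype.card_coe]

/-- Eigenvectors are small near the root if the Green function of the first generations decays. -/
lemma norm_eigenvector_tree_le {κ K d R q r₀ : ℕ} (hK : 0 < K) (hκ' : κ ≤ K + 1) (hq : 0 < q)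
    (h : d ≤ R) (hr₀ : r₀ < d) {lam E₀ E b : ℝ} {v : treeFinset κ K R → ℝ}
    (hv : GreenDecay κ K d lam E₀ q b fun x => v (treeIncl h x)) {ψ : treeFinset κ K R → ℂ}
    (hψ1 : ∀ x, ‖ψ x‖ ≤ 1) (hψ : (treeHam κ K R lam v).mulVec ψ = (E : ℂ) • ψ)
    (hE : |E - E₀| * b ≤ 1 / 2) (x : treeFinset κ K R) (hx : x.1.1 ≤ r₀) :
    ‖ψ x‖ ≤ 2 * b * ((K + 2) / (q : ℝ) ^ (2 * (d - 1))) * (q : ℝ) ^ (2 * r₀) := by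
  classical
  have hq1 : (1 : ℝ) ≤ q := by exact_mod_cast hq
  have hq0 : (0 : ℝ) < q := by positivity
  have hG : green (treeHop κ K d) lam (fun x => v (treeIncl h x)) E₀
      * ((treeHam κ K R lam v).submatrix (treeIncl h) (treeIncl h) - (E₀ : ℂ) • 1) = 1 := by
    rw [treeHam_submatrix_treeIncl]
    exact Matrix.nonsing_inv_mul _ hv.1
  have hmap : Finset.univ.map ⟨treeIncl h, treeIncl_injective h⟩
      = Finset.univ.filter fun z : treeFinset κ K R => z.1.1 < d := by
    ext z
    simp only [Finset.mem_map, Finset.mem_univ, true_and, Finset.mem_filter,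
      Function.Embedding.coeFn_mk]
    constructor
    · rintro ⟨a, rfl⟩; exact (mem_treeFinset.mp a.2).1
    · intro hz
      exact ⟨⟨z.1, mem_treeFinset.mpr ⟨hz, (mem_treeFinset.mp z.2).2⟩⟩, rfl⟩
  -- The operator on the first `d` generations differs from the full one only by the edges out of
  -- generation `d - 1`. There `ψ` is bounded by one, and division by the weight of that generation
  -- produces the small factor.
  have hζ : ∀ y : treeFinset κ K d, ‖∑ a, treeHam κ K R lam v (treeIncl h y) (treeIncl h a)
      * ψ (treeIncl h a) - (treeHam κ K R lam v).mulVec ψ (treeIncl h y)‖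
      ≤ (K + 2) / (q : ℝ) ^ (2 * (d - 1)) * (q : ℝ) ^ (2 * y.1.1) := by
    intro y
    have h1 : ∑ a, treeHam κ K R lam v (treeIncl h y) (treeIncl h a) * ψ (treeIncl h a)
        = ∑ z with z.1.1 < d, treeHam κ K R lam v (treeIncl h y) z * ψ z := by
      rw [← hmap, Finset.sum_map]; rfl
    have h2 : (treeHam κ K R lam v).mulVec ψ (treeIncl h y)
        = ∑ z, treeHam κ K R lam v (treeIncl h y) z * ψ z := rfl
    rw [h1, h2, ← Finset.sum_filter_add_sum_filter_not Finset.univ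
      (fun z : treeFinset κ K R => z.1.1 < d), sub_add_cancel_left, norm_neg]
    have hyd := (mem_treeFinset.mp y.2).1
    have hne : ∀ z : treeFinset κ K R, ¬ z.1.1 < d → treeIncl h y ≠ z := by
      rintro z hz rfl; exact hz hyd
    by_cases hlast : y.1.1 + 1 < d
    · rw [Finset.sum_eq_zero, norm_zero]
      · positivity
      · intro z hz
        have hz' := (Finset.mem_filter.mp hz).2
        rw [treeHam_apply_of_ne (hne z hz')]
        by_contra hcon
        rcases treeHop_ne_zero (left_ne_zero_of_mul hcon) with hc | hc
        · have h3 : z.1.1 = y.1.1 + 1 := hc.1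
          omega
        · have h3 : y.1.1 = z.1.1 + 1 := hc.1
          omega
    · have hyeq : y.1.1 = d - 1 := by omega
      rw [hyeq, div_mul_cancel₀ _ (by positivity)]
      calc ‖∑ z with ¬ z.1.1 < d, treeHam κ K R lam v (treeIncl h y) z * ψ z‖
          ≤ ∑ z with ¬ z.1.1 < d, ‖treeHop κ K R (treeIncl h y) z‖ := by
            refine norm_sum_le_of_le _ fun z hz => ?_
            rw [treeHam_apply_of_ne (hne z (Finset.mem_filter.mp hz).2), norm_mul]
            exact mul_le_of_le_one_right (norm_nonneg _) (hψ1 z)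
        _ ≤ ∑ z, ‖treeHop κ K R (treeIncl h y) z‖ :=
            Finset.sum_le_sum_of_subset_of_nonneg (Finset.filter_subset _ _)
              fun _ _ _ => norm_nonneg _
        _ ≤ K + 2 := sum_norm_treeHop_le hκ' hK _
  have hmain := norm_eigenvector_le hG (fun x => by positivity) hv.2 hψ hζ hE
    ⟨x.1, mem_treeFinset.mpr ⟨by omega, (mem_treeFinset.mp x.2).2⟩⟩
  have hb0 : 0 ≤ b := by
    have h1 := (Finset.sum_nonneg fun y _ => by positivity).trans (hv.2
      ⟨x.1, mem_treeFinset.mpr ⟨by omega, (mem_treeFinset.mp x.2).2⟩⟩)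
    exact nonneg_of_mul_nonneg_left h1 (by positivity)
  refine hmain.trans (mul_le_mul_of_nonneg_left ?_ (by positivity))
  exact pow_le_pow_right₀ hq1 (by dsimp only; omega)

end TreeGreen

/-! ### Eigenvalue counting functions of a tree and of its subtrees -/

section TreeCount

set_option linter.unusedSectionVars false

lemma mulVec_eigenvectorUnitary {V : Type*} [Fintype V] [DecidableEq V] {H : Matrix V V ℂ}
    (hH : H.IsHermitian) (i : V) :
    H.mulVec (fun x => (hH.eigenvectorUnitary : Matrix V V ℂ) x i)
      = (hH.eigenvalues i : ℂ) • fun x => (hH.eigenvectorUnitary : Matrix V V ℂ) x i := by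
  have h := hH.mulVec_eigenvectorBasis i
  rw [RCLike.real_smul_eq_coe_smul (K := ℂ)] at h
  exact h

lemma sum_norm_offBlock_treeHam_le {κ K R : ℕ} {J : Type*} (hκ' : κ ≤ K + 1) (hK : 0 < K)
    (lam : ℝ) (v : treeFinset κ K R → ℝ) (τ : treeFinset κ K R → J) (x : treeFinset κ K R) :
    ∑ y, ‖offBlock (treeHam κ K R lam v) τ x y‖ ≤ K + 2 := by
  refine (Finset.sum_le_sum fun y _ => ?_).trans (sum_norm_treeHop_le hκ' hK x)
  rw [offBlock, Matrix.of_apply]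
  split_ifs with h
  · rw [norm_zero]; exact norm_nonneg _
  · rw [treeHam_apply_of_ne fun h' => h (congrArg τ h')]

/-- The restriction of a potential to the subtree number `j`. -/
def subtreePotential {κ K r₀ R' : ℕ} (hr₀ : 1 ≤ r₀) (v : treeFinset κ K (r₀ + R') → ℝ)
    (j : Fin (genCard κ K r₀)) (x : treeFinset K K R') : ℝ :=
  v ⟨subtreeVertex K r₀ j x, subtreeVertex_mem hr₀ j x.2⟩

lemma eigCount_partBlock_some {κ K r₀ R' : ℕ} (hr₀ : 1 ≤ r₀) (hK : 0 < K) (lam : ℝ)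
    (v : treeFinset κ K (r₀ + R') → ℝ) (j : Fin (genCard κ K r₀)) (B : Set ℝ) :
    eigCount (partBlock (treeHam κ K (r₀ + R') lam v) treePart (some j)) B
      = eigCount (treeHam K K R' lam (subtreePotential hr₀ v j)) B := by
  rw [← eigCount_submatrix (e := subtreeEquiv hr₀ hK j), partBlock_submatrix_subtreeEquiv]
  rfl

/-- The eigenvalues of a tree are close to those of the subtrees. -/
lemma eigCount_treeHam_le {κ K d q r₀ R' : ℕ} (hK : 0 < K) (hκ' : κ ≤ K + 1) (hq : 0 < q)
    (hr₀ : 1 ≤ r₀) (h : d ≤ r₀ + R') (hd : r₀ < d) {lam E₀ b : ℝ} (hb : 0 ≤ b)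
    {v : treeFinset κ K (r₀ + R') → ℝ}
    (hv : GreenDecay κ K d lam E₀ q b fun x => v (treeIncl h x)) {B : Set ℝ} {c r : ℝ} (hr : 0 ≤ r)
    (hB : B ⊆ Set.Icc (c - r) (c + r)) (hE : ∀ e ∈ B, |e - E₀| * b ≤ 1 / 2) {δ : ℝ}
    (hδ : (K + 2) * ((treeFinset κ K (r₀ + R')).card *
      (2 * b * ((K + 2) / (q : ℝ) ^ (2 * (d - 1))) * (q : ℝ) ^ (2 * r₀))) ≤ δ) :
    eigCount (treeHam κ K (r₀ + R') lam v) B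
      ≤ eigCount (treeHam κ K r₀ lam fun x => v (treeIncl (Nat.le_add_right _ _) x))
          (Set.Icc (c - (r + δ)) (c + (r + δ)))
        + ∑ j, eigCount (treeHam K K R' lam (subtreePotential hr₀ v j))
          (Set.Icc (c - (r + δ)) (c + (r + δ))) := by
  have hH := treeHam_isHermitian κ K (r₀ + R') lam v
  have h1 := eigCount_le_sum_partBlock hH
    (treePart : _ → Option (Fin (genCard κ K r₀))) {y | y.1.1 ≤ r₀}
    (fun x y hxy => level_of_offBlock_ne_zero hr₀ lam v hxy) (by positivity)
    (sum_norm_offBlock_treeHam_le hκ' hK lam v _) hr hB (by positivity)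
    (fun i hi x hx => norm_eigenvector_tree_le hK hκ' hq h hd hv
      (fun y => entry_norm_bound_of_unitary hH.eigenvectorUnitary.2 y i)
      (mulVec_eigenvectorUnitary hH i) (hE _ hi) x hx)
    (m := (treeFinset κ K (r₀ + R')).card) (by rw [Fintype.card_coe])
  have hsub : Set.Icc (c - (r + (K + 2) * ((treeFinset κ K (r₀ + R')).card *
      (2 * b * ((K + 2) / (q : ℝ) ^ (2 * (d - 1))) * (q : ℝ) ^ (2 * r₀)))))
      (c + (r + (K + 2) * ((treeFinset κ K (r₀ + R')).card *
      (2 * b * ((K + 2) / (q : ℝ) ^ (2 * (d - 1))) * (q : ℝ) ^ (2 * r₀)))))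
      ⊆ Set.Icc (c - (r + δ)) (c + (r + δ)) := Set.Icc_subset_Icc (by linarith) (by linarith)
  refine h1.trans ((Finset.sum_le_sum fun j _ => eigCount_mono _ hsub).trans ?_)
  rw [Fintype.sum_option]
  refine add_le_add (le_of_eq ?_) (Finset.sum_le_sum fun j _ => ?_)
  · rw [← partBlock_submatrix_topEquiv hr₀, eigCount_submatrix]
  · rw [eigCount_partBlock_some hr₀ hK]

/-- The eigenvalues of the subtrees are close to eigenvalues of the tree. -/
lemma sum_eigCount_subtree_le {κ K d q r₀ R' : ℕ} (hK : 0 < K) (hκ' : κ ≤ K + 1) (hq : 0 < q)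
    (hr₀ : 1 ≤ r₀) (h : d ≤ R') (hd : 0 < d) {lam E₀ b : ℝ} (hb : 0 ≤ b)
    {v : treeFinset κ K (r₀ + R') → ℝ} {B : Fin (genCard κ K r₀) → Set ℝ}
    (hv : ∀ j, (B j).Nonempty →
      GreenDecay K K d lam E₀ q b fun x => subtreePotential hr₀ v j (treeIncl h x))
    {c r : ℝ} (hr : 0 ≤ r) (hB : ∀ j, B j ⊆ Set.Icc (c - r) (c + r))
    (hE : ∀ j, ∀ e ∈ B j, |e - E₀| * b ≤ 1 / 2) {δ : ℝ}
    (hδ : (K + 2) * ((treeFinset K K R').card *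
      (2 * b * ((K + 2) / (q : ℝ) ^ (2 * (d - 1))))) ≤ δ) :
    ∑ j, eigCount (treeHam K K R' lam (subtreePotential hr₀ v j)) (B j)
      ≤ eigCount (treeHam κ K (r₀ + R') lam v) (Set.Icc (c - (r + δ)) (c + (r + δ))) := by
  have hH := treeHam_isHermitian κ K (r₀ + R') lam v
  let τ : treeFinset κ K (r₀ + R') → Option (Fin (genCard κ K r₀)) := treePart
  -- The top part gets an empty window: its eigenvalues are not counted, so no decay and no bound on
  -- its size are needed.
  let B' : Option (Fin (genCard κ K r₀)) → Set ℝ := fun o => o.elim ∅ B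
  have h1 := sum_partBlock_le_eigCount hH τ {y | y.1.1 ≤ r₀}
    (fun x y hxy => level_of_offBlock_ne_zero hr₀ lam v hxy) (by positivity)
    (sum_norm_offBlock_treeHam_le hκ' hK lam v τ) (B := B') hr
    (fun o => by cases o with
      | none => exact Set.empty_subset _
      | some j => exact hB j)
    (ε := 2 * b * ((K + 2) / (q : ℝ) ^ (2 * (d - 1)))) (by positivity)
    (m := (treeFinset K K R').card) (by positivity) ?_ ?_
  · have hsub : Set.Icc (c - (r + (K + 2) * ((treeFinset K K R').card *
        (2 * b * ((K + 2) / (q : ℝ) ^ (2 * (d - 1)))))))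
        (c + (r + (K + 2) * ((treeFinset K K R').card *
        (2 * b * ((K + 2) / (q : ℝ) ^ (2 * (d - 1)))))))
        ⊆ Set.Icc (c - (r + δ)) (c + (r + δ)) := Set.Icc_subset_Icc (by linarith) (by linarith)
    refine le_trans ?_ (h1.trans (eigCount_mono _ hsub))
    rw [Fintype.sum_option]
    refine le_add_left (Finset.sum_le_sum fun j _ => ?_)
    exact (eigCount_partBlock_some hr₀ hK lam v j (B j)).ge
  · intro o i hi x hx
    cases o with
    | none => exact absurd hi (Set.notMem_empty _)
    | some j =>
      have hP := partBlock_isHermitian hH τ (some j)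
      let e : treeFinset K K R' ≃ {x // τ x = some j} := subtreeEquiv hr₀ hK j
      let ψ : treeFinset K K R' → ℂ := fun y => (hP.eigenvectorUnitary : Matrix _ _ ℂ) (e y) i
      have hψ : (treeHam K K R' lam (subtreePotential hr₀ v j)).mulVec ψ
          = (hP.eigenvalues i : ℂ) • ψ := by
        have h2 : treeHam K K R' lam (subtreePotential hr₀ v j)
          = (partBlock (treeHam κ K (r₀ + R') lam v) τ (some j)).submatrix e e :=
            (partBlock_submatrix_subtreeEquiv hr₀ hK j lam v).symm
        rw [h2]
        have h3 := mulVec_eigenvectorUnitary hP i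
        funext y
        rw [Matrix.submatrix_mulVec_equiv]
        have h4 : ψ ∘ e.symm = fun x => (hP.eigenvectorUnitary : Matrix _ _ ℂ) x i := by
          funext z; simp [ψ]
        rw [Function.comp_apply, h4, h3]
        rfl
      have h5 := norm_eigenvector_tree_le hK (by omega : K ≤ K + 1) hq h hd
        (hv j ⟨_, hi⟩) (fun y => entry_norm_bound_of_unitary hP.eigenvectorUnitary.2 (e y) i) hψ
        (hE j _ hi) (e.symm x) (by
          have h6 : (x.1 : ℕ × ℕ).1 ≤ r₀ := hx
          change x.1.1.1 - r₀ ≤ 0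
          omega)
      simpa [ψ] using h5
  · intro o ho
    cases o with
    | none => exact absurd ho Set.not_nonempty_empty
    | some j =>
      rw [← Fintype.card_congr (subtreeEquiv hr₀ hK j), Fintype.card_coe]

end TreeCount

/-! ### Bounded operators on `ℓ²` given by a kernel -/

section KernelOperator

set_option linter.unusedSectionVars false

variable {V : Type*}

/-- The kernel of a bounded self-adjoint operator with finitely many entries in each row. -/
structure IsBoundedKernel (k : V → V → ℂ) (D : ℝ) : Prop where
  symm : ∀ x y, star (k y x) = k x y
  finite : ∀ x, {y | k x y ≠ 0}.Finite
  sum_le : ∀ x (s : Finset V), ∑ y ∈ s, ‖k x y‖ ≤ D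

open Classical in
/-- Powers of a kernel. -/
def kerPow (k : V → V → ℂ) : ℕ → V → V → ℂ
  | 0 => fun x y => if x = y then 1 else 0
  | q + 1 => fun x y => ∑' z, k x z * kerPow k q z y

lemma kerPow_succ (k : V → V → ℂ) (q : ℕ) (x y : V) :
    kerPow k (q + 1) x y = ∑' z, k x z * kerPow k q z y := rfl

lemma kerPow_comp_equiv (k : V → V → ℂ) (e : V ≃ V) (q : ℕ) (x y : V) :
    kerPow (fun x y => k (e x) (e y)) q x y = kerPow k q (e x) (e y) := by
  induction q generalizing x with
  | zero =>
    simp only [kerPow]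
    by_cases h : x = y
    · rw [if_pos h, if_pos (congrArg e h)]
    · rw [if_neg h, if_neg (mt (fun h' => e.injective h') h)]
  | succ q ih =>
    simp only [kerPow, ih]
    exact e.tsum_eq fun z => k (e x) z * kerPow k q z (e y)

namespace IsBoundedKernel

variable {k : V → V → ℂ} {D : ℝ} (hk : IsBoundedKernel k D)

include hk

lemma norm_symm (x y : V) : ‖k y x‖ = ‖k x y‖ := by rw [← hk.symm x y, norm_star]

lemma tsum_eq (φ : V → ℂ) (x : V) :
    ∑' y, k x y * φ y = ∑ y ∈ (hk.finite x).toFinset, k x y * φ y :=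
  tsum_eq_sum fun y hy => by
    rw [Set.Finite.mem_toFinset] at hy
    rw [not_not.mp hy, zero_mul]

lemma nonneg (x : V) : 0 ≤ D := by simpa using hk.sum_le x ∅

lemma norm_tsum_sq_le (φ : V → ℂ) (x : V) :
    ‖∑' y, k x y * φ y‖ ^ 2 ≤ D * ∑ y ∈ (hk.finite x).toFinset, ‖k x y‖ * ‖φ y‖ ^ 2 := by
  rw [hk.tsum_eq]
  have h1 : ‖∑ y ∈ (hk.finite x).toFinset, k x y * φ y‖
      ≤ ∑ y ∈ (hk.finite x).toFinset, ‖k x y‖ * ‖φ y‖ :=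
    norm_sum_le_of_le _ fun y _ => (norm_mul _ _).le
  have h2 := Finset.sum_sq_le_sum_mul_sum_of_sq_le_mul (hk.finite x).toFinset
    (r := fun y => ‖k x y‖ * ‖φ y‖) (f := fun y => ‖k x y‖) (g := fun y => ‖k x y‖ * ‖φ y‖ ^ 2)
    (fun y _ => norm_nonneg _) (fun y _ => by positivity) (fun y _ => le_of_eq (by ring))
  calc _ ≤ (∑ y ∈ (hk.finite x).toFinset, ‖k x y‖ * ‖φ y‖) ^ 2 := by gcongr
    _ ≤ _ := h2
    _ ≤ _ := by
      refine mul_le_mul_of_nonneg_right (hk.sum_le x _) (Finset.sum_nonneg fun y _ => by positivity)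

/-- Schur's test for an infinite symmetric kernel, on finite sets of rows. It gives both existence
and boundedness of the operator. -/
lemma sum_norm_tsum_sq_le (ψ : lp (fun _ : V => ℂ) 2) (s : Finset V) :
    ∑ x ∈ s, ‖∑' y, k x y * ψ y‖ ^ 2 ≤ (D * ‖ψ‖) ^ 2 := by
  classical
  rcases s.eq_empty_or_nonempty with rfl | ⟨x₀, -⟩
  · rw [Finset.sum_empty]; positivity
  have hD := hk.nonneg x₀
  set S := s.biUnion fun x => (hk.finite x).toFinset with hS
  have h1 : ∀ x ∈ s, ‖∑' y, k x y * ψ y‖ ^ 2 ≤ D * ∑ y ∈ S, ‖k x y‖ * ‖ψ y‖ ^ 2 := by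
    intro x hx
    refine (hk.norm_tsum_sq_le _ x).trans (mul_le_mul_of_nonneg_left ?_ hD)
    exact Finset.sum_le_sum_of_subset_of_nonneg
      (Finset.subset_biUnion_of_mem (fun x => (hk.finite x).toFinset) hx)
      fun y _ _ => by positivity
  refine (Finset.sum_le_sum h1).trans ?_
  rw [← Finset.mul_sum, Finset.sum_comm]
  have h2 : ∀ y ∈ S, ∑ x ∈ s, ‖k x y‖ * ‖ψ y‖ ^ 2 ≤ D * ‖ψ y‖ ^ 2 := by
    intro y _
    rw [← Finset.sum_mul]
    refine mul_le_mul_of_nonneg_right ?_ (by positivity)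
    simp only [hk.norm_symm y]
    exact hk.sum_le y s
  have h3 : ∑ y ∈ S, ‖ψ y‖ ^ 2 ≤ ‖ψ‖ ^ 2 := by
    have := lp.sum_rpow_le_norm_rpow (p := 2) (by norm_num) ψ S
    simpa using this
  calc D * ∑ y ∈ S, ∑ x ∈ s, ‖k x y‖ * ‖ψ y‖ ^ 2 ≤ D * (D * ‖ψ‖ ^ 2) := by
        gcongr
        refine (Finset.sum_le_sum h2).trans ?_
        rw [← Finset.mul_sum]
        gcongr
    _ = _ := by ring

/-- A bounded kernel defines a bounded operator. -/
lemma exists_operator : ∃ A : lp (fun _ : V => ℂ) 2 →L[ℂ] lp (fun _ : V => ℂ) 2,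
    ∀ (ψ : lp (fun _ : V => ℂ) 2) (x : V), A ψ x = ∑' y, k x y * ψ y := by
  have hmem : ∀ ψ : lp (fun _ : V => ℂ) 2, Memℓp (fun x => ∑' y, k x y * ψ y) 2 := by
    intro ψ
    refine memℓp_gen' (C := (D * ‖ψ‖) ^ 2) fun s => ?_
    simpa using hk.sum_norm_tsum_sq_le ψ s
  let L : lp (fun _ : V => ℂ) 2 →ₗ[ℂ] lp (fun _ : V => ℂ) 2 :=
    { toFun := fun ψ => ⟨fun x => ∑' y, k x y * ψ y, hmem ψ⟩
      map_add' := fun φ ψ => by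
        refine lp.ext (funext fun x => ?_)
        change ∑' y, k x y * (φ + ψ) y = ∑' y, k x y * φ y + ∑' y, k x y * ψ y
        rw [hk.tsum_eq, hk.tsum_eq, hk.tsum_eq, ← Finset.sum_add_distrib]
        exact Finset.sum_congr rfl fun y _ => by rw [lp.coeFn_add, Pi.add_apply, mul_add]
      map_smul' := fun c ψ => by
        refine lp.ext (funext fun x => ?_)
        change ∑' y, k x y * (c • ψ) y = c * ∑' y, k x y * ψ y
        rw [hk.tsum_eq, hk.tsum_eq, Finset.mul_sum]
        refine Finset.sum_congr rfl fun y _ => ?_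
        rw [lp.coeFn_smul, Pi.smul_apply, smul_eq_mul]
        ring }
  refine ⟨L.mkContinuous |D| fun ψ => ?_, fun ψ x => rfl⟩
  refine lp.norm_le_of_forall_sum_le (p := 2) (by norm_num) (by positivity) fun s => ?_
  have h := hk.sum_norm_tsum_sq_le ψ s
  rw [← sq_abs, abs_mul, abs_norm] at h
  simpa [L] using h

end IsBoundedKernel

section Operator

variable {k : V → V → ℂ} {D : ℝ} {A : lp (fun _ : V => ℂ) 2 →L[ℂ] lp (fun _ : V => ℂ) 2}

lemma norm_le_of_kernel (hk : IsBoundedKernel k D) (hD : 0 ≤ D)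
    (hA : ∀ (ψ : lp (fun _ : V => ℂ) 2) (x : V), A ψ x = ∑' y, k x y * ψ y) : ‖A‖ ≤ D := by
  refine A.opNorm_le_bound hD fun ψ => ?_
  refine lp.norm_le_of_forall_sum_le (p := 2) (by norm_num) (by positivity) fun s => ?_
  simp only [hA]
  simpa using hk.sum_norm_tsum_sq_le ψ s

variable [DecidableEq V]

lemma apply_single_of_kernel
    (hA : ∀ (ψ : lp (fun _ : V => ℂ) 2) (x : V), A ψ x = ∑' y, k x y * ψ y) (x y : V) :
    A (lp.single 2 y 1) x = k x y := by
  rw [hA, tsum_eq_single y]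
  · rw [lp.single_apply_self, mul_one]
  · intro z hz
    rw [lp.single_apply_ne 2 y _ hz, mul_zero]

lemma isSelfAdjoint_of_kernel (hk : IsBoundedKernel k D)
    (hA : ∀ (ψ : lp (fun _ : V => ℂ) 2) (x : V), A ψ x = ∑' y, k x y * ψ y) :
    IsSelfAdjoint A := by
  rw [ContinuousLinearMap.isSelfAdjoint_iff']
  ext ψ x
  have h1 : ContinuousLinearMap.adjoint A ψ x
      = inner ℂ (lp.single 2 x (1 : ℂ)) (ContinuousLinearMap.adjoint A ψ) := by
    rw [lp.inner_single_left]; simp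
  rw [h1, ContinuousLinearMap.adjoint_inner_right, lp.inner_eq_tsum, hA]
  refine tsum_congr fun y => ?_
  rw [apply_single_of_kernel hA, ← hk.symm x y, RCLike.inner_apply, mul_comm]
  rfl

lemma pow_apply_single_of_kernel
    (hA : ∀ (ψ : lp (fun _ : V => ℂ) 2) (x : V), A ψ x = ∑' y, k x y * ψ y) (q : ℕ) (x y : V) :
    (A ^ q) (lp.single 2 y 1) x = kerPow k q x y := by
  induction q generalizing x with
  | zero =>
    rw [pow_zero, one_apply_eq_self, lp.single_apply, Pi.single_apply]
    simp only [kerPow]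
    congr
  | succ q ih =>
    rw [pow_succ', mul_apply_eq_comp, hA, kerPow]
    simp only [ih]

lemma inner_pow_single_of_kernel
    (hA : ∀ (ψ : lp (fun _ : V => ℂ) 2) (x : V), A ψ x = ∑' y, k x y * ψ y) (q : ℕ) (x : V) :
    inner ℂ (lp.single 2 x (1 : ℂ)) ((A ^ q) (lp.single 2 x 1)) = kerPow k q x x := by
  rw [lp.inner_single_left, pow_apply_single_of_kernel hA]
  simp

/-- Diagonal entries of powers are bounded through the norm of the operator that the kernel defines.
-/
lemma norm_kerPow_le (hk : IsBoundedKernel k D) (q : ℕ) (x : V) : ‖kerPow k q x x‖ ≤ D ^ q := by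
  obtain ⟨A, hA⟩ := hk.exists_operator
  have hD := hk.nonneg x
  rw [← inner_pow_single_of_kernel hA]
  refine (norm_inner_le_norm _ _).trans ?_
  have h1 : ‖(lp.single 2 x (1 : ℂ) : lp (fun _ : V => ℂ) 2)‖ = 1 := by
    rw [lp.norm_single (by norm_num), norm_one]
  rw [h1, one_mul]
  have h2 : ∀ ψ : lp (fun _ : V => ℂ) 2, ‖(A ^ q) ψ‖ ≤ D ^ q * ‖ψ‖ := by
    intro ψ
    induction q with
    | zero => simp
    | succ q ih =>
      rw [pow_succ', mul_apply_eq_comp, pow_succ', mul_assoc]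
      exact (A.le_of_opNorm_le (norm_le_of_kernel hk hD hA) _).trans
        (mul_le_mul_of_nonneg_left ih hD)
  simpa [h1] using h2 (lp.single 2 x 1)

/-- Polynomials of a kernel, on the diagonal. -/
def kerPoly (k : V → V → ℂ) (P : Polynomial ℝ) (x : V) : ℝ :=
  ∑ q ∈ Finset.range (P.natDegree + 1), P.coeff q * (kerPow k q x x).re

end Operator

end KernelOperator

/-! ### Spectral functionals and polynomials -/

section SpectralMeasure

variable {H : Type*} [NormedAddCommGroup H] [InnerProductSpace ℂ H] [CompleteSpace H]

lemma spectrum_subset_of_norm_le {A : H →L[ℂ] H} {D : ℝ} (hD : ‖A‖ ≤ D) {x : ℝ}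
    (hx : x ∈ spectrum ℝ A) : x ∈ Set.Icc (-D) D := by
  have h1 := spectrum.norm_le_norm_mul_of_mem hx
  have h2 : ‖(1 : H →L[ℂ] H)‖ ≤ 1 := ContinuousLinearMap.norm_id_le
  rw [Set.mem_Icc, ← abs_le, ← Real.norm_eq_abs]
  exact h1.trans ((mul_le_of_le_one_right (norm_nonneg _) h2).trans hD)

lemma spectralFunctional_apply (A : H →L[ℂ] H) (ψ : H) (f : CompactlySupportedContinuousMap ℝ ℝ) :
    spectralFunctional A ψ f = (inner ℂ ψ (cfc (fun x : ℝ => f x) A ψ)).re := rfl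

/-- The spectrum lies in `[-D, D]`, so uniform approximation there by a polynomial passes through
the functional calculus. Spectral measures are thereby accessible through moments, that is, through
finite sums over paths. -/
lemma abs_spectralFunctional_sub_le {A : H →L[ℂ] H} (hA : IsSelfAdjoint A) {D : ℝ} (hD : ‖A‖ ≤ D)
    {ψ : H} (hψ : ‖ψ‖ = 1) (f : CompactlySupportedContinuousMap ℝ ℝ) (P : Polynomial ℝ) {ε : ℝ}
    (hε : 0 ≤ ε) (h : ∀ x ∈ Set.Icc (-D) D, |f x - P.eval x| ≤ ε) :
    |spectralFunctional A ψ f - ∑ q ∈ Finset.range (P.natDegree + 1),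
      P.coeff q * (inner ℂ ψ ((A ^ q) ψ)).re| ≤ ε := by
  have hf : ContinuousOn (fun x : ℝ => f x) (spectrum ℝ A) := f.continuous.continuousOn
  have hP : ContinuousOn (fun x : ℝ => P.eval x) (spectrum ℝ A) := P.continuous.continuousOn
  have hsum : (inner ℂ ψ (Polynomial.aeval A P ψ)).re = ∑ q ∈ Finset.range (P.natDegree + 1),
      P.coeff q * (inner ℂ ψ ((A ^ q) ψ)).re := by
    rw [Polynomial.aeval_eq_sum_range, sum_apply, inner_sum, Complex.re_sum]
    refine Finset.sum_congr rfl fun q _ => ?_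
    rw [smul_apply, inner_smul_right_eq_smul, Complex.smul_re, smul_eq_mul]
  rw [← hsum, spectralFunctional_apply, ← cfc_polynomial P A, ← Complex.sub_re, ← inner_sub_right,
    ← sub_apply, ← cfc_sub (fun x : ℝ => f x) (fun x => P.eval x) A hf hP]
  refine (Complex.abs_re_le_norm _).trans ((norm_inner_le_norm _ _).trans ?_)
  rw [hψ, one_mul]
  refine (ContinuousLinearMap.le_opNorm _ _).trans ?_
  rw [hψ, mul_one]
  exact norm_cfc_le hε fun x hx => h x (spectrum_subset_of_norm_le hD hx)

end SpectralMeasure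

/-! ### The canopy tree -/

section Canopy

variable {K m₀ : ℕ}

/-- The vertex `t` layers above `x` on the way from `x` to infinity. -/
def canopyAncestor (K : ℕ) (x : CanopyVertex) (t : ℕ) : CanopyVertex := (x.1 + t, x.2 / K ^ t)

lemma canopyAncestor_succ (x : CanopyVertex) (t : ℕ) :
    canopyAncestor K x (t + 1) = canopyAncestor K (x.1 + 1, x.2 / K) t := by
  rw [canopyAncestor, canopyAncestor, pow_succ', Nat.div_div_eq_div_mul]
  exact Prod.ext (by dsimp only; omega) rfl

lemma canopy_exists_walk (x : CanopyVertex) (t : ℕ) :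
    ∃ w : (canopyGraph K).Walk x (canopyAncestor K x t), w.length = t := by
  induction t generalizing x with
  | zero =>
    have h : canopyAncestor K x 0 = x := by simp [canopyAncestor]
    rw [h]
    exact ⟨.nil, rfl⟩
  | succ t ih =>
    obtain ⟨w, hw⟩ := ih (x.1 + 1, x.2 / K)
    rw [canopyAncestor_succ]
    have h : (canopyGraph K).Adj x (x.1 + 1, x.2 / K) := Or.inl ⟨rfl, rfl⟩
    exact ⟨.cons h w, by rw [SimpleGraph.Walk.length_cons, hw]⟩

/-- Each step changes the layer by one, so a walk rises by its full length only if every step goes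
to the parent. -/
lemma canopy_level_le {x y : CanopyVertex} (w : (canopyGraph K).Walk x y) :
    y.1 ≤ x.1 + w.length ∧ (y.1 = x.1 + w.length → y = canopyAncestor K x w.length) := by
  induction w with
  | nil => simp [canopyAncestor]
  | @cons u v z h p ih =>
    rw [SimpleGraph.Walk.length_cons]
    rcases h with h | h
    · refine ⟨by omega, fun hz => ?_⟩
      rw [canopyAncestor_succ, show (u.1 + 1, u.2 / K) = v from (Prod.ext h.1 h.2).symm]
      exact ih.2 (by omega)
    · exact ⟨by omega, fun hz => by omega⟩

/-- After enough steps upwards the position number is divided down to `0`, so two vertices have a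
common ancestor. -/
lemma canopy_reachable (hK : 2 ≤ K) (x y : CanopyVertex) : (canopyGraph K).Reachable x y := by
  have h1 : ∀ z : CanopyVertex, ∀ t, z.2 ≤ t → canopyAncestor K z t = (z.1 + t, 0) := by
    intro z t ht
    rw [canopyAncestor, Nat.div_eq_of_lt]
    exact ht.trans_lt (Nat.lt_pow_self (by omega))
  have h2 : canopyAncestor K x (y.1 + x.2 + y.2) = canopyAncestor K y (x.1 + x.2 + y.2) := by
    rw [h1 _ _ (by omega), h1 _ _ (by omega)]
    exact Prod.ext (by dsimp only; omega) rfl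
  obtain ⟨w1, -⟩ := canopy_exists_walk (K := K) x (y.1 + x.2 + y.2)
  obtain ⟨w2, -⟩ := canopy_exists_walk (K := K) y (x.1 + x.2 + y.2)
  rw [h2] at w1
  exact ⟨w1.append w2.reverse⟩

lemma canopy_dist_eq_iff (hK : 2 ≤ K) (x y : CanopyVertex) :
    y.1 = x.1 + (canopyGraph K).dist x y ↔ ∃ t, y = canopyAncestor K x t := by
  constructor
  · intro h
    obtain ⟨w, hw⟩ := (canopy_reachable hK x y).exists_walk_length_eq_dist
    exact ⟨_, (canopy_level_le w).2 (by rw [hw]; exact h)⟩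
  · rintro ⟨t, rfl⟩
    obtain ⟨w, hw⟩ := (canopy_reachable hK x (canopyAncestor K x t)).exists_walk_length_eq_dist
    obtain ⟨w', hw'⟩ := canopy_exists_walk (K := K) x t
    have h1 := (canopy_level_le w).1
    have h2 := SimpleGraph.dist_le w'
    simp only [canopyAncestor] at h1 h2 hw hw' ⊢
    omega

/-- The site whose random variable is the potential at `x`. -/
def canopySite (K m₀ : ℕ) (x : CanopyVertex) : canopySites m₀ :=
  ⟨canopyAncestor K x (m₀ - x.1 % (m₀ + 1)), x.1 / (m₀ + 1), by
    have h1 := Nat.div_add_mod x.1 (m₀ + 1)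
    have h2 : x.1 % (m₀ + 1) < m₀ + 1 := Nat.mod_lt _ (Nat.succ_pos m₀)
    rw [canopyAncestor]
    dsimp only
    omega⟩

/-- The condition on the distances says that `y` is an ancestor of `x` at most `m₀` layers above it.
The site layers are `m₀ + 1` apart, so exactly one ancestor qualifies. -/
lemma canopySite_iff (hK : 2 ≤ K) (x : CanopyVertex) (y : canopySites m₀) :
    ((canopyGraph K).dist y.1 x ≤ m₀ ∧ y.1.1 = x.1 + (canopyGraph K).dist x y.1)
      ↔ y = canopySite K m₀ x := by
  have h1 := Nat.div_add_mod x.1 (m₀ + 1)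
  have h2 : x.1 % (m₀ + 1) < m₀ + 1 := Nat.mod_lt _ (Nat.succ_pos m₀)
  rw [SimpleGraph.dist_comm]
  constructor
  · rintro ⟨hd, hy⟩
    obtain ⟨t, ht⟩ := (canopy_dist_eq_iff hK x y.1).mp hy
    obtain ⟨k, hk⟩ := y.2
    have h3 : y.1.1 = x.1 + t := by rw [ht]; rfl
    refine Subtype.ext ?_
    rw [ht, canopySite]
    congr 1
    have h4 : (m₀ + 1) * (x.1 / (m₀ + 1)) + x.1 % (m₀ + 1) + t = m₀ + (m₀ + 1) * k := by omega
    have h5 : k = x.1 / (m₀ + 1) := by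
      have e1 : (m₀ + 1) * (x.1 / (m₀ + 1) + 1) = (m₀ + 1) * (x.1 / (m₀ + 1)) + (m₀ + 1) := by ring
      have e2 : (m₀ + 1) * (k + 1) = (m₀ + 1) * k + (m₀ + 1) := by ring
      have h7 : (m₀ + 1) * k < (m₀ + 1) * (x.1 / (m₀ + 1) + 1) := by omega
      have h8 : (m₀ + 1) * (x.1 / (m₀ + 1)) < (m₀ + 1) * (k + 1) := by omega
      have h9 := Nat.lt_of_mul_lt_mul_left h7
      have h10 := Nat.lt_of_mul_lt_mul_left h8
      omega
    rw [← h5] at h4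
    omega
  · intro hy
    have h3 := (canopy_dist_eq_iff hK x y.1).mpr ⟨_, congrArg Subtype.val hy⟩
    refine ⟨?_, h3⟩
    have h4 : y.1.1 = x.1 + (m₀ - x.1 % (m₀ + 1)) := by rw [hy]; rfl
    omega

lemma canopyPotential_eq (hK : 2 ≤ K) (w : canopySites m₀ → ℝ) (x : CanopyVertex) :
    canopyPotential K m₀ w x = w (canopySite K m₀ x) := by
  classical
  rw [canopyPotential, finsum_eq_single _ (canopySite K m₀ x)]
  · rw [if_pos ((canopySite_iff hK x _).mpr rfl)]
  · intro y hy
    rw [if_neg fun h => hy ((canopySite_iff hK x y).mp h)]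

/-- The neighbours of a vertex. -/
def canopyNbr (K : ℕ) (x : CanopyVertex) : Finset CanopyVertex :=
  insert (x.1 + 1, x.2 / K) ((Finset.range K).image fun r => (x.1 - 1, K * x.2 + r))

lemma mem_canopyNbr (hK : 0 < K) {x y : CanopyVertex} (h : (canopyGraph K).Adj x y) :
    y ∈ canopyNbr K x := by
  rcases h with h | h
  · exact Finset.mem_insert.mpr (Or.inl (Prod.ext h.1 h.2))
  · refine Finset.mem_insert_of_mem (Finset.mem_image.mpr ⟨y.2 % K, ?_, ?_⟩)
    · exact Finset.mem_range.mpr (Nat.mod_lt _ hK)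
    · rw [h.2, Nat.div_add_mod, h.1]
      simp

open Classical in
lemma canopy_sum_adj_le (hK : 0 < K) (x : CanopyVertex) (s : Finset CanopyVertex) :
    ∑ y ∈ s, (if (canopyGraph K).Adj x y then (1 : ℝ) else 0) ≤ K + 1 := by
  rw [← Finset.sum_filter, Finset.sum_const, nsmul_eq_mul, mul_one]
  have h : s.filter (fun y => (canopyGraph K).Adj x y) ⊆ canopyNbr K x := fun y hy =>
    mem_canopyNbr hK (Finset.mem_filter.mp hy).2
  have h2 := (Finset.card_le_card h).trans ((Finset.card_insert_le _ _).trans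
    (Nat.add_le_add_right Finset.card_image_le 1))
  rw [Finset.card_range] at h2
  exact_mod_cast h2

lemma canopyKernel_ne_zero (hK : 0 < K) {lam : ℝ} {v : CanopyVertex → ℝ} {x y : CanopyVertex}
    (h : schrodingerKernel (canopyGraph K) lam v x y ≠ 0) : y ∈ insert x (canopyNbr K x) := by
  by_contra hcon
  rw [Finset.mem_insert, not_or] at hcon
  apply h
  rw [schrodingerKernel, if_neg fun h' => hcon.2 (mem_canopyNbr hK h'),
    if_neg fun h' => hcon.1 h'.symm, add_zero]

lemma isBoundedKernel_canopy (hK : 0 < K) (lam : ℝ) {v : CanopyVertex → ℝ} {W : ℝ}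
    (hv : ∀ x, |v x| ≤ W) :
    IsBoundedKernel (schrodingerKernel (canopyGraph K) lam v) (K + 1 + |lam| * W) := by
  classical
  have hle : ∀ x y, ‖schrodingerKernel (canopyGraph K) lam v x y‖
      ≤ (if (canopyGraph K).Adj x y then (1 : ℝ) else 0) + if x = y then |lam| * W else 0 := by
    intro x y
    refine (norm_add_le _ _).trans (add_le_add ?_ ?_)
    · split_ifs <;> simp
    · split_ifs
      · rw [Complex.norm_real, Real.norm_eq_abs, abs_mul]
        exact mul_le_mul_of_nonneg_left (hv x) (abs_nonneg _)
      · simp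
  refine ⟨schrodingerKernel_conj _ _ _, fun x => ?_, fun x s => ?_⟩
  · exact (insert x (canopyNbr K x)).finite_toSet.subset fun y hy => canopyKernel_ne_zero hK hy
  · refine (Finset.sum_le_sum fun y _ => hle x y).trans ?_
    rw [Finset.sum_add_distrib]
    refine add_le_add (canopy_sum_adj_le hK x s) ?_
    have hW : 0 ≤ |lam| * W := mul_nonneg (abs_nonneg _) ((abs_nonneg _).trans (hv x))
    rw [Finset.sum_ite_eq]
    split_ifs
    · exact le_rfl
    · exact hW

/-- A bounded kernel determines the operator on the canopy tree. -/
lemma canopyOperator_apply (hK : 2 ≤ K) (lam : ℝ) {w : canopySites m₀ → ℝ} {W : ℝ}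
    (hw : ∀ y, |w y| ≤ W) (ψ : CanopySpace) (x : CanopyVertex) :
    canopyOperator K m₀ lam w ψ x
      = ∑' y, schrodingerKernel (canopyGraph K) lam (fun z => w (canopySite K m₀ z)) x y * ψ y := by
  have h1 : canopyPotential K m₀ w = fun z => w (canopySite K m₀ z) :=
    funext fun z => canopyPotential_eq hK w z
  have h2 := (isBoundedKernel_canopy (K := K) (by omega) lam
    (v := fun z => w (canopySite K m₀ z)) fun z => hw _).exists_operator
  rw [← h1] at h2 ⊢
  rw [canopyOperator, dif_pos h2]
  exact h2.choose_spec ψ x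

/-! #### Symmetries -/

/-- Exchange of the subtrees below the vertices number `a` and `b` of the layer `N`. -/
def canopySwap (K N a b : ℕ) (x : CanopyVertex) : CanopyVertex :=
  if x.1 ≤ N then (x.1, Equiv.swap a b (x.2 / K ^ (N - x.1)) * K ^ (N - x.1)
    + x.2 % K ^ (N - x.1)) else x

lemma canopySwap_fst (N a b : ℕ) (x : CanopyVertex) : (canopySwap K N a b x).1 = x.1 := by
  unfold canopySwap
  split_ifs <;> rfl

lemma canopySwap_involutive (hK : 0 < K) (N a b : ℕ) :
    Function.Involutive (canopySwap K N a b) := by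
  intro x
  by_cases h : x.1 ≤ N
  · have hpos : 0 < K ^ (N - x.1) := Nat.pow_pos hK
    have hlt := Nat.mod_lt x.2 hpos
    have h1 : canopySwap K N a b x = (x.1, Equiv.swap a b (x.2 / K ^ (N - x.1)) * K ^ (N - x.1)
      + x.2 % K ^ (N - x.1)) := if_pos h
    rw [h1, canopySwap, if_pos h]
    refine Prod.ext rfl ?_
    dsimp only
    have e1 : ∀ c : ℕ, (c * K ^ (N - x.1) + x.2 % K ^ (N - x.1)) / K ^ (N - x.1) = c := fun c => by
      rw [mul_comm, Nat.mul_add_div hpos, Nat.div_eq_of_lt hlt, add_zero]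
    have e2 : ∀ c : ℕ, (c * K ^ (N - x.1) + x.2 % K ^ (N - x.1)) % K ^ (N - x.1)
        = x.2 % K ^ (N - x.1) := fun c => by
      rw [mul_comm, Nat.mul_add_mod, Nat.mod_mod]
    rw [e1, e2, Equiv.swap_apply_self, Nat.div_add_mod']
  · have h1 : canopySwap K N a b x = x := if_neg h
    rw [h1, h1]

/-- Since `a` and `b` are siblings, exchanging the subtrees below them fixes their parent; so the
exchange preserves the relation between parent and child. -/
lemma canopySwap_parent (hK : 0 < K) {N a b : ℕ} (hab : a / K = b / K) (x : CanopyVertex) :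
    canopySwap K N a b (x.1 + 1, x.2 / K)
      = ((canopySwap K N a b x).1 + 1, (canopySwap K N a b x).2 / K) := by
  unfold canopySwap
  rcases lt_trichotomy x.1 N with h | h | h
  · obtain ⟨t, ht⟩ : ∃ t, N - x.1 = t + 1 := ⟨N - x.1 - 1, by omega⟩
    have ht' : N - (x.1 + 1) = t := by omega
    rw [if_pos (by exact h), if_pos h.le]
    dsimp only
    rw [ht, ht', Nat.div_div_eq_div_mul, ← pow_succ', pow_succ', mul_left_comm,
      Nat.mul_add_div hK, Nat.mod_mul_right_div_self]
  · rw [if_neg (by dsimp only; omega), if_pos h.le]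
    have h1 : ∀ i : ℕ, Equiv.swap a b i / K = i / K := by
      intro i
      rw [Equiv.swap_apply_def]
      split_ifs with h1 h1
      · rw [h1, hab]
      · rw [h1, hab]
      · rfl
    simp [h, h1, Nat.mod_one]
  · rw [if_neg (by dsimp only; omega), if_neg (by omega)]

/-- The canopy tree is symmetric: its automorphisms act transitively on each layer. -/
lemma exists_canopy_automorphism (hK : 2 ≤ K) (n i i' : ℕ) :
    ∃ φ : CanopyVertex ≃ CanopyVertex, φ (n, i) = (n, i') ∧ (∀ x, (φ x).1 = x.1) ∧
      ∀ x : CanopyVertex, φ (x.1 + 1, x.2 / K) = ((φ x).1 + 1, (φ x).2 / K) := by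
  -- Induction on the height `t` at which `i` and `i'` have a common ancestor: exchanging the two
  -- siblings just below that ancestor lowers the height by one.
  have key : ∀ t i, i / K ^ t = i' / K ^ t →
      ∃ φ : CanopyVertex ≃ CanopyVertex, φ (n, i) = (n, i') ∧ (∀ x, (φ x).1 = x.1) ∧
      ∀ x : CanopyVertex, φ (x.1 + 1, x.2 / K) = ((φ x).1 + 1, (φ x).2 / K) := by
    intro t
    induction t with
    | zero =>
      intro i h
      rw [pow_zero, Nat.div_one, Nat.div_one] at h
      exact ⟨Equiv.refl _, by rw [h]; rfl, fun _ => rfl, fun _ => rfl⟩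
    | succ t ih =>
      intro i h
      have hpos : 0 < K ^ t := Nat.pow_pos (by omega)
      rw [pow_succ, ← Nat.div_div_eq_div_mul, ← Nat.div_div_eq_div_mul] at h
      let σ : CanopyVertex ≃ CanopyVertex :=
        (canopySwap_involutive (K := K) (by omega) (n + t) (i / K ^ t) (i' / K ^ t)).toPerm
      have hσ : ∀ x, σ x = canopySwap K (n + t) (i / K ^ t) (i' / K ^ t) x := fun _ => rfl
      have h1 : σ (n, i) = (n, i' / K ^ t * K ^ t + i % K ^ t) := by
        rw [hσ, canopySwap, if_pos (by dsimp only; omega)]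
        simp
      obtain ⟨φ, hφ1, hφ2, hφ3⟩ := ih (i' / K ^ t * K ^ t + i % K ^ t) (by
        rw [mul_comm, Nat.mul_add_div hpos, Nat.div_eq_of_lt (Nat.mod_lt _ hpos), add_zero])
      refine ⟨σ.trans φ, ?_, fun x => ?_, fun x => ?_⟩
      · rw [Equiv.trans_apply, h1, hφ1]
      · rw [Equiv.trans_apply, hφ2, hσ, canopySwap_fst]
      · rw [Equiv.trans_apply, Equiv.trans_apply, hσ, canopySwap_parent (by omega) h, hφ3, hσ]
  -- Both numbers are less than `K ^ (i + i')`, so at this height the ancestors coincide.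
  refine key (i + i') i ?_
  rw [Nat.div_eq_of_lt, Nat.div_eq_of_lt]
  · exact (Nat.le_add_left i' i).trans_lt (Nat.lt_pow_self (by omega))
  · exact (Nat.le_add_right i i').trans_lt (Nat.lt_pow_self (by omega))

lemma canopyAncestor_equiv {φ : CanopyVertex ≃ CanopyVertex}
    (hφ : ∀ x : CanopyVertex, φ (x.1 + 1, x.2 / K) = ((φ x).1 + 1, (φ x).2 / K))
    (x : CanopyVertex) (t : ℕ) : φ (canopyAncestor K x t) = canopyAncestor K (φ x) t := by
  induction t generalizing x with
  | zero => simp [canopyAncestor]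
  | succ t ih => rw [canopyAncestor_succ, ih, hφ, ← canopyAncestor_succ]

lemma canopySite_equiv {φ : CanopyVertex ≃ CanopyVertex} (hφ1 : ∀ x, (φ x).1 = x.1)
    (hφ : ∀ x : CanopyVertex, φ (x.1 + 1, x.2 / K) = ((φ x).1 + 1, (φ x).2 / K))
    (x : CanopyVertex) : ((canopySite K m₀ (φ x)) : CanopyVertex) = φ (canopySite K m₀ x) := by
  have h : ∀ y, ((canopySite K m₀ y) : CanopyVertex)
      = canopyAncestor K y (m₀ - y.1 % (m₀ + 1)) := fun _ => rfl
  rw [h, h, canopyAncestor_equiv hφ, hφ1]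

lemma canopyKernel_equiv {φ : CanopyVertex ≃ CanopyVertex}
    (hφ : ∀ x : CanopyVertex, φ (x.1 + 1, x.2 / K) = ((φ x).1 + 1, (φ x).2 / K)) (lam : ℝ)
    (v : CanopyVertex → ℝ) (x y : CanopyVertex) :
    schrodingerKernel (canopyGraph K) lam v (φ x) (φ y)
      = schrodingerKernel (canopyGraph K) lam (fun z => v (φ z)) x y := by
  classical
  have hpar : ∀ x y : CanopyVertex, ((φ y).1 = (φ x).1 + 1 ∧ (φ y).2 = (φ x).2 / K)
      ↔ (y.1 = x.1 + 1 ∧ y.2 = x.2 / K) := by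
    intro x y
    have h1 : ((φ y).1 = (φ x).1 + 1 ∧ (φ y).2 = (φ x).2 / K)
        ↔ φ y = ((φ x).1 + 1, (φ x).2 / K) := ⟨fun h => Prod.ext h.1 h.2, fun h => by simp [h]⟩
    have h2 : (y.1 = x.1 + 1 ∧ y.2 = x.2 / K) ↔ y = (x.1 + 1, x.2 / K) :=
      ⟨fun h => Prod.ext h.1 h.2, fun h => by simp [h]⟩
    rw [h1, h2, ← hφ, φ.injective.eq_iff]
  have hadj : (canopyGraph K).Adj (φ x) (φ y) ↔ (canopyGraph K).Adj x y :=
    or_congr (hpar x y) (hpar y x)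
  unfold schrodingerKernel
  simp only [hadj, φ.injective.eq_iff]

end Canopy

/-! ### Moments of the canopy operator -/

section Moments

set_option linter.unusedSectionVars false

variable {K m₀ : ℕ}

/-- The embedding of a tree with `R` generations into the canopy tree. -/
def canopyEmb (R : ℕ) (x : ℕ × ℕ) : CanopyVertex := (R - 1 - x.1, x.2)

lemma canopyEmb_inj {R : ℕ} {x y : ℕ × ℕ} (hx : x.1 < R) (hy : y.1 < R) :
    canopyEmb R x = canopyEmb R y ↔ x = y := by
  constructor
  · intro h
    have h1 : R - 1 - x.1 = R - 1 - y.1 := congrArg Prod.fst h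
    have h2 : (canopyEmb R x).2 = (canopyEmb R y).2 := congrArg Prod.snd h
    exact Prod.ext (by omega) h2
  · rintro rfl; rfl

lemma treeFinset_lt {R : ℕ} (x : treeFinset K K R) : x.1.2 < K ^ x.1.1 := by
  have := (mem_treeFinset.mp x.2).2
  rwa [genCard_self] at this

lemma canopyEmb_parent {R : ℕ} (x y : treeFinset K K R) :
    ((canopyEmb R y).1 = (canopyEmb R x).1 + 1 ∧ (canopyEmb R y).2 = (canopyEmb R x).2 / K)
      ↔ TreeParent K y x := by
  have hx := (mem_treeFinset.mp x.2).1
  have hy := (mem_treeFinset.mp y.2).1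
  have hx2 := treeFinset_lt x
  have hy2 := treeFinset_lt y
  simp only [canopyEmb, TreeParent]
  constructor
  · rintro ⟨h1, h2⟩
    exact ⟨by omega, Or.inr h2.symm⟩
  · rintro ⟨h1, h2⟩
    refine ⟨by omega, ?_⟩
    rcases h2 with h2 | h2
    · rw [h1, h2, zero_add, pow_one] at hx2
      rw [h2, pow_zero] at hy2
      rw [Nat.div_eq_of_lt hx2]
      omega
    · exact h2.symm

lemma schrodingerKernel_canopyEmb {R : ℕ} (lam : ℝ) (v : CanopyVertex → ℝ)
    (x y : treeFinset K K R) :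
    schrodingerKernel (canopyGraph K) lam v (canopyEmb R x) (canopyEmb R y)
      = treeHam K K R lam (fun z => v (canopyEmb R z)) x y := by
  classical
  have hx := (mem_treeFinset.mp x.2).1
  have hy := (mem_treeFinset.mp y.2).1
  have hadj : (canopyGraph K).Adj (canopyEmb R x) (canopyEmb R y)
      ↔ TreeParent K x y ∨ TreeParent K y x := by
    rw [or_comm]
    exact or_congr (canopyEmb_parent x y) (canopyEmb_parent y x)
  rw [schrodingerKernel, treeHam, ham, Matrix.add_apply, treeHop, Matrix.of_apply,
    Matrix.diagonal_apply]
  simp only [hadj, canopyEmb_inj hx hy, Subtype.ext_iff]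

/-- Only the root of an embedded tree has a neighbour outside: the leaves of the tree lie in the
boundary layer. So powers are affected only if a path reaches the root. -/
lemma mem_range_canopyEmb (hK : 0 < K) {R : ℕ} {lam : ℝ} {v : CanopyVertex → ℝ}
    {x : treeFinset K K R} (hx : 1 ≤ x.1.1) {z : CanopyVertex}
    (h : schrodingerKernel (canopyGraph K) lam v (canopyEmb R x) z ≠ 0) :
    z ∈ Set.range fun y : treeFinset K K R => canopyEmb R y := by
  classical
  have hxR := (mem_treeFinset.mp x.2).1
  have hx2 := treeFinset_lt x
  by_cases hz : canopyEmb R x = z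
  · exact ⟨x, hz⟩
  have hadj : (canopyGraph K).Adj (canopyEmb R x) z := by
    by_contra hcon
    apply h
    rw [schrodingerKernel, if_neg hcon, if_neg hz, add_zero]
  rcases hadj with ⟨h1, h2⟩ | ⟨h1, h2⟩
  · simp only [canopyEmb] at h1 h2
    refine ⟨⟨(x.1.1 - 1, x.1.2 / K), mem_treeFinset.mpr ⟨by dsimp only; omega, ?_⟩⟩, ?_⟩
    · rw [genCard_self]
      refine Nat.div_lt_of_lt_mul ?_
      rwa [← pow_succ', Nat.sub_add_cancel hx]
    · exact Prod.ext (by simp only [canopyEmb]; omega) h2.symm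
  · simp only [canopyEmb] at h1 h2
    refine ⟨⟨(x.1.1 + 1, z.2), mem_treeFinset.mpr ⟨by dsimp only; omega, ?_⟩⟩, ?_⟩
    · rw [genCard_self, pow_succ]
      dsimp only
      rw [← Nat.div_lt_iff_lt_mul hK, ← h2]
      exact hx2
    · exact Prod.ext (by simp only [canopyEmb]; omega) rfl

/-- Powers of the operator on a tree agree with those on the canopy tree away from the root. -/
lemma pow_treeHam_eq_kerPow (hK : 0 < K) {R : ℕ} (lam : ℝ) (v : CanopyVertex → ℝ) (q : ℕ)
    (x y : treeFinset K K R) (hx : q ≤ x.1.1) :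
    (treeHam K K R lam (fun z => v (canopyEmb R z)) ^ q) x y
      = kerPow (schrodingerKernel (canopyGraph K) lam v) q (canopyEmb R x) (canopyEmb R y) := by
  classical
  have hlt := fun z : treeFinset K K R => (mem_treeFinset.mp z.2).1
  induction q generalizing x with
  | zero =>
    rw [pow_zero, Matrix.one_apply]
    simp only [kerPow, canopyEmb_inj (hlt x) (hlt y), Subtype.ext_iff]
  | succ q ih =>
    have hinj : Function.Injective fun z : treeFinset K K R => canopyEmb R z := fun a b h =>
      Subtype.ext ((canopyEmb_inj (hlt a) (hlt b)).mp h)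
    rw [pow_succ', Matrix.mul_apply, kerPow_succ, ← hinj.tsum_eq, tsum_fintype]
    · refine Finset.sum_congr rfl fun z _ => ?_
      rw [schrodingerKernel_canopyEmb]
      by_cases hz : treeHam K K R lam (fun z => v (canopyEmb R z)) x z = 0
      · rw [hz, zero_mul, zero_mul]
      · rw [ih z]
        by_cases hxz : x = z
        · subst hxz; omega
        · rw [treeHam_apply_of_ne hxz] at hz
          rcases treeHop_ne_zero hz with h | h <;> have := h.1 <;> omega
    · intro z hz
      exact mem_range_canopyEmb hK (by omega) (left_ne_zero_of_mul hz)

/-- In the tree the blocks are counted from the root, in the canopy tree from the boundary. The two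
partitions match because the number `R` of generations is a multiple of `m₀ + 1`. -/
lemma canopySite_canopyEmb {R a : ℕ} (hR : R = (m₀ + 1) * a) {x : ℕ × ℕ} (hx : x.1 < R)
    (hx2 : x.2 < K ^ x.1) :
    ((canopySite K m₀ (canopyEmb R x)) : CanopyVertex) = canopyEmb R (treeSite K (m₀ + 1) x) := by
  have h1 := Nat.div_add_mod x.1 (m₀ + 1)
  have h2 : x.1 % (m₀ + 1) < m₀ + 1 := Nat.mod_lt _ (Nat.succ_pos m₀)
  have hc : x.1 / (m₀ + 1) < a := Nat.div_lt_of_lt_mul (hR ▸ hx)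
  have h3 : (R - 1 - x.1) % (m₀ + 1) = m₀ - x.1 % (m₀ + 1) := by
    obtain ⟨e, rfl⟩ := Nat.exists_eq_add_of_lt hc
    have h4 : R - 1 - x.1 = (m₀ - x.1 % (m₀ + 1)) + (m₀ + 1) * e := by
      have h5 : R = (m₀ + 1) * (x.1 / (m₀ + 1)) + (m₀ + 1) * e + (m₀ + 1) := by rw [hR]; ring
      omega
    rw [h4, Nat.add_mul_mod_self_left, Nat.mod_eq_of_lt (by omega)]
  have h6 : m₀ - (R - 1 - x.1) % (m₀ + 1) = x.1 % (m₀ + 1) := by omega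
  change canopyAncestor K (canopyEmb R x) (m₀ - (R - 1 - x.1) % (m₀ + 1)) = _
  rw [h6]
  simp only [canopyAncestor, canopyEmb, treeSite, Prod.mk.injEq]
  refine ⟨by omega, ?_⟩
  split_ifs with h
  · rw [Nat.mod_eq_of_lt h, Nat.div_eq_of_lt hx2]
  · rfl

lemma canopySite_canopyEmb_eq_iff {a : ℕ} (x y : treeFinset K K ((m₀ + 1) * a)) :
    canopySite K m₀ (canopyEmb ((m₀ + 1) * a) x) = canopySite K m₀ (canopyEmb ((m₀ + 1) * a) y)
      ↔ treeSite K (m₀ + 1) x = treeSite K (m₀ + 1) y := by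
  have h : ∀ z : treeFinset K K ((m₀ + 1) * a),
      (treeSite K (m₀ + 1) z).1 < (m₀ + 1) * a := fun z =>
    (Nat.mul_div_le _ _).trans_lt (mem_treeFinset.mp z.2).1
  rw [Subtype.ext_iff, canopySite_canopyEmb rfl (mem_treeFinset.mp x.2).1 (treeFinset_lt x),
    canopySite_canopyEmb rfl (mem_treeFinset.mp y.2).1 (treeFinset_lt y),
    canopyEmb_inj (h x) (h y)]

lemma measurable_kerPow_canopy (hK : 0 < K) (lam : ℝ) (q : ℕ) (x y : CanopyVertex) :
    Measurable fun v : CanopyVertex → ℝ =>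
      kerPow (schrodingerKernel (canopyGraph K) lam v) q x y := by
  classical
  induction q generalizing x with
  | zero => exact measurable_const
  | succ q ih =>
    have h : ∀ v : CanopyVertex → ℝ, kerPow (schrodingerKernel (canopyGraph K) lam v) (q + 1) x y
        = ∑ z ∈ insert x (canopyNbr K x), schrodingerKernel (canopyGraph K) lam v x z
          * kerPow (schrodingerKernel (canopyGraph K) lam v) q z y := fun v =>
      tsum_eq_sum fun z hz => by
        rw [not_not.mp (mt (canopyKernel_ne_zero hK) hz), zero_mul]
    simp only [h]
    refine Finset.measurable_sum _ fun z _ => Measurable.mul ?_ (ih z)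
    unfold schrodingerKernel
    refine measurable_const.add ?_
    split_ifs
    · fun_prop
    · exact measurable_const

lemma measurable_pow_treeHam {κ R : ℕ} (lam : ℝ) (q : ℕ) (x y : treeFinset κ K R) :
    Measurable fun v : treeFinset κ K R → ℝ => (treeHam κ K R lam v ^ q) x y := by
  have hc : Continuous fun v : treeFinset κ K R → ℝ => treeHam κ K R lam v := by
    unfold treeHam ham
    refine continuous_const.add (Continuous.matrix_diagonal ?_)
    fun_prop
  exact ((continuous_apply_apply x y).comp (hc.pow q)).measurable

lemma kerPow_eq_pow {V : Type*} [Fintype V] [DecidableEq V] (H : Matrix V V ℂ) (q : ℕ) (x y : V) :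
    kerPow (fun x y => H x y) q x y = (H ^ q) x y := by
  induction q generalizing x with
  | zero =>
    rw [pow_zero, Matrix.one_apply]
    simp only [kerPow]
    congr
  | succ q ih => rw [pow_succ', Matrix.mul_apply, kerPow_succ, tsum_fintype]; simp only [ih]

lemma isBoundedKernel_treeHam {κ R : ℕ} (hκ : κ ≤ K + 1) (hK : 0 < K) (lam : ℝ)
    {v : treeFinset κ K R → ℝ} {W : ℝ} (hv : ∀ x, |v x| ≤ W) :
    IsBoundedKernel (fun x y => treeHam κ K R lam v x y) (K + 2 + |lam| * W) := by
  classical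
  refine ⟨fun x y => ?_, fun x => Set.toFinite _, fun x s => ?_⟩
  · exact (treeHam_isHermitian κ K R lam v).apply x y
  · calc ∑ y ∈ s, ‖treeHam κ K R lam v x y‖ ≤ ∑ y, ‖treeHam κ K R lam v x y‖ :=
          Finset.sum_le_sum_of_subset_of_nonneg (Finset.subset_univ s) fun _ _ _ => norm_nonneg _
      _ ≤ ∑ y, (‖treeHop κ K R x y‖ + if x = y then |lam| * W else 0) := by
          refine Finset.sum_le_sum fun y _ => ?_
          rw [treeHam, ham, Matrix.add_apply, Matrix.diagonal_apply]
          refine (norm_add_le _ _).trans (add_le_add le_rfl ?_)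
          split_ifs
          · rw [Complex.norm_real, Real.norm_eq_abs, abs_mul]
            exact mul_le_mul_of_nonneg_left (hv x) (abs_nonneg _)
          · simp
      _ ≤ _ := by
          rw [Finset.sum_add_distrib, Finset.sum_ite_eq, if_pos (Finset.mem_univ x)]
          exact add_le_add (sum_norm_treeHop_le hκ hK x) le_rfl

variable (ν : Measure ℝ) [IsProbabilityMeasure ν]

lemma ae_forall_abs_le {β : Type*} [Countable β] {W : ℝ} (hW : ∀ᵐ t ∂ν, |t| ≤ W) :
    ∀ᵐ w ∂(Measure.infinitePi fun _ : β => ν), ∀ y, |w y| ≤ W := by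
  rw [ae_all_iff]
  intro y
  have h := (measurePreserving_eval_infinitePi (fun _ : β => ν) y).quasiMeasurePreserving.ae hW
  exact h

/-- The moments of the averaged spectral measures of the canopy operator. -/
def canopyMoment (K m₀ : ℕ) (lam : ℝ) (q n : ℕ) : ℂ :=
  ∫ w, kerPow (schrodingerKernel (canopyGraph K) lam fun z => w (canopySite K m₀ z)) q (n, 0) (n, 0)
    ∂(Measure.infinitePi fun _ : canopySites m₀ => ν)

/-- An automorphism moves `x` to the first vertex of its layer and permutes the sites, which leaves
the law of the potential unchanged. Hence the choice of the vertices `x_n` is immaterial for the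
moments. -/
lemma integral_kerPow_canopy (hK : 2 ≤ K) (lam : ℝ) (q : ℕ) (x : CanopyVertex) :
    ∫ w, kerPow (schrodingerKernel (canopyGraph K) lam fun z => w (canopySite K m₀ z)) q x x
      ∂(Measure.infinitePi fun _ : canopySites m₀ => ν) = canopyMoment ν K m₀ lam q x.1 := by
  obtain ⟨φ, h1, h2, h3⟩ := exists_canopy_automorphism hK x.1 0 x.2
  have h4 : ∀ v : CanopyVertex → ℝ, kerPow (schrodingerKernel (canopyGraph K) lam v) q x x
      = kerPow (schrodingerKernel (canopyGraph K) lam fun z => v (φ z)) q (x.1, 0) (x.1, 0) := by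
    intro v
    have h5 : (schrodingerKernel (canopyGraph K) lam fun z => v (φ z))
        = fun y z => schrodingerKernel (canopyGraph K) lam v (φ y) (φ z) := by
      funext y z
      exact (canopyKernel_equiv h3 lam v y z).symm
    rw [h5, kerPow_comp_equiv, h1]
  simp only [h4]
  refine integral_infinitePi_comp ν (s := fun z => canopySite K m₀ (φ z))
    (s' := canopySite K m₀) (fun y z => ?_)
    (F := fun v => kerPow (schrodingerKernel (canopyGraph K) lam v) q (x.1, 0) (x.1, 0))
    (measurable_kerPow_canopy (by omega) lam q _ _)
  rw [Subtype.ext_iff, canopySite_equiv h2 h3, canopySite_equiv h2 h3, φ.injective.eq_iff,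
    Subtype.ext_iff]

lemma integral_pow_treeHam (hK : 2 ≤ K) (lam : ℝ) {a q : ℕ}
    (x : treeFinset K K ((m₀ + 1) * a)) (hx : q ≤ x.1.1) :
    ∫ w, (treeHam K K ((m₀ + 1) * a) lam (fun z => w (treeSite K (m₀ + 1) z)) ^ q) x x
      ∂(Measure.infinitePi fun _ : ℕ × ℕ => ν)
      = canopyMoment ν K m₀ lam q ((m₀ + 1) * a - 1 - x.1.1) := by
  rw [← integral_infinitePi_comp ν (V := treeFinset K K ((m₀ + 1) * a))
    (s := fun z => canopySite K m₀ (canopyEmb ((m₀ + 1) * a) z))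
    (s' := fun z => treeSite K (m₀ + 1) z) canopySite_canopyEmb_eq_iff
    (F := fun v => (treeHam K K ((m₀ + 1) * a) lam v ^ q) x x)
    (measurable_pow_treeHam lam q x x)]
  refine Eq.trans ?_ (integral_kerPow_canopy ν hK lam q (canopyEmb ((m₀ + 1) * a) x))
  refine integral_congr_ae (ae_of_all _ fun w => ?_)
  exact pow_treeHam_eq_kerPow (by omega) lam (fun z => w (canopySite K m₀ z)) q x x hx

end Moments

/-! ### Convergence of the traces -/

section Traces

set_option linter.unusedSectionVars false

variable {K m₀ : ℕ}

lemma IsBoundedKernel.mono {V : Type*} {k : V → V → ℂ} {D D' : ℝ} (h : IsBoundedKernel k D)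
    (hD : D ≤ D') : IsBoundedKernel k D' := ⟨h.symm, h.finite, fun x s => (h.sum_le x s).trans hD⟩

/-- Both sides are the trace of `P(H)`. The right-hand side is linear in diagonal entries of powers,
whose expectations can be compared with those on the canopy tree. -/
lemma sum_eval_eigenvalues {V : Type*} [Fintype V] [DecidableEq V] {H : Matrix V V ℂ}
    (hH : H.IsHermitian) (P : Polynomial ℝ) :
    ∑ i, P.eval (hH.eigenvalues i)
      = ∑ q ∈ Finset.range (P.natDegree + 1), P.coeff q * ((H ^ q).trace).re := by
  have hpow : ∀ q : ℕ, (H ^ q).trace = ∑ i, ((hH.eigenvalues i ^ q : ℝ) : ℂ) := by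
    intro q
    conv_lhs => rw [hH.spectral_theorem, ← map_pow, Unitary.conjStarAlgAut_apply, Matrix.trace_mul_cycle,
      Unitary.coe_star_mul_self, one_mul, Matrix.diagonal_pow, Matrix.trace_diagonal]
    simp
  simp only [hpow, ← Complex.ofReal_sum, Complex.ofReal_re, Polynomial.eval_eq_sum_range,
    Finset.mul_sum]
  exact Finset.sum_comm

lemma abs_eigenvalues_le {V : Type*} [Fintype V] [DecidableEq V] {H : Matrix V V ℂ}
    (hH : H.IsHermitian) {D : ℝ} (hD : IsBoundedKernel (fun x y => H x y) D) (i : V) :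
    |hH.eigenvalues i| ≤ D := by
  have hD0 := hD.nonneg i
  set ψ : V → ℂ := fun x => (hH.eigenvectorUnitary : Matrix V V ℂ) x i with hψ
  have h1 := mulVec_eigenvectorUnitary hH i
  obtain ⟨x, -, hx⟩ := Finset.exists_max_image Finset.univ (fun x => ‖ψ x‖) ⟨i, by simp⟩
  have hpos : 0 < ‖ψ x‖ := by
    by_contra hcon
    have h2 : ∀ y, ψ y = 0 := fun y =>
      norm_le_zero_iff.mp ((hx y (Finset.mem_univ _)).trans (not_lt.mp hcon))
    have h3 := congrFun (congrFun (Unitary.coe_star_mul_self hH.eigenvectorUnitary) i) i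
    rw [Matrix.mul_apply, Matrix.one_apply_eq] at h3
    rw [Finset.sum_eq_zero] at h3
    · exact zero_ne_one h3
    · intro y _
      have h4 : (hH.eigenvectorUnitary : Matrix V V ℂ) y i = 0 := h2 y
      rw [h4, mul_zero]
  have h5 : ‖H.mulVec ψ x‖ = |hH.eigenvalues i| * ‖ψ x‖ := by
    rw [hψ, h1, Pi.smul_apply, norm_smul, Complex.norm_real, Real.norm_eq_abs]
  have h6 : ‖H.mulVec ψ x‖ ≤ D * ‖ψ x‖ := by
    refine (norm_sum_le_of_le _ fun y _ => ?_).trans (?_ : ∑ y, ‖H x y‖ * ‖ψ x‖ ≤ _)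
    · rw [norm_mul]
      exact mul_le_mul_of_nonneg_left (hx y (Finset.mem_univ _)) (norm_nonneg _)
    · rw [← Finset.sum_mul]
      exact mul_le_mul_of_nonneg_right (hD.sum_le x Finset.univ) (norm_nonneg _)
  exact le_of_mul_le_mul_right (h5 ▸ h6) hpos

lemma norm_pow_apply_le {V : Type*} [Fintype V] [DecidableEq V] {H : Matrix V V ℂ} {D : ℝ}
    (hD : IsBoundedKernel (fun x y => H x y) D) (q : ℕ) (x : V) : ‖(H ^ q) x x‖ ≤ D ^ q := by
  rw [← kerPow_eq_pow]
  exact norm_kerPow_le hD q x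

variable (ν : Measure ℝ) [IsProbabilityMeasure ν]

lemma norm_canopyMoment_le (hK : 2 ≤ K) (lam : ℝ) {W : ℝ} (hW : ∀ᵐ t ∂ν, |t| ≤ W) (q n : ℕ) :
    ‖canopyMoment ν K m₀ lam q n‖ ≤ (K + 2 + |lam| * W) ^ q := by
  refine (norm_integral_le_of_norm_le_const (C := (K + 2 + |lam| * W) ^ q) ?_).trans (by simp)
  filter_upwards [ae_forall_abs_le ν hW] with w hw
  exact norm_kerPow_le ((isBoundedKernel_canopy (by omega) lam fun x => hw _).mono (by linarith)) q _

lemma integrable_pow_treeHam {κ R p : ℕ} (hκ : κ ≤ K + 1) (hK : 0 < K) (lam : ℝ) {W : ℝ}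
    (hW : ∀ᵐ t ∂ν, |t| ≤ W) (q : ℕ) (x : treeFinset κ K R) :
    Integrable (fun w => (treeHam κ K R lam (fun z => w (treeSite K p z)) ^ q) x x)
      (Measure.infinitePi fun _ : ℕ × ℕ => ν) := by
  refine Integrable.of_bound (C := (K + 2 + |lam| * W) ^ q) ?_ ?_
  · exact ((measurable_pow_treeHam lam q x x).comp
      (measurable_comp_blockMap fun z : treeFinset κ K R => treeSite K p z)).aestronglyMeasurable
  · filter_upwards [ae_forall_abs_le ν hW] with w hw
    exact norm_pow_apply_le (isBoundedKernel_treeHam hκ hK lam fun x => hw _) q x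

lemma norm_integral_pow_treeHam_le {κ R p : ℕ} (hκ : κ ≤ K + 1) (hK : 0 < K) (lam : ℝ) {W : ℝ}
    (hW : ∀ᵐ t ∂ν, |t| ≤ W) (q : ℕ) (x : treeFinset κ K R) :
    ‖∫ w, (treeHam κ K R lam (fun z => w (treeSite K p z)) ^ q) x x
      ∂(Measure.infinitePi fun _ : ℕ × ℕ => ν)‖ ≤ (K + 2 + |lam| * W) ^ q := by
  refine (norm_integral_le_of_norm_le_const (C := (K + 2 + |lam| * W) ^ q) ?_).trans (by simp)
  filter_upwards [ae_forall_abs_le ν hW] with w hw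
  exact norm_pow_apply_le (isBoundedKernel_treeHam hκ hK lam fun x => hw _) q x

lemma card_treeFinset_level {R u : ℕ} (hu : u < R) :
    (Finset.univ.filter fun x : treeFinset K K R => x.1.1 = u).card = K ^ u := by
  rw [← Finset.card_range (K ^ u)]
  refine Finset.card_nbij' (fun x => x.1.2) (fun i => if h : i < K ^ u then
    ⟨(u, i), mem_treeFinset.mpr ⟨hu, by rwa [genCard_self]⟩⟩ else
    ⟨(0, 0), mem_treeFinset.mpr ⟨by dsimp only; omega, Nat.one_pos⟩⟩) ?_ ?_ ?_ ?_
  · intro x hx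
    have hx' : x.1.1 = u := by simpa using hx
    simpa [← hx'] using treeFinset_lt x
  · intro i hi
    have hi' : i < K ^ u := by simpa using hi
    simp [hi']
  · intro x hx
    have hx' : x.1.1 = u := by simpa using hx
    have h1 := treeFinset_lt x
    rw [hx'] at h1
    refine Subtype.ext ?_
    simp only [h1, dif_pos]
    exact Prod.ext hx'.symm rfl
  · intro i hi
    have hi' : i < K ^ u := by simpa using hi
    simp [hi']

/-- The averaged moments of the operators on large trees converge. -/
lemma tendsto_trace_pow (hK : 2 ≤ K) (lam : ℝ) {W : ℝ} (hW : ∀ᵐ t ∂ν, |t| ≤ W) (q : ℕ) :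
    Tendsto (fun a : ℕ => ((K : ℂ) ^ ((m₀ + 1) * a - 1))⁻¹ *
      ∫ w, (treeHam K K ((m₀ + 1) * a) lam (fun z => w (treeSite K (m₀ + 1) z)) ^ q).trace
        ∂(Measure.infinitePi fun _ : ℕ × ℕ => ν)) atTop
      (𝓝 (∑' n : ℕ, ((K : ℂ) ^ n)⁻¹ * canopyMoment ν K m₀ lam q n)) := by
  have hK0 : (K : ℂ) ≠ 0 := by exact_mod_cast (by omega : K ≠ 0)
  set D := (K + 2 + |lam| * W) ^ q with hD
  have hD0 : 0 ≤ D := (norm_nonneg _).trans (norm_canopyMoment_le (m₀ := m₀) ν hK lam hW q 0)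
  let e : (R : ℕ) → treeFinset K K R → ℂ := fun R x =>
    ∫ w, (treeHam K K R lam (fun z => w (treeSite K (m₀ + 1) z)) ^ q) x x
      ∂(Measure.infinitePi fun _ : ℕ × ℕ => ν)
  have he : ∀ R x, ‖e R x‖ ≤ D := fun R x =>
    norm_integral_pow_treeHam_le ν (by omega) (by omega) lam hW q x
  -- Average of the diagonal moments over the generation that is `n` steps above the leaves; the
  -- trace divided by the number `K ^ (R - 1)` of leaves is `∑ K^(-n) d R n`.
  let d : ℕ → ℕ → ℂ := fun R n => if n < R then ((K : ℂ) ^ (R - 1 - n))⁻¹ *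
    ∑ x : treeFinset K K R with x.1.1 = R - 1 - n, e R x else 0
  have hcard : ∀ R n, n < R →
      ((Finset.univ.filter fun x : treeFinset K K R => x.1.1 = R - 1 - n).card : ℂ)
        = (K : ℂ) ^ (R - 1 - n) := by
    intro R n hn
    rw [card_treeFinset_level (by omega)]
    push_cast
    rfl
  have hd : ∀ R n, ‖d R n‖ ≤ D := by
    intro R n
    by_cases hn : n < R
    · simp only [d, if_pos hn]
      rw [norm_mul, norm_inv, norm_pow, Complex.norm_natCast]
      rw [inv_mul_le_iff₀ (by positivity)]
      refine (norm_sum_le_of_le _ fun x _ => he R x).trans ?_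
      rw [Finset.sum_const, card_treeFinset_level (by omega), nsmul_eq_mul]
      push_cast
      rfl
    · simp only [d, if_neg hn, norm_zero]
      exact hD0
  -- As soon as the generation is at least `q` steps from the root, the average equals the canopy
  -- moment exactly. The generations near the root carry a vanishing weight, so dominated
  -- convergence gives the limit.
  have hdlim : ∀ a n, n + q < (m₀ + 1) * a → d ((m₀ + 1) * a) n = canopyMoment ν K m₀ lam q n := by
    intro a n hn
    have hn' : n < (m₀ + 1) * a := by omega
    have h1 : ∀ x ∈ Finset.univ.filter
        (fun x : treeFinset K K ((m₀ + 1) * a) => x.1.1 = (m₀ + 1) * a - 1 - n),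
        e ((m₀ + 1) * a) x = canopyMoment ν K m₀ lam q n := by
      intro x hx
      have hx' : x.1.1 = (m₀ + 1) * a - 1 - n := by simpa using hx
      simp only [e]
      rw [integral_pow_treeHam ν hK lam x (by omega)]
      congr 1
      omega
    simp only [d, if_pos hn']
    rw [Finset.sum_congr rfl h1, Finset.sum_const, nsmul_eq_mul, hcard _ _ hn', ← mul_assoc,
      inv_mul_cancel₀ (pow_ne_zero _ hK0), one_mul]
  have hsum : ∀ a : ℕ, ((K : ℂ) ^ ((m₀ + 1) * a - 1))⁻¹ *
      ∫ w, (treeHam K K ((m₀ + 1) * a) lam (fun z => w (treeSite K (m₀ + 1) z)) ^ q).trace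
        ∂(Measure.infinitePi fun _ : ℕ × ℕ => ν)
      = ∑' n : ℕ, ((K : ℂ) ^ n)⁻¹ * d ((m₀ + 1) * a) n := by
    intro a
    set R := (m₀ + 1) * a with hR
    have h1 : ∫ w, (treeHam K K R lam (fun z => w (treeSite K (m₀ + 1) z)) ^ q).trace
        ∂(Measure.infinitePi fun _ : ℕ × ℕ => ν) = ∑ x, e R x := by
      simp only [Matrix.trace, Matrix.diag_apply]
      exact integral_finsetSum _ fun x _ =>
        integrable_pow_treeHam ν (by omega) (by omega) lam hW q x
    rw [h1, tsum_eq_sum (s := Finset.range R)]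
    · rw [← Finset.sum_fiberwise_of_maps_to (t := Finset.range R)
        (g := fun x : treeFinset K K R => x.1.1)
        (fun x _ => Finset.mem_range.mpr (mem_treeFinset.mp x.2).1), ← Finset.sum_range_reflect,
        Finset.mul_sum]
      refine Finset.sum_congr rfl fun n hn => ?_
      have hn' := Finset.mem_range.mp hn
      simp only [d, if_pos hn']
      rw [← mul_assoc, ← mul_inv, ← pow_add, show n + (R - 1 - n) = R - 1 by omega]
    · intro n hn
      rw [Finset.mem_range] at hn
      simp only [d, if_neg hn, mul_zero]
  simp only [hsum]
  refine tendsto_tsum_of_dominated_convergence (bound := fun n => ((K : ℝ)⁻¹) ^ n * D) ?_ ?_ ?_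
  · refine (summable_geometric_of_lt_one (by positivity) ?_).mul_right _
    exact inv_lt_one_of_one_lt₀ (by exact_mod_cast (by omega : 1 < K))
  · intro n
    refine Tendsto.const_mul _ (tendsto_const_nhds.congr' ?_)
    filter_upwards [eventually_gt_atTop (n + q)] with a ha
    exact (hdlim a n (ha.trans_le (Nat.le_mul_of_pos_left a (Nat.succ_pos m₀)))).symm
  · refine Eventually.of_forall fun a n => ?_
    rw [norm_mul, norm_inv, norm_pow, Complex.norm_natCast, inv_pow]
    exact mul_le_mul_of_nonneg_left (hd _ _) (by positivity)

end Traces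

/-! ### The density of states measure -/

section TestFunctions

/-- A continuous function that is `1` on `[a, b]` and `0` outside `[a - η, b + η]`. -/
def trapezoid (a b η : ℝ) (hη : 0 < η) : CompactlySupportedContinuousMap ℝ ℝ where
  toFun x := max 0 (min 1 (min ((x - a) / η + 1) ((b - x) / η + 1)))
  continuous_toFun := by fun_prop
  hasCompactSupport' := by
    refine HasCompactSupport.of_support_subset_isCompact
      (isCompact_Icc (a := a - η) (b := b + η)) fun x hx => ?_
    by_contra hcon
    apply hx
    refine max_eq_left ?_
    rw [Set.mem_Icc, not_and_or, not_le, not_le] at hcon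
    rcases hcon with h | h
    · refine (min_le_right _ _).trans ((min_le_left _ _).trans ?_)
      rw [div_add_one hη.ne']
      exact div_nonpos_of_nonpos_of_nonneg (by linarith) hη.le
    · refine (min_le_right _ _).trans ((min_le_right _ _).trans ?_)
      rw [div_add_one hη.ne']
      exact div_nonpos_of_nonpos_of_nonneg (by linarith) hη.le

variable {a b η : ℝ} (hη : 0 < η)

lemma trapezoid_apply (x : ℝ) :
    trapezoid a b η hη x = max 0 (min 1 (min ((x - a) / η + 1) ((b - x) / η + 1))) := rfl

lemma trapezoid_nonneg (x : ℝ) : 0 ≤ trapezoid a b η hη x := le_max_left _ _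

lemma trapezoid_le_one (x : ℝ) : trapezoid a b η hη x ≤ 1 :=
  max_le zero_le_one (min_le_left _ _)

lemma trapezoid_eq_one {x : ℝ} (hx : x ∈ Set.Icc a b) : trapezoid a b η hη x = 1 := by
  have h1 : 0 ≤ (x - a) / η := div_nonneg (by linarith [hx.1]) hη.le
  have h2 : 0 ≤ (b - x) / η := div_nonneg (by linarith [hx.2]) hη.le
  rw [trapezoid_apply, min_eq_left (le_min (by linarith) (by linarith)), max_eq_right zero_le_one]

lemma trapezoid_eq_zero {x : ℝ} (hx : x ∉ Set.Icc (a - η) (b + η)) : trapezoid a b η hη x = 0 := by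
  refine max_eq_left ?_
  rw [Set.mem_Icc, not_and_or, not_le, not_le] at hx
  rcases hx with h | h
  · refine (min_le_right _ _).trans ((min_le_left _ _).trans ?_)
    rw [div_add_one hη.ne']
    exact div_nonpos_of_nonpos_of_nonneg (by linarith) hη.le
  · refine (min_le_right _ _).trans ((min_le_right _ _).trans ?_)
    rw [div_add_one hη.ne']
    exact div_nonpos_of_nonpos_of_nonneg (by linarith) hη.le

lemma indicator_le_trapezoid (x : ℝ) :
    (if x ∈ Set.Icc a b then (1 : ℝ) else 0) ≤ trapezoid a b η hη x := by
  split_ifs with h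
  · rw [trapezoid_eq_one hη h]
  · exact trapezoid_nonneg hη x

lemma trapezoid_le_indicator (x : ℝ) :
    trapezoid a b η hη x ≤ if x ∈ Set.Icc (a - η) (b + η) then (1 : ℝ) else 0 := by
  split_ifs with h
  · exact trapezoid_le_one hη x
  · rw [trapezoid_eq_zero hη h]

/-- Comparison of a measure of intervals with integrals of trapezoidal functions. -/
lemma measure_Icc_le_trapezoid (μ : Measure ℝ) [IsFiniteMeasureOnCompacts μ] :
    μ (Set.Icc a b) ≤ ENNReal.ofReal (∫ x, trapezoid a b η hη x ∂μ) := by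
  have hint : Integrable (fun x => trapezoid a b η hη x) μ :=
    (trapezoid a b η hη).continuous.integrable_of_hasCompactSupport
      (trapezoid a b η hη).hasCompactSupport
  rw [ofReal_integral_eq_lintegral_ofReal hint (ae_of_all _ (trapezoid_nonneg hη)),
    ← lintegral_indicator_one measurableSet_Icc]
  refine lintegral_mono fun x => ?_
  by_cases h : x ∈ Set.Icc a b
  · rw [Set.indicator_of_mem h, trapezoid_eq_one hη h]; simp
  · rw [Set.indicator_of_notMem h]; exact zero_le

lemma trapezoid_le_measure_Icc (μ : Measure ℝ) [IsFiniteMeasureOnCompacts μ] :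
    ENNReal.ofReal (∫ x, trapezoid a b η hη x ∂μ) ≤ μ (Set.Icc (a - η) (b + η)) := by
  have hint : Integrable (fun x => trapezoid a b η hη x) μ :=
    (trapezoid a b η hη).continuous.integrable_of_hasCompactSupport
      (trapezoid a b η hη).hasCompactSupport
  rw [ofReal_integral_eq_lintegral_ofReal hint (ae_of_all _ (trapezoid_nonneg hη)),
    ← lintegral_indicator_one measurableSet_Icc]
  refine lintegral_mono fun x => ?_
  by_cases h : x ∈ Set.Icc (a - η) (b + η)
  · rw [Set.indicator_of_mem h]; simpa using trapezoid_le_one hη x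
  · rw [Set.indicator_of_notMem h, trapezoid_eq_zero hη h]; simp

lemma tendsto_measure_Icc_thicken (μ : Measure ℝ) [IsFiniteMeasure μ] (a b : ℝ) :
    Tendsto (fun k : ℕ => μ (Set.Icc (a - 1 / (k + 1)) (b + 1 / (k + 1)))) atTop
      (𝓝 (μ (Set.Icc a b))) := by
  have h : Set.Icc a b = ⋂ k : ℕ, Set.Icc (a - 1 / ((k : ℝ) + 1)) (b + 1 / (k + 1)) := by
    ext x
    simp only [Set.mem_iInter, Set.mem_Icc]
    constructor
    · intro hx k
      have : (0 : ℝ) < 1 / (k + 1) := Nat.one_div_pos_of_nat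
      exact ⟨by linarith [hx.1], by linarith [hx.2]⟩
    · intro hx
      have hl := tendsto_one_div_add_atTop_nhds_zero_nat (𝕜 := ℝ)
      constructor
      · have := hl.const_sub a
        rw [sub_zero] at this
        exact le_of_tendsto' this fun k => (hx k).1
      · have := hl.const_add b
        rw [add_zero] at this
        exact ge_of_tendsto' this fun k => (hx k).2
  rw [h]
  refine tendsto_measure_iInter_atTop (fun k => measurableSet_Icc.nullMeasurableSet) ?_
    ⟨0, measure_ne_top _ _⟩
  intro k l hkl
  have : 1 / ((l : ℝ) + 1) ≤ 1 / (k + 1) := Nat.one_div_le_one_div hkl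
  exact Set.Icc_subset_Icc (by linarith) (by linarith)

end TestFunctions

/-! ### Spectral measures are probability measures -/

section SpectralMeasureBounds

variable {H : Type*} [NormedAddCommGroup H] [InnerProductSpace ℂ H] [CompleteSpace H]

instance (A : H →L[ℂ] H) (ψ : H) : IsFiniteMeasureOnCompacts (spectralMeasureAt A ψ) := by
  unfold spectralMeasureAt
  infer_instance

lemma integral_spectralMeasureAt (A : H →L[ℂ] H) (ψ : H) (f : CompactlySupportedContinuousMap ℝ ℝ) :
    ∫ x, f x ∂(spectralMeasureAt A ψ) = spectralFunctional A ψ f :=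
  RealRMK.integral_rieszMeasure _ f

lemma isProbabilityMeasure_spectralMeasureAt {A : H →L[ℂ] H} (hA : IsSelfAdjoint A) {ψ : H}
    (hψ : ‖ψ‖ = 1) : IsProbabilityMeasure (spectralMeasureAt A ψ) := by
  constructor
  refine le_antisymm ?_ ?_
  · have h1 : (Set.univ : Set ℝ) = ⋃ n : ℕ, Set.Icc (-(n : ℝ)) n := by
      refine (Set.eq_univ_of_forall fun x => ?_).symm
      obtain ⟨n, hn⟩ := exists_nat_ge |x|
      exact Set.mem_iUnion.mpr ⟨n, abs_le.mp hn⟩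
    have hmono : Monotone fun n : ℕ => Set.Icc (-(n : ℝ)) n := fun m n hmn => by
      have : (m : ℝ) ≤ n := by exact_mod_cast hmn
      exact Set.Icc_subset_Icc (by linarith) this
    rw [h1, hmono.measure_iUnion]
    refine iSup_le fun n => (measure_Icc_le_trapezoid one_pos _).trans ?_
    rw [ENNReal.ofReal_le_one, integral_spectralMeasureAt]
    have h2 := abs_spectralFunctional_sub_le hA le_rfl hψ
      (trapezoid (-(n : ℝ)) n 1 one_pos) 0 zero_le_one fun x _ => by
        rw [Polynomial.eval_zero, sub_zero, abs_of_nonneg (trapezoid_nonneg _ _)]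
        exact trapezoid_le_one _ _
    simp only [Polynomial.coeff_zero, zero_mul, Finset.sum_const_zero, sub_zero] at h2
    exact (abs_le.mp h2).2
  · refine le_trans ?_ (measure_mono (Set.subset_univ (Set.Icc (-‖A‖ - 1) (‖A‖ + 1))))
    refine le_trans ?_ (trapezoid_le_measure_Icc one_pos _)
    -- The constant polynomial `1` agrees with the trapezoid on `[-‖A‖, ‖A‖]`, so the approximation
    -- error is exactly `0` here.
    have h2 := abs_spectralFunctional_sub_le hA le_rfl hψ
      (trapezoid (-‖A‖) ‖A‖ 1 one_pos) 1 le_rfl fun x hx => by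
        rw [Polynomial.eval_one, trapezoid_eq_one _ hx, sub_self, abs_zero]
    rw [Polynomial.natDegree_one, Finset.sum_range_one, Polynomial.coeff_one_zero, one_mul,
      pow_zero, one_apply_eq_self, inner_self_eq_norm_sq_to_K, hψ] at h2
    have h3 : spectralFunctional A ψ (trapezoid (-‖A‖) ‖A‖ 1 one_pos) = 1 := by
      have h4 := abs_eq_zero.mp (le_antisymm h2 (abs_nonneg _))
      have h5 : (((1 : ℝ) : ℂ) ^ 2).re = 1 := by norm_num
      exact (sub_eq_zero.mp h4).trans h5
    rw [integral_spectralMeasureAt, h3, ENNReal.ofReal_one]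

end SpectralMeasureBounds

/-! ### Measurability of the spectral measures and their averages -/

section DensityOfStates

set_option linter.unusedSectionVars false

variable {K m₀ : ℕ}

/-- Truncation of the random variables. -/
def truncate {β : Type*} (W : ℝ) (w : β → ℝ) (y : β) : ℝ := max (-W) (min W (w y))

lemma measurable_truncate {β : Type*} (W : ℝ) :
    Measurable (truncate W : (β → ℝ) → β → ℝ) := by
  unfold truncate
  fun_prop

lemma abs_truncate_le {β : Type*} {W : ℝ} (hW : 0 ≤ W) (w : β → ℝ) (y : β) :
    |truncate W w y| ≤ W :=
  abs_le.mpr ⟨le_max_left _ _, max_le (by linarith) (min_le_left _ _)⟩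

/-- For unbounded `ω` the operator may not exist. Truncated variables always give a bounded
operator, and for a distribution with bounded support truncation changes nothing almost surely. -/
lemma truncate_eq_self {β : Type*} {W : ℝ} {w : β → ℝ} (h : ∀ y, |w y| ≤ W) :
    truncate W w = w := by
  funext y
  obtain ⟨h1, h2⟩ := abs_le.mp (h y)
  rw [truncate, min_eq_right h2, max_eq_right h1]

lemma norm_canopyDelta (x : CanopyVertex) : ‖canopyDelta x‖ = 1 := by
  rw [canopyDelta, lp.norm_single (by norm_num), norm_one]

lemma isSelfAdjoint_canopyOperator (hK : 2 ≤ K) (lam : ℝ) {w : canopySites m₀ → ℝ} {W : ℝ}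
    (hw : ∀ y, |w y| ≤ W) : IsSelfAdjoint (canopyOperator K m₀ lam w) :=
  isSelfAdjoint_of_kernel (isBoundedKernel_canopy (by omega) lam fun _ => hw _)
    (canopyOperator_apply hK lam hw)

lemma norm_canopyOperator_le (hK : 2 ≤ K) (lam : ℝ) {w : canopySites m₀ → ℝ} {W : ℝ}
    (hW : 0 ≤ W) (hw : ∀ y, |w y| ≤ W) :
    ‖canopyOperator K m₀ lam w‖ ≤ K + 2 + |lam| * W :=
  norm_le_of_kernel ((isBoundedKernel_canopy (by omega) lam fun _ => hw _).mono (by linarith))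
    (by positivity) (canopyOperator_apply hK lam hw)

lemma abs_spectralFunctional_canopy_sub_le (hK : 2 ≤ K) (lam : ℝ) {w : canopySites m₀ → ℝ} {W : ℝ}
    (hW : 0 ≤ W) (hw : ∀ y, |w y| ≤ W) (x : CanopyVertex)
    (f : CompactlySupportedContinuousMap ℝ ℝ) (P : Polynomial ℝ) {ε : ℝ}
    (hε : 0 ≤ ε) (h : ∀ t ∈ Set.Icc (-(K + 2 + |lam| * W)) (K + 2 + |lam| * W),
      |f t - P.eval t| ≤ ε) :
    |spectralFunctional (canopyOperator K m₀ lam w) (canopyDelta x) f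
      - kerPoly (schrodingerKernel (canopyGraph K) lam fun z => w (canopySite K m₀ z)) P x| ≤ ε := by
  have h1 := abs_spectralFunctional_sub_le (isSelfAdjoint_canopyOperator hK lam hw)
    (norm_canopyOperator_le hK lam hW hw) (norm_canopyDelta x) f P hε h
  have h2 : ∑ q ∈ Finset.range (P.natDegree + 1), P.coeff q *
      (inner ℂ (canopyDelta x) ((canopyOperator K m₀ lam w ^ q) (canopyDelta x))).re
      = kerPoly (schrodingerKernel (canopyGraph K) lam fun z => w (canopySite K m₀ z)) P x :=
    Finset.sum_congr rfl fun q _ => by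
      rw [canopyDelta, inner_pow_single_of_kernel (canopyOperator_apply hK lam hw)]
  rwa [h2] at h1

lemma exists_polynomial_near (f : CompactlySupportedContinuousMap ℝ ℝ) (D : ℝ) {ε : ℝ}
    (hε : 0 < ε) : ∃ P : Polynomial ℝ, ∀ t ∈ Set.Icc (-D) D, |f t - P.eval t| ≤ ε := by
  obtain ⟨P, hP⟩ := exists_polynomial_near_of_continuousOn (-D) D f f.continuous.continuousOn ε hε
  exact ⟨P, fun t ht => by rw [abs_sub_comm]; exact (hP t ht).le⟩

lemma measurable_kerPoly_canopy (hK : 0 < K) (lam : ℝ) (P : Polynomial ℝ) (x : CanopyVertex) :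
    Measurable fun w : canopySites m₀ → ℝ =>
      kerPoly (schrodingerKernel (canopyGraph K) lam fun z => w (canopySite K m₀ z)) P x := by
  unfold kerPoly
  refine Finset.measurable_sum _ fun q _ => Measurable.const_mul ?_ _
  refine Complex.measurable_re.comp ((measurable_kerPow_canopy hK lam q x x).comp ?_)
  fun_prop

/-- A limit, uniform in `w`, of polynomials of the kernel, each of which depends on finitely many
random variables. -/
lemma measurable_spectralFunctional_canopy (hK : 2 ≤ K) (lam : ℝ) {W : ℝ} (hW : 0 ≤ W)
    (x : CanopyVertex) (f : CompactlySupportedContinuousMap ℝ ℝ) :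
    Measurable fun w : canopySites m₀ → ℝ =>
      spectralFunctional (canopyOperator K m₀ lam (truncate W w)) (canopyDelta x) f := by
  choose P hP using fun k : ℕ => exists_polynomial_near f (K + 2 + |lam| * W)
    (Nat.one_div_pos_of_nat (α := ℝ) (n := k))
  refine measurable_of_tendsto_metrizable (fun k =>
    (measurable_kerPoly_canopy (K := K) (by omega) lam (P k) x).comp (measurable_truncate W)) ?_
  rw [tendsto_pi_nhds]
  intro w
  rw [tendsto_iff_dist_tendsto_zero]
  refine squeeze_zero (fun _ => dist_nonneg) (fun k => ?_)
    (tendsto_one_div_add_atTop_nhds_zero_nat (𝕜 := ℝ))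
  rw [dist_comm, Real.dist_eq]
  exact abs_spectralFunctional_canopy_sub_le hK lam hW (abs_truncate_le hW w) x f (P k)
    (Nat.one_div_pos_of_nat).le (hP k)

lemma isProbabilityMeasure_canopy (hK : 2 ≤ K) (lam : ℝ) {W : ℝ} (hW : 0 ≤ W) (x : CanopyVertex)
    (w : canopySites m₀ → ℝ) : IsProbabilityMeasure
      (spectralMeasureAt (canopyOperator K m₀ lam (truncate W w)) (canopyDelta x)) :=
  isProbabilityMeasure_spectralMeasureAt
    (isSelfAdjoint_canopyOperator hK lam (abs_truncate_le hW w)) (norm_canopyDelta x)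

/-- Closed intervals generate, and their measures are limits of integrals of trapezoids. -/
lemma measurable_spectralMeasureAt_canopy (hK : 2 ≤ K) (lam : ℝ) {W : ℝ} (hW : 0 ≤ W)
    (x : CanopyVertex) : Measurable fun w : canopySites m₀ → ℝ =>
      spectralMeasureAt (canopyOperator K m₀ lam (truncate W w)) (canopyDelta x) := by
  have hprob := isProbabilityMeasure_canopy (m₀ := m₀) hK lam hW x
  refine Measurable.measure_of_isPiSystem_of_isProbabilityMeasure
    (BorelSpace.measurable_eq.trans (borel_eq_generateFrom_Icc ℝ)) (isPiSystem_Icc id id) ?_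
  rintro _ ⟨a, b, -, rfl⟩
  refine measurable_of_tendsto_metrizable (f := fun (k : ℕ) w => ENNReal.ofReal
    (spectralFunctional (canopyOperator K m₀ lam (truncate W w)) (canopyDelta x)
      (trapezoid a b (1 / (k + 1)) Nat.one_div_pos_of_nat)))
    (fun k => (measurable_spectralFunctional_canopy hK lam hW x _).ennreal_ofReal) ?_
  rw [tendsto_pi_nhds]
  intro w
  have := hprob w
  refine tendsto_of_tendsto_of_tendsto_of_le_of_le tendsto_const_nhds
    (tendsto_measure_Icc_thicken _ a b) (fun k => ?_) (fun k => ?_)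
  · dsimp only
    rw [← integral_spectralMeasureAt]
    exact measure_Icc_le_trapezoid _ _
  · dsimp only
    rw [← integral_spectralMeasureAt]
    exact trapezoid_le_measure_Icc _ _

variable (ν : Measure ℝ) [IsProbabilityMeasure ν]

/-- The averaged spectral measure at the vertex `x`. -/
def meanSpectral (K m₀ : ℕ) (lam W : ℝ) (x : CanopyVertex) : Measure ℝ :=
  (Measure.infinitePi fun _ : canopySites m₀ => ν).bind fun w =>
    spectralMeasureAt (canopyOperator K m₀ lam (truncate W w)) (canopyDelta x)

lemma meanSpectral_apply (hK : 2 ≤ K) (lam : ℝ) {W : ℝ} (hW : 0 ≤ W) (x : CanopyVertex)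
    {B : Set ℝ} (hB : MeasurableSet B) :
    meanSpectral ν K m₀ lam W x B
      = ∫⁻ w, spectralMeasureAt (canopyOperator K m₀ lam (truncate W w)) (canopyDelta x) B
        ∂(Measure.infinitePi fun _ : canopySites m₀ => ν) :=
  Measure.bind_apply hB (measurable_spectralMeasureAt_canopy hK lam hW x).aemeasurable

/-- The density of states measure without its normalization. -/
def layerSum (K m₀ : ℕ) (lam W : ℝ) (xs : ℕ → CanopyVertex) : Measure ℝ :=
  Measure.sum fun n => ((K : ℝ≥0∞) ^ n)⁻¹ • meanSpectral ν K m₀ lam W (xs n)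

lemma densityOfStates_eq {ρ : ℝ → ℝ} [IsProbabilityMeasure (singleSiteLaw ρ)] (hK : 2 ≤ K)
    (lam : ℝ) {W : ℝ} (hW : 0 ≤ W) (hν : ∀ᵐ t ∂(singleSiteLaw ρ), |t| ≤ W)
    (xs : ℕ → CanopyVertex) {B : Set ℝ} (hB : MeasurableSet B) :
    densityOfStates K m₀ ρ lam xs B
      = ((((K : ℝ≥0∞) - 1) / K) • layerSum (singleSiteLaw ρ) K m₀ lam W xs) B := by
  rw [densityOfStates, Measure.smul_apply, layerSum, Measure.sum_apply _ hB, smul_eq_mul]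
  congr 1
  refine tsum_congr fun n => ?_
  rw [Measure.smul_apply, smul_eq_mul, meanSpectral_apply _ hK lam hW _ hB]
  refine congrArg (((K : ℝ≥0∞) ^ n)⁻¹ * ·) ?_
  refine lintegral_congr_ae ?_
  filter_upwards [ae_forall_abs_le (singleSiteLaw ρ) hν] with w hw
  rw [truncate_eq_self hw]

end DensityOfStates

/-! ### The density of states as a limit of eigenvalue counting functions -/

section DensityOfStatesLimit

set_option linter.unusedSectionVars false

variable {K m₀ : ℕ}

lemma card_treeFinset_le_pow (hK : 2 ≤ K) (R : ℕ) : (treeFinset K K R).card ≤ K ^ R := by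
  rw [card_treeFinset]
  simp only [genCard_self]
  exact (Nat.geomSum_lt hK fun k hk => Finset.mem_range.mp hk).le

lemma isProbabilityMeasure_meanSpectral (ν : Measure ℝ) [IsProbabilityMeasure ν] (hK : 2 ≤ K)
    (lam : ℝ) {W : ℝ} (hW : 0 ≤ W) (x : CanopyVertex) :
    IsProbabilityMeasure (meanSpectral ν K m₀ lam W x) := by
  have hprob := isProbabilityMeasure_canopy (m₀ := m₀) hK lam hW x
  constructor
  rw [meanSpectral_apply ν hK lam hW x MeasurableSet.univ]
  simp

variable (ν : Measure ℝ) [IsProbabilityMeasure ν]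

lemma spectralFunctional_trapezoid_mem (hK : 2 ≤ K) (lam : ℝ) {W : ℝ} (hW : 0 ≤ W)
    (x : CanopyVertex) (w : canopySites m₀ → ℝ) (a b : ℝ) {η : ℝ} (hη : 0 < η) :
    spectralFunctional (canopyOperator K m₀ lam (truncate W w)) (canopyDelta x)
      (trapezoid a b η hη) ∈ Set.Icc (0 : ℝ) 1 := by
  have := isProbabilityMeasure_canopy (m₀ := m₀) hK lam hW x w
  rw [← integral_spectralMeasureAt]
  refine ⟨integral_nonneg (trapezoid_nonneg hη), ?_⟩
  have h := norm_integral_le_of_norm_le_const (C := 1)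
    (μ := spectralMeasureAt (canopyOperator K m₀ lam (truncate W w)) (canopyDelta x))
    (f := fun t => trapezoid a b η hη t) (ae_of_all _ fun t => by
      rw [Real.norm_eq_abs, abs_of_nonneg (trapezoid_nonneg hη t)]; exact trapezoid_le_one hη t)
  rw [probReal_univ, mul_one] at h
  exact (le_abs_self _).trans h

/-- The average of `⟨δ_x, f(H) δ_x⟩` for a trapezoidal function `f`. -/
def meanTrapezoid (K m₀ : ℕ) (lam W : ℝ) (x : CanopyVertex) (a b η : ℝ) (hη : 0 < η) : ℝ :=
  ∫ w, spectralFunctional (canopyOperator K m₀ lam (truncate W w)) (canopyDelta x)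
      (trapezoid a b η hη) ∂(Measure.infinitePi fun _ : canopySites m₀ => ν)

lemma integrable_spectralFunctional_trapezoid (hK : 2 ≤ K) (lam : ℝ) {W : ℝ} (hW : 0 ≤ W)
    (x : CanopyVertex) (a b : ℝ) {η : ℝ} (hη : 0 < η) :
    Integrable (fun w => spectralFunctional (canopyOperator K m₀ lam (truncate W w)) (canopyDelta x)
      (trapezoid a b η hη)) (Measure.infinitePi fun _ : canopySites m₀ => ν) := by
  refine Integrable.of_bound (C := 1)
    (measurable_spectralFunctional_canopy hK lam hW x _).aestronglyMeasurable (ae_of_all _ fun w => ?_)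
  have h := spectralFunctional_trapezoid_mem (m₀ := m₀) hK lam hW x w a b hη
  rw [Real.norm_eq_abs, abs_of_nonneg h.1]
  exact h.2

lemma meanTrapezoid_mem (hK : 2 ≤ K) (lam : ℝ) {W : ℝ} (hW : 0 ≤ W) (x : CanopyVertex) (a b : ℝ)
    {η : ℝ} (hη : 0 < η) : meanTrapezoid ν K m₀ lam W x a b η hη ∈ Set.Icc (0 : ℝ) 1 := by
  have h := fun w => spectralFunctional_trapezoid_mem (m₀ := m₀) hK lam hW x w a b hη
  refine ⟨integral_nonneg fun w => (h w).1, ?_⟩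
  have h2 := integral_mono (integrable_spectralFunctional_trapezoid ν hK lam hW x a b hη)
    (integrable_const 1) fun w => (h w).2
  rw [integral_const, probReal_univ, one_smul] at h2
  exact h2

lemma ofReal_meanTrapezoid (hK : 2 ≤ K) (lam : ℝ) {W : ℝ} (hW : 0 ≤ W) (x : CanopyVertex) (a b : ℝ)
    {η : ℝ} (hη : 0 < η) : ENNReal.ofReal (meanTrapezoid ν K m₀ lam W x a b η hη)
      = ∫⁻ w, ENNReal.ofReal (spectralFunctional (canopyOperator K m₀ lam (truncate W w))
        (canopyDelta x) (trapezoid a b η hη)) ∂(Measure.infinitePi fun _ : canopySites m₀ => ν) :=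
  ofReal_integral_eq_lintegral_ofReal
    (integrable_spectralFunctional_trapezoid ν hK lam hW x a b hη)
    (ae_of_all _ fun w => (spectralFunctional_trapezoid_mem hK lam hW x w a b hη).1)

lemma meanSpectral_Icc_le (hK : 2 ≤ K) (lam : ℝ) {W : ℝ} (hW : 0 ≤ W) (x : CanopyVertex) (a b : ℝ)
    {η : ℝ} (hη : 0 < η) : meanSpectral ν K m₀ lam W x (Set.Icc a b)
      ≤ ENNReal.ofReal (meanTrapezoid ν K m₀ lam W x a b η hη) := by
  rw [meanSpectral_apply ν hK lam hW x measurableSet_Icc, ofReal_meanTrapezoid ν hK lam hW]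
  refine lintegral_mono fun w => ?_
  rw [← integral_spectralMeasureAt]
  exact measure_Icc_le_trapezoid _ _

lemma le_meanSpectral_Icc (hK : 2 ≤ K) (lam : ℝ) {W : ℝ} (hW : 0 ≤ W) (x : CanopyVertex) (a b : ℝ)
    {η : ℝ} (hη : 0 < η) : ENNReal.ofReal (meanTrapezoid ν K m₀ lam W x a b η hη)
      ≤ meanSpectral ν K m₀ lam W x (Set.Icc (a - η) (b + η)) := by
  rw [meanSpectral_apply ν hK lam hW x measurableSet_Icc, ofReal_meanTrapezoid ν hK lam hW]
  refine lintegral_mono fun w => ?_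
  rw [← integral_spectralMeasureAt]
  exact trapezoid_le_measure_Icc _ _

/-- The average of `⟨δ_x, P(H) δ_x⟩` for a polynomial `P` and a vertex `x` of the layer `n`. -/
def meanPoly (K m₀ : ℕ) (lam : ℝ) (P : Polynomial ℝ) (n : ℕ) : ℝ :=
  ∑ q ∈ Finset.range (P.natDegree + 1), P.coeff q * (canopyMoment ν K m₀ lam q n).re

lemma integrable_kerPow_canopy (hK : 2 ≤ K) (lam : ℝ) {W : ℝ} (hν : ∀ᵐ t ∂ν, |t| ≤ W) (q : ℕ)
    (x : CanopyVertex) : Integrable (fun w => kerPow (schrodingerKernel (canopyGraph K) lam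
      fun z => w (canopySite K m₀ z)) q x x) (Measure.infinitePi fun _ : canopySites m₀ => ν) := by
  refine Integrable.of_bound (C := (K + 2 + |lam| * W) ^ q) ?_ ?_
  · refine ((measurable_kerPow_canopy (by omega) lam q x x).comp ?_).aestronglyMeasurable
    fun_prop
  · filter_upwards [ae_forall_abs_le ν hν] with w hw
    exact norm_kerPow_le
      ((isBoundedKernel_canopy (by omega) lam fun x => hw _).mono (by linarith)) q _

lemma integral_kerPoly_canopy (hK : 2 ≤ K) (lam : ℝ) {W : ℝ} (hν : ∀ᵐ t ∂ν, |t| ≤ W)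
    (P : Polynomial ℝ) (x : CanopyVertex) :
    ∫ w, kerPoly (schrodingerKernel (canopyGraph K) lam fun z => w (canopySite K m₀ z)) P x
      ∂(Measure.infinitePi fun _ : canopySites m₀ => ν) = meanPoly ν K m₀ lam P x.1 := by
  unfold kerPoly meanPoly
  have hint := fun q => integrable_kerPow_canopy (m₀ := m₀) ν hK lam hν q x
  have hre : ∀ q, Integrable (fun w => (kerPow (schrodingerKernel (canopyGraph K) lam
      fun z => w (canopySite K m₀ z)) q x x).re)
      (Measure.infinitePi fun _ : canopySites m₀ => ν) := fun q => (hint q).re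
  rw [integral_finsetSum _ fun q _ => (hre q).const_mul _]
  refine Finset.sum_congr rfl fun q _ => ?_
  rw [integral_const_mul, ← integral_kerPow_canopy ν hK lam q x]
  congr 1
  exact Complex.reCLM.integral_comp_comm (hint q)

lemma abs_meanTrapezoid_sub_le (hK : 2 ≤ K) (lam : ℝ) {W : ℝ} (hW : 0 ≤ W)
    (hν : ∀ᵐ t ∂ν, |t| ≤ W) (x : CanopyVertex) (a b : ℝ) {η : ℝ} (hη : 0 < η) (P : Polynomial ℝ)
    {ε : ℝ} (hε : 0 ≤ ε) (h : ∀ t ∈ Set.Icc (-(K + 2 + |lam| * W)) (K + 2 + |lam| * W),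
      |trapezoid a b η hη t - P.eval t| ≤ ε) :
    |meanTrapezoid ν K m₀ lam W x a b η hη - meanPoly ν K m₀ lam P x.1| ≤ ε := by
  have hint : Integrable (fun w => kerPoly (schrodingerKernel (canopyGraph K) lam
      fun z => w (canopySite K m₀ z)) P x) (Measure.infinitePi fun _ : canopySites m₀ => ν) :=
    integrable_finsetSum _ fun q _ =>
      ((integrable_kerPow_canopy (m₀ := m₀) ν hK lam hν q x).re.const_mul _)
  rw [meanTrapezoid, ← integral_kerPoly_canopy ν hK lam hν, ← integral_sub
    (integrable_spectralFunctional_trapezoid ν hK lam hW x a b hη) hint, ← Real.norm_eq_abs]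
  refine (norm_integral_le_of_norm_le_const (C := ε) ?_).trans (by simp)
  filter_upwards [ae_forall_abs_le ν hν] with w hw
  rw [truncate_eq_self hw]
  exact abs_spectralFunctional_canopy_sub_le hK lam hW hw x _ P hε h

lemma summable_inv_pow (hK : 2 ≤ K) : Summable fun n : ℕ => ((K : ℝ) ^ n)⁻¹ := by
  simp only [← inv_pow]
  exact summable_geometric_of_lt_one (by positivity)
    (inv_lt_one_of_one_lt₀ (by exact_mod_cast (by omega : 1 < K)))

lemma tsum_inv_pow_le (hK : 2 ≤ K) : ∑' n : ℕ, ((K : ℝ) ^ n)⁻¹ ≤ 2 := by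
  have h2 : (2 : ℝ) ≤ K := by exact_mod_cast hK
  simp only [← inv_pow]
  rw [tsum_geometric_of_lt_one (by positivity) (inv_lt_one_of_one_lt₀ (by linarith))]
  rw [inv_le_comm₀ (by
    have : (K : ℝ)⁻¹ < 1 := inv_lt_one_of_one_lt₀ (by linarith)
    linarith) (by norm_num)]
  have : (K : ℝ)⁻¹ ≤ 2⁻¹ := inv_anti₀ (by norm_num) h2
  linarith

lemma summable_meanPoly (hK : 2 ≤ K) (lam : ℝ) {W : ℝ} (hν : ∀ᵐ t ∂ν, |t| ≤ W)
    (P : Polynomial ℝ) : Summable fun n : ℕ => ((K : ℝ) ^ n)⁻¹ * meanPoly ν K m₀ lam P n := by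
  unfold meanPoly
  simp only [Finset.mul_sum]
  refine summable_sum fun q _ => ?_
  refine Summable.of_norm_bounded (g := fun n => ((K : ℝ) ^ n)⁻¹ *
    (|P.coeff q| * (K + 2 + |lam| * W) ^ q)) ((summable_inv_pow hK).mul_right _) fun n => ?_
  rw [norm_mul, norm_mul, Real.norm_of_nonneg (by positivity : (0 : ℝ) ≤ ((K : ℝ) ^ n)⁻¹)]
  gcongr
  · exact le_rfl
  · exact (Complex.abs_re_le_norm _).trans (norm_canopyMoment_le ν hK lam hν q n)

lemma summable_meanTrapezoid (hK : 2 ≤ K) (lam : ℝ) {W : ℝ} (hW : 0 ≤ W) (xs : ℕ → CanopyVertex)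
    (a b : ℝ) {η : ℝ} (hη : 0 < η) :
    Summable fun n : ℕ => ((K : ℝ) ^ n)⁻¹ * meanTrapezoid ν K m₀ lam W (xs n) a b η hη := by
  refine Summable.of_norm_bounded (summable_inv_pow hK) fun n => ?_
  have h := meanTrapezoid_mem (m₀ := m₀) ν hK lam hW (xs n) a b hη
  rw [Real.norm_of_nonneg (mul_nonneg (by positivity) h.1)]
  exact mul_le_of_le_one_right (by positivity) h.2

/-- The unnormalized density of states of a trapezoidal function. -/
def layerTrapezoid (K m₀ : ℕ) (lam W : ℝ) (xs : ℕ → CanopyVertex) (a b η : ℝ) (hη : 0 < η) : ℝ :=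
  ∑' n : ℕ, ((K : ℝ) ^ n)⁻¹ * meanTrapezoid ν K m₀ lam W (xs n) a b η hη

lemma layerTrapezoid_nonneg (hK : 2 ≤ K) (lam : ℝ) {W : ℝ} (hW : 0 ≤ W) (xs : ℕ → CanopyVertex)
    (a b : ℝ) {η : ℝ} (hη : 0 < η) : 0 ≤ layerTrapezoid ν K m₀ lam W xs a b η hη :=
  tsum_nonneg fun n => mul_nonneg (by positivity) (meanTrapezoid_mem ν hK lam hW (xs n) a b hη).1

lemma ofReal_layerTrapezoid (hK : 2 ≤ K) (lam : ℝ) {W : ℝ} (hW : 0 ≤ W) (xs : ℕ → CanopyVertex)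
    (a b : ℝ) {η : ℝ} (hη : 0 < η) :
    ENNReal.ofReal (layerTrapezoid ν K m₀ lam W xs a b η hη) = ∑' n : ℕ, ((K : ℝ≥0∞) ^ n)⁻¹
      * ENNReal.ofReal (meanTrapezoid ν K m₀ lam W (xs n) a b η hη) := by
  rw [layerTrapezoid, ENNReal.ofReal_tsum_of_nonneg (fun n => mul_nonneg (by positivity)
    (meanTrapezoid_mem ν hK lam hW (xs n) a b hη).1) (summable_meanTrapezoid ν hK lam hW xs a b hη)]
  refine tsum_congr fun n => ?_
  have hpos : (0 : ℝ) < (K : ℝ) ^ n := by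
    have : 0 < K := by omega
    positivity
  rw [ENNReal.ofReal_mul (by positivity), ENNReal.ofReal_inv_of_pos hpos,
    ENNReal.ofReal_pow (by positivity), ENNReal.ofReal_natCast]

lemma layerSum_Icc_le (hK : 2 ≤ K) (lam : ℝ) {W : ℝ} (hW : 0 ≤ W) (xs : ℕ → CanopyVertex)
    (a b : ℝ) {η : ℝ} (hη : 0 < η) : layerSum ν K m₀ lam W xs (Set.Icc a b)
      ≤ ENNReal.ofReal (layerTrapezoid ν K m₀ lam W xs a b η hη) := by
  rw [ofReal_layerTrapezoid ν hK lam hW, layerSum, Measure.sum_apply _ measurableSet_Icc]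
  refine ENNReal.tsum_le_tsum fun n => ?_
  rw [Measure.smul_apply, smul_eq_mul]
  exact mul_le_mul_right (meanSpectral_Icc_le ν hK lam hW _ a b hη) _

lemma le_layerSum_Icc (hK : 2 ≤ K) (lam : ℝ) {W : ℝ} (hW : 0 ≤ W) (xs : ℕ → CanopyVertex)
    (a b : ℝ) {η : ℝ} (hη : 0 < η) : ENNReal.ofReal (layerTrapezoid ν K m₀ lam W xs a b η hη)
      ≤ layerSum ν K m₀ lam W xs (Set.Icc (a - η) (b + η)) := by
  rw [ofReal_layerTrapezoid ν hK lam hW, layerSum, Measure.sum_apply _ measurableSet_Icc]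
  refine ENNReal.tsum_le_tsum fun n => ?_
  rw [Measure.smul_apply, smul_eq_mul]
  exact mul_le_mul_right (le_meanSpectral_Icc ν hK lam hW _ a b hη) _

/-- The error is at most `ε` in each layer, and the weights `K^(-n)` have sum at most `2`. -/
lemma abs_layerTrapezoid_sub_le (hK : 2 ≤ K) (lam : ℝ) {W : ℝ} (hW : 0 ≤ W)
    (hν : ∀ᵐ t ∂ν, |t| ≤ W) {xs : ℕ → CanopyVertex} (hxs : ∀ n, (xs n).1 = n) (a b : ℝ) {η : ℝ}
    (hη : 0 < η) (P : Polynomial ℝ) {ε : ℝ} (hε : 0 ≤ ε)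
    (h : ∀ t ∈ Set.Icc (-(K + 2 + |lam| * W)) (K + 2 + |lam| * W),
      |trapezoid a b η hη t - P.eval t| ≤ ε) :
    |layerTrapezoid ν K m₀ lam W xs a b η hη
      - ∑' n : ℕ, ((K : ℝ) ^ n)⁻¹ * meanPoly ν K m₀ lam P n| ≤ 2 * ε := by
  rw [layerTrapezoid, ← (summable_meanTrapezoid ν hK lam hW xs a b hη).tsum_sub
    (summable_meanPoly ν hK lam hν P), ← Real.norm_eq_abs]
  refine (tsum_of_norm_bounded ((summable_inv_pow hK).mul_right ε).hasSum fun n => ?_).trans ?_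
  · rw [← mul_sub, norm_mul, Real.norm_of_nonneg (by positivity)]
    refine mul_le_mul_of_nonneg_left ?_ (by positivity)
    have h1 := abs_meanTrapezoid_sub_le (m₀ := m₀) ν hK lam hW hν (xs n) a b hη P hε h
    rwa [hxs] at h1
  · rw [tsum_mul_right]
    exact mul_le_mul_of_nonneg_right (tsum_inv_pow_le hK) hε

/-! #### Finite trees -/

/-- The operator on the tree with `R` generations, as a function of the random variables. -/
abbrev treeOp (κ K p R : ℕ) (lam : ℝ) (w : ℕ × ℕ → ℝ) :
    Matrix (treeFinset κ K R) (treeFinset κ K R) ℂ :=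
  treeHam κ K R lam fun x => w (treeSite K p x)

lemma treeOp_isHermitian (κ K p R : ℕ) (lam : ℝ) (w : ℕ × ℕ → ℝ) :
    (treeOp κ K p R lam w).IsHermitian := treeHam_isHermitian κ K R lam _

lemma integrable_sum_eval (hK : 2 ≤ K) (lam : ℝ) {W : ℝ} (hν : ∀ᵐ t ∂ν, |t| ≤ W) (p R : ℕ)
    (P : Polynomial ℝ) :
    Integrable (fun w => ∑ i, P.eval ((treeOp_isHermitian K K p R lam w).eigenvalues i))
      (Measure.infinitePi fun _ : ℕ × ℕ => ν) := by
  simp only [sum_eval_eigenvalues]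
  have htr : ∀ q, Integrable (fun w => (treeOp K K p R lam w ^ q).trace)
      (Measure.infinitePi fun _ : ℕ × ℕ => ν) := fun q => integrable_finsetSum _ fun x _ =>
    integrable_pow_treeHam ν (by omega) (by omega) lam hν q x
  have hre : ∀ q, Integrable (fun w => ((treeOp K K p R lam w ^ q).trace).re)
      (Measure.infinitePi fun _ : ℕ × ℕ => ν) := fun q => (htr q).re
  exact integrable_finsetSum _ fun q _ => (hre q).const_mul _

/-- The density of states of the canopy tree as a limit of finite trees, per leaf, tested on
polynomials. Intervals follow by polynomial approximation of trapezoids. -/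
lemma tendsto_integral_sum_eval (hK : 2 ≤ K) (lam : ℝ) {W : ℝ} (hν : ∀ᵐ t ∂ν, |t| ≤ W)
    (P : Polynomial ℝ) :
    Tendsto (fun A : ℕ => ((K : ℝ) ^ ((m₀ + 1) * A - 1))⁻¹ *
      ∫ w, ∑ i, P.eval ((treeOp_isHermitian K K (m₀ + 1) ((m₀ + 1) * A) lam w).eigenvalues i)
        ∂(Measure.infinitePi fun _ : ℕ × ℕ => ν)) atTop
      (𝓝 (∑' n : ℕ, ((K : ℝ) ^ n)⁻¹ * meanPoly ν K m₀ lam P n)) := by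
  have hint : ∀ (q : ℕ) (A : ℕ), Integrable (fun w =>
      (treeOp K K (m₀ + 1) ((m₀ + 1) * A) lam w ^ q).trace)
      (Measure.infinitePi fun _ : ℕ × ℕ => ν) := fun q A =>
    integrable_finsetSum _ fun x _ =>
      integrable_pow_treeHam ν (by omega) (by omega) lam hν q x
  have h1 : ∀ A : ℕ, ((K : ℝ) ^ ((m₀ + 1) * A - 1))⁻¹ *
      ∫ w, ∑ i, P.eval ((treeOp_isHermitian K K (m₀ + 1) ((m₀ + 1) * A) lam w).eigenvalues i)
        ∂(Measure.infinitePi fun _ : ℕ × ℕ => ν)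
      = ∑ q ∈ Finset.range (P.natDegree + 1), P.coeff q *
        (((K : ℂ) ^ ((m₀ + 1) * A - 1))⁻¹ *
          ∫ w, (treeOp K K (m₀ + 1) ((m₀ + 1) * A) lam w ^ q).trace
            ∂(Measure.infinitePi fun _ : ℕ × ℕ => ν)).re := by
    intro A
    have hre : ∀ q, Integrable (fun w =>
        ((treeOp K K (m₀ + 1) ((m₀ + 1) * A) lam w ^ q).trace).re)
        (Measure.infinitePi fun _ : ℕ × ℕ => ν) := fun q => (hint q A).re
    simp only [sum_eval_eigenvalues]
    rw [integral_finsetSum _ fun q _ => (hre q).const_mul _, Finset.mul_sum]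
    refine Finset.sum_congr rfl fun q _ => ?_
    have h2 : ((K : ℂ) ^ ((m₀ + 1) * A - 1))⁻¹ = (((K : ℝ) ^ ((m₀ + 1) * A - 1))⁻¹ : ℝ) := by
      push_cast; rfl
    rw [integral_const_mul, h2, Complex.re_ofReal_mul, mul_left_comm]
    congr 2
    exact Complex.reCLM.integral_comp_comm (hint q A)
  have h3 : ∑' n : ℕ, ((K : ℝ) ^ n)⁻¹ * meanPoly ν K m₀ lam P n
      = ∑ q ∈ Finset.range (P.natDegree + 1), P.coeff q *
        (∑' n : ℕ, ((K : ℂ) ^ n)⁻¹ * canopyMoment ν K m₀ lam q n).re := by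
    have hs : ∀ q, Summable fun n : ℕ => ((K : ℂ) ^ n)⁻¹ * canopyMoment ν K m₀ lam q n := by
      intro q
      refine Summable.of_norm_bounded (g := fun n => ((K : ℝ) ^ n)⁻¹ *
        (K + 2 + |lam| * W) ^ q) ((summable_inv_pow hK).mul_right _) fun n => ?_
      rw [norm_mul, norm_inv, norm_pow, Complex.norm_natCast]
      gcongr
      exact norm_canopyMoment_le ν hK lam hν q n
    have hre : ∀ q, Summable fun n : ℕ =>
        P.coeff q * (((K : ℂ) ^ n)⁻¹ * canopyMoment ν K m₀ lam q n).re := fun q =>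
      (Complex.hasSum_re (hs q).hasSum).summable.mul_left _
    have h4 : ∀ q, P.coeff q * (∑' n : ℕ, ((K : ℂ) ^ n)⁻¹ * canopyMoment ν K m₀ lam q n).re
        = ∑' n : ℕ, P.coeff q * (((K : ℂ) ^ n)⁻¹ * canopyMoment ν K m₀ lam q n).re := by
      intro q
      rw [Complex.re_tsum (hs q), tsum_mul_left]
    simp only [h4]
    rw [← Summable.tsum_finsetSum fun q _ => hre q]
    refine tsum_congr fun n => ?_
    rw [meanPoly, Finset.mul_sum]
    refine Finset.sum_congr rfl fun q _ => ?_
    have h2 : ((K : ℂ) ^ n)⁻¹ = (((K : ℝ) ^ n)⁻¹ : ℝ) := by push_cast; rfl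
    rw [h2, Complex.re_ofReal_mul, mul_left_comm]
  simp only [h1, h3]
  refine tendsto_finsetSum _ fun q _ => Tendsto.const_mul _ ?_
  exact (Complex.continuous_re.tendsto _).comp (tendsto_trace_pow ν hK lam hν q)

lemma measurable_eigCount_treeOp {κ p R : ℕ} (lam : ℝ) {B : Set ℝ} (hB : MeasurableSet B) :
    Measurable fun w => eigCount (treeOp κ K p R lam w) B :=
  measurable_eigCount_comp (treeHop_isHermitian κ K R) lam (fun x => treeSite K p x) hB

lemma integrable_eigCount_treeOp {κ p R : ℕ} (lam : ℝ) {B : Set ℝ} (hB : MeasurableSet B) :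
    Integrable (fun w => (eigCount (treeOp κ K p R lam w) B : ℝ))
      (Measure.infinitePi fun _ : ℕ × ℕ => ν) := by
  refine Integrable.of_bound (C := (treeFinset κ K R).card) ?_ (ae_of_all _ fun w => ?_)
  · exact (measurable_from_nat.comp (measurable_eigCount_treeOp lam hB)).aestronglyMeasurable
  · rw [Real.norm_natCast]
    have := eigCount_le_card (treeOp_isHermitian κ K p R lam w) B
    rw [Fintype.card_coe] at this
    exact_mod_cast this

lemma lintegral_eigCount_treeOp {κ p R : ℕ} (lam : ℝ) {B : Set ℝ} (hB : MeasurableSet B) :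
    ∫⁻ w, (eigCount (treeOp κ K p R lam w) B : ℝ≥0∞) ∂(Measure.infinitePi fun _ : ℕ × ℕ => ν)
      = ENNReal.ofReal (∫ w, (eigCount (treeOp κ K p R lam w) B : ℝ)
          ∂(Measure.infinitePi fun _ : ℕ × ℕ => ν)) := by
  rw [ofReal_integral_eq_lintegral_ofReal (integrable_eigCount_treeOp ν lam hB)
    (ae_of_all _ fun w => Nat.cast_nonneg _)]
  simp

lemma ae_abs_eigenvalues_le (hK : 2 ≤ K) (lam : ℝ) {W : ℝ} (hν : ∀ᵐ t ∂ν, |t| ≤ W) (p R : ℕ) :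
    ∀ᵐ w ∂(Measure.infinitePi fun _ : ℕ × ℕ => ν), ∀ i,
      (treeOp_isHermitian K K p R lam w).eigenvalues i
        ∈ Set.Icc (-(K + 2 + |lam| * W)) (K + 2 + |lam| * W) := by
  filter_upwards [ae_forall_abs_le ν hν] with w hw i
  exact abs_le.mp (abs_eigenvalues_le _
    (isBoundedKernel_treeHam (by omega) (by omega) lam fun x => hw _) i)

/-- Upper bound for the number of eigenvalues of a large tree in an interval. -/
lemma eventually_lintegral_eigCount_le (hK : 2 ≤ K) (lam : ℝ) {W : ℝ} (hW : 0 ≤ W)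
    (hν : ∀ᵐ t ∂ν, |t| ≤ W) {xs : ℕ → CanopyVertex} (hxs : ∀ n, (xs n).1 = n) (a b : ℝ) {η : ℝ}
    (hη : 0 < η) {ε : ℝ} (hε : 0 < ε) :
    ∀ᶠ A : ℕ in atTop, ∫⁻ w, (eigCount (treeOp K K (m₀ + 1) ((m₀ + 1) * A) lam w) (Set.Icc a b) : ℝ≥0∞)
        ∂(Measure.infinitePi fun _ : ℕ × ℕ => ν)
      ≤ ENNReal.ofReal ((K : ℝ) ^ ((m₀ + 1) * A - 1)) *
        (layerSum ν K m₀ lam W xs (Set.Icc (a - η) (b + η)) + ENNReal.ofReal ε) := by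
  have hKpos : (0 : ℝ) < K := by exact_mod_cast (by omega : 0 < K)
  -- Two units of error come from the layer sum, one from the limit, and `K` from the polynomial
  -- approximation at the at most `K ^ R = K * K ^ (R - 1)` eigenvalues.
  set ε' := ε / (K + 3) with hε'
  have hε'0 : 0 < ε' := by positivity
  obtain ⟨P, hP⟩ := exists_polynomial_near (trapezoid a b η hη) (K + 2 + |lam| * W) hε'0
  have h1 := tendsto_integral_sum_eval (m₀ := m₀) ν hK lam hν P
  have h2 := abs_layerTrapezoid_sub_le (m₀ := m₀) ν hK lam hW hν hxs a b hη P hε'0.le hP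
  have h3 : ∑' n : ℕ, ((K : ℝ) ^ n)⁻¹ * meanPoly ν K m₀ lam P n
      < layerTrapezoid ν K m₀ lam W xs a b η hη + 3 * ε' := by
    have := (abs_le.mp h2).1
    linarith
  filter_upwards [h1.eventually_lt_const h3, eventually_ge_atTop 1] with A hA hA1
  set R := (m₀ + 1) * A with hR
  have hR1 : 1 ≤ R := Nat.mul_pos (Nat.succ_pos m₀) hA1
  have hpow : (0 : ℝ) < (K : ℝ) ^ (R - 1) := by positivity
  have hle : ∫ w, (eigCount (treeOp K K (m₀ + 1) R lam w) (Set.Icc a b) : ℝ)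
      ∂(Measure.infinitePi fun _ : ℕ × ℕ => ν)
      ≤ (∫ w, ∑ i, P.eval ((treeOp_isHermitian K K (m₀ + 1) R lam w).eigenvalues i)
        ∂(Measure.infinitePi fun _ : ℕ × ℕ => ν)) + ε' * K ^ R := by
    have h4 : ∫ w, (eigCount (treeOp K K (m₀ + 1) R lam w) (Set.Icc a b) : ℝ)
        ∂(Measure.infinitePi fun _ : ℕ × ℕ => ν)
        ≤ ∫ w, (∑ i, P.eval ((treeOp_isHermitian K K (m₀ + 1) R lam w).eigenvalues i)
        + ε' * K ^ R) ∂(Measure.infinitePi fun _ : ℕ × ℕ => ν) := by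
      refine integral_mono_ae (integrable_eigCount_treeOp ν lam measurableSet_Icc)
        ((integrable_sum_eval ν hK lam hν _ _ P).add (integrable_const _)) ?_
      filter_upwards [ae_abs_eigenvalues_le ν hK lam hν (m₀ + 1) R] with w hw
      rw [eigCount_eq_sum (treeOp_isHermitian K K (m₀ + 1) R lam w)]
      push_cast
      have h5 : ∀ i, (if (treeOp_isHermitian K K (m₀ + 1) R lam w).eigenvalues i ∈ Set.Icc a b
          then (1 : ℝ) else 0)
          ≤ P.eval ((treeOp_isHermitian K K (m₀ + 1) R lam w).eigenvalues i) + ε' := by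
        intro i
        have h6 := (abs_le.mp (hP _ (hw i))).2
        have h7 := indicator_le_trapezoid (a := a) (b := b) hη
          ((treeOp_isHermitian K K (m₀ + 1) R lam w).eigenvalues i)
        linarith
      refine (Finset.sum_le_sum fun i _ => h5 i).trans ?_
      rw [Finset.sum_add_distrib, Finset.sum_const, nsmul_eq_mul, Finset.card_univ,
        Fintype.card_coe, mul_comm _ ε']
      have h8 : ((treeFinset K K R).card : ℝ) ≤ (K : ℝ) ^ R := by
        exact_mod_cast card_treeFinset_le_pow hK R
      gcongr
    rwa [integral_add (integrable_sum_eval ν hK lam hν _ _ P) (integrable_const _),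
      integral_const, probReal_univ, one_smul] at h4
  have hKR : (K : ℝ) ^ R = K ^ (R - 1) * K := by
    rw [← pow_succ, Nat.sub_add_cancel hR1]
  rw [inv_mul_lt_iff₀ hpow] at hA
  rw [lintegral_eigCount_treeOp ν lam measurableSet_Icc]
  calc _ ≤ ENNReal.ofReal ((K : ℝ) ^ (R - 1)
        * (layerTrapezoid ν K m₀ lam W xs a b η hη + ε)) := by
        refine ENNReal.ofReal_le_ofReal (hle.trans ?_)
        rw [hKR]
        have h9 : (K + 3) * ε' = ε := by rw [hε']; field_simp
        have h10 : (K : ℝ) ^ (R - 1) * (layerTrapezoid ν K m₀ lam W xs a b η hη + ε)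
          = K ^ (R - 1) * (layerTrapezoid ν K m₀ lam W xs a b η hη + 3 * ε')
            + ε' * (K ^ (R - 1) * K) := by rw [← h9]; ring
        rw [h10]
        linarith
    _ = _ * (ENNReal.ofReal (layerTrapezoid ν K m₀ lam W xs a b η hη) + ENNReal.ofReal ε) := by
        rw [ENNReal.ofReal_mul hpow.le,
          ENNReal.ofReal_add (layerTrapezoid_nonneg ν hK lam hW xs a b hη) hε.le]
    _ ≤ _ := by
        gcongr
        exact le_layerSum_Icc ν hK lam hW xs a b hη

/-- A bound for the number of eigenvalues of large trees is a bound for the density of states. -/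
lemma layerSum_Icc_le_of_forall (hK : 2 ≤ K) (lam : ℝ) {W : ℝ} (hW : 0 ≤ W)
    (hν : ∀ᵐ t ∂ν, |t| ≤ W) {xs : ℕ → CanopyVertex} (hxs : ∀ n, (xs n).1 = n) (a b : ℝ) {η : ℝ}
    (hη : 0 < η) {X : ℝ} (hX : 0 ≤ X)
    (h : ∀ A : ℕ, 1 ≤ A → ∫⁻ w, (eigCount (treeOp K K (m₀ + 1) ((m₀ + 1) * A) lam w)
        (Set.Icc (a - η) (b + η)) : ℝ≥0∞) ∂(Measure.infinitePi fun _ : ℕ × ℕ => ν)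
      ≤ ENNReal.ofReal ((K : ℝ) ^ ((m₀ + 1) * A - 1) * X)) :
    layerSum ν K m₀ lam W xs (Set.Icc a b) ≤ ENNReal.ofReal X := by
  have hKpos : (0 : ℝ) < K := by exact_mod_cast (by omega : 0 < K)
  refine (layerSum_Icc_le ν hK lam hW xs a b hη).trans (ENNReal.ofReal_le_ofReal ?_)
  refine le_of_forall_pos_le_add fun ε hε => ?_
  -- Two units come from the layer sum and `K` from the approximation at the eigenvalues; the
  -- passage to the limit is a weak inequality and costs nothing.
  set ε' := ε / (K + 2) with hε'
  have hε'0 : 0 < ε' := by positivity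
  obtain ⟨P, hP⟩ := exists_polynomial_near (trapezoid a b η hη) (K + 2 + |lam| * W) hε'0
  have h2 := abs_layerTrapezoid_sub_le (m₀ := m₀) ν hK lam hW hν hxs a b hη P hε'0.le hP
  have h3 : ∑' n : ℕ, ((K : ℝ) ^ n)⁻¹ * meanPoly ν K m₀ lam P n ≤ X + K * ε' := by
    refine le_of_tendsto (tendsto_integral_sum_eval (m₀ := m₀) ν hK lam hν P) ?_
    filter_upwards [eventually_ge_atTop 1] with A hA1
    have hA := h A hA1
    set R := (m₀ + 1) * A with hR
    have hR1 : 1 ≤ R := Nat.mul_pos (Nat.succ_pos m₀) hA1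
    have hpow : (0 : ℝ) < (K : ℝ) ^ (R - 1) := by positivity
    have hKR : (K : ℝ) ^ R = K ^ (R - 1) * K := by
      rw [← pow_succ, Nat.sub_add_cancel hR1]
    rw [lintegral_eigCount_treeOp ν lam measurableSet_Icc,
      ENNReal.ofReal_le_ofReal_iff (by positivity)] at hA
    rw [inv_mul_le_iff₀ hpow]
    have h4 : ∫ w, ∑ i, P.eval ((treeOp_isHermitian K K (m₀ + 1) R lam w).eigenvalues i)
        ∂(Measure.infinitePi fun _ : ℕ × ℕ => ν)
        ≤ ∫ w, ((eigCount (treeOp K K (m₀ + 1) R lam w) (Set.Icc (a - η) (b + η)) : ℝ)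
        + ε' * K ^ R) ∂(Measure.infinitePi fun _ : ℕ × ℕ => ν) := by
      refine integral_mono_ae (integrable_sum_eval ν hK lam hν _ _ P)
        ((integrable_eigCount_treeOp ν lam measurableSet_Icc).add (integrable_const _)) ?_
      filter_upwards [ae_abs_eigenvalues_le ν hK lam hν (m₀ + 1) R] with w hw
      rw [eigCount_eq_sum (treeOp_isHermitian K K (m₀ + 1) R lam w)]
      push_cast
      have h5 : ∀ i, P.eval ((treeOp_isHermitian K K (m₀ + 1) R lam w).eigenvalues i)
          ≤ (if (treeOp_isHermitian K K (m₀ + 1) R lam w).eigenvalues i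
            ∈ Set.Icc (a - η) (b + η) then (1 : ℝ) else 0) + ε' := by
        intro i
        have h6 := (abs_le.mp (hP _ (hw i))).1
        have h7 := trapezoid_le_indicator (a := a) (b := b) hη
          ((treeOp_isHermitian K K (m₀ + 1) R lam w).eigenvalues i)
        linarith
      refine (Finset.sum_le_sum fun i _ => h5 i).trans ?_
      rw [Finset.sum_add_distrib, Finset.sum_const, nsmul_eq_mul, Finset.card_univ,
        Fintype.card_coe, mul_comm _ ε']
      have h8 : ((treeFinset K K R).card : ℝ) ≤ (K : ℝ) ^ R := by
        exact_mod_cast card_treeFinset_le_pow hK R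
      gcongr
    rw [integral_add (integrable_eigCount_treeOp ν lam measurableSet_Icc) (integrable_const _),
      integral_const, probReal_univ, one_smul, hKR] at h4
    refine h4.trans ?_
    calc _ ≤ (K : ℝ) ^ (R - 1) * X + ε' * (K ^ (R - 1) * K) := by gcongr
      _ = _ := by ring
  have h9 : (K + 2) * ε' = ε := by rw [hε']; field_simp
  have h10 := (abs_le.mp h2).2
  calc layerTrapezoid ν K m₀ lam W xs a b η hη ≤ (X + K * ε') + 2 * ε' := by linarith
    _ = X + (K + 2) * ε' := by ring
    _ = X + ε := by rw [h9]

end DensityOfStatesLimit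

/-! ### Absolute continuity of the density of states -/

section AbsoluteContinuity

set_option linter.unusedSectionVars false

/-- On the line closed balls are closed intervals, and the covering theorem of Besicovitch extends
the bound from balls to all sets. -/
lemma measure_le_of_forall_Icc {n : Measure ℝ} [IsFiniteMeasure n] {c : NNReal}
    (h : ∀ a b : ℝ, a ≤ b → n (Set.Icc a b) ≤ c * ENNReal.ofReal (b - a)) : n ≤ c • volume := by
  intro s
  refine (Besicovitch.vitaliFamily n).measure_le_of_frequently_le (c • volume)
    Measure.AbsolutelyContinuous.rfl s fun x _ => ?_
  have h1 := (Besicovitch.tendsto_filterAt n x).frequently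
    (p := fun a => n a ≤ (c • volume : Measure ℝ) a)
  refine h1 (Eventually.frequently ?_)
  filter_upwards [self_mem_nhdsWithin] with r hr
  have hr' : (0 : ℝ) < r := hr
  rw [Real.closedBall_eq_Icc, Measure.smul_apply, Real.volume_Icc]
  exact h _ _ (by linarith)

lemma densityAt_le {n : Measure ℝ} {c : NNReal}
    (h : ∀ a b : ℝ, a ≤ b → n (Set.Icc a b) ≤ c * ENNReal.ofReal (b - a)) (E : ℝ) :
    densityAt (fun B => n B) E ≤ c := by
  refine iSup_le fun a => iSup_le fun b => iSup_le fun hab => ?_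
  refine limsup_le_of_le (by isBoundedDefault) ?_
  filter_upwards [self_mem_nhdsWithin] with r hr
  have hr' : (0 : ℝ) < r := hr
  refine ENNReal.div_le_of_le_mul ?_
  refine (h _ _ (by nlinarith)).trans (le_of_eq ?_)
  congr 2
  ring

/-- Lebesgue differentiation along intervals that need not contain `E`: the interval `[E + ε a, E +
ε b]` belongs to the Vitali family with parameter `k` once `k ≥ |a + b| / (b - a)`. Only countably
many `k` occur, so one null set serves for all `a < b`. -/
lemma tendsto_densityAt_aux {n : Measure ℝ} [IsFiniteMeasure n] :
    ∀ᵐ E : ℝ, ∀ a b : ℝ, a < b → Tendsto (fun ε : ℝ =>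
      n (Set.Icc (E + ε * a) (E + ε * b)) / ENNReal.ofReal (ε * (b - a))) (𝓝[>] (0 : ℝ))
        (𝓝 (n.rnDeriv volume E)) := by
  have h : ∀ᵐ E : ℝ, ∀ k : ℕ, Tendsto (fun a => n a / volume a)
      ((IsUnifLocDoublingMeasure.vitaliFamily (volume : Measure ℝ) k).filterAt E)
      (𝓝 (n.rnDeriv volume E)) := ae_all_iff.mpr fun k =>
    (IsUnifLocDoublingMeasure.vitaliFamily (volume : Measure ℝ) k).ae_tendsto_rnDeriv n
  filter_upwards [h] with E hE a b hab
  obtain ⟨k, hk⟩ := exists_nat_ge (|a + b| / (b - a))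
  have hba : 0 < b - a := by linarith
  rw [div_le_iff₀ hba] at hk
  have h1 := (hE k).comp (IsUnifLocDoublingMeasure.tendsto_closedBall_filterAt volume
    (K := k) (x := E) (l := 𝓝[>] (0 : ℝ)) (fun ε : ℝ => E + ε * ((a + b) / 2))
    (fun ε : ℝ => ε * ((b - a) / 2)) ?_ ?_)
  · refine h1.congr' ?_
    filter_upwards [self_mem_nhdsWithin] with r hr
    have hr' : (0 : ℝ) < r := hr
    have h2 : Metric.closedBall (E + r * ((a + b) / 2)) (r * ((b - a) / 2))
        = Set.Icc (E + r * a) (E + r * b) := by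
      rw [Real.closedBall_eq_Icc]; congr 1 <;> ring
    simp only [Function.comp_apply]
    rw [h2, Real.volume_Icc]
    congr 2
    ring
  · refine tendsto_nhdsWithin_iff.mpr ⟨?_, ?_⟩
    · have : Tendsto (fun ε : ℝ => ε * ((b - a) / 2)) (𝓝 0) (𝓝 (0 * ((b - a) / 2))) :=
        tendsto_id.mul_const _
      rw [zero_mul] at this
      exact this.mono_left nhdsWithin_le_nhds
    · filter_upwards [self_mem_nhdsWithin] with r hr
      have hr' : (0 : ℝ) < r := hr
      exact mul_pos hr' (by linarith)
  · filter_upwards [self_mem_nhdsWithin] with r hr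
    have hr' : (0 : ℝ) < r := hr
    rw [Metric.mem_closedBall, Real.dist_eq]
    have h2 : |E - (E + r * ((a + b) / 2))| = r * (|a + b| / 2) := by
      rw [show E - (E + r * ((a + b) / 2)) = -(r * ((a + b) / 2)) by ring, abs_neg, abs_mul,
        abs_of_pos hr', abs_div, abs_two]
    rw [h2]
    nlinarith

lemma densityAt_ae_eq_rnDeriv {n : Measure ℝ} [IsFiniteMeasure n] :
    (densityAt fun B => n B) =ᵐ[volume] n.rnDeriv volume := by
  filter_upwards [tendsto_densityAt_aux (n := n)] with E hE
  refine le_antisymm ?_ ?_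
  · refine iSup_le fun a => iSup_le fun b => iSup_le fun hab => ?_
    exact (hE a b hab).limsup_eq.le
  · refine le_iSup_of_le 0 (le_iSup_of_le 1 (le_iSup_of_le one_pos ?_))
    exact (hE 0 1 one_pos).limsup_eq.ge

lemma measure_eq_lintegral_densityAt {n : Measure ℝ} [IsFiniteMeasure n] (h : n ≪ volume)
    {B : Set ℝ} (hB : MeasurableSet B) : n B = ∫⁻ E in B, densityAt (fun B => n B) E := by
  rw [lintegral_congr_ae (ae_restrict_of_ae densityAt_ae_eq_rnDeriv),
    ← withDensity_apply _ hB, Measure.withDensity_rnDeriv_eq _ _ h]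

variable {K m₀ : ℕ} (ν : Measure ℝ) [IsProbabilityMeasure ν]

lemma isFiniteMeasure_layerSum (hK : 2 ≤ K) (lam : ℝ) {W : ℝ} (hW : 0 ≤ W)
    (xs : ℕ → CanopyVertex) : IsFiniteMeasure (layerSum ν K m₀ lam W xs) := by
  constructor
  rw [layerSum, Measure.sum_apply _ MeasurableSet.univ]
  have h1 : ∀ n, (((K : ℝ≥0∞) ^ n)⁻¹ • meanSpectral ν K m₀ lam W (xs n)) Set.univ
      = ENNReal.ofReal (((K : ℝ) ^ n)⁻¹) := by
    intro n
    have := isProbabilityMeasure_meanSpectral (m₀ := m₀) ν hK lam hW (xs n)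
    have hpos : (0 : ℝ) < (K : ℝ) ^ n := by
      have : 0 < K := by omega
      positivity
    rw [Measure.smul_apply, measure_univ, smul_eq_mul, mul_one, ENNReal.ofReal_inv_of_pos hpos,
      ENNReal.ofReal_pow (by positivity), ENNReal.ofReal_natCast]
  simp only [h1]
  rw [← ENNReal.ofReal_tsum_of_nonneg (fun n => by positivity) (summable_inv_pow hK)]
  exact ENNReal.ofReal_lt_top

/-- Wegner's estimate on finite trees, divided by the number of leaves, is uniform in the size of
the tree and survives the limit. The factor `K` bounds the number of vertices per leaf. -/
lemma layerSum_Icc_le_length (hK : 2 ≤ K) {lam : ℝ} (hlam : 0 < lam) {W : ℝ} (hW : 0 ≤ W)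
    (hνW : ∀ᵐ t ∂ν, |t| ≤ W) {xs : ℕ → CanopyVertex} (hxs : ∀ n, (xs n).1 = n) {C : NNReal}
    (hν : ν ≤ C • volume) {M : ℕ} (hM : ∀ A : ℕ,
      BlockCardLE (fun x : treeFinset K K ((m₀ + 1) * A) => treeSite K (m₀ + 1) x.1) M) {a b : ℝ}
    (hab : a ≤ b) : layerSum ν K m₀ lam W xs (Set.Icc a b)
      ≤ ((K * (C * (M * lam.toNNReal⁻¹)) : NNReal) : ℝ≥0∞) * ENNReal.ofReal (b - a) := by
  have key : ∀ η : ℝ, 0 < η → layerSum ν K m₀ lam W xs (Set.Icc a b)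
      ≤ ENNReal.ofReal (K * (C * (M * lam⁻¹)) * (b - a + 2 * η)) := by
    intro η hη
    refine layerSum_Icc_le_of_forall ν hK lam hW hνW hxs a b hη
      (mul_nonneg (by positivity) (by linarith)) fun A hA => ?_
    refine (lintegral_eigCount_Icc_le ν (treeHop_isHermitian K K _) hlam (hM A) hν
      (by linarith)).trans ?_
    have h1 : (Fintype.card (treeFinset K K ((m₀ + 1) * A)) : ℝ≥0∞)
        ≤ ENNReal.ofReal ((K : ℝ) ^ ((m₀ + 1) * A - 1) * K) := by
      rw [← pow_succ, Nat.sub_add_cancel (Nat.mul_pos (by omega) hA), Fintype.card_coe,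
        ← Nat.cast_pow, ENNReal.ofReal_natCast]
      exact_mod_cast card_treeFinset_le_pow hK _
    have h2 : (C : ℝ≥0∞) * (M * ENNReal.ofReal ((b + η - (a - η)) / lam))
        = ENNReal.ofReal (C * (M * ((b - a + 2 * η) / lam))) := by
      rw [ENNReal.ofReal_mul (by positivity), ENNReal.ofReal_mul (by positivity),
        ENNReal.ofReal_coe_nnreal, ENNReal.ofReal_natCast]
      congr 4
      ring
    rw [h2]
    refine (mul_le_mul_left h1 _).trans (le_of_eq ?_)
    rw [← ENNReal.ofReal_mul (by positivity)]
    congr 1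
    ring
  have hlim : Tendsto (fun η : ℝ => ENNReal.ofReal (K * (C * (M * lam⁻¹)) * (b - a + 2 * η)))
      (𝓝[>] 0) (𝓝 (ENNReal.ofReal (K * (C * (M * lam⁻¹)) * (b - a)))) := by
    refine ENNReal.tendsto_ofReal (tendsto_nhdsWithin_of_tendsto_nhds ?_)
    have : Continuous fun η : ℝ => (K : ℝ) * (C * (M * lam⁻¹)) * (b - a + 2 * η) := by fun_prop
    simpa using this.tendsto 0
  refine (ge_of_tendsto hlim (by filter_upwards [self_mem_nhdsWithin] with η hη using key η hη)).trans
    (le_of_eq ?_)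
  rw [ENNReal.ofReal_mul (by positivity)]
  congr 1
  rw [← ENNReal.ofReal_coe_nnreal]
  congr 1
  push_cast
  rw [Real.coe_toNNReal _ hlam.le]

end AbsoluteContinuity

/-! ### The Bethe lattice as a coordinate tree -/

section BetheCoordinates

set_option linter.unusedSectionVars false

variable {K m₀ : ℕ}

/-- The coordinates of a vertex. -/
def betheCoord (x : BetheVertex K) : ℕ × ℕ := (x.1, x.2)

lemma betheCoord_injective : Function.Injective (betheCoord (K := K)) := by
  rintro ⟨r, i⟩ ⟨r', i'⟩ h
  obtain rfl : r = r' := congrArg Prod.fst h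
  have h2 : (i : ℕ) = i' := congrArg Prod.snd h
  rw [Fin.ext h2]

lemma sphereCard_eq_genCard (K r : ℕ) : sphereCard K r = genCard (K + 1) K r := by
  cases r <;> rfl

lemma val_lt_genCard (x : BetheVertex K) : (x.2 : ℕ) < genCard (K + 1) K x.1 :=
  x.2.2.trans_eq (sphereCard_eq_genCard K x.1)

instance : Countable (BetheVertex K) := betheCoord_injective.countable

/-- `y` is the ancestor of `x` that lies `t` generations above `x`. -/
def BetheIsAncestor (t : ℕ) (y x : BetheVertex K) : Prop :=
  x.1 = y.1 + t ∧ (y.1 = 0 ∨ (x.2 : ℕ) / K ^ t = y.2)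

lemma betheIsAncestor_zero_iff {y x : BetheVertex K} : BetheIsAncestor 0 y x ↔ y = x := by
  constructor
  · rintro ⟨h1, h2⟩
    refine betheCoord_injective (Prod.ext h1.symm ?_)
    change (y.2 : ℕ) = x.2
    rcases h2 with h2 | h2
    · obtain ⟨r, i⟩ := y
      obtain ⟨r', i'⟩ := x
      obtain rfl : r' = r := h1
      obtain rfl : r' = 0 := h2
      have e1 : (i : ℕ) < 1 := i.2
      have e2 : (i' : ℕ) < 1 := i'.2
      change (i : ℕ) = i'
      omega
    · rw [pow_zero, Nat.div_one] at h2
      exact h2.symm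
  · rintro rfl
    exact ⟨rfl, Or.inr (by rw [pow_zero, Nat.div_one])⟩

lemma exists_betheIsAncestor (x : BetheVertex K) {s : ℕ} (hs : s ≤ x.1) :
    ∃ y : BetheVertex K, y.1 = s ∧ BetheIsAncestor (x.1 - s) y x := by
  by_cases h0 : s = 0
  · subst h0
    exact ⟨betheRoot K, rfl, by change x.1 = 0 + (x.1 - 0); omega, Or.inl rfl⟩
  · have hlt : (x.2 : ℕ) / K ^ (x.1 - s) < sphereCard K s := by
      have h1 : genCard (K + 1) K x.1 = K ^ (x.1 - s) * genCard (K + 1) K s := by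
        rw [mul_comm, ← genCard_add (by omega), Nat.add_sub_cancel' hs]
      have h1 := (val_lt_genCard x).trans_eq h1
      exact (Nat.div_lt_of_lt_mul h1).trans_eq (sphereCard_eq_genCard K s).symm
    exact ⟨⟨s, ⟨_, hlt⟩⟩, rfl, by change x.1 = s + (x.1 - s); omega, Or.inr rfl⟩

lemma exists_walk_of_betheIsAncestor (hK : 0 < K) :
    ∀ (t : ℕ) (y x : BetheVertex K), BetheIsAncestor t y x →
      ∃ w : (betheGraph K).Walk y x, w.length = t
  | 0, y, x, h => by
      obtain rfl := betheIsAncestor_zero_iff.mp h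
      exact ⟨SimpleGraph.Walk.nil, rfl⟩
  | t + 1, y, x, h => by
      have hx := h.1
      obtain ⟨z, hz, hzx⟩ := exists_betheIsAncestor x (s := y.1 + t) (by omega)
      have h1 : x.1 - (y.1 + t) = 1 := by omega
      rw [h1] at hzx
      have hyz : BetheIsAncestor t y z := by
        refine ⟨hz, h.2.imp_right fun h2 => ?_⟩
        rcases hzx.2 with h3 | h3
        · have ht : t = 0 := by omega
          subst ht
          rw [hz, add_zero] at h3
          obtain ⟨r, i⟩ := y
          obtain ⟨r', i'⟩ := z
          obtain rfl : r = 0 := h3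
          obtain rfl : r' = 0 := hz
          have e1 : (i : ℕ) < 1 := i.2
          have e2 : (i' : ℕ) < 1 := i'.2
          change (i' : ℕ) / K ^ 0 = i
          rw [pow_zero, Nat.div_one]
          omega
        · rw [pow_one] at h3
          rw [← h3, Nat.div_div_eq_div_mul, ← pow_succ', h2]
      obtain ⟨w, hw⟩ := exists_walk_of_betheIsAncestor hK t y z hyz
      have hadj : (betheGraph K).Adj z x := Or.inl ⟨hzx.1, hzx.2.imp_right fun h => by
        rwa [pow_one] at h⟩
      exact ⟨w.append (SimpleGraph.Walk.cons hadj SimpleGraph.Walk.nil), by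
        rw [SimpleGraph.Walk.length_append, hw]; rfl⟩

/-- The generation increases by at most one per step, so a walk whose length is the difference of
the generations only descends from parents to children. -/
lemma betheIsAncestor_of_walk {y x : BetheVertex K} (w : (betheGraph K).Walk y x)
    (h : x.1 = y.1 + w.length) : BetheIsAncestor w.length y x := by
  induction w with
  | nil => exact betheIsAncestor_zero_iff.mpr rfl
  | @cons y z x hadj q ih =>
      have h1 := generation_le_length q
      rw [SimpleGraph.Walk.length_cons] at h ⊢
      rcases hadj with hadj | hadj
      · have h2 := hadj.1
        have h3 := ih (by omega)
        refine ⟨h, ?_⟩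
        rcases hadj.2 with h4 | h4
        · exact Or.inl h4
        · refine Or.inr ?_
          have h5 := h3.2.resolve_left (by omega)
          rw [pow_succ, ← Nat.div_div_eq_div_mul, h5, h4]
      · have h2 := hadj.1
        omega

lemma betheGraph_dist_of_betheIsAncestor (hK : 0 < K) {t : ℕ} {y x : BetheVertex K}
    (h : BetheIsAncestor t y x) : (betheGraph K).dist y x = t := by
  obtain ⟨w, hw⟩ := exists_walk_of_betheIsAncestor hK t y x h
  refine le_antisymm (hw ▸ SimpleGraph.dist_le w) ?_
  obtain ⟨w', hw'⟩ := w.reachable.exists_walk_length_eq_dist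
  have h1 := generation_le_length w'
  have h2 := h.1
  omega

lemma betheGraph_dist_root (hK : 0 < K) (x : BetheVertex K) :
    (betheGraph K).dist (betheRoot K) x = x.1 :=
  betheGraph_dist_of_betheIsAncestor hK
    ⟨by change x.1 = 0 + x.1; omega, Or.inl rfl⟩

lemma betheForward_iff (hK : 0 < K) {y x : BetheVertex K} :
    betheForward y x ↔ y.1 ≤ x.1 ∧ BetheIsAncestor (x.1 - y.1) y x := by
  rw [betheForward, betheGraph_dist_root hK, betheGraph_dist_root hK]
  constructor
  · intro h
    have hr : (betheGraph K).Reachable y x :=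
      (betheGraph_reachable_root y.1 y.2).symm.trans (betheGraph_reachable_root x.1 x.2)
    obtain ⟨w, hw⟩ := hr.exists_walk_length_eq_dist
    have h1 := betheIsAncestor_of_walk w (by omega)
    have h2 : x.1 - y.1 = w.length := by omega
    exact ⟨by omega, h2 ▸ h1⟩
  · rintro ⟨h1, h2⟩
    rw [betheGraph_dist_of_betheIsAncestor hK h2]
    omega

/-- The relevant ancestors lie in generations divisible by `m₀ + 1`, and exactly one of these is at
most `m₀` generations above `x`; so the sum that defines the potential has a single term. -/
lemma exists_betheSite (hK : 0 < K) (x : BetheVertex K) : ∃ y : betheSites K m₀,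
    ∀ z : betheSites K m₀, ((betheGraph K).dist z.1 x ≤ m₀ ∧ betheForward z.1 x) ↔ z = y := by
  have h1 := Nat.div_add_mod x.1 (m₀ + 1)
  have h2 : x.1 % (m₀ + 1) < m₀ + 1 := Nat.mod_lt _ (Nat.succ_pos m₀)
  obtain ⟨y, hy, hyx⟩ := exists_betheIsAncestor x (s := (m₀ + 1) * (x.1 / (m₀ + 1)))
    (Nat.mul_div_le _ _)
  refine ⟨⟨y, ?_⟩, fun z => ?_⟩
  · change (m₀ + 1) ∣ (betheGraph K).dist (betheRoot K) y
    rw [betheGraph_dist_root hK, hy]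
    exact dvd_mul_right _ _
  rw [betheForward_iff hK]
  constructor
  · rintro ⟨hd, hz1, hzx⟩
    rw [betheGraph_dist_of_betheIsAncestor hK hzx] at hd
    obtain ⟨k, hk⟩ : (m₀ + 1) ∣ (betheGraph K).dist (betheRoot K) z.1 := z.2
    rw [betheGraph_dist_root hK] at hk
    have h5 : x.1 / (m₀ + 1) = k := by
      rw [Nat.div_eq_iff (by omega)]
      rw [mul_comm] at hk
      omega
    have hzy : z.1.1 = y.1 := by rw [hk, hy, h5]
    refine Subtype.ext (betheCoord_injective (Prod.ext hzy ?_))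
    change (z.1.2 : ℕ) = y.2
    rw [← hy, ← hzy] at hyx
    rcases Nat.eq_zero_or_pos z.1.1 with h0 | h0
    · obtain ⟨⟨r, i⟩, hz⟩ := z
      obtain ⟨r', i'⟩ := y
      obtain rfl : r = 0 := h0
      obtain rfl : 0 = r' := hzy
      have e1 : (i : ℕ) < 1 := i.2
      have e2 : (i' : ℕ) < 1 := i'.2
      change (i : ℕ) = i'
      omega
    · rw [← hzx.2.resolve_left (by omega), ← hyx.2.resolve_left (by omega)]
  · rintro rfl
    refine ⟨?_, by change y.1 ≤ x.1; omega, by change BetheIsAncestor (x.1 - y.1) y x; rwa [hy]⟩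
    rw [betheGraph_dist_of_betheIsAncestor hK hyx]
    omega

/-- The site of the block that contains `x`. -/
def betheSite (hK : 0 < K) (x : BetheVertex K) : betheSites K m₀ := (exists_betheSite hK x).choose

lemma betheSite_iff (hK : 0 < K) (x : BetheVertex K) (z : betheSites K m₀) :
    ((betheGraph K).dist z.1 x ≤ m₀ ∧ betheForward z.1 x) ↔ z = betheSite hK x :=
  (exists_betheSite hK x).choose_spec z

lemma bethePotential_eq (hK : 0 < K) (w : betheSites K m₀ → ℝ) (x : BetheVertex K) :
    bethePotential K m₀ w x = w (betheSite hK x) := by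
  classical
  rw [bethePotential, finsum_eq_single _ (betheSite hK x)]
  · rw [if_pos ((betheSite_iff hK x _).mpr rfl)]
  · intro y hy
    rw [if_neg fun h => hy ((betheSite_iff hK x y).mp h)]

lemma betheCoord_betheSite (hK : 0 < K) (x : BetheVertex K) :
    betheCoord (betheSite (m₀ := m₀) hK x).1 = treeSite K (m₀ + 1) (betheCoord x) := by
  have h1 := Nat.div_add_mod x.1 (m₀ + 1)
  have h2 : x.1 % (m₀ + 1) < m₀ + 1 := Nat.mod_lt _ (Nat.succ_pos m₀)
  set z := betheSite (m₀ := m₀) hK x with hz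
  obtain ⟨hd, hf⟩ := (betheSite_iff hK x z).mpr hz
  obtain ⟨hz1, hzx⟩ := (betheForward_iff hK).mp hf
  rw [betheGraph_dist_of_betheIsAncestor hK hzx] at hd
  obtain ⟨k, hk⟩ : (m₀ + 1) ∣ (betheGraph K).dist (betheRoot K) z.1 := z.2
  rw [betheGraph_dist_root hK] at hk
  have h5 : x.1 / (m₀ + 1) = k := by
    rw [Nat.div_eq_iff (by omega)]
    rw [mul_comm] at hk
    omega
  refine Prod.ext (by rw [← h5] at hk; exact hk) ?_
  change (z.1.2 : ℕ) = if x.1 < m₀ + 1 then 0 else (x.2 : ℕ) / K ^ (x.1 % (m₀ + 1))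
  split_ifs with h
  · rw [Nat.div_eq_of_lt h] at h5
    have h0 : z.1.1 = 0 := by rw [hk, ← h5, mul_zero]
    have e1 : genCard (K + 1) K z.1.1 = 1 := by rw [h0, genCard]
    have e1 := (val_lt_genCard z.1).trans_eq e1
    exact Nat.lt_one_iff.mp e1
  · have h0 : z.1.1 ≠ 0 := by
      rw [hk]
      have : 0 < k := h5 ▸ Nat.div_pos (by omega) (by omega)
      positivity
    rw [← hzx.2.resolve_left h0]
    congr 2
    rw [hk, ← h5]
    omega

lemma mem_betheBall_iff (hK : 0 < K) {L : ℕ} {x : BetheVertex K} :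
    x ∈ betheBall K L ↔ betheCoord x ∈ treeFinset (K + 1) K (L + 1) := by
  have h1 := val_lt_genCard x
  rw [mem_treeFinset]
  change (betheGraph K).dist (betheRoot K) x ≤ L ↔ _
  rw [betheGraph_dist_root hK]
  exact ⟨fun h => ⟨Nat.lt_succ_of_le h, h1⟩, fun h => Nat.le_of_lt_succ h.1⟩

/-- The vertex with given coordinates. -/
def betheOfCoord {L : ℕ} (x : treeFinset (K + 1) K (L + 1)) : BetheVertex K :=
  ⟨x.1.1, ⟨x.1.2, by rw [sphereCard_eq_genCard]; exact (mem_treeFinset.mp x.2).2⟩⟩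

lemma betheCoord_betheOfCoord {L : ℕ} (x : treeFinset (K + 1) K (L + 1)) :
    betheCoord (betheOfCoord x) = x.1 := rfl

/-- The coordinates of the ball. -/
def betheBallEquiv (hK : 0 < K) (L : ℕ) : treeFinset (K + 1) K (L + 1) ≃ betheBall K L where
  toFun x := ⟨betheOfCoord x, (mem_betheBall_iff hK).mpr (by
    rw [betheCoord_betheOfCoord]; exact x.2)⟩
  invFun x := ⟨betheCoord x.1, (mem_betheBall_iff hK).mp x.2⟩
  left_inv _ := rfl
  right_inv _ := rfl

lemma card_betheBall (hK : 0 < K) (L : ℕ) :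
    Fintype.card (betheBall K L) = (treeFinset (K + 1) K (L + 1)).card := by
  rw [← Fintype.card_coe, Fintype.card_congr (betheBallEquiv hK L)]

lemma cutoffOperator_submatrix (hK : 0 < K) (lam : ℝ) (w : betheSites K m₀ → ℝ) (L : ℕ) :
    (cutoffOperator K m₀ lam w L).submatrix (betheBallEquiv hK L) (betheBallEquiv hK L)
      = treeHam (K + 1) K (L + 1) lam fun x => w (betheSite hK (betheOfCoord x)) := by
  classical
  ext x y
  have h1 : (betheGraph K).Adj (betheOfCoord x) (betheOfCoord y)
      ↔ (TreeParent K x y ∨ TreeParent K y x) := Iff.rfl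
  have h2 : betheOfCoord x = betheOfCoord y ↔ x = y :=
    ⟨fun h => Subtype.ext (congrArg betheCoord h), fun h => by rw [h]⟩
  rw [Matrix.submatrix_apply]
  change schrodingerKernel (betheGraph K) lam (bethePotential K m₀ w) (betheOfCoord x)
    (betheOfCoord y) = _
  rw [schrodingerKernel, treeHam, ham, Matrix.add_apply, bethePotential_eq hK, treeHop,
    Matrix.of_apply, Matrix.diagonal_apply]
  simp only [h1, h2]

lemma eigenvalueProcess_real (hK : 0 < K) (lam : ℝ) (w : betheSites K m₀ → ℝ) (E₀ : ℝ) (L : ℕ)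
    {I : Set ℝ} (hI : MeasurableSet I) :
    (eigenvalueProcess K m₀ lam w E₀ L).real I
      = eigCount (treeHam (K + 1) K (L + 1) lam fun x => w (betheSite hK (betheOfCoord x)))
        {e | ((treeFinset (K + 1) K (L + 1)).card : ℝ) * (e - E₀) ∈ I} := by
  classical
  rw [← cutoffOperator_submatrix, eigCount_submatrix,
    eigCount_eq_sum (cutoffOperator_isHermitian K m₀ lam w L), eigenvalueProcess,
    measureReal_def, Measure.finsetSum_apply, card_betheBall hK]
  rw [ENNReal.toReal_sum (by
    intro i _
    exact measure_ne_top _ _)]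
  push_cast
  refine Finset.sum_congr ?_ fun i _ => ?_
  · ext; simp
  rw [Measure.dirac_apply' _ hI, Set.indicator_apply]
  simp only [Pi.one_apply, Set.mem_ofPred_eq]
  split_ifs <;> simp

/-- The law of the potential on a ball. -/
lemma map_betheSite (hK : 0 < K) {Ω : Type*} [MeasurableSpace Ω] {P : Measure Ω}
    [IsProbabilityMeasure P] {ν : Measure ℝ} [IsProbabilityMeasure ν]
    {ω : betheSites K m₀ → Ω → ℝ} (hω : ∀ y, HasLaw (ω y) ν P) (hind : iIndepFun ω P) (L : ℕ) :
    P.map (fun a (x : treeFinset (K + 1) K (L + 1)) => ω (betheSite hK (betheOfCoord x)) a)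
      = (Measure.infinitePi fun _ : ℕ × ℕ => ν).map fun w x => w (treeSite K (m₀ + 1) x.1) := by
  have h1 : HasLaw (fun a y => ω y a) (Measure.infinitePi fun _ : betheSites K m₀ => ν) P :=
    hind.hasLaw_infinitePi hω (by
      exact aemeasurable_pi_iff.mpr fun y => (hω y).aemeasurable)
  rw [← map_infinitePi_comp ν (s := fun x : treeFinset (K + 1) K (L + 1) =>
      betheSite (m₀ := m₀) hK (betheOfCoord x)) (s' := fun x => treeSite K (m₀ + 1) x.1),
    ← h1.map_eq, AEMeasurable.map_map_of_aemeasurable ?_ h1.aemeasurable]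
  · rfl
  · refine Measurable.aemeasurable ?_
    fun_prop
  · intro x y
    rw [← betheCoord_betheOfCoord x, ← betheCoord_betheOfCoord y,
      ← betheCoord_betheSite hK, ← betheCoord_betheSite hK]
    exact ⟨fun h => by rw [h], fun h => Subtype.ext (betheCoord_injective h)⟩

end BetheCoordinates

/-! ### Compound Poisson limits -/

section CompoundPoisson

set_option linter.unusedSectionVars false

/-- The exponents `m n` run through a subset of the natural numbers; filling the gaps with `z / k`
extends the hypothesis to all exponents. -/
lemma tendsto_one_add_pow_exp_of_strictMono {m : ℕ → ℕ} (hm : StrictMono m) {g : ℕ → ℂ} {z : ℂ}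
    (h : Tendsto (fun n => (m n : ℂ) * g n) atTop (𝓝 z)) :
    Tendsto (fun n => (1 + g n) ^ m n) atTop (𝓝 (Complex.exp z)) := by
  set G : ℕ → ℂ := Function.extend m g fun k => z / k with hG
  have hGm : ∀ n, G (m n) = g n := fun n => hm.injective.extend_apply _ _ _
  have h1 : Tendsto (fun k : ℕ => (k : ℂ) * G k) atTop (𝓝 z) := by
    rw [Metric.tendsto_atTop] at h ⊢
    intro ε hε
    obtain ⟨N, hN⟩ := h ε hε
    refine ⟨m N + 1, fun k hk => ?_⟩
    by_cases hk' : ∃ n, m n = k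
    · obtain ⟨n, rfl⟩ := hk'
      rw [hGm]
      exact hN n (hm.le_iff_le.mp (by omega))
    · have hk0 : (k : ℂ) ≠ 0 := by exact_mod_cast (by omega : k ≠ 0)
      rw [hG, Function.extend_apply' _ _ _ hk', mul_div_cancel₀ _ hk0, dist_self]
      exact hε
  have h2 := (Complex.tendsto_one_add_pow_exp_of_tendsto h1).comp hm.tendsto_atTop
  refine h2.congr fun n => ?_
  simp only [Function.comp_apply, hGm]

lemma isProbabilityMeasure_convPower (ν : Measure ℝ) [IsProbabilityMeasure ν] :
    ∀ n, IsProbabilityMeasure (convPower ν n)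
  | 0 => by rw [convPower]; infer_instance
  | n + 1 => by
      have := isProbabilityMeasure_convPower ν n
      rw [convPower]
      infer_instance

lemma charFun_convPower (ν : Measure ℝ) [IsProbabilityMeasure ν] (t : ℝ) :
    ∀ n, charFun (convPower ν n) t = charFun ν t ^ n
  | 0 => by rw [convPower, charFun_dirac]; simp
  | n + 1 => by
      have := isProbabilityMeasure_convPower ν n
      rw [convPower, charFun_conv, charFun_convPower ν t n, pow_succ]

lemma isProbabilityMeasure_sum_convPower (r : NNReal) (ν : Measure ℝ) [IsProbabilityMeasure ν] :
    IsProbabilityMeasure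
      (Measure.sum fun n : ℕ => poissonMeasure r {n} • convPower ν n) := by
  constructor
  rw [Measure.sum_apply _ MeasurableSet.univ]
  have h : ∀ n, (poissonMeasure r {n} • convPower ν n) Set.univ = poissonMeasure r {n} := by
    intro n
    have := isProbabilityMeasure_convPower ν n
    rw [Measure.smul_apply, measure_univ, smul_eq_mul, mul_one]
  simp only [h]
  have h2 := Measure.tsum_indicator_apply_singleton (poissonMeasure r) Set.univ MeasurableSet.univ
  simpa using h2

lemma charFun_sum_convPower (r : NNReal) (ν : Measure ℝ) [IsProbabilityMeasure ν] (t : ℝ) :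
    charFun (Measure.sum fun n : ℕ => poissonMeasure r {n} • convPower ν n) t
      = Complex.exp (r * (charFun ν t - 1)) := by
  have := isProbabilityMeasure_sum_convPower r ν
  have hint : Integrable (fun x : ℝ => Complex.exp (t * x * Complex.I))
      (Measure.sum fun n : ℕ => poissonMeasure r {n} • convPower ν n) := by
    refine Integrable.of_bound (C := 1) (by fun_prop) (ae_of_all _ fun x => ?_)
    rw [← Complex.ofReal_mul, Complex.norm_exp_ofReal_mul_I]
  have h1 := hasSum_integral_measure hint
  rw [← charFun_apply_real] at h1
  have h2 : ∀ n : ℕ, ∫ x : ℝ, Complex.exp (t * x * Complex.I)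
      ∂(poissonMeasure r {n} • convPower ν n)
      = Complex.exp (-r) * ((r * charFun ν t) ^ n / (Nat.factorial n)) := by
    intro n
    rw [integral_smul_measure, ← charFun_apply_real, charFun_convPower, ← measureReal_def,
      poissonMeasure_real_singleton, Complex.real_smul]
    push_cast
    ring
  simp only [h2] at h1
  have h3 := (NormedSpace.expSeries_div_hasSum_exp ((r : ℂ) * charFun ν t)).mul_left
    (Complex.exp (-r))
  rw [h1.unique h3, ← Complex.exp_eq_exp_ℂ, ← Complex.exp_add]
  congr 1
  ring

/-- The jump rate is `r = ∑ p k` and the jump law gives the mass `p k / r` to `k`. For `r = 0` any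
jump law will do, here the unit mass at `0`. -/
lemma exists_isCompoundPoisson (M : ℕ) {p : ℕ → ℝ} (hp : ∀ k, 0 ≤ p k) :
    ∃ Q : ProbabilityMeasure ℝ, IsCompoundPoisson (Q : Measure ℝ) ∧ ∀ t : ℝ,
      charFun (Q : Measure ℝ) t = Complex.exp (∑ k ∈ Finset.Icc 1 M,
        (Complex.exp (Complex.I * t * k) - 1) * (p k : ℂ)) := by
  set r : ℝ := ∑ k ∈ Finset.Icc 1 M, p k with hr
  have hr0 : 0 ≤ r := Finset.sum_nonneg fun k _ => hp k
  suffices h : ∃ ν : Measure ℝ, IsProbabilityMeasure ν ∧ ∀ t : ℝ, (r : ℂ) * charFun ν t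
      = ∑ k ∈ Finset.Icc 1 M, Complex.exp (Complex.I * t * k) * (p k : ℂ) by
    obtain ⟨ν, hν, hνt⟩ := h
    refine ⟨⟨_, isProbabilityMeasure_sum_convPower r.toNNReal ν⟩, ⟨_, ν, hν, rfl⟩, fun t => ?_⟩
    have h2 := charFun_sum_convPower r.toNNReal ν t
    refine h2.trans ?_
    rw [Real.coe_toNNReal _ hr0, mul_sub, hνt, mul_one, hr]
    congr 1
    rw [Complex.ofReal_sum, ← Finset.sum_sub_distrib]
    exact Finset.sum_congr rfl fun k _ => by ring
  rcases hr0.eq_or_lt with h0 | h0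
  · refine ⟨Measure.dirac 0, inferInstance, fun t => ?_⟩
    rw [← h0, Complex.ofReal_zero, zero_mul]
    refine (Finset.sum_eq_zero fun k hk => ?_).symm
    rw [(Finset.sum_eq_zero_iff_of_nonneg fun k _ => hp k).mp h0.symm k hk]
    simp
  · refine ⟨∑ k ∈ Finset.Icc 1 M, ENNReal.ofReal (p k / r) • Measure.dirac (k : ℝ), ?_, ?_⟩
    · constructor
      rw [Measure.finsetSum_apply]
      simp only [Measure.smul_apply, measure_univ, smul_eq_mul, mul_one]
      rw [← ENNReal.ofReal_sum_of_nonneg fun k _ => div_nonneg (hp k) hr0, ← Finset.sum_div,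
        ← hr, div_self h0.ne', ENNReal.ofReal_one]
    · intro t
      rw [charFun_apply_real, integral_finsetSum_measure, Finset.mul_sum]
      · refine Finset.sum_congr rfl fun k _ => ?_
        rw [integral_smul_measure, integral_dirac,
          ENNReal.toReal_ofReal (div_nonneg (hp k) hr0), Complex.real_smul]
        have hr' : (r : ℂ) ≠ 0 := by exact_mod_cast h0.ne'
        push_cast
        rw [← mul_assoc, mul_div_cancel₀ _ hr', mul_comm]
        congr 2
        ring
      · intro k _
        exact (integrable_dirac (by simp)).smul_measure ENNReal.ofReal_ne_top

variable {Ω : Type*} [MeasurableSpace Ω]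

lemma norm_exp_sub_one_le (x : ℝ) (k : ℕ) : ‖Complex.exp (Complex.I * x * k) - 1‖ ≤ 2 := by
  have h : Complex.exp (Complex.I * x * k) = Complex.exp ((x * k : ℝ) * Complex.I) := by
    congr 1; push_cast; ring
  refine (norm_sub_le _ _).trans ?_
  rw [h, Complex.norm_exp_ofReal_mul_I, norm_one]
  norm_num

lemma norm_exp_I_mul (x y : ℝ) : ‖Complex.exp (Complex.I * x * y)‖ = 1 := by
  have h : Complex.exp (Complex.I * x * y) = Complex.exp ((x * y : ℝ) * Complex.I) := by
    congr 1; push_cast; ring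
  rw [h, Complex.norm_exp_ofReal_mul_I]

lemma integrable_exp_I_mul {P : Measure Ω} [IsFiniteMeasure P] {X : Ω → ℝ} (hX : AEMeasurable X P)
    (t : ℝ) : Integrable (fun a => Complex.exp (Complex.I * t * (X a : ℝ))) P := by
  refine Integrable.of_bound (C := 1) ?_ (ae_of_all _ fun a => (norm_exp_I_mul t _).le)
  have h : Continuous fun y : ℝ => Complex.exp (Complex.I * t * (y : ℝ)) := by fun_prop
  exact (h.measurable.comp_aemeasurable hX).aestronglyMeasurable

/-- The integrands agree unless `η > M`, and there they differ by at most `2`. -/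
lemma norm_integral_exp_sub_le {P : Measure Ω} [IsProbabilityMeasure P] {η : Ω → ℕ}
    (hη : Measurable η) (M : ℕ) (t : ℝ) :
    ‖(∫ a, Complex.exp (Complex.I * t * (η a : ℝ)) ∂P) - 1
        - ∑ k ∈ Finset.Icc 1 M, (Complex.exp (Complex.I * t * k) - 1) * (P.real {a | η a = k} : ℂ)‖
      ≤ 2 * P.real {a | M < η a} := by
  have hη' : Measurable fun a => (η a : ℝ) := measurable_from_nat.comp hη
  have hset : ∀ k, MeasurableSet {a | η a = k} := fun k => hη (measurableSet_singleton k)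
  have hM : MeasurableSet {a | M < η a} := hη measurableSet_Ioi
  have h1 : ∀ k : ℕ, (Complex.exp (Complex.I * t * k) - 1) * (P.real {a | η a = k} : ℂ)
      = ∫ a, {a | η a = k}.indicator (fun _ => Complex.exp (Complex.I * t * k) - 1) a ∂P := by
    intro k
    rw [integral_indicator_const _ (hset k), Complex.real_smul, mul_comm]
  have hi : ∀ k : ℕ, Integrable ({a | η a = k}.indicator
      fun _ => Complex.exp (Complex.I * t * k) - 1) P := fun k =>
    (integrable_const _).indicator (hset k)
  simp only [h1]
  rw [← integral_finsetSum _ fun k _ => hi k]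
  have h2 : (∫ a, Complex.exp (Complex.I * t * (η a : ℝ)) ∂P) - 1
      = ∫ a, (Complex.exp (Complex.I * t * (η a : ℝ)) - 1) ∂P := by
    rw [integral_sub (integrable_exp_I_mul hη'.aemeasurable t) (integrable_const _)]
    simp
  have h4 : Integrable (fun a => Complex.exp (Complex.I * t * (η a : ℝ)) - 1) P :=
    (integrable_exp_I_mul hη'.aemeasurable t).sub (integrable_const 1)
  rw [h2, ← integral_sub h4 (integrable_finsetSum _ fun k _ => hi k)]
  have h3 : 2 * P.real {a | M < η a} = ∫ a, {a | M < η a}.indicator (fun _ => (2 : ℝ)) a ∂P := by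
    rw [integral_indicator_const _ hM, smul_eq_mul, mul_comm]
  rw [h3]
  refine norm_integral_le_of_norm_le ((integrable_const _).indicator hM) (ae_of_all _ fun a => ?_)
  by_cases ha : η a ∈ Finset.Icc 1 M
  · rw [Finset.sum_eq_single (η a)]
    · rw [Set.indicator_of_mem (by exact rfl), Complex.ofReal_natCast, sub_self, norm_zero]
      exact Set.indicator_nonneg (fun _ _ => by norm_num) _
    · intro k _ hk
      have hk' : a ∉ {a | η a = k} := fun h => hk (Eq.symm h)
      exact Set.indicator_of_notMem hk' _
    · exact fun h => absurd ha h
  · rw [Finset.sum_eq_zero]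
    · rw [sub_zero, Complex.ofReal_natCast]
      rw [Finset.mem_Icc, not_and_or] at ha
      by_cases h0 : η a = 0
      · rw [h0]
        simp only [Nat.cast_zero, mul_zero, Complex.exp_zero, sub_self, norm_zero]
        exact Set.indicator_nonneg (fun _ _ => by norm_num) _
      · rw [Set.indicator_of_mem (by change M < η a; omega)]
        exact norm_exp_sub_one_le t _
    · intro k hk
      have hk' : a ∉ {a | η a = k} := fun h => ha (by
        have h' : η a = k := h
        rwa [h'])
      exact Set.indicator_of_notMem hk' _

/-- The characteristic functions of sums of independent rare events converge to the characteristic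
function of a compound Poisson law. -/
lemma tendsto_integral_exp_pow {P : Measure Ω} [IsProbabilityMeasure P] {η : ℕ → Ω → ℕ}
    (hη : ∀ n, Measurable (η n)) {m : ℕ → ℕ} (hm : StrictMono m) {M : ℕ} {p : ℕ → ℝ}
    (h1 : ∀ k ∈ Finset.Icc 1 M,
      Tendsto (fun n => m n * P.real {a | η n a = k}) atTop (𝓝 (p k)))
    (h2 : Tendsto (fun n => m n * P.real {a | M < η n a}) atTop (𝓝 0)) (t : ℝ) :
    Tendsto (fun n => (∫ a, Complex.exp (Complex.I * t * (η n a : ℝ)) ∂P) ^ m n) atTop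
      (𝓝 (Complex.exp (∑ k ∈ Finset.Icc 1 M,
        (Complex.exp (Complex.I * t * k) - 1) * (p k : ℂ)))) := by
  have h3 : Tendsto (fun n => (m n : ℂ) *
      ((∫ a, Complex.exp (Complex.I * t * (η n a : ℝ)) ∂P) - 1)) atTop
      (𝓝 (∑ k ∈ Finset.Icc 1 M, (Complex.exp (Complex.I * t * k) - 1) * (p k : ℂ))) := by
    have h4 : Tendsto (fun n => ∑ k ∈ Finset.Icc 1 M, (Complex.exp (Complex.I * t * k) - 1)
        * ((m n * P.real {a | η n a = k} : ℝ) : ℂ)) atTop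
        (𝓝 (∑ k ∈ Finset.Icc 1 M, (Complex.exp (Complex.I * t * k) - 1) * (p k : ℂ))) :=
      tendsto_finsetSum _ fun k hk =>
        ((Complex.continuous_ofReal.tendsto _).comp (h1 k hk)).const_mul _
    have h5 : Tendsto (fun n => (m n : ℂ) *
        ((∫ a, Complex.exp (Complex.I * t * (η n a : ℝ)) ∂P) - 1)
        - ∑ k ∈ Finset.Icc 1 M, (Complex.exp (Complex.I * t * k) - 1)
        * ((m n * P.real {a | η n a = k} : ℝ) : ℂ)) atTop (𝓝 0) := by
      refine squeeze_zero_norm (a := fun n => 2 * (m n * P.real {a | M < η n a})) (fun n => ?_) ?_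
      · have h6 : (m n : ℂ) * ((∫ a, Complex.exp (Complex.I * t * (η n a : ℝ)) ∂P) - 1)
            - ∑ k ∈ Finset.Icc 1 M, (Complex.exp (Complex.I * t * k) - 1)
              * ((m n * P.real {a | η n a = k} : ℝ) : ℂ)
            = m n * ((∫ a, Complex.exp (Complex.I * t * (η n a : ℝ)) ∂P) - 1
              - ∑ k ∈ Finset.Icc 1 M, (Complex.exp (Complex.I * t * k) - 1)
                * (P.real {a | η n a = k} : ℂ)) := by
          rw [mul_sub (m n : ℂ) (_ - 1), Finset.mul_sum]
          congr 1
          refine Finset.sum_congr rfl fun k _ => ?_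
          push_cast
          ring
        rw [h6, norm_mul, Complex.norm_natCast]
        have h7 := norm_integral_exp_sub_le (P := P) (hη n) M t
        nlinarith [Nat.cast_nonneg (α := ℝ) (m n)]
      · simpa using h2.const_mul 2
    simpa using h5.add h4
  refine (tendsto_one_add_pow_exp_of_strictMono hm h3).congr fun n => ?_
  rw [add_sub_cancel]

/-- Convergence in distribution to a compound Poisson law from the convergence of the
characteristic functions. -/
lemma exists_tendstoInDistribution {P : Measure Ω} [IsProbabilityMeasure P] {X : ℕ → Ω → ℝ}
    (hX : ∀ n, AEMeasurable (X n) P) {M : ℕ} {p : ℕ → ℝ} (hp : ∀ k, 0 ≤ p k)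
    (h : ∀ t : ℝ, Tendsto (fun n => ∫ a, Complex.exp (Complex.I * t * (X n a : ℝ)) ∂P) atTop
      (𝓝 (Complex.exp (∑ k ∈ Finset.Icc 1 M,
        (Complex.exp (Complex.I * t * k) - 1) * (p k : ℂ))))) :
    ∃ Q : ProbabilityMeasure ℝ,
      TendstoInDistribution X atTop (id : ℝ → ℝ) (fun _ => P) (Q : Measure ℝ) ∧
      IsCompoundPoisson (Q : Measure ℝ) ∧ ∀ t : ℝ,
      charFun (Q : Measure ℝ) t = Complex.exp (∑ k ∈ Finset.Icc 1 M,
        (Complex.exp (Complex.I * t * k) - 1) * (p k : ℂ)) := by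
  obtain ⟨Q, hQ, hQt⟩ := exists_isCompoundPoisson M hp
  refine ⟨Q, ⟨hX, aemeasurable_id, ?_⟩, hQ, hQt⟩
  refine ProbabilityMeasure.tendsto_iff_tendsto_charFun.2 fun t => ?_
  simp only [ProbabilityMeasure.coe_mk, Measure.map_id, hQt]
  refine (h t).congr fun n => ?_
  rw [charFun_apply_real, integral_map (hX n) (by fun_prop)]
  refine integral_congr_ae (ae_of_all _ fun a => ?_)
  dsimp only
  congr 1
  ring

lemma norm_integral_exp_sub_integral_exp_le {P : Measure Ω} [IsProbabilityMeasure P] {X Y : Ω → ℝ}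
    (hX : AEMeasurable X P) (hY : AEMeasurable Y P) {S : Set Ω} (hS : MeasurableSet S)
    (h : ∀ a ∉ S, X a = Y a) (t : ℝ) :
    ‖(∫ a, Complex.exp (Complex.I * t * (X a : ℝ)) ∂P)
      - ∫ a, Complex.exp (Complex.I * t * (Y a : ℝ)) ∂P‖ ≤ 2 * P.real S := by
  rw [← integral_sub (integrable_exp_I_mul hX t) (integrable_exp_I_mul hY t)]
  have h3 : 2 * P.real S = ∫ a, S.indicator (fun _ => (2 : ℝ)) a ∂P := by
    rw [integral_indicator_const _ hS, smul_eq_mul, mul_comm]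
  rw [h3]
  refine norm_integral_le_of_norm_le ((integrable_const _).indicator hS) (ae_of_all _ fun a => ?_)
  by_cases ha : a ∈ S
  · rw [Set.indicator_of_mem ha]
    refine (norm_sub_le _ _).trans ?_
    rw [norm_exp_I_mul, norm_exp_I_mul]
    norm_num
  · rw [Set.indicator_of_notMem ha, h a ha, sub_self, norm_zero]

end CompoundPoisson

/-! ### Sizes of balls and subtrees -/

section Sizes

set_option linter.unusedSectionVars false

variable {K : ℕ}

lemma genCard_succ_le (hK : 2 ≤ K) (r : ℕ) : genCard (K + 1) K r ≤ K * K ^ r := by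
  cases r with
  | zero => rw [genCard, pow_zero, mul_one]; omega
  | succ r =>
      rw [genCard, pow_succ']
      have h : K + 1 ≤ K * K := by nlinarith
      calc (K + 1) * K ^ r ≤ (K * K) * K ^ r := Nat.mul_le_mul_right _ h
        _ = K * (K * K ^ r) := by ring

lemma card_treeFinset_succ_le (hK : 2 ≤ K) (R : ℕ) :
    (treeFinset (K + 1) K R).card ≤ K * K ^ R := by
  rw [card_treeFinset]
  calc ∑ r ∈ Finset.range R, genCard (K + 1) K r
      ≤ ∑ r ∈ Finset.range R, K * genCard K K r :=
        Finset.sum_le_sum fun r _ => (genCard_succ_le hK r).trans_eq (by rw [genCard_self])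
    _ = K * (treeFinset K K R).card := by rw [card_treeFinset, Finset.mul_sum]
    _ ≤ K * K ^ R := Nat.mul_le_mul_left _ (card_treeFinset_le_pow hK R)

lemma pow_le_mul_card_treeFinset {R : ℕ} (hR : 1 ≤ R) :
    K ^ R ≤ K * (treeFinset (K + 1) K R).card := by
  obtain ⟨L, rfl⟩ := Nat.exists_eq_add_of_le' hR
  rw [card_treeFinset, pow_succ']
  refine Nat.mul_le_mul_left _ ((pow_le_genCard (Nat.le_succ K) L).trans ?_)
  exact Finset.single_le_sum (f := fun r => genCard (K + 1) K r) (fun _ _ => Nat.zero_le _)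
    (Finset.mem_range.mpr (Nat.lt_succ_self L))

/-- The closed form of the size of a ball. Its exactness matters: the constant `K - 1` of the next
estimate becomes the factor `K` in the bound for the `p k`. -/
lemma sub_one_mul_card_treeFinset (hK : 2 ≤ K) (L : ℕ) :
    (K - 1) * (treeFinset (K + 1) K (L + 1)).card + 2 = (K + 1) * K ^ L := by
  obtain ⟨k, rfl⟩ := Nat.exists_eq_add_of_le' hK
  induction L with
  | zero => rw [card_treeFinset]; simp [genCard]
  | succ L ih =>
      rw [card_treeFinset, Finset.sum_range_succ, ← card_treeFinset, genCard]
      rw [pow_succ]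
      have : k + 2 - 1 = k + 1 := rfl
      rw [this] at ih ⊢
      nlinarith

/-- The number of subtrees times their number of leaves is at most `K - 1` times the size of the
ball. -/
lemma genCard_mul_pow_le (hK : 2 ≤ K) {r R' : ℕ} (hr : 1 ≤ r) (hR' : 1 ≤ R') :
    genCard (K + 1) K r * K ^ (R' - 1) ≤ (K - 1) * (treeFinset (K + 1) K (r + R')).card := by
  obtain ⟨a, rfl⟩ := Nat.exists_eq_add_of_le' hr
  obtain ⟨b, rfl⟩ := Nat.exists_eq_add_of_le' hR'
  have h := sub_one_mul_card_treeFinset hK (a + b + 1)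
  rw [show a + 1 + (b + 1) = a + b + 1 + 1 by ring, Nat.add_sub_cancel, genCard, mul_assoc,
    ← pow_add]
  have h1 : 2 ≤ (K + 1) * K ^ (a + b) := by
    have : 0 < K ^ (a + b) := by positivity
    nlinarith
  have h2 : (K + 1) * K ^ (a + b + 1) = K * ((K + 1) * K ^ (a + b)) := by ring
  have h3 : 2 * ((K + 1) * K ^ (a + b)) ≤ K * ((K + 1) * K ^ (a + b)) :=
    Nat.mul_le_mul_right _ hK
  omega

/-- The number of vertices of a ball, as a real number. -/
def ballSize (K r : ℕ) : ℝ := ((treeFinset (K + 1) K (r + 7 * r)).card : ℝ)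

/-- Everything is measured in powers of `x = K ^ r`: the ball has of order `x ^ 8` vertices, a lower
tree at most `x ^ 7`, and there are at most `K * x` lower trees. -/
lemma ballSize_le (hK : 2 ≤ K) (r : ℕ) : ballSize K r ≤ K * ((K : ℝ) ^ r) ^ 8 := by
  have h := card_treeFinset_succ_le hK (r + 7 * r)
  rw [ballSize, ← pow_mul, show r * 8 = r + 7 * r by ring]
  exact_mod_cast h

lemma pow_le_ballSize {r : ℕ} (hr : 1 ≤ r) : ((K : ℝ) ^ r) ^ 8 ≤ K * ballSize K r := by
  have h := pow_le_mul_card_treeFinset (K := K) (R := r + 7 * r) (by omega)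
  rw [ballSize, ← pow_mul, show r * 8 = r + 7 * r by ring]
  exact_mod_cast h

lemma one_le_pow_real (hK : 2 ≤ K) (r : ℕ) : (1 : ℝ) ≤ (K : ℝ) ^ r :=
  one_le_pow₀ (by exact_mod_cast (by omega : 1 ≤ K))

lemma ballSize_pos (hK : 2 ≤ K) {r : ℕ} (hr : 1 ≤ r) : 0 < ballSize K r := by
  have h := pow_le_ballSize (K := K) hr
  have h1 := one_le_pow_real hK r
  have h2 : (0 : ℝ) < ((K : ℝ) ^ r) ^ 8 := by positivity
  have hK0 : (0 : ℝ) < K := by exact_mod_cast (by omega : 0 < K)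
  exact pos_of_mul_pos_right (h2.trans_le h) hK0.le

/-- The width of the boundary layers of the energy windows. -/
def layerWidth (K r : ℕ) : ℝ :=
  (K + 2) ^ 2 * ballSize K r ^ 2 * ((K ^ 20 : ℕ) : ℝ) ^ 2 / ((K : ℝ) ^ r) ^ 40

lemma layerWidth_pos (hK : 2 ≤ K) {r : ℕ} (hr : 1 ≤ r) : 0 < layerWidth K r := by
  have h1 := ballSize_pos hK hr
  have hK0 : (0 : ℝ) < K := by exact_mod_cast (by omega : 0 < K)
  unfold layerWidth
  positivity

/-- The width contains two factors `ballSize`, from the number of vertices and from the Green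
function bound. With a third one from the rescaling they are of order `x ^ 24`, against a decay `x ^
(-40)`. -/
lemma ballSize_mul_layerWidth_le (hK : 2 ≤ K) {r : ℕ} (hr : 1 ≤ r) :
    ballSize K r * layerWidth K r ≤ (K + 2) ^ 2 * (K : ℝ) ^ 43 / ((K : ℝ) ^ r) ^ 16 := by
  have h1 := ballSize_pos hK hr
  have h2 := ballSize_le hK r
  have h3 := one_le_pow_real hK r
  have hK0 : (0 : ℝ) < K := by exact_mod_cast (by omega : 0 < K)
  set x := (K : ℝ) ^ r
  have h4 : ballSize K r ^ 3 ≤ (K * x ^ 8) ^ 3 := by gcongr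
  have h5 : ballSize K r * layerWidth K r
      = ballSize K r ^ 3 * ((K + 2) ^ 2 * (K : ℝ) ^ 40 / x ^ 40) := by
    unfold layerWidth
    push_cast
    ring
  rw [h5]
  refine (mul_le_mul_of_nonneg_right h4 (by positivity)).trans (le_of_eq ?_)
  have hx : x ≠ 0 := by positivity
  field_simp

/-- The condition on the widths of the boundary layers for both comparisons. -/
lemma cut_error_le_layerWidth (hK : 2 ≤ K) {r : ℕ} (hr : 1 ≤ r) {b : ℝ}
    (hb2 : 2 * b ≤ ballSize K r) :
    (K + 2) * (((treeFinset (K + 1) K (r + 7 * r)).card : ℝ) *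
      (2 * b * ((K + 2) / ((K ^ 20 : ℕ) : ℝ) ^ (2 * (2 * r - 1))) *
        ((K ^ 20 : ℕ) : ℝ) ^ (2 * r))) ≤ layerWidth K r := by
  have hK0 : (0 : ℝ) < K := by exact_mod_cast (by omega : 0 < K)
  have hN := ballSize_pos hK hr
  set Q : ℝ := ((K ^ 20 : ℕ) : ℝ) with hQ
  have hQ0 : 0 < Q := by rw [hQ]; push_cast; positivity
  have h1 : Q ^ (2 * (2 * r - 1)) * Q ^ 2 = Q ^ (2 * r) * Q ^ (2 * r) := by
    rw [← pow_add, ← pow_add]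
    congr 1
    omega
  -- Between generation `r` and the end of the region, generation `2 * r - 1`, the weights grow by
  -- `Q ^ (2 * r)` up to a factor `Q ^ 2`; with `Q = K ^ 20` this is `x ^ 40`.
  have h2 : ((K : ℝ) ^ r) ^ 40 = Q ^ (2 * r) := by
    rw [hQ]
    push_cast
    rw [← pow_mul, ← pow_mul]
    congr 1
    ring
  have h3 : (K + 2) / Q ^ (2 * (2 * r - 1)) * Q ^ (2 * r) = (K + 2) * Q ^ 2 / Q ^ (2 * r) := by
    rw [div_mul_eq_mul_div, div_eq_div_iff (by positivity) (by positivity)]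
    calc (K + 2) * Q ^ (2 * r) * Q ^ (2 * r) = (K + 2) * (Q ^ (2 * r) * Q ^ (2 * r)) := by ring
      _ = _ := by rw [← h1]; ring
  rw [mul_assoc (2 * b), h3, layerWidth, h2]
  change (K + 2) * (ballSize K r * (2 * b * ((K + 2) * Q ^ 2 / Q ^ (2 * r)))) ≤ _
  calc (K + 2) * (ballSize K r * (2 * b * ((K + 2) * Q ^ 2 / Q ^ (2 * r))))
      ≤ (K + 2) * (ballSize K r * (ballSize K r * ((K + 2) * Q ^ 2 / Q ^ (2 * r)))) := by gcongr
    _ = _ := by ring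

/-- For a lower tree the cut is at its root, in generation `0`, so the estimate is better by the
factor `Q ^ (2 * r)`. -/
lemma subtree_cut_error_le_layerWidth (hK : 2 ≤ K) {r : ℕ} (hr : 1 ≤ r) {b : ℝ} (hb : 0 ≤ b)
    (hb2 : 2 * b ≤ ballSize K r) :
    (K + 2) * (((treeFinset K K (7 * r)).card : ℝ) *
      (2 * b * ((K + 2) / ((K ^ 20 : ℕ) : ℝ) ^ (2 * (2 * r - 1))))) ≤ layerWidth K r := by
  refine le_trans ?_ (cut_error_le_layerWidth hK hr hb2)
  have h1 : (treeFinset K K (7 * r)).card ≤ (treeFinset (K + 1) K (r + 7 * r)).card := by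
    rw [card_treeFinset, card_treeFinset]
    refine (Finset.sum_le_sum fun u _ => (genCard_self K u).trans_le
      (pow_le_genCard (Nat.le_succ K) u)).trans ?_
    exact Finset.sum_le_sum_of_subset (Finset.range_mono (by omega))
  have h2 : (1 : ℝ) ≤ ((K ^ 20 : ℕ) : ℝ) ^ (2 * r) :=
    one_le_pow₀ (by exact_mod_cast Nat.one_le_pow _ _ (by omega))
  have hK0 : (0 : ℝ) < K := by exact_mod_cast (by omega : 0 < K)
  refine mul_le_mul_of_nonneg_left (mul_le_mul (by exact_mod_cast h1)
    (le_mul_of_one_le_right (by positivity) h2) (by positivity) (by positivity)) (by positivity)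

lemma ofReal_wegner (k M : ℕ) (C : NNReal) (y : ℝ) :
    (k : ℝ≥0∞) * (C * (M * ENNReal.ofReal y)) = ENNReal.ofReal (k * (C * (M * y))) := by
  rw [ENNReal.ofReal_mul (by positivity), ENNReal.ofReal_mul (by positivity),
    ENNReal.ofReal_mul (by positivity), ENNReal.ofReal_natCast, ENNReal.ofReal_natCast,
    ENNReal.ofReal_coe_nnreal]

end Sizes

/-! ### Probabilistic estimates for the ball and its subtrees -/

section Estimates

set_option linter.unusedSectionVars false

/-- The conditions on the strength of the disorder that are used below. -/
structure StrongDisorder (K p : ℕ) (ν : Measure ℝ) (lam : ℝ) (C : NNReal) (M : ℕ) : Prop where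
  two_le : 2 ≤ K
  period_pos : 0 < p
  lam_pos : 0 < lam
  le_volume : ν ≤ C • volume
  block_le : ∑ v ∈ Finset.range p, genCard (K + 1) K v ≤ M
  exists_moment : ∃ θ : ℝ≥0∞, (∀ t₀ : ℝ, ∫⁻ t, esqrt (‖lam * t + t₀‖ₑ⁻¹) ∂ν ≤ θ) ∧
    M * θ * (M * ((K ^ 20 : ℕ) : ℝ≥0∞) ^ p
      + M * ((K + 2 : ℕ) * (((K ^ 20 : ℕ) : ℝ≥0∞) ^ p) ^ 2)) ≤ 1

variable {K p : ℕ} {ν : Measure ℝ} [IsProbabilityMeasure ν] {lam : ℝ} {C : NNReal} {M : ℕ}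

lemma sum_genCard_self_le (p : ℕ) :
    ∑ v ∈ Finset.range p, genCard K K v ≤ ∑ v ∈ Finset.range p, genCard (K + 1) K v :=
  Finset.sum_le_sum fun v _ => (genCard_self K v).trans_le (pow_le_genCard (Nat.le_succ K) v)

lemma StrongDisorder.block_le' (h : StrongDisorder K p ν lam C M) {κ : ℕ}
    (hκ : κ = K ∨ κ = K + 1) : ∑ v ∈ Finset.range p, genCard κ K v ≤ M := by
  rcases hκ with rfl | rfl
  · exact (sum_genCard_self_le p).trans h.block_le
  · exact h.block_le

lemma StrongDisorder.lintegral_eigCount_le (h : StrongDisorder K p ν lam C M) {κ : ℕ}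
    (hκ : κ = K ∨ κ = K + 1) (R : ℕ) {a b : ℝ} (hab : a ≤ b) :
    ∫⁻ w, (eigCount (treeOp κ K p R lam w) (Set.Icc a b) : ℝ≥0∞)
        ∂(Measure.infinitePi fun _ : ℕ × ℕ => ν)
      ≤ ENNReal.ofReal ((treeFinset κ K R).card * (C * (M * ((b - a) / lam)))) := by
  have hK := h.two_le
  have hb : BlockCardLE (fun x : treeFinset κ K R => treeSite K p x) M :=
    (blockCardLE_treeSite h.period_pos (by omega) (by omega) R).mono (h.block_le' hκ)
  refine (lintegral_eigCount_Icc_le ν (treeHop_isHermitian κ K R) h.lam_pos hb h.le_volume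
    hab).trans (le_of_eq ?_)
  rw [Fintype.card_coe, ofReal_wegner]

lemma esqrt_ofReal {b : ℝ} (hb : 0 ≤ b) : esqrt (ENNReal.ofReal b) = ENNReal.ofReal (√b) := by
  rw [esqrt, ENNReal.ofReal_rpow_of_nonneg hb (by norm_num), Real.sqrt_eq_rpow]

/-- The factor of the Green function bounds for the window that is obtained from `[-s, s]`. -/
def decayFactor (K r : ℕ) (s : ℝ) : ℝ := ballSize K r / (2 * s)

/-- The first `2 * r` generations have at most `K x ^ 2` vertices, and the admissible constant is of
order `x ^ 8`, so the union bound gives `x ^ 2 * x ^ (-4)`. The power `x ^ (-2)` is needed for a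
further union bound over the order of `x` lower trees. -/
lemma StrongDisorder.measure_not_greenDecay_le (h : StrongDisorder K p ν lam C M) {κ : ℕ}
    (hκ : κ = K ∨ κ = K + 1) (E : ℝ) {r : ℕ} (hr : 1 ≤ r) {s : ℝ} (hs : 0 < s) :
    (Measure.infinitePi fun _ : ℕ × ℕ => ν)
        {w | ¬ GreenDecay κ K (2 * r) lam E (K ^ 20) (decayFactor K r s)
          fun x => w (treeSite K p x)}
      ≤ ENNReal.ofReal (K * √(2 * s * K) / ((K : ℝ) ^ r) ^ 2) := by
  have hK := h.two_le
  have hK0 : (0 : ℝ) < K := by exact_mod_cast (by omega : 0 < K)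
  have hN := ballSize_pos hK hr
  have hb : 0 < decayFactor K r s := by unfold decayFactor; positivity
  have hx := one_le_pow_real hK r
  obtain ⟨θ, hθ, hsmall⟩ := h.exists_moment
  refine (BetheCanopy.measure_not_greenDecay_le ν h.period_pos (by omega) (by omega) (by omega)
    (by positivity) h.lam_pos h.le_volume (h.block_le' hκ) hθ hsmall E hb).trans ?_
  have hN2 := pow_le_ballSize (K := K) hr
  set x := (K : ℝ) ^ r with hxdef
  have hcard : ((treeFinset κ K (2 * r)).card : ℝ≥0∞) ≤ ENNReal.ofReal (K * x ^ 2) := by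
    have h1 : (treeFinset κ K (2 * r)).card ≤ K * K ^ (2 * r) := by
      rcases hκ with rfl | rfl
      · exact (card_treeFinset_le_pow hK _).trans (Nat.le_mul_of_pos_left _ (by omega))
      · exact card_treeFinset_succ_le hK _
    have h2 : (K : ℝ) * x ^ 2 = ((K * K ^ (2 * r) : ℕ) : ℝ) := by
      push_cast
      rw [hxdef, ← pow_mul, mul_comm r 2]
    rw [h2, ENNReal.ofReal_natCast]
    exact_mod_cast h1
  have hsq : x ^ 4 / √(2 * s * K) ≤ √(decayFactor K r s) := by
    refine Real.le_sqrt_of_sq_le ?_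
    rw [div_pow, Real.sq_sqrt (by positivity), decayFactor, div_le_div_iff₀ (by positivity)
      (by positivity)]
    calc (x ^ 4) ^ 2 * (2 * s) = x ^ 8 * (2 * s) := by ring
      _ ≤ K * ballSize K r * (2 * s) := by gcongr
      _ = _ := by ring
  have hs0 : 0 < √(2 * s * K) := Real.sqrt_pos.mpr (by positivity)
  rw [esqrt_ofReal hb.le, ← ENNReal.ofReal_inv_of_pos (Real.sqrt_pos.mpr hb)]
  refine (mul_le_mul_left hcard _).trans ?_
  rw [← ENNReal.ofReal_mul (by positivity)]
  refine ENNReal.ofReal_le_ofReal ?_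
  calc K * x ^ 2 * (√(decayFactor K r s))⁻¹ ≤ K * x ^ 2 * (x ^ 4 / √(2 * s * K))⁻¹ := by gcongr
    _ = _ := by
      have : x ≠ 0 := by positivity
      field_simp

/-! #### The laws of the subtrees -/

/-- Different subtrees share no block, and each is partitioned like a tree of its own: this is the
reason for independence and equality of the laws below. -/
lemma treeSite_subtreeVertex_eq_iff {a R' : ℕ} (hp : 0 < p) (ha : 1 ≤ a) (hK : 0 < K) (i j : ℕ)
    (x y : treeFinset K K R') :
    treeSite K p (subtreeVertex K (p * a) i x) = treeSite K p (subtreeVertex K (p * a) j y)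
      ↔ i = j ∧ treeSite K p x = treeSite K p y := by
  have hx : ∀ z : treeFinset K K R', z.1.2 < K ^ z.1.1 := fun z => by
    have := (mem_treeFinset.mp z.2).2
    rwa [genCard_self] at this
  rw [treeSite_subtreeVertex hp ha hK i (hx x), treeSite_subtreeVertex hp ha hK j (hx y),
    subtreeVertex_inj (treeSite_lt (hx x) hK) (treeSite_lt (hx y) hK)]

lemma lintegral_subtreePotential {κ r R' : ℕ} (hp : 0 < p) (hr : 1 ≤ r) (hpr : p ∣ r) (hK : 0 < K)
    (j : Fin (genCard κ K r)) {F : (treeFinset K K R' → ℝ) → ℝ≥0∞} (hF : Measurable F) :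
    ∫⁻ w, F (subtreePotential hr (fun x => w (treeSite K p x)) j)
        ∂(Measure.infinitePi fun _ : ℕ × ℕ => ν)
      = ∫⁻ w, F (fun x => w (treeSite K p x)) ∂(Measure.infinitePi fun _ : ℕ × ℕ => ν) := by
  obtain ⟨a, rfl⟩ := hpr
  have ha : 1 ≤ a := Nat.pos_of_mul_pos_left hr
  refine lintegral_infinitePi_comp ν (s := fun x : treeFinset K K R' =>
    treeSite K p (subtreeVertex K (p * a) j x)) (s' := fun x => treeSite K p x) (fun x y => ?_) hF
  rw [treeSite_subtreeVertex_eq_iff hp ha hK]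
  simp

lemma measure_subtreePotential {κ r R' : ℕ} (hp : 0 < p) (hr : 1 ≤ r) (hpr : p ∣ r) (hK : 0 < K)
    (j : Fin (genCard κ K r)) {T : Set (treeFinset K K R' → ℝ)} (hT : MeasurableSet T) :
    (Measure.infinitePi fun _ : ℕ × ℕ => ν)
        {w | subtreePotential hr (fun x => w (treeSite K p x)) j ∈ T}
      = (Measure.infinitePi fun _ : ℕ × ℕ => ν) 
          {w | (fun x : treeFinset K K R' => w (treeSite K p x)) ∈ T} := by
  have h := lintegral_subtreePotential (ν := ν) hp hr hpr hK j
    (F := T.indicator 1) (measurable_one.indicator hT)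
  have m1 : Measurable fun (w : ℕ × ℕ → ℝ) (x : treeFinset K K R') => w (treeSite K p x) := by
    fun_prop
  have m2 : Measurable fun (w : ℕ × ℕ → ℝ) => subtreePotential hr
      (fun x : treeFinset κ K (r + R') => w (treeSite K p x)) j :=
    measurable_pi_lambda _ fun x => measurable_pi_apply _
  have h1 := lintegral_indicator_one (μ := Measure.infinitePi fun _ : ℕ × ℕ => ν) (m1 hT)
  have h2 := lintegral_indicator_one (μ := Measure.infinitePi fun _ : ℕ × ℕ => ν) (m2 hT)
  exact h2.symm.trans (h.trans h1)

lemma integral_prod_subtreePotential {κ r R' : ℕ} (hp : 0 < p) (hr : 1 ≤ r) (hpr : p ∣ r)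
    (hK : 0 < K) {F : (treeFinset K K R' → ℝ) → ℂ} (hF : Measurable F) :
    ∫ w, ∏ j : Fin (genCard κ K r), F (subtreePotential hr (fun x => w (treeSite K p x)) j)
        ∂(Measure.infinitePi fun _ : ℕ × ℕ => ν)
      = (∫ w, F (fun x => w (treeSite K p x)) ∂(Measure.infinitePi fun _ : ℕ × ℕ => ν))
          ^ genCard κ K r := by
  obtain ⟨a, rfl⟩ := hpr
  have ha : 1 ≤ a := Nat.pos_of_mul_pos_left hr
  have h := integral_prod_infinitePi_comp ν (J := Fin (genCard κ K (p * a)))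
    (s := fun j (x : treeFinset K K R') => treeSite K p (subtreeVertex K (p * a) j x))
    (s' := fun x => treeSite K p x) (fun i j x y => by
      rw [treeSite_subtreeVertex_eq_iff hp ha hK, Fin.val_inj]) hF
  rw [Fintype.card_fin] at h
  exact h

lemma measurable_eigCount_treeHam (κ K R : ℕ) (lam : ℝ) {B : Set ℝ} (hB : MeasurableSet B) :
    Measurable fun v : treeFinset κ K R → ℝ => eigCount (treeHam κ K R lam v) B :=
  measurable_eigCount_comp (treeHop_isHermitian κ K R) lam id hB

lemma measure_ne_zero_le {Ω : Type*} [MeasurableSpace Ω] (μ : Measure Ω) {f : Ω → ℕ}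
    (hf : Measurable f) : μ {a | f a ≠ 0} ≤ ∫⁻ a, (f a : ℝ≥0∞) ∂μ := by
  have h := mul_meas_ge_le_lintegral (μ := μ) (measurable_natCast_ennreal hf) 1
  rw [one_mul] at h
  refine (measure_mono fun a ha => ?_).trans h
  have ha' : f a ≠ 0 := ha
  change (1 : ℝ≥0∞) ≤ f a
  exact_mod_cast Nat.one_le_iff_ne_zero.mpr ha'

end Estimates

/-! ### Comparison of the ball with independent subtrees -/

section Comparison

set_option linter.unusedSectionVars false

/-- The energies that are mapped to `I` by the scaling of the ball. -/
def energyWindow (K r : ℕ) (E₀ : ℝ) (I : Set ℝ) : Set ℝ := {e | ballSize K r * (e - E₀) ∈ I}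

/-- The energy that is mapped to `a` by the scaling of the ball. -/
def energyAt (K r : ℕ) (E₀ a : ℝ) : ℝ := E₀ + a / ballSize K r

/-- The number of eigenvalues in the boundary layers of the energy window. -/
def layerCount {V : Type*} [Fintype V] [DecidableEq V] (K r : ℕ) (E₀ a₀ b₀ : ℝ)
    (A : Matrix V V ℂ) : ℕ :=
  eigCount A (Set.Icc (energyAt K r E₀ a₀ - layerWidth K r) (energyAt K r E₀ a₀))
    + eigCount A (Set.Icc (energyAt K r E₀ b₀) (energyAt K r E₀ b₀ + layerWidth K r))

/-- The energy window together with its boundary layers. -/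
def enlargedWindow (K r : ℕ) (E₀ a₀ b₀ : ℝ) : Set ℝ :=
  Set.Icc (energyAt K r E₀ a₀ - layerWidth K r) (energyAt K r E₀ b₀ + layerWidth K r)

/-- The size of a window. -/
def windowScale (a₀ b₀ : ℝ) : ℝ := |a₀| + |b₀| + 1

lemma windowScale_pos (a₀ b₀ : ℝ) : 0 < windowScale a₀ b₀ := by unfold windowScale; positivity

lemma eigCount_union_le {V : Type*} [Fintype V] [DecidableEq V] {A : Matrix V V ℂ}
    (hA : A.IsHermitian) (B B' : Set ℝ) : eigCount A (B ∪ B') ≤ eigCount A B + eigCount A B' := by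
  rw [← Set.union_sdiff_self, eigCount_union hA Set.disjoint_sdiff_right]
  exact Nat.add_le_add_left (eigCount_mono A Set.sdiff_subset) _

variable {K r : ℕ} {E₀ a₀ b₀ : ℝ} {I : Set ℝ}

lemma measurableSet_energyWindow (hI : MeasurableSet I) :
    MeasurableSet (energyWindow K r E₀ I) :=
  hI.preimage (f := fun e : ℝ => ballSize K r * (e - E₀)) (by fun_prop)

lemma energyWindow_subset (hK : 2 ≤ K) (hr : 1 ≤ r) (hI : I ⊆ Set.Icc a₀ b₀) :
    energyWindow K r E₀ I ⊆ Set.Icc (energyAt K r E₀ a₀) (energyAt K r E₀ b₀) := by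
  intro e he
  have hN := ballSize_pos hK hr
  have h := hI he
  have h1 : a₀ / ballSize K r ≤ e - E₀ := by rw [div_le_iff₀' hN]; exact h.1
  have h2 : e - E₀ ≤ b₀ / ballSize K r := by rw [le_div_iff₀' hN]; exact h.2
  unfold energyAt
  exact ⟨by linarith, by linarith⟩

lemma enlargedWindow_subset (hK : 2 ≤ K) (hr : 1 ≤ r) (hI : Set.Ioo a₀ b₀ ⊆ I) :
    enlargedWindow K r E₀ a₀ b₀ ⊆ energyWindow K r E₀ I
      ∪ (Set.Icc (energyAt K r E₀ a₀ - layerWidth K r) (energyAt K r E₀ a₀)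
      ∪ Set.Icc (energyAt K r E₀ b₀) (energyAt K r E₀ b₀ + layerWidth K r)) := by
  intro e he
  have hN := ballSize_pos hK hr
  rcases le_or_gt e (energyAt K r E₀ a₀) with h1 | h1
  · exact Or.inr (Or.inl ⟨he.1, h1⟩)
  rcases le_or_gt (energyAt K r E₀ b₀) e with h2 | h2
  · exact Or.inr (Or.inr ⟨h2, he.2⟩)
  refine Or.inl (hI ⟨?_, ?_⟩)
  · unfold energyAt at h1
    rw [← div_lt_iff₀' hN]
    linarith
  · unfold energyAt at h2
    rw [← lt_div_iff₀' hN]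
    linarith

lemma eigCount_enlargedWindow_le (hK : 2 ≤ K) (hr : 1 ≤ r) (hI : Set.Ioo a₀ b₀ ⊆ I)
    {V : Type*} [Fintype V] [DecidableEq V] {A : Matrix V V ℂ} (hA : A.IsHermitian) :
    eigCount A (enlargedWindow K r E₀ a₀ b₀)
      ≤ eigCount A (energyWindow K r E₀ I) + layerCount K r E₀ a₀ b₀ A :=
  (eigCount_mono A (enlargedWindow_subset hK hr hI)).trans
    ((eigCount_union_le hA _ _).trans (Nat.add_le_add_left (eigCount_union_le hA _ _) _))

lemma two_mul_decayFactor_le (hK : 2 ≤ K) (hr : 1 ≤ r) :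
    2 * decayFactor K r (windowScale a₀ b₀) ≤ ballSize K r := by
  have hN := ballSize_pos hK hr
  have hs : 1 ≤ windowScale a₀ b₀ := by
    unfold windowScale
    linarith [abs_nonneg a₀, abs_nonneg b₀]
  unfold decayFactor
  rw [mul_div_assoc', mul_div_mul_left _ _ two_ne_zero]
  exact div_le_self hN.le hs

lemma decayFactor_nonneg (hK : 2 ≤ K) (hr : 1 ≤ r) :
    0 ≤ decayFactor K r (windowScale a₀ b₀) :=
  div_nonneg (ballSize_pos hK hr).le (by linarith [windowScale_pos a₀ b₀])

/-- A window of size `s` is scaled to `s / ballSize`, and `decayFactor` is the largest constant for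
which the absorption in the eigenvector estimate still works. -/
lemma abs_mul_decayFactor_le (hK : 2 ≤ K) (hr : 1 ≤ r) (hI : I ⊆ Set.Icc a₀ b₀) {e : ℝ}
    (he : e ∈ energyWindow K r E₀ I) :
    |e - E₀| * decayFactor K r (windowScale a₀ b₀) ≤ 1 / 2 := by
  have hN := ballSize_pos hK hr
  have hs := windowScale_pos a₀ b₀
  have h1 : |ballSize K r * (e - E₀)| ≤ windowScale a₀ b₀ := by
    have h := hI he
    unfold windowScale
    rw [abs_le]
    exact ⟨by linarith [neg_abs_le a₀, abs_nonneg b₀, h.1],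
      by linarith [le_abs_self b₀, abs_nonneg a₀, h.2]⟩
  rw [abs_mul, abs_of_pos hN] at h1
  unfold decayFactor
  rw [mul_div_assoc', div_le_div_iff₀ (by positivity) two_pos]
  linarith

lemma window_center_sub (K r : ℕ) (E₀ a₀ b₀ δ : ℝ) :
    Set.Icc ((energyAt K r E₀ a₀ + energyAt K r E₀ b₀) / 2
        - ((energyAt K r E₀ b₀ - energyAt K r E₀ a₀) / 2 + δ))
      ((energyAt K r E₀ a₀ + energyAt K r E₀ b₀) / 2
        + ((energyAt K r E₀ b₀ - energyAt K r E₀ a₀) / 2 + δ))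
      = Set.Icc (energyAt K r E₀ a₀ - δ) (energyAt K r E₀ b₀ + δ) := by
  congr 1 <;> ring

lemma energyAt_le (hK : 2 ≤ K) (hr : 1 ≤ r) (hab : a₀ ≤ b₀) :
    energyAt K r E₀ a₀ ≤ energyAt K r E₀ b₀ := by
  unfold energyAt
  have := div_le_div_of_nonneg_right hab (ballSize_pos hK hr).le
  linarith

lemma eigCount_ball_le (hK : 2 ≤ K) (hr : 1 ≤ r) (hab : a₀ ≤ b₀) (hI : I ⊆ Set.Icc a₀ b₀)
    {lam : ℝ} {v : treeFinset (K + 1) K (r + 7 * r) → ℝ}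
    (hv : GreenDecay (K + 1) K (2 * r) lam E₀ (K ^ 20) (decayFactor K r (windowScale a₀ b₀))
      fun x => v (treeIncl (by omega) x)) :
    eigCount (treeHam (K + 1) K (r + 7 * r) lam v) (energyWindow K r E₀ I)
      ≤ eigCount (treeHam (K + 1) K r lam fun x => v (treeIncl (Nat.le_add_right _ _) x))
          (enlargedWindow K r E₀ a₀ b₀)
        + ∑ j, eigCount (treeHam K K (7 * r) lam (subtreePotential hr v j))
          (enlargedWindow K r E₀ a₀ b₀) := by
  have h := eigCount_treeHam_le (K := K) (q := K ^ 20) (by omega) le_rfl (by positivity) hr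
    (by omega) (by omega) (decayFactor_nonneg hK hr) hv (B := energyWindow K r E₀ I)
    (c := (energyAt K r E₀ a₀ + energyAt K r E₀ b₀) / 2)
    (r := (energyAt K r E₀ b₀ - energyAt K r E₀ a₀) / 2)
    (by linarith [energyAt_le (E₀ := E₀) hK hr hab])
    (by
      have h1 := window_center_sub K r E₀ a₀ b₀ 0
      simp only [add_zero, sub_zero] at h1
      rw [h1]
      exact energyWindow_subset hK hr hI)
    (fun e he => abs_mul_decayFactor_le hK hr hI he)
    (cut_error_le_layerWidth hK hr (two_mul_decayFactor_le hK hr))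
  rw [window_center_sub] at h
  exact h

lemma sum_eigCount_subtree_le_enlargedWindow {κ r₀ : ℕ} (hK : 2 ≤ K) (hκ : κ ≤ K + 1)
    (hr₀ : 1 ≤ r₀) (hr : 1 ≤ r) (hab : a₀ ≤ b₀) (hI : I ⊆ Set.Icc a₀ b₀)
    {lam : ℝ} {v : treeFinset κ K (r₀ + 7 * r) → ℝ} {B : Fin (genCard κ K r₀) → Set ℝ}
    (hB : ∀ j, B j ⊆ energyWindow K r E₀ I)
    (hv : ∀ j, (B j).Nonempty → GreenDecay K K (2 * r) lam E₀ (K ^ 20)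
      (decayFactor K r (windowScale a₀ b₀))
      fun x => subtreePotential hr₀ v j (treeIncl (by omega) x)) :
    ∑ j, eigCount (treeHam K K (7 * r) lam (subtreePotential hr₀ v j)) (B j)
      ≤ eigCount (treeHam κ K (r₀ + 7 * r) lam v) (enlargedWindow K r E₀ a₀ b₀) := by
  have h := sum_eigCount_subtree_le (K := K) (q := K ^ 20) (by omega) hκ (by positivity) hr₀
    (by omega) (by omega) (decayFactor_nonneg hK hr) hv
    (c := (energyAt K r E₀ a₀ + energyAt K r E₀ b₀) / 2)
    (r := (energyAt K r E₀ b₀ - energyAt K r E₀ a₀) / 2)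
    (by linarith [energyAt_le (E₀ := E₀) hK hr hab])
    (fun j => by
      have h1 := window_center_sub K r E₀ a₀ b₀ 0
      simp only [add_zero, sub_zero] at h1
      rw [h1]
      exact (hB j).trans (energyWindow_subset hK hr hI))
    (fun j e he => abs_mul_decayFactor_le hK hr hI (hB j he))
    (subtree_cut_error_le_layerWidth hK hr (decayFactor_nonneg hK hr)
      (two_mul_decayFactor_le hK hr))
  rw [window_center_sub] at h
  exact h

/-- The configurations of a ball for which the comparison with the subtrees may fail. -/
def badBall (K r : ℕ) (lam E₀ a₀ b₀ : ℝ) : Set (treeFinset (K + 1) K (r + 7 * r) → ℝ) :=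
  {v | ¬ GreenDecay (K + 1) K (2 * r) lam E₀ (K ^ 20) (decayFactor K r (windowScale a₀ b₀))
      fun x => v (treeIncl (by omega) x)} ∪
    ({v | eigCount (treeHam (K + 1) K r lam fun x => v (treeIncl (Nat.le_add_right _ _) x))
          (enlargedWindow K r E₀ a₀ b₀) ≠ 0} ∪
      {v | layerCount K r E₀ a₀ b₀ (treeHam (K + 1) K (r + 7 * r) lam v) ≠ 0})

/-- The configurations of a subtree for which the comparison with the ball may fail. -/
def badSubtree (K r : ℕ) (lam E₀ a₀ b₀ : ℝ) : Set (treeFinset K K (7 * r) → ℝ) :=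
  {v | ¬ GreenDecay K K (2 * r) lam E₀ (K ^ 20) (decayFactor K r (windowScale a₀ b₀))
      fun x => v (treeIncl (by omega) x)} ∪
    {v | layerCount K r E₀ a₀ b₀ (treeHam K K (7 * r) lam v) ≠ 0}

/-- Each inequality enlarges the window by a boundary layer on either side, and the good
configurations have no eigenvalues there; the top tree has none in the whole enlarged window. -/
lemma eigCount_ball_eq_sum (hK : 2 ≤ K) (hr : 1 ≤ r) (hab : a₀ ≤ b₀) (hI : Set.Ioo a₀ b₀ ⊆ I)
    (hI' : I ⊆ Set.Icc a₀ b₀) {lam : ℝ} {v : treeFinset (K + 1) K (r + 7 * r) → ℝ}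
    (hv : v ∉ badBall K r lam E₀ a₀ b₀)
    (hv' : ∀ j, subtreePotential hr v j ∉ badSubtree K r lam E₀ a₀ b₀) :
    eigCount (treeHam (K + 1) K (r + 7 * r) lam v) (energyWindow K r E₀ I)
      = ∑ j, eigCount (treeHam K K (7 * r) lam (subtreePotential hr v j))
          (energyWindow K r E₀ I) := by
  simp only [badBall, badSubtree, Set.mem_union, Set.mem_ofPred_eq, not_or, not_not] at hv hv'
  refine le_antisymm ?_ ?_
  · refine (eigCount_ball_le hK hr hab hI' hv.1).trans ?_
    rw [hv.2.1, zero_add]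
    refine Finset.sum_le_sum fun j _ => ?_
    refine (eigCount_enlargedWindow_le hK hr hI (treeHam_isHermitian _ _ _ _ _)).trans ?_
    rw [(hv' j).2, add_zero]
  · refine (sum_eigCount_subtree_le_enlargedWindow hK le_rfl hr hr hab hI'
      (B := fun _ => energyWindow K r E₀ I) (fun _ => subset_rfl) fun j _ => (hv' j).1).trans ?_
    refine (eigCount_enlargedWindow_le hK hr hI (treeHam_isHermitian _ _ _ _ _)).trans ?_
    rw [hv.2.2, add_zero]

lemma measurable_layerCount (κ R : ℕ) (lam : ℝ) : Measurable fun v : treeFinset κ K R → ℝ =>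
    layerCount K r E₀ a₀ b₀ (treeHam κ K R lam v) :=
  (measurable_eigCount_treeHam κ K R lam measurableSet_Icc).add
    (measurable_eigCount_treeHam κ K R lam measurableSet_Icc)

lemma measurableSet_badBall (lam : ℝ) : MeasurableSet (badBall K r lam E₀ a₀ b₀) := by
  refine MeasurableSet.union ?_ (MeasurableSet.union ?_ ?_)
  · have h : Measurable fun (v : treeFinset (K + 1) K (r + 7 * r) → ℝ)
        (x : treeFinset (K + 1) K (2 * r)) => v (treeIncl (by omega) x) := by fun_prop
    exact h (measurableSet_greenDecay (K + 1) K (2 * r) lam E₀ (K ^ 20) _).compl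
  · have h : Measurable fun (v : treeFinset (K + 1) K (r + 7 * r) → ℝ)
        (x : treeFinset (K + 1) K r) => v (treeIncl (Nat.le_add_right _ _) x) := by fun_prop
    exact ((measurable_eigCount_treeHam (K + 1) K r lam measurableSet_Icc).comp h)
      (measurableSet_singleton 0).compl
  · exact measurable_layerCount (K + 1) _ lam (measurableSet_singleton 0).compl

lemma measurableSet_badSubtree (lam : ℝ) : MeasurableSet (badSubtree K r lam E₀ a₀ b₀) := by
  refine MeasurableSet.union ?_ ?_
  · have h : Measurable fun (v : treeFinset K K (7 * r) → ℝ)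
        (x : treeFinset K K (2 * r)) => v (treeIncl (by omega) x) := by fun_prop
    exact h (measurableSet_greenDecay K K (2 * r) lam E₀ (K ^ 20) _).compl
  · exact measurable_layerCount K _ lam (measurableSet_singleton 0).compl

/-! #### Probabilities -/

variable {p : ℕ} {ν : Measure ℝ} [IsProbabilityMeasure ν] {lam : ℝ} {C : NNReal} {M : ℕ}

lemma StrongDisorder.lintegral_layerCount_le (h : StrongDisorder K p ν lam C M) {κ : ℕ}
    (hκ : κ = K ∨ κ = K + 1) (hr : 1 ≤ r) (R : ℕ) :
    ∫⁻ w, (layerCount K r E₀ a₀ b₀ (treeOp κ K p R lam w) : ℝ≥0∞)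
        ∂(Measure.infinitePi fun _ : ℕ × ℕ => ν)
      ≤ ENNReal.ofReal (2 * ((treeFinset κ K R).card * (C * (M * (layerWidth K r / lam))))) := by
  have hδ := layerWidth_pos h.two_le hr
  have hlam := h.lam_pos
  have h1 := h.lintegral_eigCount_le hκ R (a := energyAt K r E₀ a₀ - layerWidth K r)
    (b := energyAt K r E₀ a₀) (by linarith)
  have h2 := h.lintegral_eigCount_le hκ R (a := energyAt K r E₀ b₀)
    (b := energyAt K r E₀ b₀ + layerWidth K r) (by linarith)
  rw [sub_sub_cancel] at h1
  rw [add_sub_cancel_left] at h2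
  simp only [layerCount, Nat.cast_add]
  rw [lintegral_add_left (measurable_natCast_ennreal (measurable_eigCount_treeOp lam
    measurableSet_Icc)), two_mul, ENNReal.ofReal_add (by positivity) (by positivity)]
  exact add_le_add h1 h2

/-- A bound for the product of the size of the ball and the width of the boundary layers. -/
def widthConst (K : ℕ) : ℝ := (K + 2) ^ 2 * (K : ℝ) ^ 43

lemma ballSize_mul_layerWidth_le' (hK : 2 ≤ K) (hr : 1 ≤ r) :
    ballSize K r * layerWidth K r ≤ widthConst K / (K : ℝ) ^ r := by
  refine (ballSize_mul_layerWidth_le hK hr).trans ?_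
  have hx := one_le_pow_real hK r
  unfold widthConst
  gcongr
  exact le_self_pow₀ hx (by norm_num)

/-- The power `x ^ (-2)` must beat the number of lower trees, which is of order `x`. -/
lemma StrongDisorder.measure_badSubtree_le (h : StrongDisorder K p ν lam C M) (hr : 1 ≤ r) :
    (Measure.infinitePi fun _ : ℕ × ℕ => ν) {w | (fun x : treeFinset K K (7 * r) =>
        w (treeSite K p x)) ∈ badSubtree K r lam E₀ a₀ b₀}
      ≤ ENNReal.ofReal ((K * √(2 * windowScale a₀ b₀ * K)
        + 2 * (K * (C * (M * (widthConst K / lam))))) / ((K : ℝ) ^ r) ^ 2) := by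
  have hK := h.two_le
  have hx := one_le_pow_real hK r
  have hlam := h.lam_pos
  have hK0 : (0 : ℝ) < K := by exact_mod_cast (by omega : 0 < K)
  have hδ := layerWidth_pos hK hr
  have hN := pow_le_ballSize (K := K) hr
  have hw := ballSize_mul_layerWidth_le' hK hr
  have hcard : ((treeFinset K K (7 * r)).card : ℝ) ≤ ((K : ℝ) ^ r) ^ 7 := by
    rw [← pow_mul, mul_comm r 7]
    exact_mod_cast card_treeFinset_le_pow hK (7 * r)
  have hD : 0 ≤ widthConst K := by unfold widthConst; positivity
  have h1 := h.measure_not_greenDecay_le (Or.inl rfl) E₀ hr (windowScale_pos a₀ b₀)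
  have h2 := (measure_ne_zero_le (Measure.infinitePi fun _ : ℕ × ℕ => ν)
    (f := fun w => layerCount K r E₀ a₀ b₀ (treeOp K K p (7 * r) lam w))
    ((measurable_layerCount K (7 * r) lam).comp (by fun_prop))).trans
    (h.lintegral_layerCount_le (Or.inl rfl) hr (7 * r))
  refine (measure_union_le _ _).trans ((add_le_add h1 h2).trans ?_)
  rw [← ENNReal.ofReal_add (by positivity) (by positivity), add_div]
  refine ENNReal.ofReal_le_ofReal (add_le_add_right ?_ _)
  set x := (K : ℝ) ^ r
  have h3 : x ^ 7 * layerWidth K r ≤ K * widthConst K / x ^ 2 := by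
    rw [le_div_iff₀ (by positivity)]
    calc x ^ 7 * layerWidth K r * x ^ 2 = x ^ 8 * layerWidth K r * x := by ring
      _ ≤ K * ballSize K r * layerWidth K r * x := by gcongr
      _ = K * (ballSize K r * layerWidth K r) * x := by ring
      _ ≤ K * (widthConst K / x) * x := by gcongr
      _ = K * widthConst K := by field_simp
  calc 2 * (((treeFinset K K (7 * r)).card : ℝ) * (C * (M * (layerWidth K r / lam))))
      ≤ 2 * (x ^ 7 * (C * (M * (layerWidth K r / lam)))) := by gcongr
    _ = 2 * (C * (M * ((x ^ 7 * layerWidth K r) / lam))) := by ring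
    _ ≤ 2 * (C * (M * ((K * widthConst K / x ^ 2) / lam))) := by gcongr
    _ = _ := by ring

/-- There is one ball only, so `x ^ (-1)` suffices. For the top tree, Wegner's estimate gives a
volume of order `x` times a window of order `x ^ (-8)`. -/
lemma StrongDisorder.measure_badBall_le (h : StrongDisorder K p ν lam C M) (hr : 1 ≤ r)
    (hab : a₀ ≤ b₀) :
    (Measure.infinitePi fun _ : ℕ × ℕ => ν) {w | (fun x : treeFinset (K + 1) K (r + 7 * r) =>
        w (treeSite K p x)) ∈ badBall K r lam E₀ a₀ b₀}
      ≤ ENNReal.ofReal ((K * √(2 * windowScale a₀ b₀ * K)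
        + K ^ 2 * (C * (M * ((b₀ - a₀ + 2 * widthConst K) / lam)))
        + 2 * (C * (M * (widthConst K / lam)))) / (K : ℝ) ^ r) := by
  have hK := h.two_le
  have hx := one_le_pow_real hK r
  have hlam := h.lam_pos
  have hK0 : (0 : ℝ) < K := by exact_mod_cast (by omega : 0 < K)
  have hδ := layerWidth_pos hK hr
  have hN0 := ballSize_pos hK hr
  have hN := pow_le_ballSize (K := K) hr
  have hw := ballSize_mul_layerWidth_le' hK hr
  have hcard : ((treeFinset (K + 1) K r).card : ℝ) ≤ K * (K : ℝ) ^ r := by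
    exact_mod_cast card_treeFinset_succ_le hK r
  have hD : 0 ≤ widthConst K := by unfold widthConst; positivity
  have hab' : 0 ≤ b₀ - a₀ := by linarith
  have h1 := h.measure_not_greenDecay_le (Or.inr rfl) E₀ hr (windowScale_pos a₀ b₀)
  have h2 := (measure_ne_zero_le (Measure.infinitePi fun _ : ℕ × ℕ => ν)
    (f := fun w => eigCount (treeOp (K + 1) K p r lam w) (enlargedWindow K r E₀ a₀ b₀))
    (measurable_eigCount_treeOp lam measurableSet_Icc)).trans
    (h.lintegral_eigCount_le (Or.inr rfl) r
      (by linarith [energyAt_le (E₀ := E₀) hK hr hab]))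
  have h3 := (measure_ne_zero_le (Measure.infinitePi fun _ : ℕ × ℕ => ν)
    (f := fun w => layerCount K r E₀ a₀ b₀ (treeOp (K + 1) K p (r + 7 * r) lam w))
    ((measurable_layerCount (K + 1) (r + 7 * r) lam).comp (by fun_prop))).trans
    (h.lintegral_layerCount_le (Or.inr rfl) hr (r + 7 * r))
  have hlen : energyAt K r E₀ b₀ + layerWidth K r - (energyAt K r E₀ a₀ - layerWidth K r)
      = (b₀ - a₀ + 2 * (ballSize K r * layerWidth K r)) / ballSize K r := by
    unfold energyAt
    field_simp
    ring
  rw [hlen] at h2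
  refine (measure_union_le _ _).trans ((add_le_add h1 ((measure_union_le _ _).trans
    (add_le_add h2 h3))).trans ?_)
  change _ + (_ + ENNReal.ofReal (2 * (ballSize K r * _))) ≤ _
  have hNw : 0 ≤ ballSize K r * layerWidth K r := by positivity
  rw [← ENNReal.ofReal_add (by positivity) (by positivity),
    ← ENNReal.ofReal_add (by positivity) (by positivity)]
  set x := (K : ℝ) ^ r
  rw [add_div _ (2 * _) x, add_div _ ((K : ℝ) ^ 2 * _) x, add_assoc]
  refine ENNReal.ofReal_le_ofReal (add_le_add ?_ (add_le_add ?_ ?_))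
  · gcongr
    exact le_self_pow₀ hx (by norm_num)
  · have h4 : (b₀ - a₀ + 2 * (ballSize K r * layerWidth K r)) / ballSize K r
        ≤ K * (b₀ - a₀ + 2 * widthConst K) / x ^ 2 := by
      rw [div_le_div_iff₀ hN0 (by positivity)]
      have h5 : ballSize K r * layerWidth K r ≤ widthConst K :=
        hw.trans (div_le_self hD hx)
      have h6 : x ^ 2 ≤ x ^ 8 := pow_le_pow_right₀ hx (by norm_num)
      calc (b₀ - a₀ + 2 * (ballSize K r * layerWidth K r)) * x ^ 2
          ≤ (b₀ - a₀ + 2 * widthConst K) * (K * ballSize K r) := by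
            gcongr
            exact h6.trans hN
        _ = _ := by ring
    calc ((treeFinset (K + 1) K r).card : ℝ) * (C * (M *
          ((b₀ - a₀ + 2 * (ballSize K r * layerWidth K r)) / ballSize K r / lam)))
        ≤ (K * x) * (C * (M * (K * (b₀ - a₀ + 2 * widthConst K) / x ^ 2 / lam))) := by gcongr
      _ = _ := by
        have : x ≠ 0 := by positivity
        field_simp
  · calc 2 * (ballSize K r * (C * (M * (layerWidth K r / lam))))
        = 2 * (C * (M * (ballSize K r * layerWidth K r / lam))) := by ring
      _ ≤ 2 * (C * (M * (widthConst K / x / lam))) := by gcongr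
      _ = _ := by ring

/-- Up to an event of small probability, the number of eigenvalues of the ball is the sum of the
numbers of eigenvalues of the subtrees. -/
lemma StrongDisorder.exists_measure_le (h : StrongDisorder K p ν lam C M) (E₀ : ℝ)
    (hab : a₀ ≤ b₀) (hI : Set.Ioo a₀ b₀ ⊆ I) (hI' : I ⊆ Set.Icc a₀ b₀) :
    ∃ A : ℝ, ∀ r : ℕ, ∀ hr : 1 ≤ r, p ∣ r → ∃ T : Set (ℕ × ℕ → ℝ), MeasurableSet T ∧
      (Measure.infinitePi fun _ : ℕ × ℕ => ν) T ≤ ENNReal.ofReal (A / (K : ℝ) ^ r) ∧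
      ∀ w ∉ T, eigCount (treeOp (K + 1) K p (r + 7 * r) lam w) (energyWindow K r E₀ I)
        = ∑ j : Fin (genCard (K + 1) K r), eigCount (treeHam K K (7 * r) lam
            (subtreePotential hr (fun x => w (treeSite K p x)) j)) (energyWindow K r E₀ I) := by
  have hK := h.two_le
  have hlam := h.lam_pos
  have hK0 : (0 : ℝ) < K := by exact_mod_cast (by omega : 0 < K)
  have hD : 0 ≤ widthConst K := by unfold widthConst; positivity
  have hab' : 0 ≤ b₀ - a₀ := by linarith
  set A₁ : ℝ := K * √(2 * windowScale a₀ b₀ * K)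
        + K ^ 2 * (C * (M * ((b₀ - a₀ + 2 * widthConst K) / lam)))
        + 2 * (C * (M * (widthConst K / lam))) with hA₁
  set A₂ : ℝ := K * √(2 * windowScale a₀ b₀ * K)
        + 2 * (K * (C * (M * (widthConst K / lam)))) with hA₂
  have hA₁0 : 0 ≤ A₁ := by positivity
  have hA₂0 : 0 ≤ A₂ := by positivity
  -- The exceptional event is the union of one bad event of the ball and those of at most `K * x`
  -- lower trees, each of probability at most `A₂ / x ^ 2`.
  refine ⟨A₁ + K * A₂, fun r hr hpr => ⟨{w | (fun x : treeFinset (K + 1) K (r + 7 * r) =>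
      w (treeSite K p x)) ∈ badBall K r lam E₀ a₀ b₀} ∪ ⋃ j : Fin (genCard (K + 1) K r),
      {w | subtreePotential hr (fun x : treeFinset (K + 1) K (r + 7 * r) => w (treeSite K p x)) j
        ∈ badSubtree K r lam E₀ a₀ b₀}, ?_, ?_, ?_⟩⟩
  · have m1 : Measurable fun (w : ℕ × ℕ → ℝ) (x : treeFinset (K + 1) K (r + 7 * r)) =>
        w (treeSite K p x) := by fun_prop
    refine (m1 (measurableSet_badBall lam)).union (MeasurableSet.iUnion fun j => ?_)
    have m2 : Measurable fun (w : ℕ × ℕ → ℝ) => subtreePotential hr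
        (fun x : treeFinset (K + 1) K (r + 7 * r) => w (treeSite K p x)) j :=
      measurable_pi_lambda _ fun x => measurable_pi_apply _
    exact m2 (measurableSet_badSubtree lam)
  · have hx := one_le_pow_real hK r
    refine (measure_union_le _ _).trans ((add_le_add (h.measure_badBall_le hr hab)
      (measure_iUnion_le _)).trans ?_)
    have h1 : ∀ j : Fin (genCard (K + 1) K r), (Measure.infinitePi fun _ : ℕ × ℕ => ν)
        {w | subtreePotential hr (fun x : treeFinset (K + 1) K (r + 7 * r) =>
          w (treeSite K p x)) j ∈ badSubtree K r lam E₀ a₀ b₀}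
        ≤ ENNReal.ofReal (A₂ / ((K : ℝ) ^ r) ^ 2) := fun j => by
      rw [measure_subtreePotential h.period_pos hr hpr (by omega) j
        (measurableSet_badSubtree lam)]
      exact h.measure_badSubtree_le hr
    rw [tsum_fintype]
    refine (add_le_add le_rfl (Finset.sum_le_sum fun j _ => h1 j)).trans ?_
    rw [Finset.sum_const, Finset.card_univ, Fintype.card_fin, nsmul_eq_mul,
      ← ENNReal.ofReal_natCast, ← ENNReal.ofReal_mul (by positivity),
      ← ENNReal.ofReal_add (by positivity) (by positivity), add_div A₁]
    refine ENNReal.ofReal_le_ofReal (add_le_add_right ?_ _)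
    have hm : (genCard (K + 1) K r : ℝ) ≤ K * (K : ℝ) ^ r := by
      exact_mod_cast genCard_succ_le hK r
    calc (genCard (K + 1) K r : ℝ) * (A₂ / ((K : ℝ) ^ r) ^ 2)
        ≤ (K * (K : ℝ) ^ r) * (A₂ / ((K : ℝ) ^ r) ^ 2) := by gcongr
      _ = _ := by field_simp
  · intro w hw
    simp only [Set.mem_union, Set.mem_iUnion, not_or, not_exists] at hw
    exact eigCount_ball_eq_sum hK hr hab hI hI' hw.1 hw.2

end Comparison

/-! ### The intensity of the eigenvalues of a subtree -/

section Intensity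

set_option linter.unusedSectionVars false

variable {K r m₀ : ℕ} {E₀ a₀ b₀ : ℝ} {I : Set ℝ} {ν : Measure ℝ} [IsProbabilityMeasure ν]
  {lam : ℝ} {C : NNReal} {M : ℕ}

lemma inv_ballSize_le (hK : 2 ≤ K) (hr : 1 ≤ r) :
    (ballSize K r)⁻¹ ≤ K / ((K : ℝ) ^ r) ^ 8 := by
  have hN := ballSize_pos hK hr
  have hK0 : (0 : ℝ) < K := by exact_mod_cast (by omega : 0 < K)
  rw [inv_eq_one_div, div_le_div_iff₀ hN (by positivity), one_mul]
  exact pow_le_ballSize hr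

lemma genCard_mul_card_le (hK : 2 ≤ K) (r : ℕ) :
    (genCard (K + 1) K r : ℝ) * (treeFinset K K (7 * r)).card ≤ K * ((K : ℝ) ^ r) ^ 8 := by
  have h := Nat.mul_le_mul (genCard_succ_le hK r) (card_treeFinset_le_pow hK (7 * r))
  have h2 : K * K ^ r * K ^ (7 * r) = K * (K ^ r) ^ 8 := by
    rw [mul_assoc, ← pow_add, ← pow_mul]
    congr 2
    ring
  rw [h2] at h
  exact_mod_cast h

/-- The total expected count of the lower trees is bounded uniformly in `r`; this is the compactness
from which the limits `p k` are extracted. -/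
lemma StrongDisorder.lintegral_eigCount_subtree_le {p : ℕ} (h : StrongDisorder K p ν lam C M)
    (hr : 1 ≤ r) (hab : a₀ ≤ b₀) (hI : I ⊆ Set.Icc a₀ b₀) :
    (genCard (K + 1) K r : ℝ≥0∞) * ∫⁻ w, (eigCount (treeOp K K p (7 * r) lam w)
        (energyWindow K r E₀ I) : ℝ≥0∞) ∂(Measure.infinitePi fun _ : ℕ × ℕ => ν)
      ≤ ENNReal.ofReal (K ^ 2 * (C * (M * ((b₀ - a₀) / lam)))) := by
  have hK := h.two_le
  have hlam := h.lam_pos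
  have hN := ballSize_pos hK hr
  have hab' : 0 ≤ b₀ - a₀ := by linarith
  have h1 : ∫⁻ w, (eigCount (treeOp K K p (7 * r) lam w) (energyWindow K r E₀ I) : ℝ≥0∞)
      ∂(Measure.infinitePi fun _ : ℕ × ℕ => ν) ≤ _ :=
    (lintegral_mono fun w => Nat.cast_le.mpr (eigCount_mono _ (energyWindow_subset hK hr hI))).trans
      (h.lintegral_eigCount_le (Or.inl rfl) (7 * r) (energyAt_le (E₀ := E₀) hK hr hab))
  refine (mul_le_mul_right h1 _).trans ?_
  rw [← ENNReal.ofReal_natCast, ← ENNReal.ofReal_mul (by positivity)]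
  refine ENNReal.ofReal_le_ofReal ?_
  have h2 : energyAt K r E₀ b₀ - energyAt K r E₀ a₀ = (b₀ - a₀) * (ballSize K r)⁻¹ := by
    unfold energyAt
    field_simp
    ring
  rw [h2, ← mul_assoc]
  have hK0 : (0 : ℝ) < K := by exact_mod_cast (by omega : 0 < K)
  calc (genCard (K + 1) K r : ℝ) * (treeFinset K K (7 * r)).card
        * (C * (M * ((b₀ - a₀) * (ballSize K r)⁻¹ / lam)))
      ≤ K * ((K : ℝ) ^ r) ^ 8 * (C * (M * ((b₀ - a₀) * (K / ((K : ℝ) ^ r) ^ 8) / lam))) := by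
        refine mul_le_mul (genCard_mul_card_le hK r) ?_ (by positivity) (by positivity)
        gcongr
        exact inv_ballSize_le hK hr
    _ = _ := by field_simp

/-- Subtrees with more eigenvalues in the energy window than the size of a block are rare. -/
lemma StrongDisorder.measure_lt_eigCount_le {p : ℕ} (h : StrongDisorder K p ν lam C M)
    (hr : 1 ≤ r) (hab : a₀ ≤ b₀) (hI : I ⊆ Set.Icc a₀ b₀) :
    (genCard (K + 1) K r : ℝ≥0∞) * (Measure.infinitePi fun _ : ℕ × ℕ => ν)
        {w | ∑ v ∈ Finset.range p, genCard K K v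
          < eigCount (treeOp K K p (7 * r) lam w) (energyWindow K r E₀ I)}
      ≤ ENNReal.ofReal (K * (K * (C * (M * ((b₀ - a₀ + 1) / lam)))) ^ 2 / (K : ℝ) ^ r) := by
  have hK := h.two_le
  have hlam := h.lam_pos
  have hN := ballSize_pos hK hr
  have hab' : 0 ≤ b₀ - a₀ := by linarith
  have hK0 : (0 : ℝ) < K := by exact_mod_cast (by omega : 0 < K)
  set M₀ := ∑ v ∈ Finset.range p, genCard K K v with hM₀
  -- Minami's estimate is stated for a half-open interval, so the window is extended to the left by
  -- one rescaled unit; hence the `+ 1` in the bound.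
  set lo := energyAt K r E₀ a₀ - (ballSize K r)⁻¹ with hlo
  set len := (b₀ - a₀ + 1) * (ballSize K r)⁻¹ with hlen
  have hlen0 : 0 ≤ len := by positivity
  have hend : lo + len = energyAt K r E₀ b₀ := by
    rw [hlo, hlen]
    unfold energyAt
    field_simp
    ring
  have hsub : energyWindow K r E₀ I ⊆ Set.Ioc lo (lo + len) := by
    refine (energyWindow_subset hK hr hI).trans fun e he => ⟨?_, hend ▸ he.2⟩
    have : 0 < (ballSize K r)⁻¹ := by positivity
    linarith [he.1]
  have h1 := lintegral_eigCount_Ioc_mul_sub_le ν (treeHop_isHermitian K K (7 * r)) hlam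
    (blockCardLE_treeSite h.period_pos (by omega) le_rfl (7 * r)) h.le_volume lo hlen0
  rw [Fintype.card_coe, ofReal_wegner, ← ENNReal.ofReal_pow (by positivity), ← hM₀] at h1
  have h2 : (Measure.infinitePi fun _ : ℕ × ℕ => ν)
      {w | M₀ < eigCount (treeOp K K p (7 * r) lam w) (energyWindow K r E₀ I)} ≤ _ :=
    (measure_mono fun w hw => by
      have hw' : M₀ < eigCount (treeOp K K p (7 * r) lam w) (energyWindow K r E₀ I) := hw
      have hw'' := hw'.trans_le (eigCount_mono _ hsub)
      change eigCount (treeOp K K p (7 * r) lam w) (Set.Ioc lo (lo + len))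
        * (eigCount (treeOp K K p (7 * r) lam w) (Set.Ioc lo (lo + len)) - M₀) ≠ 0
      exact Nat.mul_ne_zero (by omega) (by omega)).trans
    (measure_ne_zero_le _ (f := fun w => eigCount (treeOp K K p (7 * r) lam w)
        (Set.Ioc lo (lo + len))
        * (eigCount (treeOp K K p (7 * r) lam w) (Set.Ioc lo (lo + len)) - M₀))
      ((measurable_eigCount_treeOp lam measurableSet_Ioc).mul
      ((measurable_eigCount_treeOp lam measurableSet_Ioc).sub_const M₀)))
  simp only [Nat.cast_mul] at h2
  have h3 := h2.trans h1
  refine (mul_le_mul_right h3 _).trans ?_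
  rw [← ENNReal.ofReal_natCast, ← ENNReal.ofReal_mul (by positivity)]
  refine ENNReal.ofReal_le_ofReal ?_
  have hx := one_le_pow_real hK r
  have hm : (genCard (K + 1) K r : ℝ) ≤ K * (K : ℝ) ^ r := by
    exact_mod_cast genCard_succ_le hK r
  have hcard : ((treeFinset K K (7 * r)).card : ℝ) ≤ ((K : ℝ) ^ r) ^ 7 := by
    rw [← pow_mul, mul_comm r 7]
    exact_mod_cast card_treeFinset_le_pow hK (7 * r)
  have hMM : (M₀ : ℝ) ≤ M := by exact_mod_cast h.block_le' (Or.inl rfl)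
  have hinv := inv_ballSize_le hK hr
  set x := (K : ℝ) ^ r
  -- Powers of `x`: of order `x` trees, and a squared Wegner bound with volume `x ^ 7` and length `x
  -- ^ (-8)`; the product is of order `x ^ (-1)`.
  calc (genCard (K + 1) K r : ℝ) * ((treeFinset K K (7 * r)).card * (C * (M₀ * (len / lam)))) ^ 2
      ≤ (K * x) * (x ^ 7 * (C * (M * ((b₀ - a₀ + 1) * (K / x ^ 8) / lam)))) ^ 2 := by
        rw [hlen]
        gcongr
    _ = _ := by
      have : x ≠ 0 := by positivity
      field_simp

/-- The subtree configurations with decaying Green function. -/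
def goodSubtree (K r : ℕ) (lam E₀ s : ℝ) : Set (treeFinset K K (7 * r) → ℝ) :=
  {v | GreenDecay K K (2 * r) lam E₀ (K ^ 20) (decayFactor K r s) fun x => v (treeIncl (by omega) x)}

lemma measurableSet_goodSubtree (lam s : ℝ) : MeasurableSet (goodSubtree K r lam E₀ s) := by
  have h : Measurable fun (v : treeFinset K K (7 * r) → ℝ)
      (x : treeFinset K K (2 * r)) => v (treeIncl (by omega) x) := by fun_prop
  exact h (measurableSet_greenDecay K K (2 * r) lam E₀ (K ^ 20) _)

lemma eigCount_empty {V : Type*} [Fintype V] [DecidableEq V] {A : Matrix V V ℂ}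
    (hA : A.IsHermitian) : eigCount A ∅ = 0 := by
  classical
  rw [eigCount_eq_card hA]
  simp

lemma energyAt_sub_layerWidth (hK : 2 ≤ K) (hr : 1 ≤ r) (t : ℝ) :
    energyAt K r E₀ a₀ - t * layerWidth K r
      = energyAt K r E₀ (a₀ - t * (ballSize K r * layerWidth K r)) := by
  have hN := ballSize_pos hK hr
  unfold energyAt
  field_simp
  ring

lemma energyAt_add_layerWidth (hK : 2 ≤ K) (hr : 1 ≤ r) (t : ℝ) :
    energyAt K r E₀ b₀ + t * layerWidth K r
      = energyAt K r E₀ (b₀ + t * (ballSize K r * layerWidth K r)) := by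
  have hN := ballSize_pos hK hr
  unfold energyAt
  field_simp
  ring

/-- The expected number of eigenvalues of a good subtree in the energy window is bounded by the
density of states of the canopy tree. -/
lemma StrongDisorder.lintegral_good_le (h : StrongDisorder K (m₀ + 1) ν lam C M) {W : ℝ}
    (hW : 0 ≤ W) (hν : ∀ᵐ t ∂ν, |t| ≤ W) {xs : ℕ → CanopyVertex} (hxs : ∀ n, (xs n).1 = n)
    (hr : 1 ≤ r) (hpr : m₀ + 1 ∣ r) (hab : a₀ ≤ b₀) (hI : I ⊆ Set.Icc a₀ b₀)
    (hIm : MeasurableSet I) :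
    ∫⁻ w, (goodSubtree K r lam E₀ (windowScale a₀ b₀)).indicator (fun v =>
        (eigCount (treeHam K K (7 * r) lam v) (energyWindow K r E₀ I) : ℝ≥0∞))
        (fun x => w (treeSite K (m₀ + 1) x)) ∂(Measure.infinitePi fun _ : ℕ × ℕ => ν)
      ≤ ENNReal.ofReal ((K : ℝ) ^ (7 * r - 1)) * (layerSum ν K m₀ lam W xs
        (Set.Icc (energyAt K r E₀ a₀ - 2 * layerWidth K r)
          (energyAt K r E₀ b₀ + 2 * layerWidth K r)) + ENNReal.ofReal (layerWidth K r)) := by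
  classical
  have hK := h.two_le
  have hδ := layerWidth_pos hK hr
  have hK0 : (0 : ℝ) < K := by exact_mod_cast (by omega : 0 < K)
  set F : (treeFinset K K (7 * r) → ℝ) → ℝ≥0∞ :=
    (goodSubtree K r lam E₀ (windowScale a₀ b₀)).indicator (fun v =>
        (eigCount (treeHam K K (7 * r) lam v) (energyWindow K r E₀ I) : ℝ≥0∞)) with hF
  have hFm : Measurable F := (measurable_natCast_ennreal (measurable_eigCount_treeHam K K (7 * r)
    lam (measurableSet_energyWindow hIm))).indicator (measurableSet_goodSubtree lam _)
  obtain ⟨s, hs⟩ := hpr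
  -- A huge tree with `(m₀ + 1) * A` generations is cut at depth `r₀ = (m₀ + 1) * (a + 1)`, so that
  -- exactly `7 * r` generations remain below. It contains `K ^ r₀` independent copies of the lower
  -- tree.
  obtain ⟨A, hA, hA7⟩ := ((eventually_lintegral_eigCount_le ν hK lam hW hν hxs (m₀ := m₀)
    (energyAt K r E₀ a₀ - layerWidth K r) (energyAt K r E₀ b₀ + layerWidth K r) hδ hδ).and
    (eventually_ge_atTop (7 * s + 1))).exists
  obtain ⟨a, rfl⟩ := Nat.exists_eq_add_of_le hA7
  have hR : (m₀ + 1) * (7 * s + 1 + a) = (m₀ + 1) * (a + 1) + 7 * r := by rw [hs]; ring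
  rw [hR] at hA
  have hr₀ : 1 ≤ (m₀ + 1) * (a + 1) := Nat.mul_pos (by omega) (by omega)
  set r₀ := (m₀ + 1) * (a + 1) with hr₀def
  -- Only the good copies are counted, which the empty windows of the others express: their
  -- eigenvectors are small at their roots, so no control of the top is needed.
  have h1 : ∀ w : ℕ × ℕ → ℝ, ∑ j : Fin (genCard K K r₀),
      F (subtreePotential hr₀ (fun x => w (treeSite K (m₀ + 1) x)) j)
      ≤ (eigCount (treeOp K K (m₀ + 1) (r₀ + 7 * r) lam w) (enlargedWindow K r E₀ a₀ b₀) : ℝ≥0∞) := by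
    intro w
    set v : treeFinset K K (r₀ + 7 * r) → ℝ := fun x => w (treeSite K (m₀ + 1) x)
    have h2 := sum_eigCount_subtree_le_enlargedWindow (I := I) (E₀ := E₀) (lam := lam) (v := v) hK
      (Nat.le_succ K) hr₀ hr hab hI
      (B := fun j => if subtreePotential hr₀ v j ∈ goodSubtree K r lam E₀ (windowScale a₀ b₀)
        then energyWindow K r E₀ I else ∅)
      (fun j => by split_ifs <;> simp)
      (fun j hj => by
        by_contra hcon
        have hcon' : subtreePotential hr₀ v j ∉ goodSubtree K r lam E₀ (windowScale a₀ b₀) := hcon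
        rw [if_neg hcon'] at hj
        exact Set.not_nonempty_empty hj)
    refine le_trans (le_of_eq ?_) (Nat.cast_le.mpr h2)
    rw [Nat.cast_sum]
    refine Finset.sum_congr rfl fun j _ => ?_
    rw [hF, Set.indicator_apply]
    split_ifs
    · rfl
    · rw [eigCount_empty (treeHam_isHermitian _ _ _ _ _), Nat.cast_zero]
  have h3 := lintegral_mono (μ := Measure.infinitePi fun _ : ℕ × ℕ => ν) h1
  have hm2 : ∀ j : Fin (genCard K K r₀), Measurable fun (w : ℕ × ℕ → ℝ) =>
      F (subtreePotential hr₀ (fun x => w (treeSite K (m₀ + 1) x)) j) := fun j =>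
    hFm.comp (measurable_pi_lambda _ fun x => measurable_pi_apply _)
  rw [lintegral_finsetSum _ fun j _ => hm2 j] at h3
  simp only [lintegral_subtreePotential (ν := ν) h.period_pos hr₀ (dvd_mul_right _ _)
    (by omega : 0 < K) _ hFm] at h3
  rw [Finset.sum_const, Finset.card_univ, Fintype.card_fin, nsmul_eq_mul, genCard_self] at h3
  have h4 := h3.trans hA
  have h5 : r₀ + 7 * r - 1 = r₀ + (7 * r - 1) := by omega
  have h6 : ENNReal.ofReal ((K : ℝ) ^ (r₀ + 7 * r - 1))
      = ((K ^ r₀ : ℕ) : ℝ≥0∞) * ENNReal.ofReal ((K : ℝ) ^ (7 * r - 1)) := by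
    rw [h5, pow_add, ENNReal.ofReal_mul (by positivity), ← ENNReal.ofReal_natCast, Nat.cast_pow]
  rw [h6, mul_assoc] at h4
  -- The number of copies cancels against the number of leaves of the huge tree and leaves the
  -- number `K ^ (7 * r - 1)` of leaves of one lower tree. No trace of the size of the huge tree
  -- remains.
  have h7 := (ENNReal.mul_le_mul_iff_right (by
    have : 0 < K ^ r₀ := Nat.pow_pos (by omega)
    exact_mod_cast this.ne') (ENNReal.natCast_ne_top _)).mp h4
  rw [sub_sub, add_assoc (energyAt K r E₀ b₀), ← two_mul] at h7
  exact h7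

lemma densityAt_congr {n n' : Set ℝ → ℝ≥0∞} (h : ∀ a b : ℝ, n (Set.Icc a b) = n' (Set.Icc a b)) :
    densityAt n = densityAt n' := by
  funext E
  simp only [densityAt, h]

/-- The probability that a subtree has `k` eigenvalues in the energy window is bounded by the
density of states of the canopy tree. -/
lemma StrongDisorder.measure_eigCount_eq_le (h : StrongDisorder K (m₀ + 1) ν lam C M) {W : ℝ}
    (hW : 0 ≤ W) (hν : ∀ᵐ t ∂ν, |t| ≤ W) {xs : ℕ → CanopyVertex} (hxs : ∀ n, (xs n).1 = n)
    (hr : 1 ≤ r) (hpr : m₀ + 1 ∣ r) (hab : a₀ ≤ b₀) (hI : I ⊆ Set.Icc a₀ b₀)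
    (hIm : MeasurableSet I) (k : ℕ) :
    (genCard (K + 1) K r : ℝ≥0∞) * (k * (Measure.infinitePi fun _ : ℕ × ℕ => ν)
        {w | eigCount (treeOp K K (m₀ + 1) (7 * r) lam w) (energyWindow K r E₀ I) = k})
      ≤ ENNReal.ofReal (k * (K * (K * √(2 * windowScale a₀ b₀ * K))) / (K : ℝ) ^ r)
        + K * (ENNReal.ofReal (ballSize K r) *
          (((((K : ℝ≥0∞) - 1) / K) • layerSum ν K m₀ lam W xs)
            (Set.Icc (energyAt K r E₀ a₀ - 2 * layerWidth K r)
              (energyAt K r E₀ b₀ + 2 * layerWidth K r)) + ENNReal.ofReal (layerWidth K r))) := by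
  classical
  have hK := h.two_le
  have hδ := layerWidth_pos hK hr
  have hK0 : (0 : ℝ) < K := by exact_mod_cast (by omega : 0 < K)
  set μ := Measure.infinitePi fun _ : ℕ × ℕ => ν with hμ
  set G := goodSubtree K r lam E₀ (windowScale a₀ b₀) with hG
  set f : (treeFinset K K (7 * r) → ℝ) → ℝ≥0∞ := fun v =>
    (eigCount (treeHam K K (7 * r) lam v) (energyWindow K r E₀ I) : ℝ≥0∞) with hf
  have hfm : Measurable f := measurable_natCast_ennreal (measurable_eigCount_treeHam K K (7 * r)
    lam (measurableSet_energyWindow hIm))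
  have mS : Measurable fun (w : ℕ × ℕ → ℝ) (x : treeFinset K K (7 * r)) =>
    w (treeSite K (m₀ + 1) x) := by fun_prop
  -- Trees without decay are discarded at the price of their probability; on the others `k` times
  -- the indicator is at most the count.
  have h1 : (k : ℝ≥0∞) * μ {w | eigCount (treeOp K K (m₀ + 1) (7 * r) lam w)
      (energyWindow K r E₀ I) = k}
      ≤ k * μ {w | (fun x : treeFinset K K (7 * r) => w (treeSite K (m₀ + 1) x)) ∉ G}
        + ∫⁻ w, G.indicator f (fun x => w (treeSite K (m₀ + 1) x)) ∂μ := by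
    have hS1 : MeasurableSet {w : ℕ × ℕ → ℝ | eigCount (treeOp K K (m₀ + 1) (7 * r) lam w)
      (energyWindow K r E₀ I) = k} :=
      (measurable_eigCount_treeOp lam (measurableSet_energyWindow hIm)) (measurableSet_singleton k)
    have hS2 : MeasurableSet {w : ℕ × ℕ → ℝ | (fun x : treeFinset K K (7 * r) =>
        w (treeSite K (m₀ + 1) x)) ∉ G} := mS (measurableSet_goodSubtree lam _).compl
    rw [← lintegral_indicator_const hS1, ← lintegral_indicator_const hS2,
      ← lintegral_add_left (measurable_const.indicator hS2)]
    refine lintegral_mono fun w => ?_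
    simp only [Set.indicator_apply, Set.mem_ofPred_eq]
    by_cases hw : eigCount (treeOp K K (m₀ + 1) (7 * r) lam w) (energyWindow K r E₀ I) = k
    · by_cases hw2 : (fun x : treeFinset K K (7 * r) => w (treeSite K (m₀ + 1) x)) ∈ G
      · rw [if_pos hw, if_neg (not_not_intro hw2), if_pos hw2, zero_add, hf, ← hw]
      · rw [if_pos hw, if_pos hw2]
        exact le_self_add
    · rw [if_neg hw]
      exact zero_le
  have h2 := h.measure_not_greenDecay_le (Or.inl rfl) E₀ hr (windowScale_pos a₀ b₀)
  have h3 := h.lintegral_good_le (E₀ := E₀) hW hν hxs hr hpr hab hI hIm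
  refine (mul_le_mul_right (h1.trans (add_le_add (mul_le_mul_right h2 _) h3)) _).trans ?_
  rw [mul_add]
  refine add_le_add ?_ ?_
  · rw [← ENNReal.ofReal_natCast, ← ENNReal.ofReal_natCast, ← ENNReal.ofReal_mul (by positivity),
      ← ENNReal.ofReal_mul (by positivity)]
    refine ENNReal.ofReal_le_ofReal ?_
    have hm : (genCard (K + 1) K r : ℝ) ≤ K * (K : ℝ) ^ r := by
      exact_mod_cast genCard_succ_le hK r
    calc (genCard (K + 1) K r : ℝ) * (k * (K * √(2 * windowScale a₀ b₀ * K) / ((K : ℝ) ^ r) ^ 2))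
        ≤ (K * (K : ℝ) ^ r) * (k * (K * √(2 * windowScale a₀ b₀ * K) / ((K : ℝ) ^ r) ^ 2)) := by
          gcongr
      _ = _ := by field_simp
  · set S := layerSum ν K m₀ lam W xs (Set.Icc (energyAt K r E₀ a₀ - 2 * layerWidth K r)
        (energyAt K r E₀ b₀ + 2 * layerWidth K r)) with hS
    -- The number of lower trees times their leaves is at most `K - 1` times the size of the ball,
    -- and `(K - 1) * layerSum` is `K` times the normalized density of states.
    have h4 : (genCard (K + 1) K r : ℝ≥0∞) * ENNReal.ofReal ((K : ℝ) ^ (7 * r - 1))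
        ≤ ((K : ℝ≥0∞) - 1) * ENNReal.ofReal (ballSize K r) := by
      have h5 := genCard_mul_pow_le hK hr (R' := 7 * r) (by omega)
      have h6 : ((K : ℝ≥0∞) - 1) = ((K - 1 : ℕ) : ℝ≥0∞) := by
        rw [ENNReal.natCast_sub, Nat.cast_one]
      rw [h6, ballSize, ENNReal.ofReal_natCast, ← Nat.cast_pow, ENNReal.ofReal_natCast]
      exact_mod_cast h5
    have hKne : (K : ℝ≥0∞) ≠ 0 := by exact_mod_cast (by omega : K ≠ 0)
    have hKc : (K : ℝ≥0∞) * (((K : ℝ≥0∞) - 1) / K) = (K : ℝ≥0∞) - 1 :=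
      ENNReal.mul_div_cancel hKne (ENNReal.natCast_ne_top K)
    rw [← mul_assoc]
    refine (mul_le_mul_left h4 _).trans ?_
    rw [Measure.smul_apply, smul_eq_mul, mul_add, mul_add, mul_add]
    refine add_le_add (le_of_eq ?_) ?_
    · calc ((K : ℝ≥0∞) - 1) * ENNReal.ofReal (ballSize K r) * S
          = ((K : ℝ≥0∞) * (((K : ℝ≥0∞) - 1) / K)) * ENNReal.ofReal (ballSize K r) * S := by
            rw [hKc]
        _ = _ := by
            generalize ((K : ℝ≥0∞) - 1) / K = z
            ring
    · rw [← mul_assoc]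
      exact mul_le_mul_left (mul_le_mul_left tsub_le_self _) _

end Intensity

/-! ### The limit of the eigenvalue processes -/

section Limit

set_option linter.unusedSectionVars false

/-- As `densityAt` is a supremum over all shapes `[a, b]`, it controls windows that shrink to `E`
without being centred there. This holds at every point, not only almost everywhere. -/
lemma eventually_le_of_densityAt_lt {n : Set ℝ → ℝ≥0∞} {E : ℝ} {D : ℝ≥0∞} (hD : densityAt n E < D)
    {a b : ℝ} (hab : a < b) : ∀ᶠ s in 𝓝[>] (0 : ℝ),
      n (Set.Icc (E + s * a) (E + s * b)) ≤ D * ENNReal.ofReal (s * (b - a)) := by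
  have h1 : limsup (fun ε : ℝ => n (Set.Icc (E + ε * a) (E + ε * b))
      / ENNReal.ofReal (ε * (b - a))) (𝓝[>] (0 : ℝ)) < D :=
    lt_of_le_of_lt (by
      refine le_iSup_of_le a (le_iSup_of_le b ?_)
      rw [iSup_pos hab]) hD
  filter_upwards [eventually_lt_of_limsup_lt h1, self_mem_nhdsWithin] with s hs hs0
  have hs0' : (0 : ℝ) < s := hs0
  have hpos : 0 < s * (b - a) := mul_pos hs0' (by linarith)
  exact (ENNReal.div_le_iff (ENNReal.ofReal_pos.mpr hpos).ne' ENNReal.ofReal_ne_top).mp hs.le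

variable {K m₀ : ℕ} {E₀ a₀ b₀ : ℝ} {I : Set ℝ} {ν : Measure ℝ} [IsProbabilityMeasure ν]
  {lam : ℝ} {C : NNReal} {M : ℕ}

lemma tendsto_div_pow_zero (hK : 2 ≤ K) {r : ℕ → ℕ} (hr : Tendsto r atTop atTop) (A : ℝ) :
    Tendsto (fun n => A / (K : ℝ) ^ r n) atTop (𝓝 0) :=
  Tendsto.const_div_atTop ((tendsto_pow_atTop_atTop_of_one_lt
    (by exact_mod_cast (by omega : 1 < K))).comp hr) A

lemma tendsto_inv_ballSize (hK : 2 ≤ K) {r : ℕ → ℕ} (hr : Tendsto r atTop atTop)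
    (hr1 : ∀ n, 1 ≤ r n) : Tendsto (fun n => (ballSize K (r n))⁻¹) atTop (𝓝[>] 0) := by
  refine tendsto_nhdsWithin_iff.mpr ⟨?_, Eventually.of_forall fun n =>
    inv_pos.mpr (ballSize_pos hK (hr1 n))⟩
  refine squeeze_zero (fun n => (inv_pos.mpr (ballSize_pos hK (hr1 n))).le) (fun n => ?_)
    (tendsto_div_pow_zero hK hr K)
  refine (inv_ballSize_le hK (hr1 n)).trans ?_
  have hx := one_le_pow_real hK (r n)
  gcongr
  exact le_self_pow₀ hx (by norm_num)

/-- The density of states measure of the canopy tree. -/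
abbrev canopyDos (K m₀ : ℕ) (ν : Measure ℝ) (lam W : ℝ) (xs : ℕ → CanopyVertex) : Measure ℝ :=
  (((K : ℝ≥0∞) - 1) / K) • layerSum ν K m₀ lam W xs

/-- With an allowance `t` for the boundary layers and for the excess over the density, the window is
eventually contained in the rescaled interval `[a₀ - t, b₀ + t]`; then `t` tends to `0`. -/
lemma StrongDisorder.natCast_mul_limit_le (h : StrongDisorder K (m₀ + 1) ν lam C M) {W : ℝ}
    (hW : 0 ≤ W) (hν : ∀ᵐ t ∂ν, |t| ≤ W) {xs : ℕ → CanopyVertex} (hxs : ∀ n, (xs n).1 = n)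
    (hab : a₀ ≤ b₀) (hI : I ⊆ Set.Icc a₀ b₀) (hIm : MeasurableSet I)
    (hD : densityAt (fun B => canopyDos K m₀ ν lam W xs B) E₀ < ∞) {r : ℕ → ℕ}
    (hr : Tendsto r atTop atTop) (hr1 : ∀ n, 1 ≤ r n) (hpr : ∀ n, m₀ + 1 ∣ r n) {k : ℕ} {q : ℝ}
    (hq : Tendsto (fun n => (genCard (K + 1) K (r n) : ℝ) * (Measure.infinitePi fun _ : ℕ × ℕ =>
      ν).real {w | eigCount (treeOp K K (m₀ + 1) (7 * r n) lam w) (energyWindow K (r n) E₀ I) = k})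
      atTop (𝓝 q)) :
    k * q ≤ K * ((densityAt (fun B => canopyDos K m₀ ν lam W xs B) E₀).toReal * (b₀ - a₀)) := by
  have hK := h.two_le
  set d := (densityAt (fun B => canopyDos K m₀ ν lam W xs B) E₀).toReal with hd
  have hd0 : 0 ≤ d := ENNReal.toReal_nonneg
  have hdD : densityAt (fun B => canopyDos K m₀ ν lam W xs B) E₀ = ENNReal.ofReal d :=
    (ENNReal.ofReal_toReal hD.ne).symm
  have key : ∀ t : ℝ, 0 < t → k * q ≤ t + K * ((d + t) * (b₀ - a₀ + 2 * t) + t) := by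
    intro t ht
    have hab' : 0 ≤ b₀ - a₀ := by linarith
    refine le_of_tendsto (hq.const_mul (k : ℝ)) ?_
    have e1 : ∀ᶠ n in atTop, k * (K * (K * √(2 * windowScale a₀ b₀ * K))) / (K : ℝ) ^ r n ≤ t :=
      (tendsto_div_pow_zero hK hr _).eventually (ge_mem_nhds ht)
    have e2 : ∀ᶠ n in atTop, widthConst K / (K : ℝ) ^ r n ≤ t / 2 :=
      (tendsto_div_pow_zero hK hr _).eventually (ge_mem_nhds (by linarith))
    have e3 := (tendsto_inv_ballSize hK hr hr1).eventually (eventually_le_of_densityAt_lt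
      (hdD.trans_lt ((ENNReal.ofReal_lt_ofReal_iff (by linarith)).mpr (by linarith :
        d < d + t))) (a := a₀ - t) (b := b₀ + t) (by linarith))
    filter_upwards [e1, e2, e3] with n h1 h2 h3
    have hN := ballSize_pos hK (hr1 n)
    have hδ := layerWidth_pos hK (hr1 n)
    have hw := (ballSize_mul_layerWidth_le' hK (hr1 n)).trans h2
    have h4 := h.measure_eigCount_eq_le (E₀ := E₀) hW hν hxs (hr1 n) (hpr n) hab hI hIm k
    set μ := Measure.infinitePi fun _ : ℕ × ℕ => ν with hμ
    set S := {w : ℕ × ℕ → ℝ | eigCount (treeOp K K (m₀ + 1) (7 * r n) lam w)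
      (energyWindow K (r n) E₀ I) = k} with hS
    have h5 : Set.Icc (energyAt K (r n) E₀ a₀ - 2 * layerWidth K (r n))
        (energyAt K (r n) E₀ b₀ + 2 * layerWidth K (r n))
        ⊆ Set.Icc (E₀ + (ballSize K (r n))⁻¹ * (a₀ - t)) (E₀ + (ballSize K (r n))⁻¹ * (b₀ + t)) := by
      rw [energyAt_sub_layerWidth hK (hr1 n), energyAt_add_layerWidth hK (hr1 n)]
      unfold energyAt
      rw [div_eq_inv_mul, div_eq_inv_mul]
      refine Set.Icc_subset_Icc ?_ ?_ <;> gcongr <;> linarith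
    have h6 := (measure_mono (μ := canopyDos K m₀ ν lam W xs) h5).trans h3
    have h7 : (ENNReal.ofReal (ballSize K (r n))) *
        (canopyDos K m₀ ν lam W xs (Set.Icc (energyAt K (r n) E₀ a₀ - 2 * layerWidth K (r n))
        (energyAt K (r n) E₀ b₀ + 2 * layerWidth K (r n))) + ENNReal.ofReal (layerWidth K (r n)))
        ≤ ENNReal.ofReal ((d + t) * (b₀ - a₀ + 2 * t) + t) := by
      refine (mul_le_mul_right (add_le_add_left h6 _) _).trans ?_
      rw [← ENNReal.ofReal_mul (by positivity), ← ENNReal.ofReal_add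
        (mul_nonneg (by positivity) (mul_nonneg (by positivity) (by linarith))) (by positivity),
        ← ENNReal.ofReal_mul (by positivity)]
      refine ENNReal.ofReal_le_ofReal ?_
      have h8 : ballSize K (r n) * ((d + t) * ((ballSize K (r n))⁻¹ * (b₀ + t - (a₀ - t)))
          + layerWidth K (r n)) = (d + t) * (b₀ - a₀ + 2 * t)
            + ballSize K (r n) * layerWidth K (r n) := by
        field_simp
        ring
      rw [h8]
      linarith
    have h9 := h4.trans (add_le_add (ENNReal.ofReal_le_ofReal h1) (mul_le_mul_right h7 _))
    rw [← ENNReal.ofReal_natCast K, ← ENNReal.ofReal_mul (by positivity),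
      ← ENNReal.ofReal_add (by positivity) (by positivity)] at h9
    have h10 := ENNReal.toReal_mono ENNReal.ofReal_ne_top h9
    rw [ENNReal.toReal_ofReal (by positivity), ENNReal.toReal_mul, ENNReal.toReal_mul,
      ENNReal.toReal_natCast, ENNReal.toReal_natCast, ← measureReal_def] at h10
    calc (k : ℝ) * (genCard (K + 1) K (r n) * μ.real S)
        = genCard (K + 1) K (r n) * (k * μ.real S) := by ring
      _ ≤ _ := h10
  have hlim : Tendsto (fun t : ℝ => t + K * ((d + t) * (b₀ - a₀ + 2 * t) + t)) (𝓝[>] 0)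
      (𝓝 (K * (d * (b₀ - a₀)))) := by
    refine tendsto_nhdsWithin_of_tendsto_nhds ?_
    have hc : Continuous fun t : ℝ => t + K * ((d + t) * (b₀ - a₀ + 2 * t) + t) := by fun_prop
    have := hc.tendsto 0
    simpa using this
  exact ge_of_tendsto hlim (by filter_upwards [self_mem_nhdsWithin] with t ht using key t ht)

/-- The depths at which the balls are cut. -/
def cutDepth (m₀ n : ℕ) : ℕ := (m₀ + 1) * (n + 1)

lemma one_le_cutDepth (m₀ n : ℕ) : 1 ≤ cutDepth m₀ n := Nat.mul_pos (by omega) (by omega)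

lemma strictMono_cutDepth (m₀ : ℕ) : StrictMono (cutDepth m₀) := fun a b hab =>
  Nat.mul_lt_mul_of_pos_left (by omega) (by omega)

lemma strictMono_genCard (hK : 2 ≤ K) : StrictMono (genCard (K + 1) K) := by
  refine strictMono_nat_of_lt_succ fun n => ?_
  cases n with
  | zero => simp [genCard]; omega
  | succ n =>
      rw [genCard, genCard]
      exact Nat.mul_lt_mul_of_pos_left (Nat.pow_lt_pow_right (by omega) (by omega)) (by omega)

/-- Along a subsequence the eigenvalue processes of the balls converge to a compound Poisson
process. -/
lemma StrongDisorder.exists_tendsto (h : StrongDisorder K (m₀ + 1) ν lam C M) {W : ℝ}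
    (hW : 0 ≤ W) (hν : ∀ᵐ t ∂ν, |t| ≤ W) {xs : ℕ → CanopyVertex} (hxs : ∀ n, (xs n).1 = n)
    (hab : a₀ ≤ b₀) (hI : Set.Ioo a₀ b₀ ⊆ I) (hI' : I ⊆ Set.Icc a₀ b₀) (hIm : MeasurableSet I)
    (hD : densityAt (fun B => canopyDos K m₀ ν lam W xs B) E₀ < ∞) :
    ∃ φ : ℕ → ℕ, StrictMono φ ∧ ∃ p : ℕ → ℝ, (∀ k, 0 ≤ p k) ∧
      (∀ k, 1 ≤ k → k * p k ≤ K *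
        ((densityAt (fun B => canopyDos K m₀ ν lam W xs B) E₀).toReal * (b₀ - a₀))) ∧
      ∀ t : ℝ, Tendsto (fun n => ∫ w, Complex.exp (Complex.I * t *
        ((eigCount (treeOp (K + 1) K (m₀ + 1) (cutDepth m₀ (φ n) + 7 * cutDepth m₀ (φ n)) lam w)
          (energyWindow K (cutDepth m₀ (φ n)) E₀ I) : ℝ)))
          ∂(Measure.infinitePi fun _ : ℕ × ℕ => ν)) atTop
        (𝓝 (Complex.exp (∑ k ∈ Finset.Icc 1 (∑ v ∈ Finset.range (m₀ + 1), genCard K K v),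
          (Complex.exp (Complex.I * t * k) - 1) * (p k : ℂ)))) := by
  have hK := h.two_le
  have hlam := h.lam_pos
  have hK0 : (0 : ℝ) < K := by exact_mod_cast (by omega : 0 < K)
  have hab' : 0 ≤ b₀ - a₀ := by linarith
  set μ := Measure.infinitePi fun _ : ℕ × ℕ => ν with hμ
  set r := cutDepth m₀ with hrdef
  have hr1 : ∀ n, 1 ≤ r n := one_le_cutDepth m₀
  have hrp : ∀ n, m₀ + 1 ∣ r n := fun n => dvd_mul_right _ _
  set m : ℕ → ℕ := fun n => genCard (K + 1) K (r n) with hm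
  have hBm : ∀ n, MeasurableSet (energyWindow K (r n) E₀ I) := fun n =>
    measurableSet_energyWindow hIm
  set η : ℕ → (ℕ × ℕ → ℝ) → ℕ := fun n w =>
    eigCount (treeOp K K (m₀ + 1) (7 * r n) lam w) (energyWindow K (r n) E₀ I) with hη
  have hηm : ∀ n, Measurable (η n) := fun n => measurable_eigCount_treeOp lam (hBm n)
  set Bd : ℝ := K ^ 2 * (C * (M * ((b₀ - a₀) / lam))) with hBd
  have hBd0 : 0 ≤ Bd := by positivity
  -- The index is shifted because only counts `k ≥ 1` matter; the sequences stay in a product of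
  -- compact intervals, so one subsequence works for all `k`.
  set u : ℕ → ℕ → ℝ := fun n k => m n * μ.real {w | η n w = k + 1} with hu
  have hu_mem : ∀ n, u n ∈ Set.pi Set.univ fun _ : ℕ => Set.Icc 0 Bd := by
    intro n k _
    refine ⟨by positivity, ?_⟩
    have h1 := h.lintegral_eigCount_subtree_le (E₀ := E₀) (hr1 n) hab hI'
    have h2 : μ {w | η n w = k + 1} ≤ ∫⁻ w, (η n w : ℝ≥0∞) ∂μ :=
      (measure_mono fun w hw => by
        have hw' : η n w = k + 1 := hw
        change η n w ≠ 0
        omega).trans (measure_ne_zero_le μ (hηm n))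
    have h3 := ENNReal.toReal_mono ENNReal.ofReal_ne_top ((mul_le_mul_right h2 _).trans h1)
    rw [ENNReal.toReal_ofReal hBd0, ENNReal.toReal_mul, ENNReal.toReal_natCast,
      ← measureReal_def] at h3
    exact h3
  obtain ⟨q, hq, φ, hφ, hlim⟩ := (isCompact_univ_pi fun _ : ℕ =>
    isCompact_Icc (a := (0 : ℝ)) (b := Bd)).tendsto_subseq hu_mem
  have hlim' := tendsto_pi_nhds.mp hlim
  have hq0 : ∀ k, 0 ≤ q k := fun k => (hq k (Set.mem_univ k)).1
  have hp : ∀ k, 1 ≤ k → Tendsto (fun n => (m (φ n) : ℝ) * μ.real {w | η (φ n) w = k}) atTop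
      (𝓝 (q (k - 1))) := by
    intro k hk
    obtain ⟨j, rfl⟩ := Nat.exists_eq_add_of_le' hk
    exact hlim' j
  have hrφ : StrictMono fun n => r (φ n) := (strictMono_cutDepth m₀).comp hφ
  refine ⟨φ, hφ, fun k => q (k - 1), fun k => hq0 _, fun k hk => ?_, fun t => ?_⟩
  · exact h.natCast_mul_limit_le hW hν hxs hab hI' hIm hD hrφ.tendsto_atTop (fun n => hr1 _)
      (fun n => hrp _) (hp k hk)
  · have h2 : Tendsto (fun n => (m (φ n) : ℝ) * μ.real
        {w | ∑ v ∈ Finset.range (m₀ + 1), genCard K K v < η (φ n) w}) atTop (𝓝 0) := by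
      refine squeeze_zero (fun n => by positivity) (fun n => ?_) (tendsto_div_pow_zero hK
        hrφ.tendsto_atTop (K * (K * (C * (M * ((b₀ - a₀ + 1) / lam)))) ^ 2))
      have h1 := h.measure_lt_eigCount_le (E₀ := E₀) (hr1 (φ n)) hab hI'
      have h3 := ENNReal.toReal_mono ENNReal.ofReal_ne_top h1
      rw [ENNReal.toReal_ofReal (by positivity), ENNReal.toReal_mul, ENNReal.toReal_natCast,
        ← measureReal_def] at h3
      exact h3
    have h3 := tendsto_integral_exp_pow (P := μ) (η := fun n => η (φ n)) (fun n => hηm _)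
      (m := fun n => m (φ n)) ((strictMono_genCard hK).comp hrφ)
      (M := ∑ v ∈ Finset.range (m₀ + 1), genCard K K v) (p := fun k => q (k - 1))
      (fun k hk => hp k (Finset.mem_Icc.mp hk).1) h2 t
    obtain ⟨A, hA⟩ := h.exists_measure_le E₀ hab hI hI'
    -- Outside an event of vanishing probability the count of the ball is a sum of `m` i.i.d.
    -- counts, so its characteristic function is asymptotically an `m`-th power.
    have h4 : Tendsto (fun n => (∫ w, Complex.exp (Complex.I * t *
        ((eigCount (treeOp (K + 1) K (m₀ + 1) (r (φ n) + 7 * r (φ n)) lam w)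
          (energyWindow K (r (φ n)) E₀ I) : ℝ))) ∂μ)
        - (∫ w, Complex.exp (Complex.I * t * (η (φ n) w : ℝ)) ∂μ) ^ m (φ n)) atTop (𝓝 0) := by
      refine squeeze_zero_norm (a := fun n => 2 * (max A 0 / (K : ℝ) ^ r (φ n))) (fun n => ?_) ?_
      · obtain ⟨T, hT, hTμ, hTeq⟩ := hA (r (φ n)) (hr1 _) (hrp _)
        have hF : Measurable fun v : treeFinset K K (7 * r (φ n)) → ℝ =>
            Complex.exp (Complex.I * t *
              ((eigCount (treeHam K K (7 * r (φ n)) lam v) (energyWindow K (r (φ n)) E₀ I) : ℝ))) := by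
          have h5 : Measurable fun y : ℕ => Complex.exp (Complex.I * t * ((y : ℝ) : ℂ)) :=
            measurable_from_nat
          exact h5.comp (measurable_eigCount_treeHam K K _ lam (hBm _))
        have h5 := integral_prod_subtreePotential (ν := ν) (κ := K + 1) h.period_pos (hr1 (φ n))
          (hrp (φ n)) (by omega) hF
        rw [← h5]
        have h6 : ∀ w : ℕ × ℕ → ℝ, ∏ j : Fin (genCard (K + 1) K (r (φ n))),
            Complex.exp (Complex.I * t * ((eigCount (treeHam K K (7 * r (φ n)) lam
              (subtreePotential (hr1 (φ n)) (fun x => w (treeSite K (m₀ + 1) x)) j))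
                (energyWindow K (r (φ n)) E₀ I) : ℝ)))
            = Complex.exp (Complex.I * t * (((∑ j : Fin (genCard (K + 1) K (r (φ n))),
              eigCount (treeHam K K (7 * r (φ n)) lam
              (subtreePotential (hr1 (φ n)) (fun x => w (treeSite K (m₀ + 1) x)) j))
                (energyWindow K (r (φ n)) E₀ I) : ℕ) : ℝ))) := by
          intro w
          rw [← Complex.exp_sum, ← Finset.mul_sum]
          push_cast
          rfl
        simp only [h6]
        refine (norm_integral_exp_sub_integral_exp_le (S := T) ?_ ?_ hT (fun w hw => ?_) t).trans ?_
        · have h7 : Measurable fun y : ℕ => (y : ℝ) := measurable_from_nat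
          exact (h7.comp (measurable_eigCount_treeOp lam (hBm _))).aemeasurable
        · have h7 : Measurable fun y : ℕ => (y : ℝ) := measurable_from_nat
          refine (h7.comp (Finset.measurable_sum _ fun j _ => ?_)).aemeasurable
          exact (measurable_eigCount_treeHam K K _ lam (hBm _)).comp
            (measurable_pi_lambda _ fun x => measurable_pi_apply _)
        · exact congrArg _ (hTeq w hw)
        · have h8 := ENNReal.toReal_mono ENNReal.ofReal_ne_top (hTμ.trans
            (ENNReal.ofReal_le_ofReal (div_le_div_of_nonneg_right (le_max_left A 0)
              (by positivity))))
          rw [ENNReal.toReal_ofReal (by positivity), ← measureReal_def] at h8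
          linarith
      · simpa using (tendsto_div_pow_zero hK hrφ.tendsto_atTop (max A 0)).const_mul 2
    simpa using h4.add h3

/-- The characteristic function of the number of rescaled eigenvalues of a ball. -/
lemma aemeasurable_and_integral_exp_eigenvalueProcess (hK : 0 < K) {Ω : Type*} [MeasurableSpace Ω]
    {P : Measure Ω} [IsProbabilityMeasure P] {ω : betheSites K m₀ → Ω → ℝ}
    (hω : ∀ y, HasLaw (ω y) ν P) (hind : iIndepFun ω P) (hIm : MeasurableSet I) {L R : ℕ}
    (hLR : L + 1 = R) :
    AEMeasurable (fun a => (eigenvalueProcess K m₀ lam (fun y => ω y a) E₀ L).real I) P ∧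
    ∀ t : ℝ, ∫ a, Complex.exp (Complex.I * t *
        ((eigenvalueProcess K m₀ lam (fun y => ω y a) E₀ L).real I : ℝ)) ∂P
      = ∫ w, Complex.exp (Complex.I * t * ((eigCount (treeOp (K + 1) K (m₀ + 1) R lam w)
        {e | ((treeFinset (K + 1) K R).card : ℝ) * (e - E₀) ∈ I} : ℝ)))
          ∂(Measure.infinitePi fun _ : ℕ × ℕ => ν) := by
  subst hLR
  set S : Set ℝ := {e | ((treeFinset (K + 1) K (L + 1)).card : ℝ) * (e - E₀) ∈ I}
  have hS : MeasurableSet S := hIm.preimage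
    (f := fun e : ℝ => ((treeFinset (K + 1) K (L + 1)).card : ℝ) * (e - E₀)) (by fun_prop)
  set V : Ω → treeFinset (K + 1) K (L + 1) → ℝ := fun a x => ω (betheSite hK (betheOfCoord x)) a
  have hV : AEMeasurable V P := aemeasurable_pi_iff.mpr fun x => (hω _).aemeasurable
  have hc : Measurable fun v : treeFinset (K + 1) K (L + 1) → ℝ =>
      (eigCount (treeHam (K + 1) K (L + 1) lam v) S : ℝ) :=
    (measurable_from_nat (f := fun y : ℕ => (y : ℝ))).comp (measurable_eigCount_treeHam _ _ _ lam hS)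
  have hX : ∀ a, (eigenvalueProcess K m₀ lam (fun y => ω y a) E₀ L).real I
      = (eigCount (treeHam (K + 1) K (L + 1) lam (V a)) S : ℝ) := fun a =>
    eigenvalueProcess_real hK lam _ E₀ L hIm
  simp only [hX]
  refine ⟨hc.comp_aemeasurable hV, fun t => ?_⟩
  have hF : Measurable fun v : treeFinset (K + 1) K (L + 1) → ℝ => Complex.exp (Complex.I * t *
      ((eigCount (treeHam (K + 1) K (L + 1) lam v) S : ℝ))) := by
    have h5 : Measurable fun y : ℝ => Complex.exp (Complex.I * t * (y : ℂ)) := by fun_prop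
    exact h5.comp hc
  have h1 := congrArg (fun m => ∫ v, Complex.exp (Complex.I * t *
      ((eigCount (treeHam (K + 1) K (L + 1) lam v) S : ℝ))) ∂m) (map_betheSite hK hω hind L)
  have m2 : Measurable fun (w : ℕ × ℕ → ℝ) (x : treeFinset (K + 1) K (L + 1)) =>
      w (treeSite K (m₀ + 1) x.1) := by fun_prop
  rwa [integral_map hV hF.aestronglyMeasurable,
    integral_map m2.aemeasurable hF.aestronglyMeasurable] at h1

end Limit

/-! ### Properties of the single site distribution -/

section SingleSite

variable {ρ : ℝ → ℝ}

lemma isProbabilityMeasure_singleSiteLaw (hρ : ∀ x, 0 ≤ ρ x) (hint : ∫ x, ρ x = 1) :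
    IsProbabilityMeasure (singleSiteLaw ρ) := by
  have hi : Integrable ρ := by
    by_contra hcon
    rw [integral_undef hcon] at hint
    exact zero_ne_one hint
  constructor
  rw [singleSiteLaw, withDensity_apply _ MeasurableSet.univ, Measure.restrict_univ,
    ← ofReal_integral_eq_lintegral_ofReal hi (ae_of_all _ hρ), hint, ENNReal.ofReal_one]

lemma exists_singleSiteLaw_le (hρ : ∀ x, 0 ≤ ρ x) (hb : MemLp ρ ⊤ volume) :
    ∃ C : NNReal, singleSiteLaw ρ ≤ C • volume := by
  refine ⟨(eLpNorm ρ ⊤ volume).toNNReal, ?_⟩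
  have h1 : singleSiteLaw ρ ≤ volume.withDensity fun _ => eLpNorm ρ ⊤ volume := by
    refine withDensity_mono ?_
    rw [eLpNorm_exponent_top]
    filter_upwards [ae_le_eLpNormEssSup (f := ρ) (μ := volume)] with x hx
    rwa [Real.enorm_of_nonneg (hρ x)] at hx
  rw [withDensity_const] at h1
  refine h1.trans (le_of_eq ?_)
  conv_lhs => rw [← ENNReal.coe_toNNReal hb.eLpNorm_ne_top]
  rfl

lemma exists_ae_abs_le_singleSiteLaw (hm : Measurable ρ) (hs : HasCompactSupport ρ) :
    ∃ W : ℝ, 0 ≤ W ∧ ∀ᵐ t ∂(singleSiteLaw ρ), |t| ≤ W := by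
  obtain ⟨W, hW⟩ := hs.isCompact.isBounded.subset_closedBall (0 : ℝ)
  refine ⟨|W|, abs_nonneg W, ?_⟩
  rw [singleSiteLaw, ae_withDensity_iff (by fun_prop)]
  refine ae_of_all _ fun x hx => ?_
  have h1 : x ∈ tsupport ρ := subset_tsupport ρ fun h0 => hx (by rw [h0, ENNReal.ofReal_zero])
  have h2 := hW h1
  rw [Metric.mem_closedBall, Real.dist_eq, sub_zero] at h2
  exact h2.trans (le_abs_self W)

/-- The condition of the fractional moment bound reads `θ * X ≤ 1` with `X` depending on `K` and `p`
only, and `θ = X⁻¹` is reached for all large `lam`, uniformly in the energy. -/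
lemma exists_forall_strongDisorder {K p : ℕ} (hK : 2 ≤ K) (hp : 0 < p) {ν : Measure ℝ}
    [IsProbabilityMeasure ν] {C : NNReal} (hν : ν ≤ C • volume) :
    ∃ lam₀ : ℝ, 0 < lam₀ ∧ ∀ lam, lam₀ < lam →
      StrongDisorder K p ν lam C (∑ v ∈ Finset.range p, genCard (K + 1) K v) := by
  set M := ∑ v ∈ Finset.range p, genCard (K + 1) K v with hM
  set X : ℝ≥0∞ := M * (M * ((K ^ 20 : ℕ) : ℝ≥0∞) ^ p
      + M * ((K + 2 : ℕ) * (((K ^ 20 : ℕ) : ℝ≥0∞) ^ p) ^ 2)) with hX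
  have hXtop : X ≠ ⊤ := by
    have h1 : X = ((M * (M * (K ^ 20) ^ p + M * ((K + 2) * ((K ^ 20) ^ p) ^ 2)) : ℕ) : ℝ≥0∞) := by
      rw [hX]; push_cast; rfl
    rw [h1]
    exact ENNReal.natCast_ne_top _
  obtain ⟨lam₀, h0, h⟩ := exists_lintegral_esqrt_inv_le ν hν (ENNReal.inv_pos.mpr hXtop)
  refine ⟨lam₀, h0, fun lam hlam => ⟨hK, hp, h0.trans hlam, hν, le_rfl, X⁻¹, h lam hlam, ?_⟩⟩
  rw [mul_comm (M : ℝ≥0∞), mul_assoc, ← hX]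
  exact ENNReal.inv_mul_le_one X

lemma exists_window {I : Set ℝ} (hI : I.OrdConnected) (hb : Bornology.IsBounded I) :
    ∃ a b : ℝ, a ≤ b ∧ Set.Ioo a b ⊆ I ∧ I ⊆ Set.Icc a b ∧ volume.real I = b - a := by
  suffices h : ∃ a b : ℝ, a ≤ b ∧ Set.Ioo a b ⊆ I ∧ I ⊆ Set.Icc a b by
    obtain ⟨a, b, hab, h1, h2⟩ := h
    refine ⟨a, b, hab, h1, h2, le_antisymm ?_ ?_⟩
    · have := measureReal_mono h2 (μ := volume) (by rw [Real.volume_Icc]; exact ENNReal.ofReal_ne_top)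
      rwa [Real.volume_real_Icc_of_le hab] at this
    · have := measureReal_mono h1 (μ := volume) hb.measure_lt_top.ne
      rwa [Real.volume_real_Ioo_of_le hab] at this
  rcases I.eq_empty_or_nonempty with rfl | hne
  · exact ⟨0, 0, le_rfl, by simp, by simp⟩
  · have hba := hb.bddAbove
    have hbb := hb.bddBelow
    refine ⟨sInf I, sSup I, csInf_le_csSup hne hbb hba, fun x hx => ?_, fun x hx =>
      ⟨csInf_le hbb hx, le_csSup hba hx⟩⟩
    obtain ⟨y, hy, hyx⟩ := exists_lt_of_csInf_lt hne hx.1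
    obtain ⟨z, hz, hzx⟩ := exists_lt_of_lt_csSup hne hx.2
    exact hI.out hy hz ⟨hyx.le, hzx.le⟩

lemma densityOfStates_Icc_eq [IsProbabilityMeasure (singleSiteLaw ρ)] {K m₀ : ℕ} (hK : 2 ≤ K)
    (lam : ℝ) {W : ℝ} (hW : 0 ≤ W) (hν : ∀ᵐ t ∂(singleSiteLaw ρ), |t| ≤ W)
    (xs : ℕ → CanopyVertex) : densityAt (densityOfStates K m₀ ρ lam xs)
      = densityAt fun B => canopyDos K m₀ (singleSiteLaw ρ) lam W xs B :=
  densityAt_congr fun _ _ => densityOfStates_eq hK lam hW hν xs measurableSet_Icc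

lemma StrongDisorder.canopyDos_Icc_le {K m₀ : ℕ} {ν : Measure ℝ} [IsProbabilityMeasure ν]
    {lam : ℝ} {C : NNReal} {M : ℕ} (h : StrongDisorder K (m₀ + 1) ν lam C M) {W : ℝ}
    (hW : 0 ≤ W) (hν : ∀ᵐ t ∂ν, |t| ≤ W) {xs : ℕ → CanopyVertex} (hxs : ∀ n, (xs n).1 = n)
    {a b : ℝ} (hab : a ≤ b) : canopyDos K m₀ ν lam W xs (Set.Icc a b)
      ≤ ((K * (C * (M * lam.toNNReal⁻¹)) : NNReal) : ℝ≥0∞) * ENNReal.ofReal (b - a) := by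
  have hK := h.two_le
  rw [Measure.smul_apply, smul_eq_mul]
  refine (mul_le_of_le_one_left zero_le ?_).trans (layerSum_Icc_le_length ν hK h.lam_pos hW hν hxs
    h.le_volume (fun A => (blockCardLE_treeSite h.period_pos (by omega) le_rfl _).mono
      (h.block_le' (Or.inl rfl))) hab)
  exact ENNReal.div_le_of_le_mul (by rw [one_mul]; exact tsub_le_self)

end SingleSite

end BetheCanopy

end

/-! ### Conclusion -/

theorem theorem3 (K m₀ : ℕ) (hK : 2 ≤ K) (ρ : ℝ → ℝ) (hρ_meas : Measurable ρ)
    (hρ_nonneg : ∀ x, 0 ≤ ρ x) (hρ_int : ∫ x, ρ x = 1) (hρ_bdd : MemLp ρ ⊤ volume)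
    (hρ_supp : HasCompactSupport ρ) :
    ∃ lam₀ : ℝ, 0 < lam₀ ∧ ∀ lam : ℝ, lam₀ < lam →
      -- the density of states measure of the canopy tree and its density
      ∀ xs : ℕ → BetheCanopy.CanopyVertex, (∀ n, (xs n).1 = n) →
      (∀ B : Set ℝ, MeasurableSet B →
        BetheCanopy.densityOfStates K m₀ ρ lam xs B
          = ∫⁻ E in B, BetheCanopy.densityAt (BetheCanopy.densityOfStates K m₀ ρ lam xs) E) ∧
      ∀ E₀ : ℝ,
        BetheCanopy.densityAt (BetheCanopy.densityOfStates K m₀ ρ lam xs) E₀ < ∞ ∧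
        -- the independent random variables on the Bethe lattice
        ∀ (Ω : Type*) [MeasurableSpace Ω] (P : Measure Ω) [IsProbabilityMeasure P]
          (ω : BetheCanopy.betheSites K m₀ → Ω → ℝ),
          (∀ y, HasLaw (ω y) (BetheCanopy.singleSiteLaw ρ) P) → iIndepFun ω P →
          ∀ I : Set ℝ, I.OrdConnected → Bornology.IsBounded I →
            ∃ L : ℕ → ℕ, StrictMono L ∧
              ∃ (Q : ProbabilityMeasure ℝ) (p : ℕ → ℝ),
                TendstoInDistribution
                  (fun n a => (BetheCanopy.eigenvalueProcess K m₀ lam (fun y => ω y a) E₀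
                    (L n)).real I)
                  atTop (id : ℝ → ℝ) (fun _ => P) (Q : Measure ℝ) ∧
                BetheCanopy.IsCompoundPoisson (Q : Measure ℝ) ∧
                (∀ t : ℝ, charFun (Q : Measure ℝ) t =
                  Complex.exp (∑ k ∈ Finset.Icc 1 ((K ^ (m₀ + 1) - 1) / (K - 1)),
                    (Complex.exp (Complex.I * t * k) - 1) * (p k : ℂ))) ∧
                ∀ k ∈ Finset.Icc 1 ((K ^ (m₀ + 1) - 1) / (K - 1)),
                  0 ≤ p k ∧
                  p k ≤ K * (BetheCanopy.densityAt
                    (BetheCanopy.densityOfStates K m₀ ρ lam xs) E₀).toReal / k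
                      * volume.real I := by
  have := BetheCanopy.isProbabilityMeasure_singleSiteLaw hρ_nonneg hρ_int
  obtain ⟨C, hC⟩ := BetheCanopy.exists_singleSiteLaw_le hρ_nonneg hρ_bdd
  obtain ⟨W, hW, hν⟩ := BetheCanopy.exists_ae_abs_le_singleSiteLaw hρ_meas hρ_supp
  obtain ⟨lam₀, hlam₀, hdis⟩ := BetheCanopy.exists_forall_strongDisorder hK m₀.succ_pos hC
  refine ⟨lam₀, hlam₀, fun lam hlam xs hxs => ?_⟩
  have h := hdis lam hlam
  set n := BetheCanopy.canopyDos K m₀ (BetheCanopy.singleSiteLaw ρ) lam W xs with hn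
  have hnle := fun a b (hab : a ≤ b) => h.canopyDos_Icc_le hW hν hxs hab
  have hdens := BetheCanopy.densityOfStates_Icc_eq hK lam hW hν xs (m₀ := m₀) (ρ := ρ)
  have : IsFiniteMeasure n := by
    have := BetheCanopy.isFiniteMeasure_layerSum (m₀ := m₀) (BetheCanopy.singleSiteLaw ρ) hK lam hW xs
    refine Measure.smul_finite _ (ENNReal.div_lt_top ?_ ?_).ne
    · exact ENNReal.sub_ne_top (ENNReal.natCast_ne_top K)
    · exact_mod_cast (by omega : K ≠ 0)
  have hfin : ∀ E₀, BetheCanopy.densityAt (BetheCanopy.densityOfStates K m₀ ρ lam xs) E₀ < ∞ := fun E₀ => by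
    rw [hdens]
    exact (BetheCanopy.densityAt_le hnle E₀).trans_lt ENNReal.coe_lt_top
  refine ⟨fun B hB => ?_, fun E₀ => ⟨hfin E₀, ?_⟩⟩
  · rw [BetheCanopy.densityOfStates_eq hK lam hW hν xs hB, hdens]
    refine BetheCanopy.measure_eq_lintegral_densityAt (n := n) ?_ hB
    -- The Lipschitz bound on intervals makes the density of states absolutely continuous, so its
    -- pointwise density represents it.
    exact (Measure.absolutelyContinuous_of_le (BetheCanopy.measure_le_of_forall_Icc hnle)).trans
      Measure.smul_absolutelyContinuous
  · intro Ω _ P _ ω hω hind I hI hb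
    have hIm : MeasurableSet I := hI.measurableSet
    obtain ⟨a₀, b₀, hab, h1, h2, hvol⟩ := BetheCanopy.exists_window hI hb
    have hD := hfin E₀
    rw [hdens] at hD ⊢
    obtain ⟨φ, hφ, p, hp0, hp, hlim⟩ := h.exists_tendsto hW hν hxs hab h1 h2 hIm hD
    have hcut : StrictMono fun n => BetheCanopy.cutDepth m₀ (φ n) := (BetheCanopy.strictMono_cutDepth m₀).comp hφ
    have hM : ∑ v ∈ Finset.range (m₀ + 1), BetheCanopy.genCard K K v = (K ^ (m₀ + 1) - 1) / (K - 1) := by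
      simp only [BetheCanopy.genCard_self]
      exact Nat.geomSum_eq hK _
    have hL : ∀ n, BetheCanopy.cutDepth m₀ (φ n) + 7 * BetheCanopy.cutDepth m₀ (φ n) - 1 + 1
        = BetheCanopy.cutDepth m₀ (φ n) + 7 * BetheCanopy.cutDepth m₀ (φ n) := fun n => by
      have := BetheCanopy.one_le_cutDepth m₀ (φ n)
      omega
    -- A ball of radius `L` has `L + 1` generations; hence the radius is one less than the `8 * r`
    -- generations of the tree.
    refine ⟨fun n => BetheCanopy.cutDepth m₀ (φ n) + 7 * BetheCanopy.cutDepth m₀ (φ n) - 1, fun i j hij => ?_, ?_⟩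
    · have := hcut hij
      have := hL i
      have := hL j
      dsimp only at *
      omega
    have hX := fun n => BetheCanopy.aemeasurable_and_integral_exp_eigenvalueProcess (lam := lam) (E₀ := E₀)
      (by omega : 0 < K) hω hind hIm (hL n)
    obtain ⟨Q, hQ, hQc, hQt⟩ := BetheCanopy.exists_tendstoInDistribution (fun n => (hX n).1) hp0
      fun t => (hlim t).congr fun n => ((hX n).2 t).symm
    rw [hM] at hQt
    refine ⟨Q, p, hQ, hQc, hQt, fun k hk => ⟨hp0 k, ?_⟩⟩
    have hk1 := (Finset.mem_Icc.mp hk).1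
    have hk0 : (0 : ℝ) < k := by exact_mod_cast hk1
    rw [hvol, div_mul_eq_mul_div, le_div_iff₀ hk0, mul_comm (p k), mul_assoc]
    exact hp k hk1
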